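/- Let $n\ge 1$ and $l\ge n$ be integers and put $s_l:=\frac{l-n+1}{2}$. Let $B\subseteq\mathbb{C}^n$ be the open unit ball, let $\mathrm{d}S$ be the surface measure on $S^{2n-1}=\partial B$, and let $\mathrm{d}\mu_l=c_l(1-|z|^2)^{l-n}\,\mathrm{d}V$ be the normalized (probability) measure on $B$. Let $A^2_l(B)$ be the weighted Bergman space of holomorphic functions in $L^2(B,\mu_l)$. The group $SU(n,1)$ acts on $B$ and on $S^{2n-1}$ by $g.z=\frac{az+b}{cz+d}$ for $g=\begin{pmatrix}a&b\\c&d\end{pmatrix}$; put $J(g,z)=cz+d$. For $m\in\mathbb{Z}$, the action of weight $m$ on functions on $B$, and on functions (and, by duality, distributions) on $S^{2n-1}$, is $$(\pi_m(g)f)(z)=J(g^{-1},z)^{-m}f(g^{-1}.z).$$ Let $\Delta_H\ge 0$ be the sub-Laplacian of the contact distribution $H_\zeta=\{v\in\mathbb{C}^n:\bar\zeta\cdot v=0\}$ of $S^{2n-1}$, that is $\Delta_H=-(\Delta_{S^{2n-1}}-T^2)$ with $T$ the generator of $\zeta\mapsto e^{it}\zeta$, if $n\ge 2$, and $\Delta_H=-\frac{\mathrm{d}^2}{\mathrm{d}\theta^2}$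 if $n=1$. Put $\kappa=2$ if $n\geq 2$ and $\kappa=1$ if $n=1$. For $s\in\mathbb{R}$ let $$W^s_H(S^{2n-1}):=(1+\Delta_H)^{-\kappa s/2}L^2(S^{2n-1})\subseteq\mathcal{D}'(S^{2n-1}),$$ with the Hilbert space structure for which $(1+\Delta_H)^{\kappa s/2}:W^s_H(S^{2n-1})\to L^2(S^{2n-1})$ is unitary. (So orders are counted such that $T$ has order one, and $\|z^\alpha\|_{W^s_H}\sim|\alpha|^s\|z^\alpha\|_{L^2(S^{2n-1})}$ as $|\alpha|\to\infty$.) Theorem. The Szegö map $$Sf(z)=\frac{1}{(2\pi i)^n}\int_{S^{2n-1}}\frac{f(\zeta)\,\mathrm{d}S(\zeta)}{(1-\bar\zeta\cdot z)^n},\qquad f\in C^\infty(S^{2n-1}),\ z\in B,$$ extends to a bounded operator with closed range $$S:W^{-s_l}_H(S^{2n-1})\to L^2(B,\mu_l).$$ Its range is $A^2_l(B)$. Its source space $(\ker S)^\perp$ is $$W^{-s_l}_{H,\mathrm{hol}}(S^{2n-1})=\{f\in W^{-s_l}_H(S^{2n-1}): f \text{ extends holomorphically to } B\},$$ where $f$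 extends holomorphically to $B$ if there is a holomorphic function $F$ on $B$ with $F(r\,\cdot)\to f$ in the sense of distributions on $S^{2n-1}$ as $r\to1-$. The operator $S$ is $SU(n,1)$-equivariant: for every $m\in\mathbb{Z}$, $\pi_m$ acts by bounded operators on $W^{-s_l}_H(S^{2n-1})$ and on $L^2(B,\mu_l)$; for $m=n$ one has $S\pi_n(g)=\pi_n(g)S$ on all of $W^{-s_l}_H(S^{2n-1})$; and for every $m\in\mathbb{Z}$ the space $W^{-s_l}_{H,\mathrm{hol}}(S^{2n-1})$ is invariant under $\pi_m$ and $S\pi_m(g)f=\pi_m(g)Sf$ for all $f\in W^{-s_l}_{H,\mathrm{hol}}(S^{2n-1})$ and $g\in SU(n,1)$. -/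

import Mathlib

open MeasureTheory Filter Topology
open scoped ContDiff InnerProductSpace

noncomputable section

namespace SzegoBall

/-! ### The unit sphere and the unit ball of `ℂⁿ` -/

/-- `ℂⁿ` with its Hermitian norm. -/
abbrev Cn (n : ℕ) : Type := EuclideanSpace ℂ (Fin n)

/-- The unit sphere `S^{2n-1}` of `ℂⁿ`. -/
abbrev Sph (n : ℕ) : Type := Metric.sphere (0 : Cn n) 1

/-- The open unit ball `B` of `ℂⁿ`. -/
abbrev Ball (n : ℕ) : Set (Cn n) := Metric.ball (0 : Cn n) 1

/-- The surface measure `dS` on the unit sphere. -/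
def surf (n : ℕ) : Measure (Sph n) := (volume : Measure (Cn n)).toSphere

/-- `L²(S^{2n-1})`. -/
abbrev L2S (n : ℕ) : Type := Lp ℂ 2 (surf n)

/-- The weight `(1 - |z|²)^{l-n} dV` on the ball, not normalised (used for `n ≤ l` only). -/
def ballWeight (n l : ℕ) : Measure (Cn n) :=
  (volume.restrict (Ball n)).withDensity fun z => ENNReal.ofReal ((1 - ‖z‖ ^ 2) ^ (l - n))

/-- The probability measure `dμ_l = c_l (1 - |z|²)^{l-n} dV` on the ball. -/
def muBall (n l : ℕ) : Measure (Cn n) := (ballWeight n l Set.univ)⁻¹ • ballWeight n l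

/-- `L²(B, μ_l)`. -/
abbrev L2B (n l : ℕ) : Type := Lp ℂ 2 (muBall n l)

/-- The weighted Bergman space `A²_l(B)`: the classes in `L²(B, μ_l)` of holomorphic functions. -/
def bergman (n l : ℕ) : Set (L2B n l) :=
  {F | ∃ h : Cn n → ℂ, DifferentiableOn ℂ h (Ball n) ∧ F =ᵐ[muBall n l] h}

/-! ### Smooth functions on the sphere and the Szegö map -/

/-- The extension of a function on the sphere to `ℂⁿ ∖ {0}` that is constant on rays
(with value `0` at the origin). -/
def radialExt {n : ℕ} (f : Sph n → ℂ) (x : Cn n) : ℂ :=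
  if h : x = 0 then 0
  else f ⟨(‖x‖⁻¹ : ℝ) • x, by
    rw [mem_sphere_zero_iff_norm, norm_smul, norm_inv, norm_norm,
      inv_mul_cancel₀ (norm_ne_zero_iff.mpr h)]⟩

/-- `f ∈ C^∞(S^{2n-1})` (real smoothness). -/
def IsSmooth {n : ℕ} (f : Sph n → ℂ) : Prop := ContDiffOn ℝ ∞ (radialExt f) {0}ᶜ

/-- The Szegö map `S f(z) = (2πi)^{-n} ∫ f(ζ) (1 - ζ̄ · z)^{-n} dS(ζ)`. Mathlib's inner product
is conjugate-linear in its first argument, so `⟪ζ, z⟫ = ζ̄ · z`. -/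
def szego {n : ℕ} (f : Sph n → ℂ) (z : Cn n) : ℂ :=
  (1 / (2 * (Real.pi : ℂ) * Complex.I) ^ n) *
    ∫ ζ : Sph n, f ζ / (1 - ⟪(ζ : Cn n), z⟫_ℂ) ^ n ∂(surf n)

/-! ### The sub-Laplacian and the Heisenberg–Sobolev scale -/

/-- The second derivative `T² f` along the Reeb field `T = d/dt|₀ (ζ ↦ e^{it} ζ)` of the standard
contact structure of the sphere. -/
def reebSq {n : ℕ} (f : Sph n → ℂ) (ζ : Sph n) : ℂ :=
  iteratedDeriv 2 (fun t : ℝ => radialExt f (Complex.exp (t * Complex.I) • (ζ : Cn n))) 0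

/-- The (negative) Laplace–Beltrami operator of the round sphere: the Euclidean Laplacian of the
extension that is constant on rays. -/
def sphereLaplacian {n : ℕ} (f : Sph n → ℂ) (ζ : Sph n) : ℂ :=
  Laplacian.laplacian (radialExt f) (ζ : Cn n)

/-- The (nonnegative) sub-Laplacian `Δ_H = -∑ X_j²`, where the `X_j` form an orthonormal frame of
the contact distribution `H_ζ = {v | ζ̄ · v = 0}`. Since the orthogonal complement of `H` in the
tangent bundle is spanned by the unit field `T`, whose orbits are geodesics, this is
`-(Δ_S - T²)`. For `n = 1` the filtration of the circle is trivial, `H` is the whole tangent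
bundle, and `Δ_H = -Δ_S`. -/
def subLaplacian {n : ℕ} (f : Sph n → ℂ) (ζ : Sph n) : ℂ :=
  if n = 1 then -sphereLaplacian f ζ else -(sphereLaplacian f ζ - reebSq f ζ)

/-- The eigenspace of `Δ_H` in `L²(S^{2n-1})` for the eigenvalue `lam`. -/
def eigenspace (n : ℕ) (lam : ℝ) : Submodule ℂ (L2S n) :=
  (Submodule.span ℂ {v : L2S n | ∃ f : Sph n → ℂ, IsSmooth f ∧
    (∀ ζ, subLaplacian f ζ = (lam : ℂ) * f ζ) ∧ v =ᵐ[surf n] f}).topologicalClosure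

instance (n : ℕ) (lam : ℝ) : (eigenspace n lam).HasOrthogonalProjection :=
  haveI : CompleteSpace (eigenspace n lam) := Submodule.topologicalClosure.completeSpace _
  inferInstance

open Classical in
/-- The class in `L²(S^{2n-1})` of a square integrable function (and `0` for other functions). -/
def toL2 {n : ℕ} (f : Sph n → ℂ) : L2S n :=
  if h : MemLp f 2 (surf n) then h.toLp f else 0

/-- `(1 + Δ_H)^r φ ∈ L²(S^{2n-1})` for smooth `φ` and real `r`, by the spectral decomposition
`∑_λ (1 + λ)^r P_λ φ` of the self-adjoint operator `Δ_H`, whose spectrum is discrete. -/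
def subLaplacianPow {n : ℕ} (r : ℝ) (φ : Sph n → ℂ) : L2S n :=
  ∑' lam : ℝ, (((1 + lam) ^ r : ℝ) : ℂ) • (eigenspace n lam).starProjection (toL2 φ)

/-- The length of the filtration of the tangent bundle of `S^{2n-1}` that defines its Heisenberg
calculus: `2` for the contact structure (`n ≥ 2`) and `1` for the circle. -/
def filtrationStep (n : ℕ) : ℝ := if n = 1 then 1 else 2

/-- The Heisenberg–Sobolev space `W^s_H(S^{2n-1}) = (1 + Δ_H)^{-κ s/2} L²(S^{2n-1})`, with
`κ = filtrationStep n`, as a Hilbert space of distributions. The norm is the one that makes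
`(1 + Δ_H)^{κ s/2} : W^s_H → L²` unitary, so an element `u = (1 + Δ_H)^{-κ s/2} v` is stored as
`v ∈ L²`; the distribution `u` itself is `HeisSob.pair u`.

Orders are counted so that the Reeb field `T` has order one, i.e. so that
`‖z^α‖_{W^s_H} ∼ |α|^s ‖z^α‖_{L²}` for holomorphic monomials: for `n ≥ 2` one has
`Δ_H z^α = (2n-2)|α| z^α` and `κ = 2`; for `n = 1` one has `Δ_H z^k = k² z^k` and `κ = 1`. -/
def HeisSob (n : ℕ) (_s : ℝ) : Type := L2S n

instance (n : ℕ) (s : ℝ) : NormedAddCommGroup (HeisSob n s) :=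
  inferInstanceAs (NormedAddCommGroup (L2S n))

instance (n : ℕ) (s : ℝ) : InnerProductSpace ℂ (HeisSob n s) :=
  inferInstanceAs (InnerProductSpace ℂ (L2S n))

instance (n : ℕ) (s : ℝ) : CompleteSpace (HeisSob n s) :=
  inferInstanceAs (CompleteSpace (L2S n))

/-- The element `v = (1 + Δ_H)^{κ s/2} u` of `L²(S^{2n-1})`. -/
def HeisSob.toL2S {n : ℕ} {s : ℝ} (u : HeisSob n s) : L2S n := u

/-- The value `⟨u, φ⟩` of the distribution `u = (1 + Δ_H)^{-κ s/2} v` on a test function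
`φ ∈ C^∞(S^{2n-1})`, i.e. `∫ v · (1 + Δ_H)^{-κ s/2} φ dS` (bilinear pairing). -/
def HeisSob.pair {n : ℕ} {s : ℝ} (u : HeisSob n s) (φ : Sph n → ℂ) : ℂ :=
  ∫ ζ : Sph n, u.toL2S ζ * subLaplacianPow (-(filtrationStep n * s) / 2) φ ζ ∂(surf n)

/-- The distribution `u` is (integration against) the function `f`. -/
def HeisSob.IsFunction {n : ℕ} {s : ℝ} (u : HeisSob n s) (f : Sph n → ℂ) : Prop :=
  ∀ φ : Sph n → ℂ, IsSmooth φ → u.pair φ = ∫ ζ : Sph n, f ζ * φ ζ ∂(surf n)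

/-- `u` extends holomorphically to `B`: it is the distributional boundary value of a holomorphic
function `F` on the ball, `F(r ·) → u` as `r → 1-`. -/
def HeisSob.ExtendsHolomorphically {n : ℕ} {s : ℝ} (u : HeisSob n s) : Prop :=
  ∃ F : Cn n → ℂ, DifferentiableOn ℂ F (Ball n) ∧
    ∀ φ : Sph n → ℂ, IsSmooth φ →
      Tendsto (fun r : ℝ => ∫ ζ : Sph n, F (r • (ζ : Cn n)) * φ ζ ∂(surf n))
        (𝓝[<] 1) (𝓝 (u.pair φ))

/-! ### The group `SU(n,1)` and its actions -/

/-- The diagonal matrix `diag(1, …, 1, -1)`. -/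
def formJ (n : ℕ) : Matrix (Fin n ⊕ Unit) (Fin n ⊕ Unit) ℂ :=
  Matrix.diagonal (Sum.elim (fun _ => 1) (fun _ => -1))

/-- `SU(n,1)`: the matrices of determinant one that preserve the Hermitian form
`|z₁|² + ⋯ + |z_n|² - |w|²`. -/
def SU (n : ℕ) : Subgroup (Matrix.SpecialLinearGroup (Fin n ⊕ Unit) ℂ) where
  carrier := {g | (g : Matrix (Fin n ⊕ Unit) (Fin n ⊕ Unit) ℂ).conjTranspose * formJ n *
    (g : Matrix (Fin n ⊕ Unit) (Fin n ⊕ Unit) ℂ) = formJ n}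
  one_mem' := by simp
  mul_mem' := by
    intro a b ha hb
    simp only [Set.mem_ofPred_eq, Matrix.SpecialLinearGroup.coe_mul,
      Matrix.conjTranspose_mul] at ha hb ⊢
    calc _ = (b : Matrix (Fin n ⊕ Unit) (Fin n ⊕ Unit) ℂ).conjTranspose *
          ((a : Matrix (Fin n ⊕ Unit) (Fin n ⊕ Unit) ℂ).conjTranspose * formJ n *
            (a : Matrix (Fin n ⊕ Unit) (Fin n ⊕ Unit) ℂ)) *
          (b : Matrix (Fin n ⊕ Unit) (Fin n ⊕ Unit) ℂ) := by
            simp only [Matrix.mul_assoc]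
      _ = formJ n := by rw [ha, hb]
  inv_mem' := by
    intro a ha
    simp only [Set.mem_ofPred_eq] at ha ⊢
    have h1 : (a : Matrix (Fin n ⊕ Unit) (Fin n ⊕ Unit) ℂ) *
        ((a⁻¹ : Matrix.SpecialLinearGroup (Fin n ⊕ Unit) ℂ) :
          Matrix (Fin n ⊕ Unit) (Fin n ⊕ Unit) ℂ) = 1 := by
      rw [← Matrix.SpecialLinearGroup.coe_mul, mul_inv_cancel,
        Matrix.SpecialLinearGroup.coe_one]
    have h2 := congrArg Matrix.conjTranspose h1
    rw [Matrix.conjTranspose_mul, Matrix.conjTranspose_one] at h2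
    generalize ((a⁻¹ : Matrix.SpecialLinearGroup (Fin n ⊕ Unit) ℂ) :
          Matrix (Fin n ⊕ Unit) (Fin n ⊕ Unit) ℂ) = x at h1 h2 ⊢
    calc x.conjTranspose * formJ n * x = (x.conjTranspose *
          (a : Matrix (Fin n ⊕ Unit) (Fin n ⊕ Unit) ℂ).conjTranspose) * formJ n *
          ((a : Matrix (Fin n ⊕ Unit) (Fin n ⊕ Unit) ℂ) * x) := by
            conv_lhs => rw [← ha]
            simp only [Matrix.mul_assoc]
      _ = formJ n := by rw [h1, h2, Matrix.one_mul, Matrix.mul_one]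

/-- The entries of `g ∈ SU(n,1)`. -/
def entry {n : ℕ} (g : SU n) (i j : Fin n ⊕ Unit) : ℂ :=
  ((g : Matrix.SpecialLinearGroup (Fin n ⊕ Unit) ℂ) : Matrix (Fin n ⊕ Unit) (Fin n ⊕ Unit) ℂ) i j

/-- `J(g, z) = c z + d` for `g = (a b; c d)`. -/
def autJ {n : ℕ} (g : SU n) (z : Cn n) : ℂ :=
  (∑ j, entry g (Sum.inr ()) (Sum.inl j) * z j) + entry g (Sum.inr ()) (Sum.inr ())

/-- The Möbius transform `g.z = (a z + b) / (c z + d)` for `g = (a b; c d)`. -/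
def mobius {n : ℕ} (g : SU n) (z : Cn n) : Cn n :=
  WithLp.toLp 2 fun i =>
    ((∑ j, entry g (Sum.inl i) (Sum.inl j) * z j) + entry g (Sum.inl i) (Sum.inr ())) / autJ g z

theorem mobius_mem_sphere {n : ℕ} (g : SU n) (ζ : Sph n) :
    mobius g (ζ : Cn n) ∈ Metric.sphere (0 : Cn n) 1 := by
  obtain ⟨z, hz⟩ := ζ
  rw [mem_sphere_zero_iff_norm] at hz ⊢
  have hz2 : ∑ i, star (z i) * z i = 1 := by
    have h := EuclideanSpace.norm_sq_eq z
    rw [hz] at h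
    have h' := congrArg (fun x : ℝ => (x : ℂ)) h
    push_cast at h'
    rw [one_pow] at h'
    rw [h']
    exact Finset.sum_congr rfl fun i _ => Complex.conj_mul' (z i)
  set M : Matrix (Fin n ⊕ Unit) (Fin n ⊕ Unit) ℂ :=
    ((g : Matrix.SpecialLinearGroup (Fin n ⊕ Unit) ℂ) : Matrix (Fin n ⊕ Unit) (Fin n ⊕ Unit) ℂ) with hM
  have hg : M.conjTranspose * formJ n * M = formJ n := g.2
  set w : Fin n ⊕ Unit → ℂ := Sum.elim (fun i => z i) (fun _ => 1) with hw
  have hl : ∀ i, M.mulVec w (Sum.inl i) =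
      (∑ j, entry g (Sum.inl i) (Sum.inl j) * z j) + entry g (Sum.inl i) (Sum.inr ()) := by
    intro i
    simp [Matrix.mulVec, dotProduct, Fintype.sum_sum_type, hw, entry, hM]
  have hr : M.mulVec w (Sum.inr ()) = autJ g z := by
    simp [Matrix.mulVec, dotProduct, Fintype.sum_sum_type, hw, entry, autJ, hM]
  have key : star (M.mulVec w) ⬝ᵥ (formJ n).mulVec (M.mulVec w) = 0 := by
    have h1 : star (M.mulVec w) ⬝ᵥ (formJ n).mulVec (M.mulVec w) =
        star w ⬝ᵥ (M.conjTranspose * formJ n * M).mulVec w := by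
      rw [Matrix.star_mulVec, ← Matrix.dotProduct_mulVec, Matrix.mulVec_mulVec,
        Matrix.mulVec_mulVec, Matrix.mul_assoc]
    rw [h1, hg]
    simp only [formJ, Matrix.mulVec_diagonal, dotProduct, Fintype.sum_sum_type, hw]
    have hz3 := hz2
    simp at hz3 ⊢
    rw [hz3]
    ring
  have key2 : ∑ i, ‖M.mulVec w (Sum.inl i)‖ ^ 2 = ‖autJ g z‖ ^ 2 := by
    simp only [formJ, Matrix.mulVec_diagonal, dotProduct, Fintype.sum_sum_type] at key
    have h2 : ∑ i, star (M.mulVec w (Sum.inl i)) * M.mulVec w (Sum.inl i) =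
        star (M.mulVec w (Sum.inr ())) * M.mulVec w (Sum.inr ()) := by
      have h3 := key
      simp only [Pi.star_apply, Sum.elim_inl, Sum.elim_inr, one_mul, neg_mul, mul_neg,
        Finset.univ_unique, Finset.sum_singleton, PUnit.default_eq_unit] at h3
      linear_combination h3
    rw [hr] at h2
    have h4 : ((∑ i, ‖M.mulVec w (Sum.inl i)‖ ^ 2 : ℝ) : ℂ) = ((‖autJ g z‖ ^ 2 : ℝ) : ℂ) := by
      push_cast
      rw [← Complex.conj_mul', ← starRingEnd_apply] at *
      rw [← h2]
      exact Finset.sum_congr rfl fun i _ => (Complex.conj_mul' _).symm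
    exact_mod_cast h4
  have hD : autJ g z ≠ 0 := by
    intro h0
    rw [h0, norm_zero, zero_pow two_ne_zero,
      Finset.sum_eq_zero_iff_of_nonneg fun i _ => sq_nonneg _] at key2
    have h5 : M.mulVec w = 0 := by
      funext k
      rcases k with i | u
      · simpa using key2 i (Finset.mem_univ i)
      · rw [show u = () from rfl, hr, h0]; rfl
    have hdet : M.det ≠ 0 := by
      rw [hM, (g : Matrix.SpecialLinearGroup (Fin n ⊕ Unit) ℂ).2]; exact one_ne_zero
    have h6 := congrFun (Matrix.eq_zero_of_mulVec_eq_zero hdet h5) (Sum.inr ())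
    simp [hw] at h6
  have hn2 : ‖mobius g z‖ ^ 2 = 1 := by
    rw [EuclideanSpace.norm_sq_eq]
    have : ∀ i, ‖(mobius g z) i‖ ^ 2 = ‖M.mulVec w (Sum.inl i)‖ ^ 2 / ‖autJ g z‖ ^ 2 := by
      intro i
      rw [hl i, ← div_pow, ← norm_div]
      rfl
    rw [Finset.sum_congr rfl fun i _ => this i, ← Finset.sum_div, key2]
    exact div_self (pow_ne_zero 2 (norm_ne_zero_iff.mpr hD))
  nlinarith [norm_nonneg (mobius g z)]

/-- The action of `SU(n,1)` on the sphere by Möbius transforms. -/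
def sphMobius {n : ℕ} (g : SU n) (ζ : Sph n) : Sph n := ⟨mobius g ζ, mobius_mem_sphere g ζ⟩

/-- The action of weight `m` on functions on the ball: `F ↦ J(g⁻¹, z)^{-m} F(g⁻¹.z)`. -/
def ballAct {n : ℕ} (m : ℤ) (g : SU n) (F : Cn n → ℂ) (z : Cn n) : ℂ :=
  autJ g⁻¹ z ^ (-m) * F (mobius g⁻¹ z)

/-- The distribution `u'` is the image of `u` under the action of weight `m` of `g` on the sphere,
`f ↦ J(g⁻¹, ζ)^{-m} f(g⁻¹.ζ)`. It is written in weak form: substituting `ζ = g.η`, for which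
`J(g⁻¹, g.η) = J(g, η)⁻¹` and `dS(g.η) = |J(g, η)|^{-2n} dS(η)`, gives
`∫ J(g⁻¹, ζ)^{-m} f(g⁻¹.ζ) φ(ζ) dS(ζ) = ∫ f(η) J(g, η)^m |J(g, η)|^{-2n} φ(g.η) dS(η)`. -/
def HeisSob.IsTranslate {n : ℕ} {s : ℝ} (m : ℤ) (g : SU n) (u u' : HeisSob n s) : Prop :=
  ∀ φ : Sph n → ℂ, IsSmooth φ →
    u'.pair φ = u.pair fun η =>
      autJ g (η : Cn n) ^ m * ((‖autJ g (η : Cn n)‖ ^ (-(2 * n : ℤ)) : ℝ) : ℂ) * φ (sphMobius g η)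

/-- `ρ` is the action of weight `m` of `SU(n,1)` on `W^s_H(S^{2n-1})` by bounded operators. -/
def IsSphereRep {n : ℕ} {s : ℝ} (m : ℤ) (ρ : SU n →* (HeisSob n s →L[ℂ] HeisSob n s)) : Prop :=
  ∀ (g : SU n) (u : HeisSob n s), HeisSob.IsTranslate m g u (ρ g u)

/-- `π` is the action of weight `m` of `SU(n,1)` on `L²(B, μ_l)` by bounded operators. -/
def IsBallRep {n l : ℕ} (m : ℤ) (π : SU n →* (L2B n l →L[ℂ] L2B n l)) : Prop :=
  ∀ (g : SU n) (F : L2B n l), π g F =ᵐ[muBall n l] ballAct m g F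

end SzegoBall

end

/-!
The sphere carries the orthogonal decomposition of `L²` into the spaces of bihomogeneous harmonic
polynomials of bidegree `(p, q)` (`isOrthDecomp_harm`; density is Stone-Weierstrass together with
the fact that every polynomial agrees on the sphere with a sum of harmonic ones). The
sub-Laplacian acts on the component `(p, q)` by the scalar `lam`, so the Sobolev space becomes a
weighted Hilbert sum of the components. An element `(1 + Δ_H)^r v` of negative order is stored as
`v ∈ L²`, and the operator `(1 + Δ_H)^(-r)` is `smoothing`.

*Boundedness of the translations.* It suffices to bound `π_m(g)` on `L²` functions in the norm of
negative order (`exists_norm_smoothing_repS_le`); the extension by density is `sobRep`. Every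
group element is a hyperbolic element times an element of the stabilizer of the origin
(`exists_hyp_mul`), and the stabilizer preserves each bidegree and the norm. Along a hyperbolic
one-parameter group the weighted energy `∑ w(p, q) ‖P_{p,q} f‖²` is controlled by Grönwall's
inequality: the generator moves a bidegree only to its neighbours, and in the real part of the
weighted pairing the raising and lowering terms cancel up to the differences of the weight at
neighbouring bidegrees, which tame weights keep of lower order (`tsum_re_genOp_le`,
`energy_repS_le`). The weights are first regularised by `regWt ε`, and the bound is uniform as
`ε → 0`.

*The Szegő map.* On the sphere the powers `(ζ̄ ⬝ z)^k` of the kernel expansion see only the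
bidegree `(k, 0)`. The map is therefore a constant multiple of `f ↦ ∑ F_k`, where `F_k` is the
holomorphic homogeneous polynomial whose boundary value is the `(k, 0)` component of `f`
(`hasSum_szego`). The constant is found from the reproducing property `szego_of_differentiableOn`,
which is the mean value property at the origin carried to other points by the equivariance
`szego_translate`. In the Bergman space the `F_k` are orthogonal, with squared norm equal to that
on the sphere times the beta integral `radMoment`, of order `k^(-(l-n+1))`. Up to bounded factors
this is the inverse of the square of `holWt`, the factor by which `(1 + Δ_H)^r` scales the
component `(k, 0)` (`exists_holWt_sq_bounds`). Consequently the Szegő map is, up to equivalence of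
norms, an isometry from the closed span of the components `(k, 0)` onto the space of
square-integrable holomorphic functions, and it vanishes on the other components. Closed range,
the range and the orthogonal complement of the kernel follow (`exists_inner_eq`, `isClosed_range`,
`range_szego`, `ker_orthogonal`).

*Holomorphic extension.* That the closed span `hardy n` consists of the distributions with a
holomorphic extension (`mem_hardy_iff`) is Abel's theorem in one direction and the comparison of
homogeneous components as `r → 1` in the other. On boundary values of holomorphic functions the
Szegő map is a constant multiple of the extension, and extension commutes with the action of every
weight. This gives the equivariance for all weights on the Hardy part (`szego_equivariant_hardy`),
while weight `n` is a change of variables on the whole sphere.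
-/

open MeasureTheory Filter Topology
open scoped ContDiff InnerProductSpace

noncomputable section

namespace SzegoBall

/-! ### Directional derivatives and the Laplacian -/

/-- The derivative of `f` in the real direction `v`. -/
def dd {n : ℕ} (v : Cn n) (f : Cn n → ℂ) (x : Cn n) : ℂ := fderiv ℝ f x v

/-- The Wirtinger derivative `∂_b = ∑ b_j ∂/∂z_j`, as `(D_b - i D_{ib}) / 2`. -/
def dz {n : ℕ} (b : Cn n) (f : Cn n → ℂ) (x : Cn n) : ℂ :=
  (dd b f x - Complex.I * dd (Complex.I • b) f x) / 2

/-- The Wirtinger derivative `∂̄_b = ∑ b̄_j ∂/∂z̄_j`, as `(D_b + i D_{ib}) / 2`. -/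
def dzb {n : ℕ} (b : Cn n) (f : Cn n → ℂ) (x : Cn n) : ℂ :=
  (dd b f x + Complex.I * dd (Complex.I • b) f x) / 2

section Calculus

variable {n : ℕ} {f g : Cn n → ℂ} {x : Cn n}

theorem contDiff_dd (hf : ContDiff ℝ ∞ f) (v : Cn n) : ContDiff ℝ ∞ (dd v f) :=
  (hf.fderiv_right (m := ∞) (by simp)).clm_apply contDiff_const

theorem contDiffAt_dd (hf : ContDiffAt ℝ ∞ f x) (v : Cn n) : ContDiffAt ℝ ∞ (dd v f) x :=
  (hf.fderiv_right (m := ∞) (by simp)).clm_apply contDiffAt_const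

theorem contDiff_dz (hf : ContDiff ℝ ∞ f) (b : Cn n) : ContDiff ℝ ∞ (dz b f) :=
  ((contDiff_dd hf b).sub (contDiff_const.mul (contDiff_dd hf _))).div_const 2

theorem contDiff_dzb (hf : ContDiff ℝ ∞ f) (b : Cn n) : ContDiff ℝ ∞ (dzb b f) :=
  ((contDiff_dd hf b).add (contDiff_const.mul (contDiff_dd hf _))).div_const 2

theorem differentiableAt_of_smooth (hf : ContDiffAt ℝ ∞ f x) : DifferentiableAt ℝ f x :=
  hf.differentiableAt (by simp)

theorem two_le_smooth : (2 : WithTop ℕ∞) ≤ ∞ := by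
  exact WithTop.coe_le_coe.2 (le_top : (2 : ℕ∞) ≤ ⊤)

theorem dd_mul (hf : DifferentiableAt ℝ f x) (hg : DifferentiableAt ℝ g x) (v : Cn n) :
    dd v (fun y => f y * g y) x = f x * dd v g x + dd v f x * g x := by
  unfold dd
  rw [fderiv_fun_mul hf hg]
  simp [mul_comm]

theorem dd_add (hf : DifferentiableAt ℝ f x) (hg : DifferentiableAt ℝ g x) (v : Cn n) :
    dd v (fun y => f y + g y) x = dd v f x + dd v g x := by
  unfold dd
  rw [fderiv_fun_add hf hg]; rfl

theorem dd_sub (hf : DifferentiableAt ℝ f x) (hg : DifferentiableAt ℝ g x) (v : Cn n) :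
    dd v (fun y => f y - g y) x = dd v f x - dd v g x := by
  unfold dd
  rw [fderiv_fun_sub hf hg]; rfl

theorem dd_const_mul (hf : DifferentiableAt ℝ f x) (c : ℂ) (v : Cn n) :
    dd v (fun y => c * f y) x = c * dd v f x := by
  unfold dd
  rw [fderiv_const_mul hf]; rfl

theorem dd_clm (L : Cn n →L[ℝ] ℂ) (v : Cn n) : dd v (fun y => L y) x = L v := by
  unfold dd
  rw [L.fderiv]

theorem dd_conj (hf : DifferentiableAt ℝ f x) (v : Cn n) :
    dd v (fun y => (starRingEnd ℂ) (f y)) x = (starRingEnd ℂ) (dd v f x) := by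
  unfold dd
  have := (Complex.conjCLE.toContinuousLinearMap.hasFDerivAt.comp x hf.hasFDerivAt).fderiv
  have h2 : (fun y => (starRingEnd ℂ) (f y)) = (Complex.conjCLE.toContinuousLinearMap) ∘ f := by
    ext y; simp
  rw [h2, this]; simp

theorem dd_sum_smul {ι : Type*} (s : Finset ι) (c : ι → ℝ) (v : ι → Cn n) :
    dd (∑ i ∈ s, c i • v i) f x = ∑ i ∈ s, (c i : ℂ) * dd (v i) f x := by
  unfold dd
  simp [map_sum, map_smul]

theorem dd_dd_eq (hf : ContDiffAt ℝ ∞ f x) (v w : Cn n) :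
    dd v (dd w f) x = fderiv ℝ (fderiv ℝ f) x v w := by
  have h : DifferentiableAt ℝ (fderiv ℝ f) x :=
    (hf.fderiv_right (m := ∞) (by simp)).differentiableAt (by simp)
  unfold dd
  have h2 := (h.hasFDerivAt.clm_apply (hasFDerivAt_const w x)).fderiv
  rw [h2]
  simp

theorem dd_comm (hf : ContDiffAt ℝ ∞ f x) (v w : Cn n) :
    dd v (dd w f) x = dd w (dd v f) x := by
  rw [dd_dd_eq hf, dd_dd_eq hf]
  exact (hf.isSymmSndFDerivAt (by simpa using two_le_smooth)) v w

theorem laplacian_eq_sum_dd {ι : Type*} [Fintype ι] (e : OrthonormalBasis ι ℝ (Cn n))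
    (hf : ContDiffAt ℝ ∞ f x) :
    Laplacian.laplacian f x = ∑ i, dd (e i) (dd (e i) f) x := by
  rw [InnerProductSpace.laplacian_eq_iteratedFDeriv_orthonormalBasis f e]
  refine Finset.sum_congr rfl fun i _ => ?_
  rw [iteratedFDeriv_two_apply, dd_dd_eq hf]
  simp

theorem dd_congr (h : f =ᶠ[𝓝 x] g) (v : Cn n) : dd v f x = dd v g x := by
  unfold dd
  rw [h.fderiv_eq]

theorem laplacian_mul (hf : ContDiffAt ℝ ∞ f x) (hg : ContDiffAt ℝ ∞ g x)
    {ι : Type*} [Fintype ι] (e : OrthonormalBasis ι ℝ (Cn n)) :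
    Laplacian.laplacian (fun y => f y * g y) x =
      f x * Laplacian.laplacian g x + 2 * ∑ i, dd (e i) f x * dd (e i) g x +
        Laplacian.laplacian f x * g x := by
  rw [laplacian_eq_sum_dd e hf, laplacian_eq_sum_dd e hg, laplacian_eq_sum_dd e (hf.mul hg),
    Finset.mul_sum, Finset.mul_sum, Finset.sum_mul, ← Finset.sum_add_distrib,
    ← Finset.sum_add_distrib]
  refine Finset.sum_congr rfl fun i _ => ?_
  have h1 : dd (e i) (fun y => f y * g y) =ᶠ[𝓝 x]
      fun y => f y * dd (e i) g y + dd (e i) f y * g y := by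
    filter_upwards [(hf.of_le (m := 1) (by simp)).eventually (by simp),
      (hg.of_le (m := 1) (by simp)).eventually (by simp)] with y hy hy'
    exact dd_mul (hy.differentiableAt (by simp)) (hy'.differentiableAt (by simp)) _
  have d1 := differentiableAt_of_smooth hf
  have d2 := differentiableAt_of_smooth hg
  have d3 := differentiableAt_of_smooth (contDiffAt_dd hf (e i))
  have d4 := differentiableAt_of_smooth (contDiffAt_dd hg (e i))
  rw [dd_congr h1, dd_add (f := fun y => f y * dd (e i) g y) (g := fun y => dd (e i) f y * g y)
    (d1.mul d4) (d3.mul d2), dd_mul d1 d4, dd_mul d3 d2]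
  ring

theorem laplacian_dd (hf : ContDiff ℝ ∞ f) (v : Cn n) :
    Laplacian.laplacian (dd v f) x = dd v (Laplacian.laplacian f) x := by
  let e := stdOrthonormalBasis ℝ (Cn n)
  have h0 : Laplacian.laplacian f = fun y => ∑ i, dd (e i) (dd (e i) f) y :=
    funext fun y => laplacian_eq_sum_dd e hf.contDiffAt
  have hs := fun w : Cn n => contDiff_dd hf w
  rw [laplacian_eq_sum_dd e (hs v).contDiffAt, h0]
  have h1 : dd v (fun y => ∑ i, dd (e i) (dd (e i) f) y) x =
      ∑ i, dd v (dd (e i) (dd (e i) f)) x := by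
    rw [dd, fderiv_fun_sum fun i _ =>
      differentiableAt_of_smooth (contDiff_dd (hs (e i)) (e i)).contDiffAt]
    simp [dd]
  rw [h1]
  refine Finset.sum_congr rfl fun i _ => ?_
  rw [dd_comm (hs (e i)).contDiffAt]
  congr 1
  funext y
  exact dd_comm hf.contDiffAt _ _

theorem dd_smul_complex (hw : ℂ) (b : Cn n) :
    dd (hw • b) f x = hw.re * dd b f x + hw.im * dd (Complex.I • b) f x := by
  have h : hw • b = hw.re • b + hw.im • (Complex.I • b) := by
    conv_lhs => rw [← Complex.re_add_im hw, add_smul, mul_smul]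
    rfl
  unfold dd
  rw [h, map_add, map_smul, map_smul]
  simp

theorem dz_smul (w : ℂ) (b : Cn n) : dz (w • b) f x = w * dz b f x := by
  unfold dz
  rw [smul_smul, dd_smul_complex w, dd_smul_complex (Complex.I * w)]
  conv_rhs => rw [← Complex.re_add_im w]
  simp only [Complex.mul_re, Complex.mul_im, Complex.I_re, Complex.I_im]
  push_cast
  linear_combination ((w.im : ℂ) / 2 * dd (Complex.I • b) f x) * Complex.I_sq

theorem dzb_smul (w : ℂ) (b : Cn n) : dzb (w • b) f x = (starRingEnd ℂ) w * dzb b f x := by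
  unfold dzb
  rw [smul_smul, dd_smul_complex w, dd_smul_complex (Complex.I * w)]
  have : (starRingEnd ℂ) w = w.re - w.im * Complex.I := by
    apply Complex.ext <;> simp
  rw [this]
  simp only [Complex.mul_re, Complex.mul_im, Complex.I_re, Complex.I_im]
  push_cast
  linear_combination ((w.im : ℂ) / 2 * dd (Complex.I • b) f x) * Complex.I_sq

theorem dz_add_dzb (b : Cn n) : dz b f x + dzb b f x = dd b f x := by
  unfold dz dzb; ring

theorem conj_dz (hf : DifferentiableAt ℝ f x) (b : Cn n) :
    dz b (fun y => (starRingEnd ℂ) (f y)) x = (starRingEnd ℂ) (dzb b f x) := by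
  unfold dz dzb
  rw [dd_conj hf, dd_conj hf]
  simp [sub_eq_add_neg, Complex.conj_ofNat]

theorem inner_complex_eq (b v : Cn n) :
    ⟪b, v⟫_ℂ = (⟪b, v⟫_ℝ : ℂ) + Complex.I * (⟪Complex.I • b, v⟫_ℝ : ℂ) := by
  simp only [PiLp.inner_apply, Complex.inner]
  push_cast
  rw [Finset.mul_sum, ← Finset.sum_add_distrib]
  refine Finset.sum_congr rfl fun i _ => ?_
  apply Complex.ext
  · simp
  · simp; ring

/-- `∑_e ⟨b, e⟩ D_e f = 2 ∂̄_b f` over a real orthonormal basis. -/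
theorem sum_inner_dd {ι : Type*} [Fintype ι] (e : OrthonormalBasis ι ℝ (Cn n)) (b : Cn n) :
    ∑ i, ⟪b, e i⟫_ℂ * dd (e i) f x = 2 * dzb b f x := by
  have h (v : Cn n) : ∑ i, (⟪v, e i⟫_ℝ : ℂ) * dd (e i) f x = dd v f x := by
    conv_rhs => rw [← e.sum_repr' v]
    rw [dd_sum_smul]
    refine Finset.sum_congr rfl fun i _ => ?_
    rw [real_inner_comm]
  simp only [inner_complex_eq, add_mul, Finset.sum_add_distrib, mul_assoc]
  rw [← Finset.mul_sum, h, h]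
  unfold dzb; ring

end Calculus

/-! ### Bihomogeneous harmonic functions -/

/-- `Y` is a smooth harmonic function on `ℂⁿ` that is homogeneous of degree `p` in `z` and of
degree `q` in `z̄`. Integer degrees are allowed so that derivatives lower degrees without
exception; such functions vanish if one of the degrees is negative (`IsHarm.eq_zero`). -/
structure IsHarm {n : ℕ} (p q : ℤ) (Y : Cn n → ℂ) : Prop where
  smooth : ContDiff ℝ ∞ Y
  homog : ∀ c : ℂ, c ≠ 0 → ∀ z, Y (c • z) = c ^ p * (starRingEnd ℂ) c ^ q * Y z
  harmonic : ∀ z, Laplacian.laplacian Y z = 0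

section Bihomogeneous

variable {n : ℕ} {p q : ℤ} {Y : Cn n → ℂ}

theorem dd_homog (hs : ContDiff ℝ ∞ Y)
    (hh : ∀ c : ℂ, c ≠ 0 → ∀ z, Y (c • z) = c ^ p * (starRingEnd ℂ) c ^ q * Y z)
    {c : ℂ} (hc : c ≠ 0) (b z : Cn n) :
    dd b Y (c • z) = c ^ p * (starRingEnd ℂ) c ^ q * dd (c⁻¹ • b) Y z := by
  have h1 : (fun y => Y (c • y)) = fun y => (c ^ p * (starRingEnd ℂ) c ^ q) * Y y :=
    funext fun y => hh c hc y
  have h2 := congrArg (fun F => dd (c⁻¹ • b) F z) h1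
  rw [dd_const_mul (differentiableAt_of_smooth hs.contDiffAt)] at h2
  rw [← h2]
  let A : Cn n →L[ℝ] Cn n := (c • ContinuousLinearMap.id ℂ (Cn n)).restrictScalars ℝ
  have h3 : HasFDerivAt (fun y => Y (c • y)) ((fderiv ℝ Y (c • z)).comp A) z :=
    (differentiableAt_of_smooth (x := c • z) hs.contDiffAt).hasFDerivAt.comp z A.hasFDerivAt
  unfold dd
  rw [h3.fderiv]
  simp [A, smul_smul, hc]

theorem dz_homog (hs : ContDiff ℝ ∞ Y)
    (hh : ∀ c : ℂ, c ≠ 0 → ∀ z, Y (c • z) = c ^ p * (starRingEnd ℂ) c ^ q * Y z)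
    {c : ℂ} (hc : c ≠ 0) (b z : Cn n) :
    dz b Y (c • z) = c ^ (p - 1) * (starRingEnd ℂ) c ^ q * dz b Y z := by
  have : dz b Y (c • z) = c ^ p * (starRingEnd ℂ) c ^ q * dz (c⁻¹ • b) Y z := by
    unfold dz
    rw [dd_homog hs hh hc, dd_homog hs hh hc, smul_comm]
    ring
  rw [this, dz_smul, zpow_sub_one₀ hc]
  ring

theorem dzb_homog (hs : ContDiff ℝ ∞ Y)
    (hh : ∀ c : ℂ, c ≠ 0 → ∀ z, Y (c • z) = c ^ p * (starRingEnd ℂ) c ^ q * Y z)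
    {c : ℂ} (hc : c ≠ 0) (b z : Cn n) :
    dzb b Y (c • z) = c ^ p * (starRingEnd ℂ) c ^ (q - 1) * dzb b Y z := by
  have : dzb b Y (c • z) = c ^ p * (starRingEnd ℂ) c ^ q * dzb (c⁻¹ • b) Y z := by
    unfold dzb
    rw [dd_homog hs hh hc, dd_homog hs hh hc, smul_comm]
    ring
  rw [this, dzb_smul, zpow_sub_one₀ (by simpa using hc), map_inv₀]
  ring

/-- Euler's identity for the derivative in the direction `w z`. -/
theorem euler_aux (hs : ContDiff ℝ ∞ Y)
    (hh : ∀ c : ℂ, c ≠ 0 → ∀ z, Y (c • z) = c ^ p * (starRingEnd ℂ) c ^ q * Y z)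
    (w : ℂ) (z : Cn n) : dd (w • z) Y z = (p * w + q * (starRingEnd ℂ) w) * Y z := by
  let c : ℝ → ℂ := fun t => 1 + t * w
  have hc : HasDerivAt c w 0 := by
    simpa [c] using ((Complex.ofRealCLM.hasDerivAt (x := (0 : ℝ))).mul_const w).const_add 1
  have hc0 : c 0 = 1 := by simp [c]
  have h1 : HasDerivAt (fun t => Y (c t • z)) (dd (w • z) Y z) 0 := by
    have hd : HasFDerivAt Y (fderiv ℝ Y z) (c 0 • z) := by
      rw [hc0, one_smul]; exact (differentiableAt_of_smooth hs.contDiffAt).hasFDerivAt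
    exact hd.comp_hasDerivAt (0 : ℝ) (hc.smul_const z)
  have hcc : HasDerivAt (fun t => (starRingEnd ℂ) (c t)) ((starRingEnd ℂ) w) 0 := by
    exact (Complex.conjCLE.toContinuousLinearMap.hasFDerivAt (x := c 0)).comp_hasDerivAt
      (0 : ℝ) hc
  have hz1 : HasDerivAt (fun t => c t ^ p) (p * w) 0 := by
    have := HasDerivAt.comp (0 : ℝ) (hasDerivAt_zpow p (c 0) (Or.inl (by simp [hc0]))) hc
    simp only [hc0, one_zpow, mul_one] at this
    exact this
  have hz2 : HasDerivAt (fun t => (starRingEnd ℂ) (c t) ^ q) (q * (starRingEnd ℂ) w) 0 := by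
    have := HasDerivAt.comp (0 : ℝ)
      (hasDerivAt_zpow q ((starRingEnd ℂ) (c 0)) (Or.inl (by simp [hc0]))) hcc
    simp only [hc0, map_one, one_zpow, mul_one] at this
    exact this
  have h2 : HasDerivAt (fun t => c t ^ p * (starRingEnd ℂ) (c t) ^ q * Y z)
      ((p * w + q * (starRingEnd ℂ) w) * Y z) 0 := by
    have := (hz1.mul hz2).mul_const (Y z)
    simpa [hc0] using this
  have hev : (fun t => Y (c t • z)) =ᶠ[𝓝 0]
      fun t => c t ^ p * (starRingEnd ℂ) (c t) ^ q * Y z := by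
    have : ∀ᶠ t in 𝓝 (0 : ℝ), c t ≠ 0 :=
      hc.continuousAt.eventually_ne (by simp [hc0])
    filter_upwards [this] with t ht
    exact hh _ ht z
  exact h1.unique (h2.congr_of_eventuallyEq hev)

theorem euler_dzb (hs : ContDiff ℝ ∞ Y)
    (hh : ∀ c : ℂ, c ≠ 0 → ∀ z, Y (c • z) = c ^ p * (starRingEnd ℂ) c ^ q * Y z)
    (z : Cn n) : dzb z Y z = q * Y z := by
  have h1 := euler_aux hs hh 1 z
  have h2 := euler_aux hs hh Complex.I z
  rw [one_smul] at h1
  rw [dzb, h1, h2]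
  simp only [map_one, Complex.conj_I]
  linear_combination ((p - q : ℂ) / 2 * Y z) * Complex.I_sq

/-- A function of negative total degree that is continuous at the origin vanishes. -/
theorem homog_neg_degree (hs : Continuous Y)
    (hh : ∀ c : ℂ, c ≠ 0 → ∀ z, Y (c • z) = c ^ p * (starRingEnd ℂ) c ^ q * Y z)
    (hpq : p + q < 0) (z : Cn n) : Y z = 0 := by
  -- `Y z = t ^ (-(p + q)) Y (t z)` tends to `0` as `t → 0+`
  have h1 : Tendsto (fun t : ℝ => ((t : ℂ) ^ (-(p + q)).toNat) * Y ((t : ℂ) • z)) (𝓝[>] 0)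
      (𝓝 (0 * Y ((0 : ℂ) • z))) := by
    have hc : Continuous fun t : ℝ => ((t : ℂ) ^ (-(p + q)).toNat) * Y ((t : ℂ) • z) := by
      fun_prop
    have := (hc.tendsto 0).mono_left (nhdsWithin_le_nhds (s := Set.Ioi 0))
    have hne : (-(p + q)).toNat ≠ 0 := by omega
    simpa only [Complex.ofReal_zero, zero_pow hne] using this
  have h2 : Tendsto (fun t : ℝ => ((t : ℂ) ^ (-(p + q)).toNat) * Y ((t : ℂ) • z)) (𝓝[>] 0)
      (𝓝 (Y z)) := by
    refine tendsto_const_nhds.congr' ?_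
    filter_upwards [self_mem_nhdsWithin] with t ht
    have ht0 : (t : ℂ) ≠ 0 := by exact_mod_cast (ne_of_gt ht)
    rw [hh _ ht0, ← zpow_natCast, Int.toNat_of_nonneg (by omega), Complex.conj_ofReal]
    rw [← mul_assoc, ← zpow_add₀ ht0, ← zpow_add₀ ht0]
    simp
  simpa using tendsto_nhds_unique h2 h1

/-- Smooth functions of negative degree in `z` vanish: lower the degree in `z̄` by derivatives
until the total degree is negative, and return by Euler's identity. -/
theorem homog_neg_left (hs : ContDiff ℝ ∞ Y) (hp : p < 0)
    (hh : ∀ c : ℂ, c ≠ 0 → ∀ z, Y (c • z) = c ^ p * (starRingEnd ℂ) c ^ q * Y z)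
    (z : Cn n) : Y z = 0 := by
  suffices H : ∀ (k : ℕ) (q : ℤ) (Y : Cn n → ℂ), q ≤ k → ContDiff ℝ ∞ Y →
      (∀ c : ℂ, c ≠ 0 → ∀ z, Y (c • z) = c ^ p * (starRingEnd ℂ) c ^ q * Y z) →
      ∀ z, Y z = 0 from H q.toNat q Y (by omega) hs hh z
  intro k
  induction k with
  | zero =>
    intro q Y hq hs hh z
    exact homog_neg_degree hs.continuous hh (by push_cast at hq; omega) z
  | succ k ih =>
    intro q Y hq hs hh z
    by_cases hpq : p + q < 0
    · exact homog_neg_degree hs.continuous hh hpq z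
    have h1 := ih (q - 1) (dzb z Y) (by push_cast at hq; omega) (contDiff_dzb hs z)
      (fun c hc y => dzb_homog hs hh hc z y) z
    rw [euler_dzb hs hh] at h1
    have hq0 : (q : ℂ) ≠ 0 := by
      have : q ≠ 0 := by omega
      exact_mod_cast this
    exact (mul_eq_zero.1 h1).resolve_left hq0

theorem laplacian_lincomb {f g : Cn n → ℂ} {z : Cn n} (hf : ContDiffAt ℝ 2 f z)
    (hg : ContDiffAt ℝ 2 g z) (a b : ℂ) :
    Laplacian.laplacian (fun y => a * f y + b * g y) z =
      a * Laplacian.laplacian f z + b * Laplacian.laplacian g z := by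
  have h1 := ContDiffAt.laplacian_add (f₁ := a • f) (f₂ := b • g) (hf.const_smul a)
    (hg.const_smul b)
  rw [InnerProductSpace.laplacian_smul _ hf, InnerProductSpace.laplacian_smul _ hg] at h1
  exact h1

namespace IsHarm

theorem conj (h : IsHarm p q Y) : IsHarm q p fun z => (starRingEnd ℂ) (Y z) where
  smooth := Complex.conjCLE.contDiff.comp h.smooth
  homog c hc z := by
    rw [h.homog c hc]; simp [mul_comm]
  harmonic z := by
    have h2 : (fun z => (starRingEnd ℂ) (Y z)) = Complex.conjCLE.toContinuousLinearMap ∘ Y := by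
      ext y; simp
    rw [h2, ContDiffAt.laplacian_CLM_comp_left (h.smooth.contDiffAt.of_le two_le_smooth)]
    simp [h.harmonic z]

theorem eq_zero_of_left_neg (h : IsHarm p q Y) (hp : p < 0) (z : Cn n) : Y z = 0 :=
  homog_neg_left h.smooth hp h.homog z

theorem eq_zero_of_right_neg (h : IsHarm p q Y) (hq : q < 0) (z : Cn n) : Y z = 0 := by
  simpa using h.conj.eq_zero_of_left_neg hq z

theorem zero : IsHarm p q (fun _ : Cn n => (0 : ℂ)) where
  smooth := contDiff_const
  homog c hc z := by simp
  harmonic z := by simp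

theorem add {Z : Cn n → ℂ} (h : IsHarm p q Y) (h' : IsHarm p q Z) :
    IsHarm p q fun z => Y z + Z z where
  smooth := h.smooth.add h'.smooth
  homog c hc z := by rw [h.homog c hc, h'.homog c hc]; ring
  harmonic z := by
    have := ContDiffAt.laplacian_add (x := z) (h.smooth.contDiffAt.of_le two_le_smooth)
      (h'.smooth.contDiffAt.of_le two_le_smooth)
    rw [h.harmonic, h'.harmonic, add_zero] at this
    exact this

theorem const_mul (h : IsHarm p q Y) (c : ℂ) : IsHarm p q fun z => c * Y z where
  smooth := contDiff_const.mul h.smooth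
  homog w hw z := by rw [h.homog w hw]; ring
  harmonic z := by
    have := InnerProductSpace.laplacian_smul (𝕜 := ℂ) (x := z) c
      (h.smooth.contDiffAt.of_le two_le_smooth)
    rw [h.harmonic, smul_zero] at this
    exact this

theorem const (c : ℂ) : IsHarm 0 0 (fun _ : Cn n => c) where
  smooth := contDiff_const
  homog c hc z := by simp
  harmonic z := by simp

theorem laplacian_dd_eq_zero (h : IsHarm p q Y) (v z : Cn n) :
    Laplacian.laplacian (SzegoBall.dd v Y) z = 0 := by
  rw [laplacian_dd h.smooth]
  have : (Laplacian.laplacian Y) = fun _ => 0 := funext h.harmonic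
  rw [this]
  simp [SzegoBall.dd]

theorem dz (h : IsHarm p q Y) (b : Cn n) : IsHarm (p - 1) q (dz b Y) where
  smooth := contDiff_dz h.smooth b
  homog c hc z := dz_homog h.smooth h.homog hc b z
  harmonic z := by
    have s1 := (contDiff_dd h.smooth b).contDiffAt (x := z) |>.of_le two_le_smooth
    have s2 := (contDiff_dd h.smooth (Complex.I • b)).contDiffAt (x := z) |>.of_le two_le_smooth
    have h1 : SzegoBall.dz b Y = fun y => (2 : ℂ)⁻¹ * SzegoBall.dd b Y y +
        (-Complex.I / 2) * SzegoBall.dd (Complex.I • b) Y y := by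
      funext y
      simp only [SzegoBall.dz]
      ring
    rw [h1, laplacian_lincomb s1 s2, h.laplacian_dd_eq_zero, h.laplacian_dd_eq_zero]
    simp

theorem dzb (h : IsHarm p q Y) (b : Cn n) : IsHarm p (q - 1) (dzb b Y) := by
  have h1 := (h.conj.dz b).conj
  have h2 : (fun z => (starRingEnd ℂ) (SzegoBall.dz b (fun z => (starRingEnd ℂ) (Y z)) z)) =
      SzegoBall.dzb b Y := by
    funext z
    rw [conj_dz (differentiableAt_of_smooth h.smooth.contDiffAt), Complex.conj_conj]
  rwa [h2] at h1

end IsHarm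

/-- The real-linear map `z ↦ b̄ · z`. -/
def ell {n : ℕ} (b : Cn n) : Cn n →L[ℝ] ℂ := (innerSL ℂ b).restrictScalars ℝ

theorem ell_apply (b z : Cn n) : ell b z = ⟪b, z⟫_ℂ := rfl

theorem laplacian_clm (L : Cn n →L[ℝ] ℂ) (z : Cn n) :
    Laplacian.laplacian (fun y => L y) z = 0 := by
  rw [laplacian_eq_sum_dd (stdOrthonormalBasis ℝ (Cn n)) L.contDiff.contDiffAt]
  refine Finset.sum_eq_zero fun i _ => ?_
  have : dd ((stdOrthonormalBasis ℝ (Cn n)) i) (fun y => L y) =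
      fun _ => L ((stdOrthonormalBasis ℝ (Cn n)) i) := by
    funext y; exact dd_clm L _
  rw [this]
  simp [dd]

/-- The square of the norm as a complex valued function. -/
def nsq {n : ℕ} (z : Cn n) : ℂ := ((‖z‖ ^ 2 : ℝ) : ℂ)

theorem contDiff_nsq : ContDiff ℝ ∞ (nsq (n := n)) :=
  Complex.ofRealCLM.contDiff.comp (contDiff_norm_sq ℝ)

theorem dd_nsq (v z : Cn n) : dd v nsq z = ((2 * ⟪z, v⟫_ℝ : ℝ) : ℂ) := by
  have h1 := (Complex.ofRealCLM.hasFDerivAt).comp z (hasStrictFDerivAt_norm_sq z).hasFDerivAt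
  have h2 : HasFDerivAt (nsq (n := n)) _ z := h1
  unfold dd
  rw [h2.fderiv]
  simp

theorem laplacian_nsq (z : Cn n) : Laplacian.laplacian nsq z = 4 * (n : ℂ) := by
  let e := stdOrthonormalBasis ℝ (Cn n)
  rw [laplacian_eq_sum_dd e contDiff_nsq.contDiffAt]
  have h (i) : dd (e i) (dd (e i) nsq) z = 2 := by
    have h1 : dd (e i) (nsq (n := n)) =
        fun y => ((2 : ℝ) • (Complex.ofRealCLM.comp (innerSL ℝ (e i)))) y := by
      funext y; rw [dd_nsq, real_inner_comm]; simp
    rw [h1, dd_clm]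
    simp
  rw [Finset.sum_congr rfl fun i _ => h i]
  have hf : Module.finrank ℝ (Cn n) = 2 * n := by
    rw [← Module.finrank_mul_finrank ℝ ℂ (Cn n)]
    simp
  simp [hf]
  ring

namespace IsHarm

theorem ell_mul (h : IsHarm p q Y) (b z : Cn n) :
    Laplacian.laplacian (fun y => ell b y * Y y) z = 4 * SzegoBall.dzb b Y z := by
  let e := stdOrthonormalBasis ℝ (Cn n)
  rw [laplacian_mul (ell b).contDiff.contDiffAt h.smooth.contDiffAt e, h.harmonic,
    laplacian_clm]
  simp only [dd_clm, ell_apply]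
  rw [sum_inner_dd e b]
  ring

theorem euler_real (h : IsHarm p q Y) (z : Cn n) :
    SzegoBall.dd z Y z = (p + q) * Y z := by
  have := euler_aux h.smooth h.homog 1 z
  simpa using this

theorem nsq_mul (h : IsHarm p q Y) (z : Cn n) :
    Laplacian.laplacian (fun y => nsq y * Y y) z = 4 * (n + p + q) * Y z := by
  let e := stdOrthonormalBasis ℝ (Cn n)
  rw [laplacian_mul contDiff_nsq.contDiffAt h.smooth.contDiffAt e, h.harmonic, laplacian_nsq]
  have h1 : ∑ i, SzegoBall.dd (e i) nsq z * SzegoBall.dd (e i) Y z =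
      2 * SzegoBall.dd z Y z := by
    conv_rhs => rw [← e.sum_repr' z]
    rw [dd_sum_smul, Finset.mul_sum, e.sum_repr' z]
    refine Finset.sum_congr rfl fun i _ => ?_
    rw [dd_nsq, real_inner_comm]
    push_cast; ring
  rw [h1, h.euler_real]
  ring

/-- The harmonic part of degree `(p + 1, q)` of `(b̄ · z) Y`. If `n + p + q = 1`, then
`∂̄_b Y = 0`, and the junk value of the inverse does not matter. -/
theorem raise (h : IsHarm p q Y) (b : Cn n) :
    IsHarm (p + 1) q
      fun z => ell b z * Y z - ((n + p + q - 1 : ℂ))⁻¹ * (nsq z * SzegoBall.dzb b Y z) where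
  smooth := ((ell b).contDiff.mul h.smooth).sub
    (contDiff_const.mul (contDiff_nsq.mul (contDiff_dzb h.smooth b)))
  homog c hc z := by
    have hc' : (starRingEnd ℂ) c ≠ 0 := by simpa using hc
    have hN : nsq (c • z) = c * (starRingEnd ℂ) c * nsq z := by
      rw [Complex.mul_conj, Complex.normSq_eq_norm_sq]
      simp only [nsq, norm_smul]
      push_cast; ring
    rw [h.homog c hc, (h.dzb b).homog c hc, hN, zpow_add_one₀ hc, zpow_sub_one₀ hc']
    simp only [ell_apply, inner_smul_right]
    field_simp
  harmonic z := by
    have s1 : ContDiffAt ℝ 2 (fun z => ell b z * Y z) z :=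
      ((ell b).contDiff.mul h.smooth).contDiffAt.of_le two_le_smooth
    have s2 : ContDiffAt ℝ 2 (fun z => nsq z * SzegoBall.dzb b Y z) z :=
      (contDiff_nsq.mul (contDiff_dzb h.smooth b)).contDiffAt.of_le two_le_smooth
    have h1 : (fun z => ell b z * Y z - ((n + p + q - 1 : ℂ))⁻¹ *
        (nsq z * SzegoBall.dzb b Y z)) = fun z => 1 * (ell b z * Y z) +
          (-((n + p + q - 1 : ℂ))⁻¹) * (nsq z * SzegoBall.dzb b Y z) := by
      funext y; ring
    rw [h1, laplacian_lincomb s1 s2, h.ell_mul, (h.dzb b).nsq_mul]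
    by_cases h0 : (n + p + q - 1 : ℂ) = 0
    · have : SzegoBall.dzb b Y z = 0 := by
        have h0' : (n : ℤ) + p + q - 1 = 0 := by exact_mod_cast h0
        by_cases hq : q - 1 < 0
        · exact (h.dzb b).eq_zero_of_right_neg hq z
        · rcases Nat.eq_zero_or_pos n with rfl | hn
          · rw [Subsingleton.elim b 0]
            simp [SzegoBall.dzb, SzegoBall.dd]
          · exact (h.dzb b).eq_zero_of_left_neg (by omega) z
      simp [this]
    · push_cast
      have : (n : ℂ) + p + (q - 1) = n + p + q - 1 := by ring
      rw [this]
      field_simp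
      ring

end IsHarm

end Bihomogeneous

/-! ### Smooth functions on the sphere -/

section Smooth

variable {n : ℕ}

theorem norm_sph (ζ : Sph n) : ‖(ζ : Cn n)‖ = 1 := by simp

theorem sph_ne_zero (ζ : Sph n) : (ζ : Cn n) ≠ 0 := by
  intro h; simpa [h] using norm_sph ζ

/-- The radial projection of a nonzero vector to the sphere. -/
def radProj (x : Cn n) (h : x ≠ 0) : Sph n :=
  ⟨(‖x‖⁻¹ : ℝ) • x, by
    rw [mem_sphere_zero_iff_norm, norm_smul, norm_inv, norm_norm,
      inv_mul_cancel₀ (norm_ne_zero_iff.mpr h)]⟩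

theorem radialExt_of_ne (f : Sph n → ℂ) {x : Cn n} (h : x ≠ 0) :
    radialExt f x = f (radProj x h) := by
  simp [radialExt, h, radProj]

theorem radialExt_smul (f : Sph n → ℂ) {r : ℝ} (hr : 0 < r) (x : Cn n) :
    radialExt f (r • x) = radialExt f x := by
  by_cases hx : x = 0
  · simp [hx]
  · have h2 : r • x ≠ 0 := smul_ne_zero hr.ne' hx
    rw [radialExt_of_ne f hx, radialExt_of_ne f h2]
    congr 1
    apply Subtype.ext
    simp only [radProj, norm_smul, smul_smul, Real.norm_eq_abs, abs_of_pos hr]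
    congr 1
    field_simp

theorem radialExt_coe (f : Sph n → ℂ) (ζ : Sph n) : radialExt f ζ = f ζ := by
  rw [radialExt_of_ne f (sph_ne_zero ζ)]
  congr 1
  apply Subtype.ext
  simp [radProj]

theorem IsSmooth.contDiffAt {f : Sph n → ℂ} (hf : IsSmooth f) {x : Cn n} (hx : x ≠ 0) :
    ContDiffAt ℝ ∞ (radialExt f) x :=
  ContDiffOn.contDiffAt hf (isOpen_compl_singleton.mem_nhds hx)

theorem contDiffAt_normalize {x : Cn n} (hx : x ≠ 0) :
    ContDiffAt ℝ ∞ (fun y : Cn n => (‖y‖⁻¹ : ℝ) • y) x :=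
  ((contDiffAt_norm ℝ hx).inv (norm_ne_zero_iff.2 hx)).smul contDiffAt_id

/-- A function on the sphere is smooth if it is the restriction of a function that is smooth near
each point of the sphere. -/
theorem IsSmooth.of_contDiffAt {f : Sph n → ℂ} (F : Cn n → ℂ)
    (hF : ∀ ζ : Sph n, ContDiffAt ℝ ∞ F ζ) (h : ∀ ζ : Sph n, f ζ = F ζ) : IsSmooth f := by
  intro x hx
  have hx0 : x ≠ 0 := hx
  have h1 : ContDiffAt ℝ ∞ (fun y : Cn n => F ((‖y‖⁻¹ : ℝ) • y)) x :=
    (hF (radProj x hx0)).comp x (contDiffAt_normalize hx0)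
  refine (h1.congr_of_eventuallyEq ?_).contDiffWithinAt
  filter_upwards [isOpen_compl_singleton.mem_nhds hx0] with y hy
  rw [radialExt_of_ne f hy, h]
  rfl

theorem IsSmooth.continuous {f : Sph n → ℂ} (hf : IsSmooth f) : Continuous f := by
  rw [continuous_iff_continuousAt]
  intro ζ
  have h1 : ContinuousAt (fun ζ : Sph n => radialExt f ζ) ζ :=
    ContinuousAt.comp (hf.contDiffAt (sph_ne_zero ζ)).continuousAt
      continuous_subtype_val.continuousAt
  simpa only [radialExt_coe] using h1

theorem radialExt_mul (f g : Sph n → ℂ) :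
    radialExt (fun ζ => f ζ * g ζ) = fun x => radialExt f x * radialExt g x := by
  funext x
  by_cases hx : x = 0
  · simp [radialExt, hx]
  · simp only [radialExt_of_ne _ hx]

theorem radialExt_const_mul (c : ℂ) (f : Sph n → ℂ) :
    radialExt (fun ζ => c * f ζ) = fun x => c * radialExt f x := by
  funext x
  by_cases hx : x = 0
  · simp [radialExt, hx]
  · simp only [radialExt_of_ne _ hx]

theorem IsSmooth.mul {f g : Sph n → ℂ} (hf : IsSmooth f) (hg : IsSmooth g) :
    IsSmooth fun ζ => f ζ * g ζ := by
  unfold IsSmooth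
  rw [radialExt_mul]
  exact ContDiffOn.mul hf hg

theorem IsSmooth.const_mul {f : Sph n → ℂ} (hf : IsSmooth f) (c : ℂ) :
    IsSmooth fun ζ => c * f ζ := by
  unfold IsSmooth
  rw [radialExt_const_mul]
  exact ContDiffOn.mul contDiffOn_const hf

theorem IsSmooth.add {f g : Sph n → ℂ} (hf : IsSmooth f) (hg : IsSmooth g) :
    IsSmooth fun ζ => f ζ + g ζ :=
  .of_contDiffAt (fun x => radialExt f x + radialExt g x)
    (fun ζ => (hf.contDiffAt (sph_ne_zero ζ)).add (hg.contDiffAt (sph_ne_zero ζ)))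
    fun ζ => by simp only [radialExt_coe]

theorem IsSmooth.conj {f : Sph n → ℂ} (hf : IsSmooth f) :
    IsSmooth fun ζ => (starRingEnd ℂ) (f ζ) :=
  .of_contDiffAt (fun x => (starRingEnd ℂ) (radialExt f x))
    (fun ζ => Complex.conjCLE.contDiff.contDiffAt.comp _ (hf.contDiffAt (sph_ne_zero ζ)))
    fun ζ => by simp only [radialExt_coe]

theorem dd_homog_real {F : Cn n → ℂ} {x : Cn n} {r : ℝ} {c : ℂ} (hr : 0 < r) (hx : x ≠ 0)
    (hF : ∀ y : Cn n, y ≠ 0 → DifferentiableAt ℝ F y)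
    (hh : ∀ y : Cn n, y ≠ 0 → F (r • y) = c * F y) (v : Cn n) :
    dd v F (r • x) = (r : ℂ)⁻¹ * c * dd v F x := by
  have h1 : (fun y => F (r • y)) =ᶠ[𝓝 x] fun y => c * F y := by
    filter_upwards [isOpen_compl_singleton.mem_nhds hx] with y hy using hh y hy
  have h2 := dd_congr h1 v
  rw [dd_const_mul (hF x hx)] at h2
  let A : Cn n →L[ℝ] Cn n := r • ContinuousLinearMap.id ℝ (Cn n)
  have h3 : HasFDerivAt (fun y => F (r • y)) ((fderiv ℝ F (r • x)).comp A) x :=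
    (hF (r • x) (smul_ne_zero hr.ne' hx)).hasFDerivAt.comp x A.hasFDerivAt
  unfold dd at h2 ⊢
  rw [h3.fderiv] at h2
  have hr0 : (r : ℂ) ≠ 0 := by exact_mod_cast hr.ne'
  simp [A] at h2
  rw [mul_assoc, ← h2]
  field_simp

section RadialDerivatives

variable {f : Sph n → ℂ}

theorem IsSmooth.dd_smul (hf : IsSmooth f) {x : Cn n} {r : ℝ} (hr : 0 < r) (hx : x ≠ 0) (v : Cn n) :
    dd v (radialExt f) (r • x) = (r : ℂ)⁻¹ * dd v (radialExt f) x := by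
  have := dd_homog_real (c := 1) hr hx
    (fun y hy => differentiableAt_of_smooth (hf.contDiffAt hy))
    (fun y _ => by rw [radialExt_smul f hr, one_mul]) v
  rwa [mul_one] at this

theorem IsSmooth.laplacian_smul (hf : IsSmooth f) {x : Cn n} {r : ℝ} (hr : 0 < r) (hx : x ≠ 0) :
    Laplacian.laplacian (radialExt f) (r • x) =
      (r : ℂ)⁻¹ ^ 2 * Laplacian.laplacian (radialExt f) x := by
  let e := stdOrthonormalBasis ℝ (Cn n)
  rw [laplacian_eq_sum_dd e (hf.contDiffAt hx),
    laplacian_eq_sum_dd e (hf.contDiffAt (smul_ne_zero hr.ne' hx)), Finset.mul_sum]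
  refine Finset.sum_congr rfl fun i _ => ?_
  rw [dd_homog_real (c := (r : ℂ)⁻¹) hr hx
    (fun y hy => differentiableAt_of_smooth (contDiffAt_dd (hf.contDiffAt hy) _))
    (fun y hy => hf.dd_smul hr hy _)]
  ring

theorem IsSmooth.dd_self (hf : IsSmooth f) {x : Cn n} (hx : x ≠ 0) : dd x (radialExt f) x = 0 := by
  have h1 : HasDerivAt (fun t : ℝ => radialExt f (t • x)) (dd x (radialExt f) x) 1 := by
    have hd : HasFDerivAt (radialExt f) (fderiv ℝ (radialExt f) x) ((1 : ℝ) • x) := by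
      rw [one_smul]; exact (differentiableAt_of_smooth (hf.contDiffAt hx)).hasFDerivAt
    have := hd.comp_hasDerivAt (1 : ℝ) ((hasDerivAt_id (1 : ℝ)).smul_const x)
    rw [one_smul] at this
    exact this
  have h2 : HasDerivAt (fun t : ℝ => radialExt f (t • x)) 0 1 := by
    refine (hasDerivAt_const (1 : ℝ) (radialExt f x)).congr_of_eventuallyEq ?_
    filter_upwards [eventually_gt_nhds (zero_lt_one (α := ℝ))] with t ht
    exact radialExt_smul f ht x
  exact h1.unique h2

end RadialDerivatives

/-- The derivative of `f` along the Reeb field `ζ ↦ i ζ`. -/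
def reeb (f : Sph n → ℂ) (ζ : Sph n) : ℂ := dd (Complex.I • (ζ : Cn n)) (radialExt f) ζ

theorem IsSmooth.radialExt_reeb {f : Sph n → ℂ} (hf : IsSmooth f) {x : Cn n} (hx : x ≠ 0) :
    radialExt (reeb f) x = dd (Complex.I • x) (radialExt f) x := by
  have hr : 0 < ‖x‖⁻¹ := inv_pos.2 (norm_pos_iff.2 hx)
  rw [radialExt_of_ne _ hx, reeb]
  simp only [radProj]
  rw [hf.dd_smul hr hx]
  have h1 : Complex.I • ((‖x‖⁻¹ : ℝ) • x) = (‖x‖⁻¹ : ℝ) • (Complex.I • x) := smul_comm _ _ _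
  have h0 : (‖x‖ : ℂ) ≠ 0 := by exact_mod_cast norm_ne_zero_iff.2 hx
  rw [h1]
  simp only [dd, map_smul, Complex.real_smul]
  push_cast
  field_simp

theorem IsSmooth.reeb {f : Sph n → ℂ} (hf : IsSmooth f) : IsSmooth (reeb f) := by
  refine .of_contDiffAt (fun x => fderiv ℝ (radialExt f) x (Complex.I • x)) (fun ζ => ?_)
    fun ζ => rfl
  refine ((hf.contDiffAt (sph_ne_zero ζ)).fderiv_right (m := ∞) (by simp)).clm_apply ?_
  exact (contDiff_id.const_smul Complex.I).contDiffAt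

theorem exp_smul_ne_zero (t : ℝ) {x : Cn n} (hx : x ≠ 0) :
    Complex.exp (t * Complex.I) • x ≠ 0 := smul_ne_zero (Complex.exp_ne_zero _) hx

theorem IsSmooth.hasDerivAt_flow {f : Sph n → ℂ} (hf : IsSmooth f) {x : Cn n} (hx : x ≠ 0)
    (t : ℝ) : HasDerivAt (fun t : ℝ => radialExt f (Complex.exp (t * Complex.I) • x))
      (radialExt (SzegoBall.reeb f) (Complex.exp (t * Complex.I) • x)) t := by
  rw [hf.radialExt_reeb (exp_smul_ne_zero t hx)]
  have h1 : HasDerivAt (fun t : ℝ => Complex.exp (t * Complex.I))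
      (Complex.exp (t * Complex.I) * Complex.I) t := by
    have := ((hasDerivAt_id (t : ℂ)).mul_const Complex.I).cexp.comp_ofReal
    simpa using this
  have h2 := h1.smul_const x
  have h3 := (differentiableAt_of_smooth
    (hf.contDiffAt (exp_smul_ne_zero t hx))).hasFDerivAt.comp_hasDerivAt t h2
  rw [smul_smul, mul_comm Complex.I]
  exact h3

theorem IsSmooth.reebSq_eq {f : Sph n → ℂ} (hf : IsSmooth f) :
    reebSq f = SzegoBall.reeb (SzegoBall.reeb f) := by
  funext ζ
  unfold reebSq
  rw [iteratedDeriv_succ, iteratedDeriv_one]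
  have h1 : deriv (fun t : ℝ => radialExt f (Complex.exp (t * Complex.I) • (ζ : Cn n))) =
      fun t : ℝ => radialExt (SzegoBall.reeb f) (Complex.exp (t * Complex.I) • (ζ : Cn n)) :=
    funext fun t => (hf.hasDerivAt_flow (sph_ne_zero ζ) t).deriv
  rw [h1, (hf.reeb.hasDerivAt_flow (sph_ne_zero ζ) 0).deriv]
  simp [radialExt_coe]

theorem IsSmooth.sphereLaplacian {f : Sph n → ℂ} (hf : IsSmooth f) :
    IsSmooth (sphereLaplacian f) := by
  let e := stdOrthonormalBasis ℝ (Cn n)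
  refine .of_contDiffAt (fun x => ∑ i, dd (e i) (dd (e i) (radialExt f)) x) (fun ζ => ?_)
    fun ζ => laplacian_eq_sum_dd e (hf.contDiffAt (sph_ne_zero ζ))
  exact ContDiffAt.sum fun i _ => contDiffAt_dd (contDiffAt_dd (hf.contDiffAt (sph_ne_zero ζ)) _) _

theorem IsSmooth.subLaplacian {f : Sph n → ℂ} (hf : IsSmooth f) : IsSmooth (subLaplacian f) := by
  have h1 : SzegoBall.subLaplacian f = fun ζ => (-1) * SzegoBall.sphereLaplacian f ζ +
      (if n = 1 then 0 else 1) * SzegoBall.reeb (SzegoBall.reeb f) ζ := by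
    funext ζ
    unfold SzegoBall.subLaplacian
    rw [hf.reebSq_eq]
    split_ifs <;> ring
  rw [h1]
  exact (hf.sphereLaplacian.const_mul _).add (hf.reeb.reeb.const_mul _)

theorem reeb_mul {f g : Sph n → ℂ} (hf : IsSmooth f) (hg : IsSmooth g) (ζ : Sph n) :
    reeb (fun ζ => f ζ * g ζ) ζ = f ζ * reeb g ζ + reeb f ζ * g ζ := by
  unfold reeb
  rw [radialExt_mul, dd_mul (differentiableAt_of_smooth (hf.contDiffAt (sph_ne_zero ζ)))
    (differentiableAt_of_smooth (hg.contDiffAt (sph_ne_zero ζ))), radialExt_coe, radialExt_coe]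

end Smooth

/-! ### Polar coordinates and integration by parts on the sphere -/

section Polar

variable {n : ℕ}

theorem finrank_real_Cn (n : ℕ) : Module.finrank ℝ (Cn n) = 2 * n := by
  rw [← Module.finrank_mul_finrank ℝ ℂ (Cn n)]
  simp

instance (n : ℕ) : IsFiniteMeasure (surf n) := by unfold surf; infer_instance

/-- The radial part of Lebesgue measure in polar coordinates. -/
abbrev radMeasure (n : ℕ) : Measure (Set.Ioi (0 : ℝ)) := Measure.volumeIoiPow (2 * n - 1)

theorem measurePreserving_polar (n : ℕ) :
    MeasurePreserving (homeomorphUnitSphereProd (Cn n)) (Measure.comap Subtype.val volume)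
      ((surf n).prod (radMeasure n)) := by
  have := Measure.measurePreserving_homeomorphUnitSphereProd (volume : Measure (Cn n))
  rw [finrank_real_Cn] at this
  exact this

theorem polar_symm (x : ({0}ᶜ : Set (Cn n))) :
    ((homeomorphUnitSphereProd (Cn n) x).2 : ℝ) • ((homeomorphUnitSphereProd (Cn n) x).1 : Cn n) =
      x := by
  rw [← homeomorphUnitSphereProd_symm_apply_coe, Homeomorph.symm_apply_apply]

theorem integral_polar [NeZero n] (F : Cn n → ℂ) :
    ∫ x, F x = ∫ y : Sph n × Set.Ioi (0 : ℝ), F ((y.2 : ℝ) • (y.1 : Cn n))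
      ∂((surf n).prod (radMeasure n)) := by
  rw [← (measurePreserving_polar n).integral_comp
    (homeomorphUnitSphereProd (Cn n)).measurableEmbedding]
  simp only [polar_symm]
  rw [integral_subtype_comap (measurableSet_singleton _).compl fun x => F x,
    restrict_compl_singleton]

theorem lintegral_polar [NeZero n] (F : Cn n → ENNReal) (hF : Measurable F) :
    ∫⁻ x, F x = ∫⁻ r in Set.Ioi (0 : ℝ), ENNReal.ofReal (r ^ (2 * n - 1)) *
      ∫⁻ ζ : Sph n, F (r • (ζ : Cn n)) ∂(surf n) := by
  have hm : Measurable fun y : Sph n × Set.Ioi (0 : ℝ) => F ((y.2 : ℝ) • (y.1 : Cn n)) := by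
    fun_prop
  have h1 : ∫⁻ x, F x = ∫⁻ y : Sph n × Set.Ioi (0 : ℝ), F ((y.2 : ℝ) • (y.1 : Cn n))
      ∂((surf n).prod (radMeasure n)) := by
    rw [← (measurePreserving_polar n).lintegral_comp_emb
      (homeomorphUnitSphereProd (Cn n)).measurableEmbedding]
    simp only [polar_symm]
    rw [lintegral_subtype_comap (measurableSet_singleton _).compl fun x => F x,
      restrict_compl_singleton]
  have hm2 : Measurable fun r : ℝ => ∫⁻ ζ : Sph n, F (r • (ζ : Cn n)) ∂(surf n) := by
    have : Measurable fun y : ℝ × Sph n => F (y.1 • (y.2 : Cn n)) := by fun_prop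
    exact this.lintegral_prod_right'
  rw [h1, lintegral_prod_symm _ hm.aemeasurable, radMeasure, Measure.volumeIoiPow,
    lintegral_withDensity_eq_lintegral_mul _ (by fun_prop)
      (g := fun r : Set.Ioi (0 : ℝ) => ∫⁻ ζ : Sph n, F ((r : ℝ) • (ζ : Cn n)) ∂(surf n))
      (hm2.comp measurable_subtype_coe)]
  rw [← lintegral_subtype_comap measurableSet_Ioi fun r : ℝ =>
    ENNReal.ofReal (r ^ (2 * n - 1)) * ∫⁻ ζ : Sph n, F (r • (ζ : Cn n)) ∂(surf n)]
  rfl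

/-- The integral of a function `χ(|x|) G(x/|x|)` is a product. -/
theorem integral_polar_mul [NeZero n] (F : Cn n → ℂ) (G : Sph n → ℂ) (χ : ℝ → ℂ)
    (h : ∀ (ζ : Sph n) (r : ℝ), 0 < r → F (r • (ζ : Cn n)) = G ζ * χ r) :
    ∫ x, F x = (∫ ζ, G ζ ∂(surf n)) * ∫ r, χ (r : ℝ) ∂(radMeasure n) := by
  rw [integral_polar, ← integral_prod_mul]
  exact integral_congr_ae (.of_forall fun y => h y.1 y.2 y.2.2)

/-- A smooth bump on the line, supported away from `0`. -/
def bump : ContDiffBump (1 : ℝ) := ⟨1 / 4, 1 / 2, by norm_num, by norm_num⟩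

/-- A radial cutoff function supported in an annulus. -/
def cutoff (x : Cn n) : ℂ := ((bump (‖x‖ ^ 2) : ℝ) : ℂ)

theorem contDiff_cutoff : ContDiff ℝ ∞ (cutoff (n := n)) :=
  Complex.ofRealCLM.contDiff.comp (bump.contDiff.comp (contDiff_norm_sq ℝ))

theorem cutoff_eq_zero {x : Cn n} (hx : ‖x‖ ^ 2 < 1 / 2) : cutoff x = 0 := by
  unfold cutoff
  rw [bump.zero_of_le_dist]
  · simp
  · rw [Real.dist_eq, abs_sub_comm]
    exact le_trans (by simp only [bump]; linarith) (le_abs_self _)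

theorem cutoff_eq_zero' {x : Cn n} (hx : 2 < ‖x‖) : cutoff x = 0 := by
  unfold cutoff
  rw [bump.zero_of_le_dist]
  · simp
  · rw [Real.dist_eq]
    exact le_trans (by simp only [bump]; nlinarith) (le_abs_self _)

theorem contDiff_cutoff_mul {h : Cn n → ℂ} (hh : ∀ x ≠ 0, ContDiffAt ℝ ∞ h x) :
    ContDiff ℝ ∞ fun x => cutoff x * h x := by
  rw [contDiff_iff_contDiffAt]
  intro x
  by_cases hx : x = 0
  · subst hx
    refine (contDiffAt_const (c := (0 : ℂ))).congr_of_eventuallyEq ?_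
    have : ∀ᶠ y in 𝓝 (0 : Cn n), ‖y‖ ^ 2 < 1 / 2 := by
      have hc : Continuous fun y : Cn n => ‖y‖ ^ 2 := by fun_prop
      exact hc.continuousAt.eventually_lt continuousAt_const (by simp)
    filter_upwards [this] with y hy
    rw [cutoff_eq_zero hy, zero_mul]
  · exact contDiff_cutoff.contDiffAt.mul (hh x hx)

theorem hasCompactSupport_cutoff_mul (h : Cn n → ℂ) :
    HasCompactSupport fun x => cutoff x * h x := by
  refine HasCompactSupport.of_support_subset_isCompact (isCompact_closedBall (0 : Cn n) 2) ?_
  intro x hx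
  by_contra hx2
  rw [mem_closedBall_zero_iff, not_le] at hx2
  exact hx (by simp only [cutoff_eq_zero' hx2, zero_mul])

theorem integrable_dd_cutoff {h : Cn n → ℂ} (hh : ∀ x ≠ 0, ContDiffAt ℝ ∞ h x) (v : Cn n) :
    Integrable (dd v fun x => cutoff x * h x) :=
  (contDiff_dd (contDiff_cutoff_mul hh) v).continuous.integrable_of_hasCompactSupport
    ((hasCompactSupport_cutoff_mul h).fderiv_apply (𝕜 := ℝ) v)

/-- The divergence theorem for a compactly supported vector field. -/
theorem integral_dd_cutoff {h : Cn n → ℂ} (hh : ∀ x ≠ 0, ContDiffAt ℝ ∞ h x) (v : Cn n) :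
    ∫ x, dd v (fun x => cutoff x * h x) x = 0 := by
  have hs := contDiff_cutoff_mul hh
  have h1 := integral_mul_fderiv_eq_neg_fderiv_mul_of_integrable (μ := volume)
    (f := fun _ : Cn n => (1 : ℂ)) (g := fun x => cutoff x * h x) (v := v) (by simp)
    (by simpa only [one_mul] using! integrable_dd_cutoff hh v)
    (by simpa using hs.continuous.integrable_of_hasCompactSupport (hasCompactSupport_cutoff_mul h))
    (fun x _ => by fun_prop) (fun x _ => differentiableAt_of_smooth hs.contDiffAt)
  simpa [dd] using h1

theorem dd_cutoff (v x : Cn n) :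
    dd v cutoff x = ((deriv bump (‖x‖ ^ 2) : ℝ) : ℂ) * ((2 * ⟪x, v⟫_ℝ : ℝ) : ℂ) := by
  have hb : HasDerivAt bump (deriv bump (‖x‖ ^ 2)) (‖x‖ ^ 2) :=
    ((bump.contDiff (n := 1)).differentiable (by simp)).differentiableAt.hasDerivAt
  have h1 := Complex.ofRealCLM.hasFDerivAt.comp x
    (hb.comp_hasFDerivAt x (hasStrictFDerivAt_norm_sq x).hasFDerivAt)
  have h2 : HasFDerivAt (cutoff (n := n)) _ x := h1
  unfold dd
  rw [h2.fderiv]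
  simp

/-- If `χ(|x|²) |x|^{-k} G(x/|x|)` is the divergence of a compactly supported field, then the
integral of `G` over the sphere vanishes. -/
theorem integral_sphere_eq_zero [NeZero n] (G : Sph n → ℂ) (F : Cn n → ℂ) (k : ℕ)
    (hF : ∫ x, F x = 0)
    (h : ∀ (ζ : Sph n) (r : ℝ), 0 < r →
      F (r • (ζ : Cn n)) = G ζ * (cutoff (r • (ζ : Cn n)) * (r : ℂ)⁻¹ ^ k)) :
    ∫ ζ, G ζ ∂(surf n) = 0 := by
  have hc (ζ : Sph n) (r : ℝ) : cutoff (r • (ζ : Cn n)) = ((bump (r ^ 2) : ℝ) : ℂ) := by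
    simp [cutoff, norm_smul]
  -- in polar coordinates, the integral of the field's divergence is the integral of `G` times a
  -- radial factor
  have h1 := integral_polar_mul F G (fun r => ((bump (r ^ 2) : ℝ) : ℂ) * (r : ℂ)⁻¹ ^ k)
    fun ζ r hr => by rw [h ζ r hr, hc]
  have h2 := integral_polar_mul (n := n)
    (fun x => cutoff x * ((‖x‖⁻¹ ^ k : ℝ) : ℂ)) (fun _ => 1)
    (fun r => ((bump (r ^ 2) : ℝ) : ℂ) * (r : ℂ)⁻¹ ^ k)
    fun ζ r hr => by simp [hc, norm_smul, abs_of_pos hr]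
  -- the radial factor does not vanish, since the cutoff has positive integral
  have h3 : ∫ x : Cn n, cutoff x * ((‖x‖⁻¹ ^ k : ℝ) : ℂ) ≠ 0 := by
    have hcont : Continuous fun x : Cn n => cutoff x * ((‖x‖⁻¹ ^ k : ℝ) : ℂ) := by
      refine (contDiff_cutoff_mul fun x hx => ?_).continuous
      exact Complex.ofRealCLM.contDiff.contDiffAt.comp x
        (((contDiffAt_norm ℝ hx).inv (norm_ne_zero_iff.2 hx)).pow k)
    have hreal : (fun x : Cn n => cutoff x * ((‖x‖⁻¹ ^ k : ℝ) : ℂ)) =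
        fun x => ((bump (‖x‖ ^ 2) * ‖x‖⁻¹ ^ k : ℝ) : ℂ) := by
      funext x; simp [cutoff]
    have hcs := hasCompactSupport_cutoff_mul fun x : Cn n => ((‖x‖⁻¹ ^ k : ℝ) : ℂ)
    rw [hreal] at hcont hcs ⊢
    rw [integral_complex_ofReal]
    have hcont2 : Continuous fun x : Cn n => bump (‖x‖ ^ 2) * ‖x‖⁻¹ ^ k := by
      exact Complex.continuous_re.comp hcont
    have hcs2 : HasCompactSupport fun x : Cn n => bump (‖x‖ ^ 2) * ‖x‖⁻¹ ^ k := by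
      have := hcs.comp_left (g := Complex.re) (by simp)
      exact this
    obtain ⟨x0, hx0⟩ := exists_norm_eq (Cn n) (zero_le_one (α := ℝ))
    have := hcont2.integral_pos_of_hasCompactSupport_nonneg_nonzero (μ := volume) (x := x0) hcs2
      (fun x => mul_nonneg bump.nonneg (by positivity)) (by
        rw [hx0]
        simp only [one_pow, inv_one, mul_one]
        rw [bump.one_of_mem_closedBall (by simp [bump.rIn_pos.le])]
        exact one_ne_zero)
    exact_mod_cast this.ne'
  rw [h2] at h3
  rw [hF] at h1
  exact (mul_eq_zero.1 h1.symm).resolve_right (right_ne_zero_of_mul h3)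

/-- The Laplace–Beltrami operator is symmetric. -/
theorem integral_sphereLaplacian_mul [NeZero n] {f g : Sph n → ℂ} (hf : IsSmooth f)
    (hg : IsSmooth g) :
    ∫ ζ, (g ζ * sphereLaplacian f ζ - f ζ * sphereLaplacian g ζ) ∂(surf n) = 0 := by
  let e := stdOrthonormalBasis ℝ (Cn n)
  set u := radialExt f with hu
  set w := radialExt g with hw
  have su : ∀ x ≠ 0, ContDiffAt ℝ ∞ u x := fun x hx => hf.contDiffAt hx
  have sw : ∀ x ≠ 0, ContDiffAt ℝ ∞ w x := fun x hx => hg.contDiffAt hx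
  -- the field `χ (w ∇u - u ∇w)`
  let h : Fin (Module.finrank ℝ (Cn n)) → Cn n → ℂ :=
    fun i x => w x * dd (e i) u x - u x * dd (e i) w x
  have sh : ∀ i, ∀ x ≠ 0, ContDiffAt ℝ ∞ (h i) x := fun i x hx =>
    ((sw x hx).mul (contDiffAt_dd (su x hx) _)).sub ((su x hx).mul (contDiffAt_dd (sw x hx) _))
  refine integral_sphere_eq_zero _ (fun x => ∑ i, dd (e i) (fun x => cutoff x * h i x) x) 2 ?_ ?_
  · rw [integral_finsetSum _ fun i _ => integrable_dd_cutoff (sh i) _]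
    exact Finset.sum_eq_zero fun i _ => integral_dd_cutoff (sh i) _
  · intro ζ r hr
    set x : Cn n := r • (ζ : Cn n) with hx
    have hx0 : x ≠ 0 := smul_ne_zero hr.ne' (sph_ne_zero ζ)
    have d1 := differentiableAt_of_smooth (su x hx0)
    have d2 := differentiableAt_of_smooth (sw x hx0)
    have key : ∀ i, dd (e i) (fun x => cutoff x * h i x) x =
        cutoff x * (w x * dd (e i) (dd (e i) u) x - u x * dd (e i) (dd (e i) w) x) +
          dd (e i) cutoff x * h i x := by
      intro i
      have d3 := differentiableAt_of_smooth (contDiffAt_dd (su x hx0) (e i))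
      have d4 := differentiableAt_of_smooth (contDiffAt_dd (sw x hx0) (e i))
      rw [dd_mul (differentiableAt_of_smooth contDiff_cutoff.contDiffAt)
        (differentiableAt_of_smooth (sh i x hx0)),
        dd_sub (f := fun x => w x * dd (e i) u x) (g := fun x => u x * dd (e i) w x)
          (d2.mul d3) (d1.mul d4), dd_mul d2 d3, dd_mul d1 d4]
      ring
    -- functions that are constant on rays have gradients orthogonal to that of the radial cutoff,
    -- so the cutoff is not differentiated in the divergence
    have hrad : ∀ F : Sph n → ℂ, IsSmooth F →
        ∑ i, dd (e i) cutoff x * dd (e i) (radialExt F) x = 0 := by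
      intro F hF
      have h1 : ∑ i, ((⟪x, e i⟫_ℝ : ℝ) : ℂ) * dd (e i) (radialExt F) x = 0 := by
        have h2 := hF.dd_self hx0
        conv at h2 => lhs; arg 1; rw [← e.sum_repr' x]
        rw [dd_sum_smul] at h2
        rw [← h2]
        refine Finset.sum_congr rfl fun i _ => ?_
        rw [real_inner_comm]
      simp only [dd_cutoff]
      rw [← mul_zero (((deriv bump (‖x‖ ^ 2) : ℝ) : ℂ) * 2), ← h1, Finset.mul_sum]
      refine Finset.sum_congr rfl fun i _ => ?_
      push_cast; ring
    rw [Finset.sum_congr rfl fun i _ => key i, Finset.sum_add_distrib, ← Finset.mul_sum,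
      Finset.sum_sub_distrib, ← Finset.mul_sum, ← Finset.mul_sum,
      ← laplacian_eq_sum_dd e (su x hx0), ← laplacian_eq_sum_dd e (sw x hx0)]
    have h0 : ∑ i, dd (e i) cutoff x * h i x = 0 := by
      have : ∀ i, dd (e i) cutoff x * h i x = w x * (dd (e i) cutoff x * dd (e i) u x) -
          u x * (dd (e i) cutoff x * dd (e i) w x) := fun i => by simp only [h]; ring
      rw [Finset.sum_congr rfl fun i _ => this i, Finset.sum_sub_distrib, ← Finset.mul_sum,
        ← Finset.mul_sum, hrad f hf, hrad g hg]
      simp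
    rw [h0, hu, hw, hx, hf.laplacian_smul hr (sph_ne_zero ζ), hg.laplacian_smul hr (sph_ne_zero ζ),
      radialExt_smul _ hr, radialExt_smul _ hr, radialExt_coe, radialExt_coe, sphereLaplacian,
      sphereLaplacian]
    ring

theorem real_inner_I_smul (x : Cn n) : ⟪x, Complex.I • x⟫_ℝ = 0 := by
  simp only [PiLp.inner_apply, Complex.inner]
  exact Finset.sum_eq_zero fun i _ => by simp; ring

/-- The Reeb field is divergence free. -/
theorem integral_reeb [NeZero n] {f : Sph n → ℂ} (hf : IsSmooth f) :
    ∫ ζ, reeb f ζ ∂(surf n) = 0 := by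
  let e := stdOrthonormalBasis ℝ (Cn n)
  set u := radialExt f with hu
  have su : ∀ x ≠ 0, ContDiffAt ℝ ∞ u x := fun x hx => hf.contDiffAt hx
  -- the field `χ u · (i x)`: since `i x` is tangent to the spheres and divergence free, its
  -- divergence is `χ` times the derivative of `u` along `i x`
  let L : Fin (Module.finrank ℝ (Cn n)) → Cn n →L[ℝ] ℂ := fun i =>
    Complex.ofRealCLM.comp ((innerSL ℝ (e i)).comp
      ((Complex.I • ContinuousLinearMap.id ℂ (Cn n)).restrictScalars ℝ))
  have hL : ∀ i x, L i x = ((⟪e i, Complex.I • x⟫_ℝ : ℝ) : ℂ) := fun i x => rfl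
  let h : Fin (Module.finrank ℝ (Cn n)) → Cn n → ℂ := fun i x => u x * L i x
  have sh : ∀ i, ∀ x ≠ 0, ContDiffAt ℝ ∞ (h i) x := fun i x hx =>
    (su x hx).mul (L i).contDiff.contDiffAt
  refine integral_sphere_eq_zero _ (fun x => ∑ i, dd (e i) (fun x => cutoff x * h i x) x) 0 ?_ ?_
  · rw [integral_finsetSum _ fun i _ => integrable_dd_cutoff (sh i) _]
    exact Finset.sum_eq_zero fun i _ => integral_dd_cutoff (sh i) _
  · intro ζ r hr
    set x : Cn n := r • (ζ : Cn n) with hx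
    have hx0 : x ≠ 0 := smul_ne_zero hr.ne' (sph_ne_zero ζ)
    have key : ∀ i, dd (e i) (fun x => cutoff x * h i x) x =
        cutoff x * (L i x * dd (e i) u x) + dd (e i) cutoff x * h i x := by
      intro i
      rw [dd_mul (differentiableAt_of_smooth contDiff_cutoff.contDiffAt)
        (differentiableAt_of_smooth (sh i x hx0)),
        dd_mul (differentiableAt_of_smooth (su x hx0)) (L i).differentiableAt, dd_clm, hL i (e i),
        real_inner_I_smul]
      simp only [Complex.ofReal_zero]
      ring
    have h1 : ∑ i, L i x * dd (e i) u x = dd (Complex.I • x) u x := by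
      conv_rhs => rw [← e.sum_repr' (Complex.I • x)]
      rw [dd_sum_smul]
      rfl
    have h2 : ∑ i, dd (e i) cutoff x * h i x = 0 := by
      have h3 : ∑ i, (⟪x, e i⟫_ℝ : ℝ) * ⟪e i, Complex.I • x⟫_ℝ = 0 := by
        rw [e.sum_inner_mul_inner, real_inner_I_smul]
      have h4 : ∀ i, dd (e i) cutoff x * h i x = (((deriv bump (‖x‖ ^ 2) : ℝ) : ℂ) * 2 * u x) *
          (((⟪x, e i⟫_ℝ : ℝ) * ⟪e i, Complex.I • x⟫_ℝ : ℝ) : ℂ) := fun i => by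
        simp only [h, hL, dd_cutoff]; push_cast; ring
      rw [Finset.sum_congr rfl fun i _ => h4 i, ← Finset.mul_sum, ← Complex.ofReal_sum, h3]
      simp
    rw [Finset.sum_congr rfl fun i _ => key i, Finset.sum_add_distrib, ← Finset.mul_sum, h1, h2,
      hu, ← hf.radialExt_reeb hx0, hx, radialExt_smul _ hr, radialExt_coe]
    ring

theorem IsSmooth.integrable {f : Sph n → ℂ} (hf : IsSmooth f) : Integrable f (surf n) :=
  hf.continuous.integrable_of_hasCompactSupport (HasCompactSupport.of_compactSpace _)

theorem integral_reeb_mul [NeZero n] {f g : Sph n → ℂ} (hf : IsSmooth f) (hg : IsSmooth g) :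
    ∫ ζ, reeb f ζ * g ζ ∂(surf n) = -∫ ζ, f ζ * reeb g ζ ∂(surf n) := by
  have h := integral_reeb (hf.mul hg)
  simp only [reeb_mul hf hg] at h
  rw [integral_add (hf.mul hg.reeb).integrable (hf.reeb.mul hg).integrable] at h
  linear_combination h

/-- The sub-Laplacian is symmetric for the bilinear pairing. -/
theorem integral_subLaplacian_mul [NeZero n] {f g : Sph n → ℂ} (hf : IsSmooth f)
    (hg : IsSmooth g) :
    ∫ ζ, subLaplacian f ζ * g ζ ∂(surf n) = ∫ ζ, f ζ * subLaplacian g ζ ∂(surf n) := by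
  have h1 := integral_sphereLaplacian_mul hf hg
  rw [integral_sub (hg.mul hf.sphereLaplacian).integrable
    (hf.mul hg.sphereLaplacian).integrable] at h1
  have h2 : ∫ ζ, reeb (reeb f) ζ * g ζ ∂(surf n) = ∫ ζ, f ζ * reeb (reeb g) ζ ∂(surf n) := by
    rw [integral_reeb_mul hf.reeb hg, integral_reeb_mul hf hg.reeb, neg_neg]
  have h3 : ∀ (F G : Sph n → ℂ), IsSmooth F → IsSmooth G →
      ∫ ζ, G ζ * subLaplacian F ζ ∂(surf n) = -(∫ ζ, G ζ * sphereLaplacian F ζ ∂(surf n)) +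
        (if n = 1 then 0 else 1) * ∫ ζ, reeb (reeb F) ζ * G ζ ∂(surf n) := by
    intro F G hF hG
    rw [← integral_const_mul, ← integral_neg, ← integral_add
      (f := fun ζ => -(G ζ * sphereLaplacian F ζ)) (hG.mul hF.sphereLaplacian).integrable.neg
      ((hF.reeb.reeb.mul hG).const_mul _).integrable]
    refine integral_congr_ae (.of_forall fun ζ => ?_)
    simp only [subLaplacian, hF.reebSq_eq]
    split_ifs <;> ring
  have h4 : ∫ ζ, subLaplacian f ζ * g ζ ∂(surf n) = ∫ ζ, g ζ * subLaplacian f ζ ∂(surf n) := by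
    simp only [mul_comm]
  have h5 : ∫ ζ, f ζ * reeb (reeb g) ζ ∂(surf n) = ∫ ζ, reeb (reeb g) ζ * f ζ ∂(surf n) := by
    simp only [mul_comm]
  rw [h4, h3 f g hf hg, h3 g f hg hf, h2, h5]
  linear_combination -h1

end Polar

/-! ### Orthogonal decompositions of a Hilbert space -/

section Hilbert

variable {H : Type*} [NormedAddCommGroup H] [InnerProductSpace ℂ H] {ι : Type*}
  {V : ι → Submodule ℂ H}

/-- The subspaces `V i` are mutually orthogonal and span a dense subspace. -/
structure IsOrthDecomp (V : ι → Submodule ℂ H) : Prop where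
  orth : ∀ i j, i ≠ j → ∀ x ∈ V i, ∀ y ∈ V j, ⟪x, y⟫_ℂ = 0
  total : (⨆ i, V i).topologicalClosure = ⊤

namespace IsOrthDecomp

theorem orthogonalFamily (h : IsOrthDecomp V) :
    OrthogonalFamily ℂ (fun i => V i) fun i => (V i).subtypeₗᵢ :=
  fun i j hij x y => h.orth i j hij x x.2 y y.2

theorem proj_of_mem_ne [∀ i, CompleteSpace (V i)] (h : IsOrthDecomp V) {i j : ι} (hij : i ≠ j)
    {x : H} (hx : x ∈ V j) : (V i).starProjection x = 0 := by
  rw [Submodule.starProjection_apply_eq_zero_iff, Submodule.mem_orthogonal]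
  exact fun y hy => h.orth i j hij y hy x hx

end IsOrthDecomp

theorem proj_of_mem [∀ i, CompleteSpace (V i)] {i : ι} {x : H} (hx : x ∈ V i) :
    (V i).starProjection x = x :=
  Submodule.starProjection_eq_self_iff.2 hx

theorem proj_mem [∀ i, CompleteSpace (V i)] (i : ι) (x : H) : (V i).starProjection x ∈ V i :=
  Submodule.starProjection_apply_mem _ _

theorem inner_proj_left [∀ i, CompleteSpace (V i)] (i : ι) (x y : H) :
    ⟪(V i).starProjection x, y⟫_ℂ = ⟪(V i).starProjection x, (V i).starProjection y⟫_ℂ := by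
  rw [← Submodule.inner_starProjection_left_eq_right,
    proj_of_mem (proj_mem i x)]

namespace IsOrthDecomp

variable [CompleteSpace H] [∀ i, CompleteSpace (V i)]

/-- A square summable family of components is the family of components of a vector. -/
theorem exists_of_summable (h : IsOrthDecomp V) {w : ι → H} (hw : ∀ i, w i ∈ V i)
    (hs : Summable fun i => ‖w i‖ ^ 2) :
    ∃ x, HasSum w x ∧ ∀ i, (V i).starProjection x = w i := by
  classical
  have h1 : Summable w :=
    (h.orthogonalFamily.summable_iff_norm_sq_summable fun i => (⟨w i, hw i⟩ : V i)).2 hs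
  refine ⟨∑' i, w i, h1.hasSum, fun i => ?_⟩
  refine (h1.hasSum.mapL (V i).starProjection).unique ?_
  have : (fun j => (V i).starProjection (w j)) = fun j => if j = i then w i else 0 := by
    funext j
    split_ifs with hj
    · subst hj; exact proj_of_mem (hw j)
    · exact h.proj_of_mem_ne (Ne.symm hj) (hw j)
  rw [this]
  exact hasSum_ite_eq i (w i)

theorem hasSum_proj (h : IsOrthDecomp V) (x : H) :
    HasSum (fun i => (V i).starProjection x) x := by
  have hV : IsHilbertSum ℂ (fun i => V i) fun i => (V i).subtypeₗᵢ :=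
    IsHilbertSum.mkInternal _ h.orthogonalFamily h.total.ge
  obtain ⟨w, rfl⟩ := hV.linearIsometryEquiv.symm.surjective x
  have h1 := hV.hasSum_linearIsometryEquiv_symm w
  have h2 : Summable fun i => ‖(w i : H)‖ ^ 2 :=
    (h.orthogonalFamily.summable_iff_norm_sq_summable fun i => w i).1 h1.summable
  obtain ⟨y, hy, hy2⟩ := h.exists_of_summable (fun i => (w i).2) h2
  have h3 : hV.linearIsometryEquiv.symm w = y := h1.unique hy
  rw [h3]
  simpa only [hy2] using hy

theorem ext (h : IsOrthDecomp V) {x y : H}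
    (hxy : ∀ i, (V i).starProjection x = (V i).starProjection y) : x = y := by
  have h1 := h.hasSum_proj x
  simp only [hxy] at h1
  exact h1.unique (h.hasSum_proj y)

theorem hasSum_inner (h : IsOrthDecomp V) (x y : H) :
    HasSum (fun i => ⟪(V i).starProjection x, (V i).starProjection y⟫_ℂ) ⟪x, y⟫_ℂ := by
  have h1 := (h.hasSum_proj y).mapL (innerSL ℂ x)
  simp only [innerSL_apply_apply] at h1
  have h2 : ∀ i, ⟪x, (V i).starProjection y⟫_ℂ =
      ⟪(V i).starProjection x, (V i).starProjection y⟫_ℂ := fun i => by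
    rw [← Submodule.inner_starProjection_left_eq_right, inner_proj_left]
  simpa only [h2] using h1

theorem hasSum_norm_sq (h : IsOrthDecomp V) (x : H) :
    HasSum (fun i => ‖(V i).starProjection x‖ ^ 2) (‖x‖ ^ 2) := by
  have h1 := (h.hasSum_inner x x).mapL Complex.reCLM
  simp only [inner_self_eq_norm_sq_to_K] at h1
  have h2 : ∀ r : ℝ, Complex.reCLM ((r : ℂ) ^ 2) = r ^ 2 := fun r => by
    rw [← Complex.ofReal_pow]; exact Complex.ofReal_re _
  have h3 := h1
  simp only [Complex.coe_algebraMap, h2] at h3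
  exact h3

/-- The operator that acts on `V i` as the real scalar `d i`. -/
theorem exists_diagonal (h : IsOrthDecomp V) {d : ι → ℝ} {C : ℝ} (hC : ∀ i, |d i| ≤ C) :
    ∃ T : H →L[ℂ] H, ∀ x i, (V i).starProjection (T x) = (d i : ℂ) • (V i).starProjection x := by
  have hmem : ∀ x i, (d i : ℂ) • (V i).starProjection x ∈ V i := fun x i =>
    Submodule.smul_mem _ _ (proj_mem i x)
  have hle : ∀ x i, ‖(d i : ℂ) • (V i).starProjection x‖ ^ 2 ≤
      C ^ 2 * ‖(V i).starProjection x‖ ^ 2 := fun x i => by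
    rw [norm_smul, mul_pow, Complex.norm_real, Real.norm_eq_abs]
    gcongr
    exact hC i
  have hsum : ∀ x, Summable fun i => ‖(d i : ℂ) • (V i).starProjection x‖ ^ 2 := fun x =>
    Summable.of_nonneg_of_le (fun i => by positivity) (hle x)
      ((h.hasSum_norm_sq x).summable.mul_left _)
  choose T hT1 hT2 using fun x => h.exists_of_summable (hmem x) (hsum x)
  by_cases hι : Nonempty ι
  · have hC0 : 0 ≤ C := le_trans (abs_nonneg _) (hC hι.some)
    let L : H →ₗ[ℂ] H :=
      { toFun := T
        map_add' := fun x y => h.ext fun i => by simp only [map_add, hT2, smul_add]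
        map_smul' := fun c x => h.ext fun i => by
          simp only [map_smul, hT2, RingHom.id_apply]; rw [smul_comm] }
    refine ⟨L.mkContinuous C fun x => ?_, fun x i => hT2 x i⟩
    have h1 := h.hasSum_norm_sq (T x)
    simp only [hT2] at h1
    have h2 := hasSum_le (hle x) h1 ((h.hasSum_norm_sq x).mul_left (C ^ 2))
    rw [← mul_pow] at h2
    exact le_of_sq_le_sq h2 (by positivity)
  · exact ⟨0, fun x i => (hι ⟨i⟩).elim⟩

end IsOrthDecomp

end Hilbert

/-! ### Bihomogeneous harmonics are eigenfunctions of the sub-Laplacian -/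

section Eigen

variable {n : ℕ} {p q : ℤ} {Y : Cn n → ℂ}

/-- The restriction of a function on `ℂⁿ` to the unit sphere. -/
def res {n : ℕ} (Y : Cn n → ℂ) (ζ : Sph n) : ℂ := Y ζ

theorem IsHarm.isSmooth (h : IsHarm p q Y) : IsSmooth (res Y) :=
  .of_contDiffAt Y (fun _ => h.smooth.contDiffAt) fun _ => rfl

/-- The power `|x|^{2s}` of the norm. -/
def nrpow {n : ℕ} (s : ℝ) (x : Cn n) : ℂ := (((‖x‖ ^ 2) ^ s : ℝ) : ℂ)

theorem hasFDerivAt_nrpow (s : ℝ) {x : Cn n} (hx : x ≠ 0) (v : Cn n) :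
    dd v (nrpow s) x = 2 * s * nrpow (s - 1) x * (⟪x, v⟫_ℝ : ℂ) := by
  have hx2 : ‖x‖ ^ 2 ≠ 0 := by simpa using hx
  have h1 := Complex.ofRealCLM.hasFDerivAt.comp x
    ((hasStrictFDerivAt_norm_sq x).hasFDerivAt.rpow_const (p := s) (Or.inl hx2))
  have h2 : HasFDerivAt (nrpow (n := n) s) _ x := h1
  unfold dd
  rw [h2.fderiv]
  simp [nrpow]
  ring

theorem contDiffAt_nrpow (s : ℝ) {x : Cn n} (hx : x ≠ 0) : ContDiffAt ℝ ∞ (nrpow s) x :=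
  Complex.ofRealCLM.contDiff.contDiffAt.comp x
    ((contDiff_norm_sq ℝ).contDiffAt.rpow_const_of_ne (by simpa using hx))

theorem nrpow_sph (s : ℝ) (ζ : Sph n) : nrpow s (ζ : Cn n) = 1 := by
  simp [nrpow]

theorem laplacian_nrpow (s : ℝ) (ζ : Sph n) :
    Laplacian.laplacian (nrpow s) (ζ : Cn n) = 4 * s * (s - 1) + 4 * s * n := by
  let e := stdOrthonormalBasis ℝ (Cn n)
  have hζ := sph_ne_zero ζ
  rw [laplacian_eq_sum_dd e (contDiffAt_nrpow s hζ)]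
  have h (i) : dd (e i) (dd (e i) (nrpow s)) (ζ : Cn n) =
      4 * s * (s - 1) * ((⟪(ζ : Cn n), e i⟫_ℝ * ⟪e i, (ζ : Cn n)⟫_ℝ : ℝ) : ℂ) + 2 * s := by
    have h1 : dd (e i) (nrpow (n := n) s) =ᶠ[𝓝 (ζ : Cn n)]
        fun y => (2 * s) * (nrpow (s - 1) y * (Complex.ofRealCLM.comp (innerSL ℝ (e i))) y) := by
      filter_upwards [isOpen_compl_singleton.mem_nhds hζ] with y hy
      rw [hasFDerivAt_nrpow s hy, real_inner_comm]
      simp; ring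
    have d1 := differentiableAt_of_smooth (contDiffAt_nrpow (s - 1) hζ)
    rw [dd_congr h1, dd_const_mul
        (f := fun y => nrpow (s - 1) y * (Complex.ofRealCLM.comp (innerSL ℝ (e i))) y)
        (d1.mul (ContinuousLinearMap.differentiableAt _)),
      dd_mul d1 (ContinuousLinearMap.differentiableAt _), dd_clm, hasFDerivAt_nrpow _ hζ,
      nrpow_sph, nrpow_sph]
    simp only [ContinuousLinearMap.comp_apply, innerSL_apply_apply, Complex.ofRealCLM_apply]
    rw [real_inner_self_eq_norm_sq, e.norm_eq_one]
    push_cast; ring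
  rw [Finset.sum_congr rfl fun i _ => h i, Finset.sum_add_distrib, ← Finset.mul_sum,
    ← Complex.ofReal_sum, e.sum_inner_mul_inner, real_inner_self_eq_norm_sq, norm_sph]
  simp [finrank_real_Cn]
  ring

theorem IsHarm.radialExt_res (h : IsHarm p q Y) {x : Cn n} (hx : x ≠ 0) :
    radialExt (res Y) x = nrpow (-(p + q : ℝ) / 2) x * Y x := by
  rw [radialExt_of_ne _ hx]
  have hn : 0 < ‖x‖ := norm_pos_iff.2 hx
  have h0 : ((‖x‖⁻¹ : ℝ) : ℂ) ≠ 0 := by exact_mod_cast (inv_pos.2 hn).ne'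
  have h1 : res Y (radProj x hx) = Y (((‖x‖⁻¹ : ℝ) : ℂ) • x) := rfl
  rw [h1, h.homog _ h0, Complex.conj_ofReal, ← zpow_add₀ h0]
  congr 1
  unfold nrpow
  have : (‖x‖ ^ 2) ^ (-(p + q : ℝ) / 2) = (‖x‖⁻¹) ^ (p + q) := by
    rw [← Real.rpow_natCast, ← Real.rpow_mul hn.le, inv_zpow, ← zpow_neg, ← Real.rpow_intCast]
    congr 1
    push_cast; ring
  rw [this]
  push_cast; rfl

theorem IsHarm.radialExt_eventuallyEq (h : IsHarm p q Y) (ζ : Sph n) :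
    radialExt (res Y) =ᶠ[𝓝 (ζ : Cn n)] fun x => nrpow (-(p + q : ℝ) / 2) x * Y x := by
  filter_upwards [isOpen_compl_singleton.mem_nhds (sph_ne_zero ζ)] with y hy
  exact h.radialExt_res hy

theorem IsHarm.sphereLaplacian_res (h : IsHarm p q Y) (ζ : Sph n) :
    sphereLaplacian (res Y) ζ = -((p + q) * (p + q + 2 * n - 2)) * Y ζ := by
  let e := stdOrthonormalBasis ℝ (Cn n)
  have hζ := sph_ne_zero ζ
  unfold sphereLaplacian
  rw [(InnerProductSpace.laplacian_congr_nhds (h.radialExt_eventuallyEq ζ)).eq_of_nhds,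
    laplacian_mul (contDiffAt_nrpow _ hζ) h.smooth.contDiffAt e, h.harmonic, laplacian_nrpow]
  have h1 : ∑ i, dd (e i) (nrpow (-(p + q : ℝ) / 2)) (ζ : Cn n) * dd (e i) Y ζ =
      -(p + q) * dd (ζ : Cn n) Y ζ := by
    conv_rhs => rw [← e.sum_repr' (ζ : Cn n)]
    rw [dd_sum_smul, Finset.mul_sum, e.sum_repr' (ζ : Cn n)]
    refine Finset.sum_congr rfl fun i _ => ?_
    rw [hasFDerivAt_nrpow _ hζ, nrpow_sph, real_inner_comm]
    push_cast; ring
  rw [h1, h.euler_real]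
  push_cast; ring

theorem IsHarm.reeb_res (h : IsHarm p q Y) :
    reeb (res Y) = fun ζ => (Complex.I * (p - q)) * res Y ζ := by
  funext ζ
  have hζ := sph_ne_zero ζ
  unfold reeb
  rw [dd_congr (h.radialExt_eventuallyEq ζ),
    dd_mul (differentiableAt_of_smooth (contDiffAt_nrpow _ hζ))
      (differentiableAt_of_smooth h.smooth.contDiffAt), hasFDerivAt_nrpow _ hζ, nrpow_sph,
    nrpow_sph, real_inner_I_smul, euler_aux h.smooth h.homog]
  simp only [res, Complex.conj_I, Complex.ofReal_zero]
  ring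

theorem reeb_const_mul {f : Sph n → ℂ} (hf : IsSmooth f) (c : ℂ) :
    reeb (fun ζ => c * f ζ) = fun ζ => c * reeb f ζ := by
  funext ζ
  unfold reeb
  rw [radialExt_const_mul, dd_const_mul (differentiableAt_of_smooth
    (hf.contDiffAt (sph_ne_zero ζ)))]

/-- The eigenvalue of the sub-Laplacian on bihomogeneous harmonics of degree `(p, q)`. -/
def lam (n : ℕ) (i : ℤ × ℤ) : ℝ :=
  if n = 1 then (i.1 + i.2 : ℝ) ^ 2 else 4 * i.1 * i.2 + (2 * n - 2) * (i.1 + i.2)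

theorem IsHarm.subLaplacian_res (h : IsHarm p q Y) (ζ : Sph n) :
    subLaplacian (res Y) ζ = (lam n (p, q) : ℂ) * res Y ζ := by
  unfold subLaplacian
  rw [h.sphereLaplacian_res, h.isSmooth.reebSq_eq, h.reeb_res, reeb_const_mul h.isSmooth,
    h.reeb_res]
  unfold lam res
  split_ifs with hn
  · subst hn
    push_cast; ring
  · push_cast
    linear_combination ((p - q : ℂ) ^ 2 * Y ζ) * Complex.I_sq

end Eigen

/-! ### Square integrable functions on the sphere -/

section L2

variable {n : ℕ}

/-- The class in `L²(S)` of a continuous function. -/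
def cls (n : ℕ) : C(Sph n, ℂ) →L[ℂ] L2S n := ContinuousMap.toLp 2 (surf n) ℂ

theorem coeFn_cls (f : C(Sph n, ℂ)) : cls n f =ᵐ[surf n] f :=
  ContinuousMap.coeFn_toLp (p := 2) (𝕜 := ℂ) (surf n) f

theorem toL2_of_memLp {f : Sph n → ℂ} (hf : MemLp f 2 (surf n)) : toL2 f = hf.toLp f := by
  simp [toL2, hf]

theorem memLp_of_continuous {f : Sph n → ℂ} (hf : Continuous f) : MemLp f 2 (surf n) :=
  (Lp.memLp (cls n ⟨f, hf⟩)).ae_eq (coeFn_cls ⟨f, hf⟩)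

theorem toL2_eq_cls {f : Sph n → ℂ} (hf : Continuous f) : toL2 f = cls n ⟨f, hf⟩ := by
  rw [toL2_of_memLp (memLp_of_continuous hf)]
  apply Lp.ext
  filter_upwards [(memLp_of_continuous hf).coeFn_toLp, coeFn_cls ⟨f, hf⟩] with ζ h1 h2
  rw [h1, h2]; rfl

theorem coeFn_toL2 {f : Sph n → ℂ} (hf : Continuous f) : toL2 f =ᵐ[surf n] f := by
  rw [toL2_eq_cls hf]
  exact coeFn_cls ⟨f, hf⟩

theorem eq_toL2 {f : Sph n → ℂ} (hf : Continuous f) {v : L2S n} (h : v =ᵐ[surf n] f) :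
    v = toL2 f := by
  apply Lp.ext
  filter_upwards [h, coeFn_toL2 hf] with ζ h1 h2
  rw [h1, h2]

theorem inner_L2 (v w : L2S n) : ⟪v, w⟫_ℂ = ∫ ζ, (starRingEnd ℂ) (v ζ) * w ζ ∂(surf n) := by
  rw [L2.inner_def]
  simp only [RCLike.inner_apply, mul_comm]

theorem inner_toL2_left {f : Sph n → ℂ} (hf : Continuous f) (v : L2S n) :
    ⟪toL2 f, v⟫_ℂ = ∫ ζ, (starRingEnd ℂ) (f ζ) * v ζ ∂(surf n) := by
  rw [inner_L2]
  refine integral_congr_ae ?_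
  filter_upwards [coeFn_toL2 hf] with ζ h
  rw [h]

theorem inner_toL2 {f g : Sph n → ℂ} (hf : Continuous f) (hg : Continuous g) :
    ⟪toL2 f, toL2 g⟫_ℂ = ∫ ζ, (starRingEnd ℂ) (f ζ) * g ζ ∂(surf n) := by
  rw [inner_toL2_left hf]
  refine integral_congr_ae ?_
  filter_upwards [coeFn_toL2 hg] with ζ h
  rw [h]

theorem toL2_add {f g : Sph n → ℂ} (hf : Continuous f) (hg : Continuous g) :
    toL2 (fun ζ => f ζ + g ζ) = toL2 f + toL2 g := by
  rw [toL2_eq_cls hf, toL2_eq_cls hg, toL2_eq_cls (f := fun ζ => f ζ + g ζ) (hf.add hg), ← map_add]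
  rfl

theorem toL2_const_mul {f : Sph n → ℂ} (hf : Continuous f) (c : ℂ) :
    toL2 (fun ζ => c * f ζ) = c • toL2 f := by
  rw [toL2_eq_cls hf, toL2_eq_cls (f := fun ζ => c * f ζ) (continuous_const.mul hf), ← map_smul]
  rfl

theorem IsHarm.continuous_res {p q : ℤ} {Y : Cn n → ℂ} (h : IsHarm p q Y) : Continuous (res Y) :=
  h.isSmooth.continuous

/-- The closure in `L²(S)` of the space of bihomogeneous harmonics of degree `(p, q)`. -/
def harm (n : ℕ) (i : ℤ × ℤ) : Submodule ℂ (L2S n) :=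
  (Submodule.span ℂ {v : L2S n | ∃ Y, IsHarm i.1 i.2 Y ∧ v = toL2 (res Y)}).topologicalClosure

instance (i : ℤ × ℤ) : CompleteSpace (harm n i) := Submodule.topologicalClosure.completeSpace _

instance (lam : ℝ) : CompleteSpace (eigenspace n lam) :=
  Submodule.topologicalClosure.completeSpace _

theorem IsHarm.mem_harm {p q : ℤ} {Y : Cn n → ℂ} (h : IsHarm p q Y) :
    toL2 (res Y) ∈ harm n (p, q) :=
  Submodule.le_topologicalClosure _ (Submodule.subset_span ⟨Y, h, rfl⟩)

/-- Orthogonality of two sets passes to the closures of their spans. -/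
theorem inner_eq_zero_of_span {H : Type*} [NormedAddCommGroup H] [InnerProductSpace ℂ H]
    {s t : Set H} (h : ∀ x ∈ s, ∀ y ∈ t, ⟪x, y⟫_ℂ = 0) {x y : H}
    (hx : x ∈ (Submodule.span ℂ s).topologicalClosure)
    (hy : y ∈ (Submodule.span ℂ t).topologicalClosure) : ⟪x, y⟫_ℂ = 0 := by
  have h1 : Submodule.span ℂ s ≤ (Submodule.span ℂ t)ᗮ :=
    Submodule.isOrtho_span.2 fun u hu v hv => h u hu v hv
  rw [← Submodule.orthogonal_closure] at h1
  have h2 := Submodule.topologicalClosure_minimal _ h1 (Submodule.isClosed_orthogonal _) hx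
  rw [Submodule.mem_orthogonal'] at h2
  exact h2 y hy

theorem conj_subLaplacian {f : Sph n → ℂ} (hf : IsSmooth f) (ζ : Sph n) :
    subLaplacian (fun ζ => (starRingEnd ℂ) (f ζ)) ζ = (starRingEnd ℂ) (subLaplacian f ζ) := by
  have hr : ∀ g : Sph n → ℂ, radialExt (fun ζ => (starRingEnd ℂ) (g ζ)) =
      fun x => (starRingEnd ℂ) (radialExt g x) := by
    intro g; funext x
    by_cases hx : x = 0
    · simp [radialExt, hx]
    · simp only [radialExt_of_ne _ hx]
  have h1 : ∀ g : Sph n → ℂ, IsSmooth g → reeb (fun ζ => (starRingEnd ℂ) (g ζ)) =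
      fun ζ => (starRingEnd ℂ) (reeb g ζ) := by
    intro g hg; funext ζ
    unfold reeb
    rw [hr, dd_conj (differentiableAt_of_smooth (hg.contDiffAt (sph_ne_zero ζ)))]
  have h2 : sphereLaplacian (fun ζ => (starRingEnd ℂ) (f ζ)) ζ =
      (starRingEnd ℂ) (sphereLaplacian f ζ) := by
    unfold sphereLaplacian
    have h3 : radialExt (fun ζ => (starRingEnd ℂ) (f ζ)) =
        Complex.conjCLE.toContinuousLinearMap ∘ radialExt f := by
      rw [hr]; ext y; simp
    rw [h3, ContDiffAt.laplacian_CLM_comp_left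
      ((hf.contDiffAt (sph_ne_zero ζ)).of_le two_le_smooth)]
    simp
  unfold subLaplacian
  rw [h2, hf.conj.reebSq_eq, hf.reebSq_eq, h1 f hf, h1 _ hf.reeb]
  split_ifs <;> simp

/-- The sub-Laplacian is symmetric. -/
theorem inner_subLaplacian [NeZero n] {f g : Sph n → ℂ} (hf : IsSmooth f) (hg : IsSmooth g) :
    ⟪toL2 (subLaplacian f), toL2 g⟫_ℂ = ⟪toL2 f, toL2 (subLaplacian g)⟫_ℂ := by
  rw [inner_toL2 hf.subLaplacian.continuous hg.continuous,
    inner_toL2 hf.continuous hg.subLaplacian.continuous]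
  simp only [← conj_subLaplacian hf]
  exact integral_subLaplacian_mul hf.conj hg

/-- `f` is a smooth eigenfunction of the sub-Laplacian. -/
structure IsEigen (lam : ℝ) (f : Sph n → ℂ) : Prop where
  smooth : IsSmooth f
  eigen : ∀ ζ, subLaplacian f ζ = (lam : ℂ) * f ζ

theorem IsEigen.toL2_subLaplacian {lam : ℝ} {f : Sph n → ℂ} (h : IsEigen lam f) :
    toL2 (subLaplacian f) = (lam : ℂ) • toL2 f := by
  rw [← toL2_const_mul h.smooth.continuous]
  congr 1
  funext ζ
  exact h.eigen ζ

theorem eigenspace_eq (lam : ℝ) : eigenspace n lam =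
    (Submodule.span ℂ {v : L2S n | ∃ f, IsEigen lam f ∧ v = toL2 f}).topologicalClosure := by
  unfold eigenspace
  congr 2
  ext v
  constructor
  · rintro ⟨f, hf, he, hv⟩
    exact ⟨f, ⟨hf, he⟩, eq_toL2 hf.continuous hv⟩
  · rintro ⟨f, hf, rfl⟩
    exact ⟨f, hf.smooth, hf.eigen, coeFn_toL2 hf.smooth.continuous⟩

theorem IsEigen.inner_subLaplacian [NeZero n] {lam : ℝ} {f g : Sph n → ℂ} (hf : IsEigen lam f)
    (hg : IsSmooth g) : ⟪toL2 f, toL2 (subLaplacian g)⟫_ℂ = lam * ⟪toL2 f, toL2 g⟫_ℂ := by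
  rw [← SzegoBall.inner_subLaplacian hf.smooth hg, hf.toL2_subLaplacian, inner_smul_left]
  simp

theorem IsEigen.inner_eq_zero [NeZero n] {l₁ l₂ : ℝ} {f g : Sph n → ℂ} (hf : IsEigen l₁ f)
    (hg : IsEigen l₂ g) (h : l₁ ≠ l₂) : ⟪toL2 f, toL2 g⟫_ℂ = 0 := by
  have h1 := hf.inner_subLaplacian hg.smooth
  rw [hg.toL2_subLaplacian, inner_smul_right] at h1
  have h2 : ((l₁ : ℂ) - l₂) * ⟪toL2 f, toL2 g⟫_ℂ = 0 := by linear_combination -h1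
  exact (mul_eq_zero.1 h2).resolve_left (sub_ne_zero.2 (by exact_mod_cast h))

theorem eigenspace_orth [NeZero n] {l₁ l₂ : ℝ} (h : l₁ ≠ l₂) {x y : L2S n}
    (hx : x ∈ eigenspace n l₁) (hy : y ∈ eigenspace n l₂) : ⟪x, y⟫_ℂ = 0 := by
  rw [eigenspace_eq] at hx hy
  refine inner_eq_zero_of_span ?_ hx hy
  rintro _ ⟨f, hf, rfl⟩ _ ⟨g, hg, rfl⟩
  exact hf.inner_eq_zero hg h

theorem IsHarm.isEigen {p q : ℤ} {Y : Cn n → ℂ} (h : IsHarm p q Y) :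
    IsEigen (lam n (p, q)) (res Y) := ⟨h.isSmooth, h.subLaplacian_res⟩

theorem harm_le_eigenspace (i : ℤ × ℤ) : harm n i ≤ eigenspace n (lam n i) := by
  rw [eigenspace_eq]
  refine Submodule.topologicalClosure_mono (Submodule.span_mono ?_)
  rintro _ ⟨Y, hY, rfl⟩
  exact ⟨_, hY.isEigen, rfl⟩

theorem harm_neg {i : ℤ × ℤ} (h : i.1 < 0 ∨ i.2 < 0) : harm n i = ⊥ := by
  have : {v : L2S n | ∃ Y, IsHarm i.1 i.2 Y ∧ v = toL2 (res Y)} ⊆ {0} := by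
    rintro _ ⟨Y, hY, rfl⟩
    have h0 : res Y = fun _ => 0 * 1 := by
      funext ζ
      rcases h with h | h
      · simpa [res] using hY.eq_zero_of_left_neg h ζ
      · simpa [res] using hY.eq_zero_of_right_neg h ζ
    rw [h0, toL2_const_mul continuous_const, zero_smul]
    rfl
  unfold harm
  rw [eq_bot_iff]
  refine Submodule.topologicalClosure_minimal _ ?_ (by simp)
  rw [Submodule.span_le]
  exact this

theorem proj_harm_neg {i : ℤ × ℤ} (h : i.1 < 0 ∨ i.2 < 0) (x : L2S n) :
    (harm n i).starProjection x = 0 := by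
  have h1 : (harm n i).starProjection x ∈ (⊥ : Submodule ℂ (L2S n)) :=
    (harm_neg h).le (proj_mem (V := harm n) i x)
  simpa using h1

/-- Harmonics of different weights under the circle action are orthogonal. -/
theorem IsHarm.inner_eq_zero_of_weight [NeZero n] {p q p' q' : ℤ} {Y Z : Cn n → ℂ}
    (hY : IsHarm p q Y) (hZ : IsHarm p' q' Z) (h : p - q ≠ p' - q') :
    ⟪toL2 (res Y), toL2 (res Z)⟫_ℂ = 0 := by
  rw [inner_toL2 hY.continuous_res hZ.continuous_res]
  have h1 := integral_reeb_mul hY.conj.isSmooth hZ.isSmooth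
  rw [hY.conj.reeb_res, hZ.reeb_res] at h1
  set A := ∫ ζ, (starRingEnd ℂ) (res Y ζ) * res Z ζ ∂(surf n) with hA
  have h2 : ∫ ζ : Sph n, Complex.I * (q - p) * res (fun z => (starRingEnd ℂ) (Y z)) ζ * res Z ζ
      ∂(surf n) = Complex.I * (q - p) * A := by
    rw [hA, ← integral_const_mul]
    refine integral_congr_ae (.of_forall fun ζ => ?_)
    simp only [res]; ring
  have h3 : ∫ ζ : Sph n, res (fun z => (starRingEnd ℂ) (Y z)) ζ *
      (Complex.I * (p' - q') * res Z ζ) ∂(surf n) = Complex.I * (p' - q') * A := by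
    rw [hA, ← integral_const_mul]
    refine integral_congr_ae (.of_forall fun ζ => ?_)
    simp only [res]; ring
  rw [h2, h3] at h1
  have h4 : (Complex.I * ((p - q : ℤ) - (p' - q' : ℤ))) * A = 0 := by
    push_cast; linear_combination -h1
  refine (mul_eq_zero.1 h4).resolve_left (mul_ne_zero Complex.I_ne_zero (sub_ne_zero.2 ?_))
  exact_mod_cast h

/-- Among the bidegrees with a fixed difference `p - q`, the eigenvalue of `Δ_H` determines the
bidegree: it is a strictly increasing function of `p + q ≥ 0`. -/
theorem lam_injective [NeZero n] {p q p' q' : ℤ} (hp : 0 ≤ p) (hq : 0 ≤ q) (hp' : 0 ≤ p')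
    (hq' : 0 ≤ q') (hd : p - q = p' - q') (hl : lam n (p, q) = lam n (p', q')) :
    p = p' ∧ q = q' := by
  have hn : 1 ≤ n := NeZero.one_le
  have h1 : (p + q) ^ 2 = (p' + q') ^ 2 ∨
      (p + q) ^ 2 + 2 * (n - 1) * (p + q) = (p' + q') ^ 2 + 2 * (n - 1 : ℤ) * (p' + q') := by
    unfold lam at hl
    split_ifs at hl with h
    · left; exact_mod_cast hl
    · right
      have hd' : (p - q : ℝ) ^ 2 = (p' - q' : ℝ) ^ 2 := by
        have : (p - q : ℝ) = p' - q' := by exact_mod_cast hd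
        rw [this]
      have : ((p + q : ℝ)) ^ 2 + 2 * (n - 1) * (p + q) =
          (p' + q' : ℝ) ^ 2 + 2 * (n - 1 : ℝ) * (p' + q') := by
        simp only at hl
        linear_combination hl + hd'
      exact_mod_cast this
  have hn' : (0 : ℤ) ≤ n - 1 := by omega
  have h2 : ∃ k : ℤ, 0 ≤ k ∧ (p + q - (p' + q')) * (p + q + (p' + q') + k) = 0 := by
    rcases h1 with h1 | h1
    · exact ⟨0, le_rfl, by linear_combination h1⟩
    · exact ⟨2 * (n - 1), by omega, by linear_combination h1⟩
  obtain ⟨k, hk, h2⟩ := h2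
  rcases mul_eq_zero.1 h2 with h2 | h2
  · omega
  · omega

end L2

/-! ### The decomposition into bihomogeneous harmonics -/

section Decomp

variable {n : ℕ}

theorem IsHarm.toL2_eq_zero {p q : ℤ} {Y : Cn n → ℂ} (h : IsHarm p q Y) (hn : p < 0 ∨ q < 0) :
    toL2 (res Y) = 0 := by
  have := h.mem_harm
  rw [harm_neg hn] at this
  simpa using this

/-- Different bidegrees are orthogonal: they differ in the weight `p - q` of the circle action, or
else in the eigenvalue of `Δ_H`. -/
theorem harm_orth [NeZero n] {i j : ℤ × ℤ} (hij : i ≠ j) {x y : L2S n} (hx : x ∈ harm n i)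
    (hy : y ∈ harm n j) : ⟪x, y⟫_ℂ = 0 := by
  refine inner_eq_zero_of_span ?_ hx hy
  rintro _ ⟨Y, hY, rfl⟩ _ ⟨Z, hZ, rfl⟩
  by_cases hd : i.1 - i.2 = j.1 - j.2
  · by_cases h1 : i.1 < 0 ∨ i.2 < 0
    · rw [hY.toL2_eq_zero h1, inner_zero_left]
    by_cases h2 : j.1 < 0 ∨ j.2 < 0
    · rw [hZ.toL2_eq_zero h2, inner_zero_right]
    push Not at h1 h2
    refine hY.isEigen.inner_eq_zero hZ.isEigen fun hl => hij ?_
    have := lam_injective h1.1 h1.2 h2.1 h2.2 hd hl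
    exact Prod.ext this.1 this.2
  · exact hY.inner_eq_zero_of_weight hZ hd

/-- The restriction of a bihomogeneous harmonic to the sphere, as a continuous function. -/
def IsHarm.cres {p q : ℤ} {Y : Cn n → ℂ} (h : IsHarm p q Y) : C(Sph n, ℂ) :=
  ⟨res Y, h.continuous_res⟩

/-- The finite sums of restrictions of bihomogeneous harmonics. -/
def harmSums (n : ℕ) : Submodule ℂ C(Sph n, ℂ) :=
  Submodule.span ℂ {f | ∃ p q Y, ∃ h : IsHarm (n := n) p q Y, f = h.cres}

/-- The function `ζ ↦ b̄ · ζ` on the sphere. -/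
def cell (b : Cn n) : C(Sph n, ℂ) := ⟨fun ζ => ell b ζ, by fun_prop⟩

theorem nsq_sph (ζ : Sph n) : nsq (ζ : Cn n) = 1 := by simp [nsq]

/-- On the sphere `(b̄ · ζ) Y` is a sum of harmonics of the degrees `(p + 1, q)` and
`(p, q - 1)`. -/
theorem cell_mul_mem (b : Cn n) {f : C(Sph n, ℂ)} (hf : f ∈ harmSums n) :
    cell b * f ∈ harmSums n := by
  induction hf using Submodule.span_induction with
  | mem f hf =>
    obtain ⟨p, q, Y, h, rfl⟩ := hf
    have h1 : cell b * h.cres =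
        (h.raise b).cres + ((n + p + q - 1 : ℂ))⁻¹ • (h.dzb b).cres := by
      ext ζ
      simp only [ContinuousMap.mul_apply, ContinuousMap.add_apply, ContinuousMap.smul_apply, cell,
        IsHarm.cres, ContinuousMap.coe_mk, res, smul_eq_mul, nsq_sph]
      ring
    rw [h1]
    exact Submodule.add_mem _ (Submodule.subset_span ⟨_, _, _, h.raise b, rfl⟩)
      (Submodule.smul_mem _ _ (Submodule.subset_span ⟨_, _, _, h.dzb b, rfl⟩))
  | zero => simp
  | add x y _ _ hx hy => rw [mul_add]; exact Submodule.add_mem _ hx hy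
  | smul c x _ hx => rw [mul_smul_comm]; exact Submodule.smul_mem _ _ hx

theorem star_mem_harmSums {f : C(Sph n, ℂ)} (hf : f ∈ harmSums n) : star f ∈ harmSums n := by
  induction hf using Submodule.span_induction with
  | mem f hf =>
    obtain ⟨p, q, Y, h, rfl⟩ := hf
    exact Submodule.subset_span ⟨_, _, _, h.conj, by ext ζ; rfl⟩
  | zero => simp
  | add x y _ _ hx hy => rw [star_add]; exact Submodule.add_mem _ hx hy
  | smul c x _ hx => rw [star_smul]; exact Submodule.smul_mem _ _ hx

/-- The sums of bihomogeneous harmonics form an algebra that separates points, so they are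
uniformly dense. -/
theorem harmSums_dense (n : ℕ) : (harmSums n).topologicalClosure = ⊤ := by
  let A : StarSubalgebra ℂ C(Sph n, ℂ) := StarAlgebra.adjoin ℂ (Set.range cell)
  have hA : ∀ a ∈ A, ∀ f ∈ harmSums n, a * f ∈ harmSums n := by
    intro a ha
    have ha' : a ∈ Algebra.adjoin ℂ (Set.range cell ∪ star (Set.range cell)) := by
      rw [← StarAlgebra.adjoin_toSubalgebra]; exact ha
    induction ha' using Algebra.adjoin_induction with
    | mem x hx =>
      intro f hf
      rcases hx with ⟨b, rfl⟩ | ⟨b, hb⟩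
      · exact cell_mul_mem b hf
      · have h1 := star_mem_harmSums (cell_mul_mem b (star_mem_harmSums hf))
        rw [star_mul, star_star, hb, star_star, mul_comm] at h1
        exact h1
    | algebraMap r =>
      intro f hf
      rw [← Algebra.smul_def]; exact Submodule.smul_mem _ _ hf
    | add x y hx hy ihx ihy =>
      intro f hf
      rw [add_mul]
      refine Submodule.add_mem _ (ihx ?_ f hf) (ihy ?_ f hf)
      all_goals rw [← StarAlgebra.adjoin_toSubalgebra] at *; assumption
    | mul x y hx hy ihx ihy =>
      intro f hf
      rw [mul_assoc]
      refine ihx ?_ _ (ihy ?_ f hf)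
      all_goals rw [← StarAlgebra.adjoin_toSubalgebra] at *; assumption
  have h1 : (1 : C(Sph n, ℂ)) ∈ harmSums n :=
    Submodule.subset_span ⟨0, 0, fun _ => 1, IsHarm.const 1, rfl⟩
  have hsub : (A : Set C(Sph n, ℂ)) ⊆ harmSums n := fun a ha => by
    simpa using hA a ha 1 h1
  have hsep : A.SeparatesPoints := by
    intro x y hxy
    refine ⟨cell ((x : Cn n) - (y : Cn n)), ⟨cell ((x : Cn n) - (y : Cn n)),
      StarAlgebra.subset_adjoin ℂ _ ⟨_, rfl⟩, rfl⟩, fun h => hxy (Subtype.ext ?_)⟩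
    have h2 : ⟪(x : Cn n) - (y : Cn n), (x : Cn n) - (y : Cn n)⟫_ℂ = 0 := by
      rw [inner_sub_right]
      exact sub_eq_zero.2 h
    exact sub_eq_zero.1 (inner_self_eq_zero.1 h2)
  have hd := ContinuousMap.starSubalgebra_topologicalClosure_eq_top_of_separatesPoints A hsep
  rw [eq_top_iff]
  intro f _
  have hf : f ∈ A.topologicalClosure := by rw [hd]; trivial
  exact closure_mono hsub hf

theorem harm_total (n : ℕ) : (⨆ i, harm n i).topologicalClosure = ⊤ := by
  have h1 : ∀ f ∈ harmSums n, cls n f ∈ ⨆ i, harm n i := by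
    intro f hf
    induction hf using Submodule.span_induction with
    | mem f hf =>
      obtain ⟨p, q, Y, h, rfl⟩ := hf
      have h2 := h.mem_harm
      rw [toL2_eq_cls h.continuous_res] at h2
      exact Submodule.mem_iSup_of_mem (p, q) h2
    | zero => simp
    | add x y _ _ hx hy => rw [map_add]; exact Submodule.add_mem _ hx hy
    | smul c x _ hx => rw [map_smul]; exact Submodule.smul_mem _ _ hx
  have h2 : ∀ f, cls n f ∈ (⨆ i, harm n i).topologicalClosure := by
    intro f
    have hf : f ∈ (harmSums n).topologicalClosure := by rw [harmSums_dense]; trivial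
    exact map_mem_closure (cls n).continuous hf h1
  have h3 : DenseRange (cls n) :=
    ContinuousMap.toLp_denseRange ℂ (surf n) (p := 2) ℂ (by simp)
  rw [eq_top_iff]
  intro v _
  have h4 : v ∈ closure (Set.range (cls n)) := h3 v
  exact closure_minimal (Set.range_subset_iff.2 h2) (Submodule.isClosed_topologicalClosure _) h4

theorem isOrthDecomp_harm (n : ℕ) [NeZero n] : IsOrthDecomp (harm n) :=
  ⟨fun _ _ hij _ hx _ hy => harm_orth hij hx hy, harm_total n⟩

theorem isOrthDecomp_eigenspace (n : ℕ) [NeZero n] : IsOrthDecomp (eigenspace n) := by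
  refine ⟨fun _ _ hij _ hx _ hy => eigenspace_orth hij hx hy, ?_⟩
  rw [eq_top_iff, ← harm_total n]
  exact Submodule.topologicalClosure_mono (iSup_le fun i =>
    (harm_le_eigenspace i).trans (le_iSup (eigenspace n) _))

/-- The projection of `L²(S)` onto the harmonics of degree `i = (p, q)`. -/
abbrev hproj {n : ℕ} (i : ℤ × ℤ) : L2S n →L[ℂ] L2S n := (harm n i).starProjection

/-- The eigenspaces of `Δ_H` are the sums of the spaces `harm n i` with the same `lam n i`. -/
theorem hproj_eigen [NeZero n] (i : ℤ × ℤ) (mu : ℝ) (x : L2S n) :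
    hproj i ((eigenspace n mu).starProjection x) = if mu = lam n i then hproj i x else 0 := by
  refine ext_inner_right ℂ fun y => ?_
  rw [Submodule.inner_starProjection_left_eq_right, Submodule.inner_starProjection_left_eq_right]
  have hy : hproj i y ∈ eigenspace n (lam n i) := harm_le_eigenspace i (proj_mem i y)
  split_ifs with h
  · subst h
    rw [proj_of_mem (V := eigenspace n) hy, Submodule.inner_starProjection_left_eq_right]
  · rw [(isOrthDecomp_eigenspace n).proj_of_mem_ne h hy, inner_zero_right, inner_zero_left]

/-- The eigenvalue `lam`, with negative degrees replaced by zero. -/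
def lamPos (n : ℕ) (i : ℤ × ℤ) : ℝ := lam n (max i.1 0, max i.2 0)

theorem lam_nonneg [NeZero n] {i : ℤ × ℤ} (h1 : 0 ≤ i.1) (h2 : 0 ≤ i.2) : 0 ≤ lam n i := by
  unfold lam
  have hn : (1 : ℝ) ≤ n := by exact_mod_cast (NeZero.one_le : 1 ≤ n)
  have h1' : (0 : ℝ) ≤ i.1 := by exact_mod_cast h1
  have h2' : (0 : ℝ) ≤ i.2 := by exact_mod_cast h2
  split_ifs
  · positivity
  · have : (0 : ℝ) ≤ 2 * n - 2 := by linarith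
    positivity

theorem lamPos_nonneg [NeZero n] (i : ℤ × ℤ) : 0 ≤ lamPos n i :=
  lam_nonneg (le_max_right _ _) (le_max_right _ _)

theorem lamPos_eq {i : ℤ × ℤ} (h1 : 0 ≤ i.1) (h2 : 0 ≤ i.2) : lamPos n i = lam n i := by
  unfold lamPos
  rw [max_eq_left h1, max_eq_left h2]

/-- `Δ_H` has no negative eigenvalues, since all its eigenvalues on the spaces `harm n i ≠ 0` are
nonnegative. -/
theorem eigen_neg [NeZero n] {mu : ℝ} (hmu : mu < 0) (x : L2S n) :
    (eigenspace n mu).starProjection x = 0 := by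
  refine (isOrthDecomp_harm n).ext fun i => ?_
  rw [hproj_eigen, map_zero]
  split_ifs with h
  · by_cases hi : i.1 < 0 ∨ i.2 < 0
    · exact proj_harm_neg hi x
    · push Not at hi
      have := lam_nonneg (n := n) hi.1 hi.2
      rw [← h] at this
      exact absurd hmu (not_lt.2 this)
  · rfl

/-- The smooth function `(1 + Δ_H)^N φ`. -/
def iterSub (N : ℕ) (φ : Sph n → ℂ) : Sph n → ℂ := (fun f ζ => f ζ + subLaplacian f ζ)^[N] φ

theorem isSmooth_iterSub {φ : Sph n → ℂ} (hφ : IsSmooth φ) (N : ℕ) : IsSmooth (iterSub N φ) := by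
  induction N with
  | zero => exact hφ
  | succ N ih =>
    unfold iterSub
    rw [Function.iterate_succ_apply']
    exact ih.add ih.subLaplacian

theorem eigen_add_subLaplacian [NeZero n] {φ : Sph n → ℂ} (hφ : IsSmooth φ) (mu : ℝ) :
    (eigenspace n mu).starProjection (toL2 fun ζ => φ ζ + subLaplacian φ ζ) =
      ((1 + mu : ℝ) : ℂ) • (eigenspace n mu).starProjection (toL2 φ) := by
  have h1 : toL2 (fun ζ => φ ζ + subLaplacian φ ζ) - ((1 + mu : ℝ) : ℂ) • toL2 φ ∈
      (eigenspace n mu)ᗮ := by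
    rw [eigenspace_eq, Submodule.orthogonal_closure, Submodule.mem_orthogonal]
    intro u hu
    induction hu using Submodule.span_induction with
    | mem u hu =>
      obtain ⟨f, hf, rfl⟩ := hu
      rw [toL2_add hφ.continuous hφ.subLaplacian.continuous, inner_sub_right, inner_add_right,
        hf.inner_subLaplacian hφ, inner_smul_right]
      push_cast; ring
    | zero => simp
    | add x y _ _ hx hy => rw [inner_add_left, hx, hy, add_zero]
    | smul c x _ hx => rw [inner_smul_left, hx, mul_zero]
  have h2 := (Submodule.starProjection_apply_eq_zero_iff _).2 h1
  rw [map_sub, map_smul] at h2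
  exact sub_eq_zero.1 h2

theorem eigen_iterSub [NeZero n] {φ : Sph n → ℂ} (hφ : IsSmooth φ) (mu : ℝ) (N : ℕ) :
    (eigenspace n mu).starProjection (toL2 (iterSub N φ)) =
      (((1 + mu) ^ N : ℝ) : ℂ) • (eigenspace n mu).starProjection (toL2 φ) := by
  induction N with
  | zero => simp [iterSub]
  | succ N ih =>
    have : iterSub (N + 1) φ = fun ζ => iterSub N φ ζ + subLaplacian (iterSub N φ) ζ := by
      unfold iterSub
      rw [Function.iterate_succ_apply']
    rw [this, eigen_add_subLaplacian (isSmooth_iterSub hφ N), ih, smul_smul, pow_succ']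
    push_cast; rfl

/-- The series defining `(1 + Δ_H)^r φ` converges for smooth `φ`: its terms are dominated by the
components of `(1 + Δ_H)^N φ` for `N ≥ r`. -/
theorem hasSum_subLaplacianPow [NeZero n] (r : ℝ) {φ : Sph n → ℂ} (hφ : IsSmooth φ) :
    HasSum (fun mu : ℝ => (((1 + mu) ^ r : ℝ) : ℂ) • (eigenspace n mu).starProjection (toL2 φ))
      (subLaplacianPow r φ) := by
  obtain ⟨N, hN⟩ := exists_nat_ge r
  have hmem : ∀ mu : ℝ, (((1 + mu) ^ r : ℝ) : ℂ) • (eigenspace n mu).starProjection (toL2 φ) ∈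
      eigenspace n mu := fun mu => Submodule.smul_mem _ _ (proj_mem (V := eigenspace n) mu _)
  have hle : ∀ mu : ℝ,
      ‖(((1 + mu) ^ r : ℝ) : ℂ) • (eigenspace n mu).starProjection (toL2 φ)‖ ^ 2 ≤
        ‖(eigenspace n mu).starProjection (toL2 (iterSub N φ))‖ ^ 2 := by
    intro mu
    rcases lt_or_ge mu 0 with hmu | hmu
    · rw [eigen_neg hmu, eigen_neg hmu]; simp
    · rw [eigen_iterSub hφ, norm_smul, norm_smul, Complex.norm_real, Complex.norm_real,
        Real.norm_of_nonneg (by positivity), Real.norm_of_nonneg (by positivity)]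
      gcongr
      rw [← Real.rpow_natCast]
      exact Real.rpow_le_rpow_of_exponent_le (by linarith) hN
  have hs := ((isOrthDecomp_eigenspace n).hasSum_norm_sq (toL2 (iterSub N φ))).summable
  obtain ⟨x, hx, -⟩ := (isOrthDecomp_eigenspace n).exists_of_summable hmem
    (Summable.of_nonneg_of_le (fun mu => by positivity) hle hs)
  unfold subLaplacianPow
  exact hx.summable.hasSum

/-- `(1 + Δ_H)^r` acts on the component of bidegree `i` as the scalar `(1 + lamPos n i) ^ r`. -/
theorem hproj_subLaplacianPow [NeZero n] (r : ℝ) {φ : Sph n → ℂ} (hφ : IsSmooth φ) (i : ℤ × ℤ) :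
    hproj i (subLaplacianPow r φ) = (((1 + lamPos n i) ^ r : ℝ) : ℂ) • hproj i (toL2 φ) := by
  by_cases hi : i.1 < 0 ∨ i.2 < 0
  · rw [hproj, proj_harm_neg hi, proj_harm_neg hi, smul_zero]
  push Not at hi
  rw [lamPos_eq hi.1 hi.2]
  refine ((hasSum_subLaplacianPow r hφ).mapL (hproj i)).unique ?_
  have : (fun mu : ℝ => hproj i ((((1 + mu) ^ r : ℝ) : ℂ) •
      (eigenspace n mu).starProjection (toL2 φ))) = fun mu : ℝ => if mu = lam n i then
        (((1 + lam n i) ^ r : ℝ) : ℂ) • hproj i (toL2 φ) else 0 := by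
    funext mu
    rw [map_smul, hproj_eigen]
    split_ifs with h
    · rw [h]
    · simp
  rw [this]
  exact hasSum_ite_eq (lam n i) _

end Decomp

/-! ### Möbius transforms of the ball and the sphere -/

section Moebius

variable {n : ℕ}

/-- The matrix of `g ∈ SU(n,1)`. -/
def mat (g : SU n) : Matrix (Fin n ⊕ Unit) (Fin n ⊕ Unit) ℂ :=
  ((g : Matrix.SpecialLinearGroup (Fin n ⊕ Unit) ℂ) : Matrix (Fin n ⊕ Unit) (Fin n ⊕ Unit) ℂ)

theorem mat_mul (g h : SU n) : mat (g * h) = mat g * mat h := by simp [mat]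

theorem mat_one : mat (1 : SU n) = 1 := by simp [mat]

theorem mat_form (g : SU n) : (mat g).conjTranspose * formJ n * mat g = formJ n := g.2

theorem det_mat (g : SU n) : (mat g).det = 1 :=
  (g : Matrix.SpecialLinearGroup (Fin n ⊕ Unit) ℂ).2

/-- The vector `(z, 1)`. -/
def homv (z : Cn n) : Fin n ⊕ Unit → ℂ := Sum.elim (fun i => z i) fun _ => 1

/-- The numerator `a z + b` of a Möbius transform. -/
def numer (g : SU n) (z : Cn n) (i : Fin n) : ℂ :=
  (∑ j, entry g (Sum.inl i) (Sum.inl j) * z j) + entry g (Sum.inl i) (Sum.inr ())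

theorem mat_mulVec (g : SU n) (z : Cn n) :
    (mat g).mulVec (homv z) = Sum.elim (numer g z) fun _ => autJ g z := by
  funext k
  rcases k with i | u
  · simp [Matrix.mulVec, dotProduct, Fintype.sum_sum_type, homv, entry, mat, numer]
  · simp [Matrix.mulVec, dotProduct, Fintype.sum_sum_type, homv, entry, mat, autJ]

theorem mobius_apply (g : SU n) (z : Cn n) (i : Fin n) :
    mobius g z i = numer g z i / autJ g z := rfl

theorem mat_mulVec_homv {g : SU n} {z : Cn n} (h : autJ g z ≠ 0) :
    (mat g).mulVec (homv z) = autJ g z • homv (mobius g z) := by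
  rw [mat_mulVec]
  funext k
  rcases k with i | u
  · simp only [Sum.elim_inl, homv, Pi.smul_apply, mobius_apply, smul_eq_mul]
    field_simp
  · simp [homv]

theorem form_invariant (g : SU n) (u v : Fin n ⊕ Unit → ℂ) :
    star ((mat g).mulVec u) ⬝ᵥ (formJ n).mulVec ((mat g).mulVec v) =
      star u ⬝ᵥ (formJ n).mulVec v := by
  conv_rhs => rw [← mat_form g]
  rw [Matrix.star_mulVec, ← Matrix.dotProduct_mulVec, Matrix.mulVec_mulVec, Matrix.mulVec_mulVec,
    Matrix.mul_assoc]

theorem form_homv (η z : Cn n) :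
    star (homv η) ⬝ᵥ (formJ n).mulVec (homv z) = ⟪η, z⟫_ℂ - 1 := by
  simp only [formJ, Matrix.mulVec_diagonal, dotProduct, Fintype.sum_sum_type, homv,
    PiLp.inner_apply, RCLike.inner_apply]
  simp [mul_comm, sub_eq_add_neg]

/-- The transformation law of the kernel `1 - η̄ · z`, which is the value of the invariant Hermitian
form at `(η, 1)` and `(z, 1)` up to sign. -/
theorem inner_mobius (g : SU n) {η z : Cn n} (hη : autJ g η ≠ 0) (hz : autJ g z ≠ 0) :
    (starRingEnd ℂ) (autJ g η) * autJ g z * (1 - ⟪mobius g η, mobius g z⟫_ℂ) = 1 - ⟪η, z⟫_ℂ := by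
  have h := form_invariant g (homv η) (homv z)
  rw [mat_mulVec_homv hη, mat_mulVec_homv hz, form_homv, star_smul, Matrix.mulVec_smul,
    smul_dotProduct, dotProduct_smul, form_homv] at h
  simp only [smul_eq_mul, RCLike.star_def] at h
  linear_combination -h

/-- If `J(g, z) = 0` for some `|z| ≤ 1`, then the invariant form is `|a z + b|² ≥ 0` at the image
`(a z + b, 0)` of `(z, 1)`, and `|z|² - 1 ≤ 0` at `(z, 1)`. So the image is zero, although `g` is
invertible. -/
theorem autJ_ne_zero (g : SU n) {z : Cn n} (hz : ‖z‖ ≤ 1) : autJ g z ≠ 0 := by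
  intro h0
  have h := form_invariant g (homv z) (homv z)
  rw [form_homv, mat_mulVec, inner_self_eq_norm_sq_to_K] at h
  simp only [formJ, Matrix.mulVec_diagonal, dotProduct, Fintype.sum_sum_type, h0, Pi.star_apply,
    Sum.elim_inl, Sum.elim_inr, RCLike.star_def, one_mul, Complex.conj_mul'] at h
  simp only [map_zero, zero_mul, Finset.sum_const_zero, add_zero] at h
  have h2 : ∑ i, ‖numer g z i‖ ^ 2 = ‖z‖ ^ 2 - 1 := by
    have h3 : ((∑ i, ‖numer g z i‖ ^ 2 : ℝ) : ℂ) = ((‖z‖ ^ 2 - 1 : ℝ) : ℂ) := by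
      push_cast; exact h
    exact_mod_cast h3
  have h4 : ∑ i, ‖numer g z i‖ ^ 2 = 0 :=
    le_antisymm (by rw [h2]; nlinarith [norm_nonneg z]) (Finset.sum_nonneg fun i _ => sq_nonneg _)
  rw [Finset.sum_eq_zero_iff_of_nonneg fun i _ => sq_nonneg _] at h4
  have h5 : (mat g).mulVec (homv z) = 0 := by
    rw [mat_mulVec]
    funext k
    rcases k with i | u
    · simpa using h4 i (Finset.mem_univ i)
    · exact h0
  have h6 := congrFun (Matrix.eq_zero_of_mulVec_eq_zero (by rw [det_mat]; exact one_ne_zero) h5)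
    (Sum.inr ())
  simp [homv] at h6

theorem autJ_mul (g h : SU n) {z : Cn n} (hz : autJ h z ≠ 0) :
    autJ (g * h) z = autJ g (mobius h z) * autJ h z := by
  have h1 := congrFun (mat_mulVec (g * h) z) (Sum.inr ())
  rw [mat_mul, ← Matrix.mulVec_mulVec, mat_mulVec_homv hz, Matrix.mulVec_smul, mat_mulVec] at h1
  simp only [Pi.smul_apply, Sum.elim_inr, smul_eq_mul] at h1
  rw [← h1, mul_comm]

theorem mobius_mul (g h : SU n) {z : Cn n} (hz : autJ h z ≠ 0) :
    mobius (g * h) z = mobius g (mobius h z) := by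
  ext i
  have h1 := congrFun (mat_mulVec (g * h) z) (Sum.inl i)
  rw [mat_mul, ← Matrix.mulVec_mulVec, mat_mulVec_homv hz, Matrix.mulVec_smul, mat_mulVec] at h1
  simp only [Pi.smul_apply, Sum.elim_inl, smul_eq_mul] at h1
  rw [mobius_apply, mobius_apply, autJ_mul g h hz, ← h1]
  by_cases h0 : autJ g (mobius h z) = 0
  · simp [h0]
  · field_simp

theorem homv_mulVec_one (z : Cn n) : numer 1 z = (fun i => z i) ∧ autJ 1 z = 1 := by
  have h1 := mat_mulVec (1 : SU n) z
  rw [mat_one, Matrix.one_mulVec] at h1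
  exact ⟨funext fun i => (congrFun h1 (Sum.inl i)).symm, (congrFun h1 (Sum.inr ())).symm⟩

theorem autJ_one (z : Cn n) : autJ (1 : SU n) z = 1 := (homv_mulVec_one z).2

theorem mobius_one (z : Cn n) : mobius (1 : SU n) z = z := by
  ext i
  rw [mobius_apply, (homv_mulVec_one z).1, autJ_one, div_one]

theorem norm_mobius (g : SU n) {z : Cn n} (hz : ‖z‖ ≤ 1) :
    ‖autJ g z‖ ^ 2 * (1 - ‖mobius g z‖ ^ 2) = 1 - ‖z‖ ^ 2 := by
  have h := inner_mobius g (autJ_ne_zero g hz) (autJ_ne_zero g hz)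
  rw [inner_self_eq_norm_sq_to_K, inner_self_eq_norm_sq_to_K, Complex.conj_mul'] at h
  have h2 : ((‖autJ g z‖ ^ 2 * (1 - ‖mobius g z‖ ^ 2) : ℝ) : ℂ) = ((1 - ‖z‖ ^ 2 : ℝ) : ℂ) := by
    push_cast
    exact h
  exact_mod_cast h2

theorem norm_mobius_le (g : SU n) {z : Cn n} (hz : ‖z‖ ≤ 1) : ‖mobius g z‖ ≤ 1 := by
  have h := norm_mobius g hz
  have h1 : 0 < ‖autJ g z‖ ^ 2 := by have := norm_pos_iff.2 (autJ_ne_zero g hz); positivity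
  by_contra h2
  push Not at h2
  have h3 : 1 - ‖mobius g z‖ ^ 2 < 0 := by nlinarith
  nlinarith [mul_neg_of_pos_of_neg h1 h3, norm_nonneg z]

theorem norm_mobius_lt (g : SU n) {z : Cn n} (hz : ‖z‖ < 1) : ‖mobius g z‖ < 1 := by
  have h := norm_mobius g hz.le
  have h1 : 0 < ‖autJ g z‖ ^ 2 := by have := norm_pos_iff.2 (autJ_ne_zero g hz.le); positivity
  by_contra h2
  push Not at h2
  have h3 : 1 - ‖mobius g z‖ ^ 2 ≤ 0 := by nlinarith
  nlinarith [mul_nonpos_of_nonneg_of_nonpos h1.le h3, norm_nonneg z]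

theorem mobius_inv_mobius (g : SU n) {z : Cn n} (hz : ‖z‖ ≤ 1) :
    mobius g⁻¹ (mobius g z) = z := by
  rw [← mobius_mul _ _ (autJ_ne_zero g hz), inv_mul_cancel, mobius_one]

theorem mobius_mobius_inv (g : SU n) {z : Cn n} (hz : ‖z‖ ≤ 1) :
    mobius g (mobius g⁻¹ z) = z := by
  rw [← mobius_mul _ _ (autJ_ne_zero _ hz), mul_inv_cancel, mobius_one]

theorem autJ_inv_mobius (g : SU n) {z : Cn n} (hz : ‖z‖ ≤ 1) :
    autJ g⁻¹ (mobius g z) * autJ g z = 1 := by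
  rw [← autJ_mul _ _ (autJ_ne_zero g hz), inv_mul_cancel, autJ_one]

theorem autJ_mobius_inv (g : SU n) {z : Cn n} (hz : ‖z‖ ≤ 1) :
    autJ g (mobius g⁻¹ z) * autJ g⁻¹ z = 1 := by
  rw [← autJ_mul _ _ (autJ_ne_zero _ hz), mul_inv_cancel, autJ_one]

theorem mobius_image_ball (g : SU n) : mobius g '' Ball n = Ball n := by
  ext w
  simp only [Set.mem_image, mem_ball_zero_iff]
  constructor
  · rintro ⟨z, hz, rfl⟩
    exact norm_mobius_lt g hz
  · intro hw
    exact ⟨mobius g⁻¹ w, norm_mobius_lt _ hw, mobius_mobius_inv g hw.le⟩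

theorem mobius_injOn (g : SU n) : Set.InjOn (mobius g) (Ball n) := by
  intro z hz w hw h
  rw [mem_ball_zero_iff] at hz hw
  rw [← mobius_inv_mobius g hz.le, h, mobius_inv_mobius g hw.le]

/-- The linear form `v ↦ c v` of `J(g, z) = c z + d`. -/
def rowC (g : SU n) : Cn n →L[ℂ] ℂ :=
  ∑ j, entry g (Sum.inr ()) (Sum.inl j) • (EuclideanSpace.proj j : Cn n →L[ℂ] ℂ)

theorem autJ_eq (g : SU n) (z : Cn n) :
    autJ g z = rowC g z + entry g (Sum.inr ()) (Sum.inr ()) := by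
  simp [autJ, rowC]

/-- The linear form `v ↦ (a v)_i`. -/
def rowA (g : SU n) (i : Fin n) : Cn n →L[ℂ] ℂ :=
  ∑ j, entry g (Sum.inl i) (Sum.inl j) • (EuclideanSpace.proj j : Cn n →L[ℂ] ℂ)

theorem numer_eq (g : SU n) (z : Cn n) (i : Fin n) :
    numer g z i = rowA g i z + entry g (Sum.inl i) (Sum.inr ()) := by
  simp [numer, rowA]

theorem contDiff_autJ (g : SU n) {k : WithTop ℕ∞} : ContDiff ℂ k (autJ g) := by
  have : autJ g = fun z => rowC g z + entry g (Sum.inr ()) (Sum.inr ()) :=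
    funext (autJ_eq g)
  rw [this]
  exact (rowC g).contDiff.add contDiff_const

theorem continuous_autJ (g : SU n) : Continuous (autJ g) :=
  (contDiff_autJ g (k := 0)).continuous

theorem hasFDerivAt_autJ (g : SU n) (z : Cn n) : HasFDerivAt (autJ g) (rowC g) z := by
  have : autJ g = fun z => rowC g z + entry g (Sum.inr ()) (Sum.inr ()) :=
    funext (autJ_eq g)
  rw [this]
  exact (rowC g).hasFDerivAt.add_const _

theorem contDiffAt_mobius (g : SU n) {z : Cn n} (hz : autJ g z ≠ 0) {k : WithTop ℕ∞} :
    ContDiffAt ℂ k (mobius g) z := by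
  rw [contDiffAt_euclidean]
  intro i
  have : (fun z => mobius g z i) =
      fun z => (rowA g i z + entry g (Sum.inl i) (Sum.inr ())) / autJ g z := by
    funext z; rw [mobius_apply, numer_eq]
  rw [this]
  exact ((rowA g i).contDiff.add contDiff_const).contDiffAt.div (contDiff_autJ g).contDiffAt hz

/-- The matrix of the complex derivative of a Möbius transform. -/
def mobiusD (g : SU n) (z : Cn n) : Matrix (Fin n) (Fin n) ℂ :=
  (autJ g z)⁻¹ • ((mat g).toBlocks₁₁ -
    (Matrix.of fun i (_ : Unit) => mobius g z i) * (mat g).toBlocks₂₁)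

theorem hasFDerivAt_mobius (g : SU n) {z : Cn n} (hz : autJ g z ≠ 0) :
    HasFDerivAt (mobius g) (Matrix.toLpLin 2 2 (mobiusD g z)).toContinuousLinearMap z := by
  rw [← hasFDerivWithinAt_univ, hasFDerivWithinAt_euclidean]
  intro i
  rw [hasFDerivWithinAt_univ]
  have h1 : (fun z => mobius g z i) =
      fun z => (rowA g i z + entry g (Sum.inl i) (Sum.inr ())) / autJ g z := by
    funext z; rw [mobius_apply, numer_eq]
  rw [h1]
  have h2 := ((rowA g i).hasFDerivAt (x := z)).add_const (entry g (Sum.inl i) (Sum.inr ()))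
  simp only [div_eq_mul_inv]
  refine (h2.mul ((hasDerivAt_inv hz).comp_hasFDerivAt z (hasFDerivAt_autJ g z))).congr_fderiv ?_
  ext v
  have h3 : rowA g i z + entry g (Sum.inl i) (Sum.inr ()) = mobius g z i * autJ g z := by
    rw [← numer_eq, mobius_apply]; field_simp
  have h4 : (mobiusD g z).mulVec v i = (autJ g z)⁻¹ * (rowA g i v - mobius g z i * rowC g v) := by
    simp [mobiusD, Matrix.mulVec, dotProduct, rowA, rowC, Finset.mul_sum, Matrix.mul_apply,
      entry, mat, Matrix.toBlocks₁₁, Matrix.toBlocks₂₁, sub_mul, mul_sub, Finset.sum_sub_distrib,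
      mul_assoc]
  have h5 : (PiLp.proj 2 (fun _ : Fin n => ℂ) i ∘L
      (Matrix.toLpLin 2 2 (mobiusD g z)).toContinuousLinearMap) v = (mobiusD g z).mulVec v i := by
    simp [Matrix.toLpLin_apply]
  rw [h3]
  refine Eq.trans ?_ h5.symm
  rw [h4]
  simp
  field_simp
  ring

/-- The complex Jacobian determinant `J(g, z)^{-(n+1)}`: the derivative is a Schur complement in `g`
times a unipotent matrix, and `det g = 1`. -/
theorem det_mobiusD (g : SU n) {z : Cn n} (hz : autJ g z ≠ 0) :
    (mobiusD g z).det = (autJ g z)⁻¹ ^ (n + 1) := by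
  let E : Matrix (Fin n ⊕ Unit) (Fin n ⊕ Unit) ℂ :=
    Matrix.fromBlocks 1 (Matrix.of fun i (_ : Unit) => z i) 0 1
  have hE : E.det = 1 := by simp [E]
  let Dm : Matrix Unit Unit ℂ := Matrix.of fun _ _ => autJ g z
  have h1 : mat g * E = Matrix.fromBlocks (mat g).toBlocks₁₁
    (Matrix.of fun i (_ : Unit) => numer g z i)
      (mat g).toBlocks₂₁ Dm := by
    conv_lhs => rw [← Matrix.fromBlocks_toBlocks (mat g)]
    rw [Matrix.fromBlocks_multiply]
    congr 1
    · simp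
    · ext i j
      simp [Matrix.mul_apply, numer, entry, mat, Matrix.toBlocks₁₁, Matrix.toBlocks₁₂]
    · simp
    · ext i j
      simp [Matrix.mul_apply, autJ, entry, mat, Matrix.toBlocks₂₁, Matrix.toBlocks₂₂, Dm]
  have hD : Dm.det = autJ g z := by simp [Dm]
  let _ : Invertible Dm := Matrix.invertibleOfIsUnitDet _ (by rw [hD]; exact hz.isUnit)
  have h2 := congrArg Matrix.det h1
  rw [Matrix.det_mul, det_mat, hE, Matrix.det_fromBlocks₂₂, hD] at h2
  have hinv : ⅟Dm = Matrix.of fun _ _ => (autJ g z)⁻¹ := by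
    rw [invOf_eq_right_inv]
    ext i j
    simp [Matrix.mul_apply, Dm, hz]
  have h3 : (Matrix.of fun i (_ : Unit) => numer g z i) * ⅟Dm =
      Matrix.of fun i (_ : Unit) => mobius g z i := by
    rw [hinv]
    ext i j
    simp [Matrix.mul_apply, mobius_apply, div_eq_mul_inv]
  rw [h3] at h2
  rw [mobiusD, Matrix.det_smul, Fintype.card_fin]
  have h4 : ((mat g).toBlocks₁₁ - (Matrix.of fun i (_ : Unit) => mobius g z i) *
      (mat g).toBlocks₂₁).det = (autJ g z)⁻¹ := by
    field_simp
    linear_combination -h2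
  rw [h4, pow_succ]

end Moebius

/-! ### Change of variables on the ball and polar coordinates -/

section ChangeOfVariables

variable {n : ℕ}

/-- The real derivative of a Möbius transform. -/
def mobiusR (g : SU n) (z : Cn n) : Cn n →L[ℝ] Cn n :=
  ((Matrix.toLpLin 2 2 (mobiusD g z)).toContinuousLinearMap).restrictScalars ℝ

theorem hasFDerivAt_mobius_real (g : SU n) {z : Cn n} (hz : autJ g z ≠ 0) :
    HasFDerivAt (mobius g) (mobiusR g z) z :=
  (hasFDerivAt_mobius g hz).restrictScalars ℝ

theorem abs_det_mobiusR (g : SU n) {z : Cn n} (hz : autJ g z ≠ 0) :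
    |(mobiusR g z).det| = ‖autJ g z‖⁻¹ ^ (2 * n + 2) := by
  have h1 : (mobiusR g z).det =
      LinearMap.det ((Matrix.toLpLin 2 2 (mobiusD g z)).restrictScalars ℝ) := rfl
  rw [h1, LinearMap.det_restrictScalars, Algebra.norm_complex_apply, LinearMap.det_toLpLin,
    det_mobiusD g hz, Complex.normSq_eq_norm_sq, abs_of_nonneg (by positivity), norm_pow, norm_inv,
    ← pow_mul]
  congr 1
  ring

theorem one_sub_norm_mobius (g : SU n) {z : Cn n} (hz : ‖z‖ ≤ 1) :
    1 - ‖mobius g z‖ ^ 2 = ‖autJ g z‖⁻¹ ^ 2 * (1 - ‖z‖ ^ 2) := by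
  have h := norm_mobius g hz
  have h1 := norm_pos_iff.2 (autJ_ne_zero g hz)
  field_simp
  linarith

theorem lintegral_ball_mobius (g : SU n) (F : Cn n → ENNReal) :
    ∫⁻ w in Ball n, F w = ∫⁻ z in Ball n,
      ENNReal.ofReal (‖autJ g z‖⁻¹ ^ (2 * n + 2)) * F (mobius g z) := by
  have hJ : ∀ z ∈ Ball n, autJ g z ≠ 0 := fun z hz =>
    autJ_ne_zero g (mem_ball_zero_iff.1 hz).le
  have h := lintegral_image_eq_lintegral_abs_det_fderiv_mul (volume : Measure (Cn n))
    (s := Ball n) measurableSet_ball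
    (fun z hz => (hasFDerivAt_mobius_real g (hJ z hz)).hasFDerivWithinAt) (mobius_injOn g) F
  rw [mobius_image_ball] at h
  rw [h]
  refine setLIntegral_congr_fun measurableSet_ball fun z hz => ?_
  simp only [abs_det_mobiusR g (hJ z hz)]

theorem integral_ball_mobius (g : SU n) (F : Cn n → ℝ) :
    ∫ w in Ball n, F w = ∫ z in Ball n, ‖autJ g z‖⁻¹ ^ (2 * n + 2) * F (mobius g z) := by
  have hJ : ∀ z ∈ Ball n, autJ g z ≠ 0 := fun z hz =>
    autJ_ne_zero g (mem_ball_zero_iff.1 hz).le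
  have h := integral_image_eq_integral_abs_det_fderiv_smul (volume : Measure (Cn n))
    (s := Ball n) measurableSet_ball
    (fun z hz => (hasFDerivAt_mobius_real g (hJ z hz)).hasFDerivWithinAt) (mobius_injOn g) F
  rw [mobius_image_ball] at h
  rw [h]
  refine setIntegral_congr_fun measurableSet_ball fun z hz => ?_
  simp only [abs_det_mobiusR g (hJ z hz), smul_eq_mul]

/-- The radial weight `2 ε r (1 - r²)^{ε - 1}`, whose mass concentrates at `r = 1` as `ε → 0`. -/
def shellW (ε r : ℝ) : ℝ := 2 * ε * r * (1 - r ^ 2) ^ (ε - 1)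

theorem shellW_nonneg {ε r : ℝ} (hε : 0 < ε) (h0 : 0 < r) (h1 : r < 1) : 0 ≤ shellW ε r := by
  have : 0 ≤ (1 - r ^ 2) := by nlinarith
  unfold shellW
  positivity

theorem hasDerivAt_shell {ε r : ℝ} (h0 : 0 < r) (h1 : r < 1) :
    HasDerivAt (fun r : ℝ => -(1 - r ^ 2) ^ ε) (shellW ε r) r := by
  have h2 : HasDerivAt (fun r : ℝ => 1 - r ^ 2) (-(2 * r)) r := by
    simpa using (hasDerivAt_pow 2 r).const_sub 1
  have h3 : 1 - r ^ 2 ≠ 0 := by nlinarith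
  refine (h2.rpow_const (p := ε) (Or.inl h3)).neg.congr_deriv ?_
  unfold shellW
  ring

theorem continuousOn_shell {ε : ℝ} (hε : 0 < ε) :
    ContinuousOn (fun r : ℝ => -(1 - r ^ 2) ^ ε) (Set.Icc 0 1) :=
  ((continuous_const.sub (continuous_pow 2)).rpow_const fun _ => Or.inr hε.le).neg.continuousOn

theorem integrableOn_shellW {ε : ℝ} (hε : 0 < ε) :
    IntegrableOn (shellW ε) (Set.Ioc 0 1) :=
  intervalIntegral.integrableOn_deriv_of_nonneg (continuousOn_shell hε)
    (fun _ hr => hasDerivAt_shell hr.1 hr.2) fun _ hr => shellW_nonneg hε hr.1 hr.2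

theorem integral_shellW {ε : ℝ} (hε : 0 < ε) : ∫ r in Set.Ioo 0 1, shellW ε r = 1 := by
  rw [← integral_Ioc_eq_integral_Ioo, ← intervalIntegral.integral_of_le zero_le_one,
    intervalIntegral.integral_eq_sub_of_hasDerivAt_of_le zero_le_one (continuousOn_shell hε)
      (fun _ hr => hasDerivAt_shell hr.1 hr.2)
      ((intervalIntegrable_iff_integrableOn_Ioc_of_le zero_le_one).2 (integrableOn_shellW hε))]
  simp [Real.zero_rpow hε.ne']

/-- The weights `shellW ε` form an approximate identity at `r = 1` as `ε → 0`. -/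
theorem tendsto_integral_shellW {g : ℝ → ℝ} (hg : ContinuousOn g (Set.Icc 0 1)) :
    Tendsto (fun ε : ℝ => ∫ r in Set.Ioo 0 1, shellW ε r • g r) (𝓝[>] 0) (𝓝 (g 1)) := by
  have hpos : ∀ᶠ ε : ℝ in 𝓝[>] 0, 0 < ε := eventually_mem_nhdsWithin
  have hlt : ∀ᶠ ε : ℝ in 𝓝[>] 0, ε < 1 :=
    (eventually_lt_nhds one_pos).filter_mono nhdsWithin_le_nhds
  refine tendsto_setIntegral_peak_smul_of_integrableOn_of_tendsto (s := Set.Ioo 0 1)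
    (t := Set.Ioo 0 1) (x₀ := 1) measurableSet_Ioo measurableSet_Ioo subset_rfl
    self_mem_nhdsWithin (by simp) ?_ ?_ ?_ ?_ ?_ ?_
  · filter_upwards [hpos] with ε hε r hr using shellW_nonneg hε hr.1 hr.2
  · intro u hu h1u
    obtain ⟨η, hη, hball⟩ := Metric.isOpen_iff.1 hu 1 h1u
    rw [Metric.tendstoUniformlyOn_iff]
    intro δ hδ
    have hsmall : ∀ᶠ ε : ℝ in 𝓝[>] 0, ε < δ * η / 4 :=
      (eventually_lt_nhds (by positivity)).filter_mono nhdsWithin_le_nhds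
    filter_upwards [hpos, hlt, hsmall] with ε hε hε1 hεs r hr
    obtain ⟨⟨hr0, hr1⟩, hru⟩ := hr
    have hrη : r ≤ 1 - η := by
      by_contra h
      push Not at h
      exact hru (hball (by rw [Metric.mem_ball, Real.dist_eq, abs_lt]; constructor <;> linarith))
    have hx : η ≤ 1 - r ^ 2 := by nlinarith
    have hx1 : 1 - r ^ 2 ≤ 1 := by nlinarith
    have hx0 : 0 < 1 - r ^ 2 := by linarith
    have hpow : (1 - r ^ 2) ^ (ε - 1) ≤ η⁻¹ := by
      calc (1 - r ^ 2) ^ (ε - 1) ≤ (1 - r ^ 2) ^ (-1 : ℝ) :=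
            Real.rpow_le_rpow_of_exponent_ge hx0 hx1 (by linarith)
        _ = (1 - r ^ 2)⁻¹ := Real.rpow_neg_one _
        _ ≤ η⁻¹ := inv_anti₀ hη hx
    rw [Pi.zero_apply, dist_zero_left, Real.norm_of_nonneg (shellW_nonneg hε hr0 hr1)]
    calc shellW ε r ≤ 2 * ε * 1 * η⁻¹ := by unfold shellW; gcongr
      _ < δ := by
        rw [← div_eq_mul_inv, div_lt_iff₀ hη]
        nlinarith [mul_pos hδ hη]
  · refine tendsto_const_nhds.congr' ?_
    filter_upwards [hpos] with ε hε using (integral_shellW hε).symm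
  · filter_upwards [hpos] with ε hε
    exact ((integrableOn_shellW hε).mono_set Set.Ioo_subset_Ioc_self).aestronglyMeasurable
  · exact (hg.integrableOn_Icc).mono_set Set.Ioo_subset_Icc_self
  · exact (hg 1 (by simp)).mono_left (nhdsWithin_mono _ Set.Ioo_subset_Icc_self)

theorem integral_polar_iterated [NeZero n] {E : Type*} [NormedAddCommGroup E] [NormedSpace ℝ E]
    {F : Cn n → E} (hF : Integrable F) :
    ∫ x, F x = ∫ r in Set.Ioi (0 : ℝ), r ^ (2 * n - 1) •
      ∫ ζ : Sph n, F (r • (ζ : Cn n)) ∂(surf n) := by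
  have h1 : ∫ x, F x = ∫ y : Sph n × Set.Ioi (0 : ℝ), F ((y.2 : ℝ) • (y.1 : Cn n))
      ∂((surf n).prod (radMeasure n)) := by
    rw [← (measurePreserving_polar n).integral_comp
      (homeomorphUnitSphereProd (Cn n)).measurableEmbedding]
    simp only [polar_symm]
    rw [integral_subtype_comap (measurableSet_singleton _).compl fun x => F x,
      restrict_compl_singleton]
  have h2 : Integrable (fun y : Sph n × Set.Ioi (0 : ℝ) => F ((y.2 : ℝ) • (y.1 : Cn n)))
      ((surf n).prod (radMeasure n)) := by
    rw [← (measurePreserving_polar n).integrable_comp_emb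
      (homeomorphUnitSphereProd (Cn n)).measurableEmbedding]
    have h3 : Integrable (fun x : ({0}ᶜ : Set (Cn n)) => F x)
        (Measure.comap (Subtype.val) (volume : Measure (Cn n))) := by
      have := (MeasurableEmbedding.subtype_coe
        (measurableSet_singleton (0 : Cn n)).compl).integrableOn_map_iff (f := F)
        (μ := Measure.comap (Subtype.val) (volume : Measure (Cn n))) (s := Set.univ)
      rw [map_comap_subtype_coe (measurableSet_singleton (0 : Cn n)).compl] at this
      have h4 := this.1 (by rw [IntegrableOn, Measure.restrict_univ]; exact hF.integrableOn)
      rw [IntegrableOn, Set.preimage_univ, Measure.restrict_univ] at h4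
      exact h4
    refine h3.congr (Eventually.of_forall fun x => ?_)
    simp only [Function.comp, polar_symm]
  rw [h1, integral_prod_symm _ h2, radMeasure, Measure.volumeIoiPow,
    integral_withDensity_eq_integral_toReal_smul (by fun_prop) (by simp)]
  rw [← integral_subtype_comap measurableSet_Ioi fun r : ℝ =>
    r ^ (2 * n - 1) • ∫ ζ : Sph n, F (r • (ζ : Cn n)) ∂(surf n)]
  refine integral_congr_ae (Eventually.of_forall fun r => ?_)
  have hr : (0 : ℝ) < r := r.2
  simp only
  rw [ENNReal.toReal_ofReal (by positivity)]

end ChangeOfVariables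

/-! ### Change of variables on the sphere -/

section SphereChangeOfVariables

variable {n : ℕ}

theorem norm_smul_sph {r : ℝ} (hr : 0 < r) (ζ : Sph n) : ‖r • (ζ : Cn n)‖ = r := by
  rw [norm_smul, norm_sph, mul_one, Real.norm_of_nonneg hr.le]

/-- Integrability follows from that of `shellW ε` in polar coordinates, as `r^{2n-1} ≤ r` on `[0,
1]`. -/
theorem integrableOn_shell [NeZero n] {ε : ℝ} (hε : 0 < ε) :
    IntegrableOn (fun z : Cn n => (1 - ‖z‖ ^ 2) ^ (ε - 1)) (Ball n) := by
  rw [← integrable_indicator_iff measurableSet_ball]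
  have hm : Measurable ((Ball n).indicator fun z : Cn n => (1 - ‖z‖ ^ 2) ^ (ε - 1)) :=
    Measurable.indicator (by fun_prop) measurableSet_ball
  refine ⟨hm.aestronglyMeasurable, ?_⟩
  rw [HasFiniteIntegral, lintegral_polar _ hm.enorm]
  have hbound : ∀ r ∈ Set.Ioi (0 : ℝ), ENNReal.ofReal (r ^ (2 * n - 1)) *
      ∫⁻ ζ : Sph n, ‖(Ball n).indicator (fun z : Cn n => (1 - ‖z‖ ^ 2) ^ (ε - 1)) (r • (ζ : Cn n))‖ₑ
        ∂(surf n) ≤ (Set.Ioc 0 1).indicator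
          (fun r => ‖shellW ε r‖ₑ * (ENNReal.ofReal (2 * ε)⁻¹ * surf n Set.univ)) r := by
    intro r hr
    have hr0 : 0 < r := hr
    rcases lt_or_ge r 1 with h1 | h1
    · have h2 : ∀ ζ : Sph n, (Ball n).indicator (fun z : Cn n => (1 - ‖z‖ ^ 2) ^ (ε - 1))
          (r • (ζ : Cn n)) = (1 - r ^ 2) ^ (ε - 1) := by
        intro ζ
        rw [Set.indicator_of_mem (by rw [mem_ball_zero_iff, norm_smul_sph hr0]; exact h1),
          norm_smul_sph hr0]
      have h3 : 0 ≤ 1 - r ^ 2 := by nlinarith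
      simp only [h2, lintegral_const]
      rw [Set.indicator_of_mem (by exact ⟨hr0, h1.le⟩), ← mul_assoc, ← mul_assoc]
      refine mul_le_mul' ?_ le_rfl
      rw [Real.enorm_of_nonneg (by positivity), Real.enorm_of_nonneg (shellW_nonneg hε hr0 h1),
        ← ENNReal.ofReal_mul (by positivity), ← ENNReal.ofReal_mul (shellW_nonneg hε hr0 h1)]
      apply ENNReal.ofReal_le_ofReal
      have h4 : shellW ε r * (2 * ε)⁻¹ = r * (1 - r ^ 2) ^ (ε - 1) := by
        unfold shellW; field_simp
      rw [h4]
      gcongr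
      have := NeZero.one_le (n := n)
      exact pow_le_of_le_one hr0.le h1.le (by omega)
    · have h2 : ∀ ζ : Sph n, (Ball n).indicator (fun z : Cn n => (1 - ‖z‖ ^ 2) ^ (ε - 1))
          (r • (ζ : Cn n)) = 0 := by
        intro ζ
        rw [Set.indicator_of_notMem
          (by rw [mem_ball_zero_iff, norm_smul_sph hr0]; exact not_lt.2 h1)]
      simp [h2]
  refine (setLIntegral_mono' measurableSet_Ioi hbound).trans_lt ?_
  refine (setLIntegral_le_lintegral _ _).trans_lt ?_
  rw [lintegral_indicator measurableSet_Ioc, lintegral_mul_const' _ _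
    (ENNReal.mul_ne_top ENNReal.ofReal_ne_top (measure_ne_top _ _))]
  exact ENNReal.mul_lt_top (integrableOn_shellW hε).2
    (ENNReal.mul_lt_top ENNReal.ofReal_lt_top (measure_lt_top _ _))

theorem smul_sph_mem_closedBall {r : ℝ} (h0 : 0 ≤ r) (h1 : r ≤ 1) (ζ : Sph n) :
    r • (ζ : Cn n) ∈ Metric.closedBall (0 : Cn n) 1 := by
  rw [mem_closedBall_zero_iff, norm_smul, norm_sph, mul_one, Real.norm_of_nonneg h0]
  exact h1

theorem continuousOn_sphere_mean {E : Type*} [NormedAddCommGroup E] [NormedSpace ℝ E]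
    {F : Cn n → E} (hF : ContinuousOn F (Metric.closedBall 0 1)) :
    ContinuousOn (fun r : ℝ => ∫ ζ : Sph n, F (r • (ζ : Cn n)) ∂(surf n)) (Set.Icc 0 1) := by
  obtain ⟨C, hC⟩ := (isCompact_closedBall (0 : Cn n) 1).exists_bound_of_continuousOn hF
  have hc : ∀ r ∈ Set.Icc (0 : ℝ) 1, Continuous fun ζ : Sph n => F (r • (ζ : Cn n)) := fun r hr =>
    hF.comp_continuous (by fun_prop) fun ζ => smul_sph_mem_closedBall hr.1 hr.2 ζ
  intro r₀ hr₀
  refine continuousWithinAt_of_dominated (bound := fun _ => C) ?_ ?_ (integrable_const _) ?_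
  · filter_upwards [self_mem_nhdsWithin] with r hr
    exact (hc r hr).aestronglyMeasurable
  · filter_upwards [self_mem_nhdsWithin] with r hr
    exact Eventually.of_forall fun ζ => hC _ (smul_sph_mem_closedBall hr.1 hr.2 ζ)
  · refine Eventually.of_forall fun ζ => ?_
    exact (hF _ (smul_sph_mem_closedBall hr₀.1 hr₀.2 ζ)).comp (f := fun r : ℝ => r • (ζ : Cn n))
      (by fun_prop) fun r hr => smul_sph_mem_closedBall hr.1 hr.2 ζ

theorem integrableOn_mul_shell [NeZero n] {F : Cn n → ℝ}
    (hF : ContinuousOn F (Metric.closedBall 0 1)) {ε : ℝ} (hε : 0 < ε) :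
    IntegrableOn (fun z : Cn n => F z * (1 - ‖z‖ ^ 2) ^ (ε - 1)) (Ball n) := by
  obtain ⟨C, hC⟩ := (isCompact_closedBall (0 : Cn n) 1).exists_bound_of_continuousOn hF
  refine Integrable.bdd_mul (c := C) (integrableOn_shell hε)
    ((hF.mono Metric.ball_subset_closedBall).aestronglyMeasurable measurableSet_ball) ?_
  exact (ae_restrict_iff' measurableSet_ball).2 (Eventually.of_forall fun z hz =>
    hC z (Metric.ball_subset_closedBall hz))

/-- The sphere measure is the limit as `ε → 0` of the measures `2 ε (1 - |z|²)^{ε - 1} dV`. -/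
theorem tendsto_integral_shell [NeZero n] {F : Cn n → ℝ}
    (hF : ContinuousOn F (Metric.closedBall 0 1)) :
    Tendsto (fun ε : ℝ => 2 * ε * ∫ z in Ball n, F z * (1 - ‖z‖ ^ 2) ^ (ε - 1)) (𝓝[>] 0)
      (𝓝 (∫ ζ : Sph n, F ζ ∂(surf n))) := by
  have hg : ContinuousOn (fun r : ℝ => r ^ (2 * n - 2) *
      ∫ ζ : Sph n, F (r • (ζ : Cn n)) ∂(surf n)) (Set.Icc 0 1) :=
    (continuous_pow _).continuousOn.mul (continuousOn_sphere_mean hF)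
  have h := tendsto_integral_shellW hg
  simp only [one_pow, one_mul, one_smul] at h
  refine h.congr' ?_
  filter_upwards [self_mem_nhdsWithin] with ε hε
  have hε : 0 < ε := hε
  have h1 := integral_polar_iterated
    ((integrable_indicator_iff measurableSet_ball).2 (integrableOn_mul_shell hF hε))
  simp only [smul_eq_mul] at h1
  rw [integral_indicator measurableSet_ball] at h1
  rw [h1, ← integral_const_mul]
  have h2 : ∀ r ∈ Set.Ioi (0 : ℝ), 2 * ε * (r ^ (2 * n - 1) * ∫ ζ : Sph n, (Ball n).indicator
      (fun z : Cn n => F z * (1 - ‖z‖ ^ 2) ^ (ε - 1)) (r • (ζ : Cn n)) ∂(surf n)) =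
      (Set.Ioo 0 1).indicator (fun r => shellW ε r • (r ^ (2 * n - 2) *
        ∫ ζ : Sph n, F (r • (ζ : Cn n)) ∂(surf n))) r := by
    intro r hr
    have hr0 : 0 < r := hr
    rcases lt_or_ge r 1 with h1 | h1
    · have h2 : ∀ ζ : Sph n, (Ball n).indicator (fun z : Cn n => F z * (1 - ‖z‖ ^ 2) ^ (ε - 1))
          (r • (ζ : Cn n)) = F (r • (ζ : Cn n)) * (1 - r ^ 2) ^ (ε - 1) := by
        intro ζ
        rw [Set.indicator_of_mem (by rw [mem_ball_zero_iff, norm_smul_sph hr0]; exact h1),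
          norm_smul_sph hr0]
      simp only [h2]
      rw [Set.indicator_of_mem (by exact ⟨hr0, h1⟩), integral_mul_const, smul_eq_mul]
      have h3 : r ^ (2 * n - 1) = r ^ (2 * n - 2) * r := by
        rw [← pow_succ]
        have := NeZero.one_le (n := n)
        congr 1
        omega
      rw [h3]
      unfold shellW
      ring
    · have h2 : ∀ ζ : Sph n, (Ball n).indicator (fun z : Cn n => F z * (1 - ‖z‖ ^ 2) ^ (ε - 1))
          (r • (ζ : Cn n)) = 0 := by
        intro ζ
        rw [Set.indicator_of_notMem
          (by rw [mem_ball_zero_iff, norm_smul_sph hr0]; exact not_lt.2 h1)]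
      rw [Set.indicator_of_notMem (by rintro ⟨_, h⟩; linarith)]
      simp [h2]
  rw [setIntegral_congr_fun measurableSet_Ioi h2, setIntegral_indicator measurableSet_Ioo]
  rw [Set.inter_eq_right.2 Set.Ioo_subset_Ioi_self]

theorem continuousOn_mobius (g : SU n) : ContinuousOn (mobius g) (Metric.closedBall 0 1) :=
  fun _ hz => ((contDiffAt_mobius g (k := 0) (autJ_ne_zero g
    (mem_closedBall_zero_iff.1 hz))).continuousAt).continuousWithinAt

theorem mobius_mem_closedBall (g : SU n) {z : Cn n} (hz : z ∈ Metric.closedBall (0 : Cn n) 1) :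
    mobius g z ∈ Metric.closedBall (0 : Cn n) 1 := by
  rw [mem_closedBall_zero_iff] at hz ⊢
  exact norm_mobius_le g hz

theorem continuousOn_inv_norm_autJ (g : SU n) :
    ContinuousOn (fun z => ‖autJ g z‖⁻¹) (Metric.closedBall 0 1) :=
  (continuous_autJ g).norm.continuousOn.inv₀ fun _ hz =>
    norm_ne_zero_iff.2 (autJ_ne_zero g (mem_closedBall_zero_iff.1 hz))

/-- One half of the change of variables on the sphere; the other half is this one for `g⁻¹`. -/
theorem integral_sphMobius_le [NeZero n] (g : SU n) {F : Cn n → ℝ}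
    (hF : ContinuousOn F (Metric.closedBall 0 1)) (h0 : ∀ z, 0 ≤ F z) :
    ∫ ζ : Sph n, F ζ ∂(surf n) ≤
      ∫ ζ : Sph n, ‖autJ g (ζ : Cn n)‖⁻¹ ^ (2 * n) * F (mobius g ζ) ∂(surf n) := by
  obtain ⟨M, hM⟩ := (isCompact_closedBall (0 : Cn n) 1).exists_bound_of_continuousOn
    (continuousOn_inv_norm_autJ g)
  -- the weight `(1 - |z|²)^{ε-1} dV` is transformed with the Jacobian `|J|^{-2n-2ε}`, and the
  -- factor `|J|^{-2ε} ≤ M'^{2ε}` tends to one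
  set M' := max M 1
  have hG : ContinuousOn (fun z : Cn n => ‖autJ g z‖⁻¹ ^ (2 * n) * F (mobius g z))
      (Metric.closedBall 0 1) :=
    ((continuousOn_inv_norm_autJ g).pow _).mul
      (hF.comp (continuousOn_mobius g) fun _ hz => mobius_mem_closedBall g hz)
  have hlim : Tendsto (fun ε : ℝ => (M' ^ 2) ^ ε) (𝓝[>] 0) (𝓝 1) := by
    have : Continuous fun ε : ℝ => (M' ^ 2) ^ ε :=
      Real.continuous_const_rpow (by positivity)
    simpa using (this.tendsto 0).mono_left nhdsWithin_le_nhds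
  have h1 := hlim.mul (tendsto_integral_shell hG)
  rw [one_mul] at h1
  refine le_of_tendsto_of_tendsto (tendsto_integral_shell hF) h1 ?_
  filter_upwards [self_mem_nhdsWithin] with ε hε
  have hε : 0 < ε := hε
  rw [mul_left_comm]
  refine mul_le_mul_of_nonneg_left ?_ (by positivity)
  rw [integral_ball_mobius g, ← integral_const_mul]
  refine integral_mono_of_nonneg ?_ ((integrableOn_mul_shell hG hε).const_mul _) ?_
  · refine (ae_restrict_iff' measurableSet_ball).2 (Eventually.of_forall fun z hz => ?_)
    have := norm_mobius_lt g (mem_ball_zero_iff.1 hz)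
    have h2 : 0 ≤ 1 - ‖mobius g z‖ ^ 2 := by nlinarith [norm_nonneg (mobius g z)]
    have h3 := h0 (mobius g z)
    simp only [Pi.zero_apply]
    positivity
  · refine (ae_restrict_iff' measurableSet_ball).2 (Eventually.of_forall fun z hz => ?_)
    have hz1 := mem_ball_zero_iff.1 hz
    have hJ := norm_pos_iff.2 (autJ_ne_zero g hz1.le)
    have hz2 : 0 < 1 - ‖z‖ ^ 2 := by nlinarith [norm_nonneg z]
    simp only
    rw [one_sub_norm_mobius g hz1.le, Real.mul_rpow (by positivity) hz2.le]
    have h4 : ‖autJ g z‖⁻¹ ^ (2 * n + 2) * (‖autJ g z‖⁻¹ ^ 2) ^ (ε - 1) =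
        ‖autJ g z‖⁻¹ ^ (2 * n) * (‖autJ g z‖⁻¹ ^ 2) ^ ε := by
      rw [Real.rpow_sub_one (by positivity), pow_add]
      field_simp
    have h5 : (‖autJ g z‖⁻¹ ^ 2) ^ ε ≤ (M' ^ 2) ^ ε := by
      have h6 := hM z (Metric.ball_subset_closedBall hz)
      rw [Real.norm_of_nonneg (by positivity)] at h6
      gcongr
      exact h6.trans (le_max_left _ _)
    have h3 := h0 (mobius g z)
    calc _ = (‖autJ g z‖⁻¹ ^ (2 * n + 2) * (‖autJ g z‖⁻¹ ^ 2) ^ (ε - 1)) *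
          (F (mobius g z) * (1 - ‖z‖ ^ 2) ^ (ε - 1)) := by ring
      _ = (‖autJ g z‖⁻¹ ^ 2) ^ ε * (‖autJ g z‖⁻¹ ^ (2 * n) * F (mobius g z) *
          (1 - ‖z‖ ^ 2) ^ (ε - 1)) := by rw [h4]; ring
      _ ≤ _ := by gcongr

theorem integral_sphMobius_of_nonneg [NeZero n] (g : SU n) {F : Cn n → ℝ}
    (hF : ContinuousOn F (Metric.closedBall 0 1)) (h0 : ∀ z, 0 ≤ F z) :
    ∫ ζ : Sph n, ‖autJ g (ζ : Cn n)‖⁻¹ ^ (2 * n) * F (mobius g ζ) ∂(surf n) =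
      ∫ ζ : Sph n, F ζ ∂(surf n) := by
  refine le_antisymm ?_ (integral_sphMobius_le g hF h0)
  have hG : ContinuousOn (fun z : Cn n => ‖autJ g z‖⁻¹ ^ (2 * n) * F (mobius g z))
      (Metric.closedBall 0 1) :=
    ((continuousOn_inv_norm_autJ g).pow _).mul
      (hF.comp (continuousOn_mobius g) fun _ hz => mobius_mem_closedBall g hz)
  refine (integral_sphMobius_le g⁻¹ hG fun z => by have := h0 (mobius g z); positivity).trans_eq ?_
  refine integral_congr_ae (Eventually.of_forall fun ζ => ?_)
  have h1 := autJ_mobius_inv g (norm_sph ζ).le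
  simp only
  rw [mobius_mobius_inv g (norm_sph ζ).le, ← mul_assoc, ← mul_pow, ← mul_inv, ← norm_mul, mul_comm,
    mul_comm (autJ g⁻¹ _), h1]
  simp

/-- The measure `|J(g, η)|^{-2n} dS(η)`. -/
def sphJac (g : SU n) : Measure (Sph n) :=
  (surf n).withDensity fun η => ENNReal.ofReal (‖autJ g (η : Cn n)‖⁻¹ ^ (2 * n))

theorem continuous_sphMobius (g : SU n) : Continuous (sphMobius g) :=
  Continuous.subtype_mk ((continuousOn_mobius g).comp_continuous continuous_subtype_val fun ζ => by
    rw [mem_closedBall_zero_iff]; exact (norm_sph ζ).le) _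

theorem continuous_inv_norm_autJ_sph (g : SU n) :
    Continuous fun η : Sph n => ‖autJ g (η : Cn n)‖⁻¹ :=
  (continuousOn_inv_norm_autJ g).comp_continuous continuous_subtype_val fun ζ => by
    rw [mem_closedBall_zero_iff]; exact (norm_sph ζ).le

theorem measurable_sphJac (g : SU n) :
    Measurable fun η : Sph n => ENNReal.ofReal (‖autJ g (η : Cn n)‖⁻¹ ^ (2 * n)) :=
  ((continuous_inv_norm_autJ_sph g).pow _).measurable.ennreal_ofReal

instance (g : SU n) : IsFiniteMeasure (sphJac g) := by
  refine isFiniteMeasure_withDensity_ofReal ?_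
  exact (((continuous_inv_norm_autJ_sph g).pow _).integrable_of_hasCompactSupport
    (HasCompactSupport.of_compactSpace _)).2

/-- The change of variables `dS(g.η) = |J(g, η)|^{-2n} dS(η)` on the sphere. -/
theorem measurePreserving_sphMobius [NeZero n] (g : SU n) :
    MeasurePreserving (sphMobius g) (sphJac g) (surf n) := by
  refine ⟨(continuous_sphMobius g).measurable, ?_⟩
  refine ext_of_forall_integral_eq_of_IsFiniteMeasure fun f => ?_
  rw [integral_map (continuous_sphMobius g).aemeasurable f.continuous.aestronglyMeasurable, sphJac,
    integral_withDensity_eq_integral_toReal_smul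
      (measurable_sphJac g) (by simp)]
  -- nonnegative continuous functions on the sphere are extended continuously to the closed ball
  have key : ∀ f : C(Sph n, ℝ), (∀ ζ, 0 ≤ f ζ) →
      ∫ ζ : Sph n, ‖autJ g (ζ : Cn n)‖⁻¹ ^ (2 * n) * f (sphMobius g ζ) ∂(surf n) =
        ∫ ζ, f ζ ∂(surf n) := by
    intro f hf
    obtain ⟨F, hF⟩ := ContinuousMap.exists_extension
      (Metric.isClosed_sphere (x := (0 : Cn n)) (ε := 1)).isClosedEmbedding_subtypeVal f
    have hFf : ∀ ζ : Sph n, F ζ = f ζ := fun ζ => congrArg (fun k : C(Sph n, ℝ) => k ζ) hF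
    have h := integral_sphMobius_of_nonneg g (F := fun z => |F z|)
      (by fun_prop) fun z => abs_nonneg _
    have h1 : ∀ ζ : Sph n, |F ζ| = f ζ := fun ζ => by rw [hFf, abs_of_nonneg (hf ζ)]
    simp only [h1] at h
    rw [← h]
    refine integral_congr_ae (Eventually.of_forall fun ζ => ?_)
    simp only
    rw [← h1]
    rfl
  have hi : ∀ f : C(Sph n, ℝ), Integrable f (surf n) := fun f =>
    f.continuous.integrable_of_hasCompactSupport (HasCompactSupport.of_compactSpace _)
  have hi2 : ∀ f : C(Sph n, ℝ), Integrable
      (fun ζ : Sph n => ‖autJ g (ζ : Cn n)‖⁻¹ ^ (2 * n) * f (sphMobius g ζ)) (surf n) := fun f =>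
    (((continuous_inv_norm_autJ_sph g).pow _).mul (f.continuous.comp
      (continuous_sphMobius g))).integrable_of_hasCompactSupport
        (HasCompactSupport.of_compactSpace _)
  -- a general function is a difference of nonnegative ones, `f = (f + ‖f‖) - ‖f‖`
  let C : ℝ := ‖f‖
  have hC : ∀ ζ, 0 ≤ f ζ + C := fun ζ => by
    have := f.norm_coe_le_norm ζ
    rw [Real.norm_eq_abs] at this
    linarith [neg_abs_le (f ζ)]
  let f1 : C(Sph n, ℝ) := ⟨fun ζ => f ζ + C, by fun_prop⟩
  let f2 : C(Sph n, ℝ) := ⟨fun _ => C, by fun_prop⟩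
  have e1 := key f1 hC
  have e2 := key f2 fun _ => norm_nonneg f
  have e3 := integral_sub (hi f1) (hi f2)
  have e4 := integral_sub (hi2 f1) (hi2 f2)
  rw [e1, e2, ← e3] at e4
  have e5 : ∀ ζ, f1 ζ - f2 ζ = f ζ := fun ζ => by simp [f1, f2]
  simp only [← mul_sub, e5] at e4
  rw [← e4]
  refine integral_congr_ae (Eventually.of_forall fun ζ => ?_)
  simp only [smul_eq_mul]
  rw [ENNReal.toReal_ofReal (by positivity)]

/-- The change of variables on the sphere for arbitrary complex functions; both integrals are zero
if one of them does not exist. -/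
theorem integral_sphMobius [NeZero n] (g : SU n) (f : Sph n → ℂ) :
    ∫ ζ : Sph n, ((‖autJ g (ζ : Cn n)‖⁻¹ ^ (2 * n) : ℝ) : ℂ) * f (sphMobius g ζ) ∂(surf n) =
      ∫ ζ, f ζ ∂(surf n) := by
  have hme : MeasurableEmbedding (sphMobius g) := by
    refine ((continuous_sphMobius g).isClosedEmbedding fun ζ η h => ?_).measurableEmbedding
    have h1 := congrArg (fun ξ : Sph n => mobius g⁻¹ (ξ : Cn n)) h
    simp only [sphMobius, mobius_inv_mobius g (norm_sph _).le] at h1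
    exact Subtype.ext h1
  rw [← (measurePreserving_sphMobius g).integral_comp hme f, sphJac,
    integral_withDensity_eq_integral_toReal_smul
      (measurable_sphJac g) (by simp)]
  refine integral_congr_ae (Eventually.of_forall fun ζ => ?_)
  simp only
  rw [ENNReal.toReal_ofReal (by positivity), Complex.real_smul]

end SphereChangeOfVariables

/-! ### Weighted composition operators -/

section WeightedComposition

variable {X : Type*} [MeasurableSpace X] {μ : Measure X}

theorem absolutelyContinuous_of_measurePreserving {T : X → X} {j : X → ENNReal} (hj : Measurable j)
    (hj0 : ∀ᵐ x ∂μ, j x ≠ 0) (hT : MeasurePreserving T (μ.withDensity j) μ) :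
    Measure.QuasiMeasurePreserving T μ μ :=
  ⟨hT.measurable, ((withDensity_absolutelyContinuous' hj.aemeasurable hj0).map hT.measurable).trans
    hT.map_eq.absolutelyContinuous⟩

/-- If `j` is the Jacobian of `T` and `|w|² ≤ C j`, then `f ↦ w · (f ∘ T)` is bounded on `L²`. -/
theorem eLpNorm_weightedComp_le {T : X → X} {j : X → ENNReal} {w : X → ℂ} {C : ENNReal}
    (hj : Measurable j) (hT : MeasurePreserving T (μ.withDensity j) μ)
    (hle : ∀ᵐ x ∂μ, ‖w x‖ₑ ^ 2 ≤ C * j x) (hC : C ≠ ⊤) {f : X → ℂ} (hf : StronglyMeasurable f) :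
    eLpNorm (fun x => w x * f (T x)) 2 μ ≤ C ^ (1 / 2 : ℝ) * eLpNorm f 2 μ := by
  rw [eLpNorm_eq_lintegral_rpow_enorm_toReal (by simp) (by simp),
    eLpNorm_eq_lintegral_rpow_enorm_toReal (by simp) (by simp)]
  simp only [ENNReal.toReal_ofNat, ENNReal.rpow_ofNat]
  rw [← ENNReal.mul_rpow_of_nonneg _ _ (by norm_num)]
  refine ENNReal.rpow_le_rpow ?_ (by norm_num)
  have hm : Measurable fun x => ‖f x‖ₑ ^ 2 := hf.measurable.enorm.pow_const 2
  rw [← hT.lintegral_comp hm, lintegral_withDensity_eq_lintegral_mul _ hj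
      (g := fun x => ‖f (T x)‖ₑ ^ 2) (hm.comp hT.measurable),
    ← lintegral_const_mul' _ _ hC]
  refine lintegral_mono_ae (hle.mono fun x hx => ?_)
  simp only [Pi.mul_apply]
  rw [enorm_mul, mul_pow, ← mul_assoc]
  gcongr

/-- The weighted composition operator `F ↦ w · (F ∘ T)` on `L²`. It is well defined on classes
because the Jacobian `j` does not vanish, so that preimages of null sets under `T` are null sets. -/
theorem exists_weightedComp {T : X → X} {j : X → ENNReal} {w : X → ℂ} {C : ENNReal}
    (hj : Measurable j) (hj0 : ∀ᵐ x ∂μ, j x ≠ 0) (hT : MeasurePreserving T (μ.withDensity j) μ)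
    (hw : AEStronglyMeasurable w μ) (hle : ∀ᵐ x ∂μ, ‖w x‖ₑ ^ 2 ≤ C * j x) (hC : C ≠ ⊤) :
    ∃ W : Lp ℂ 2 μ →L[ℂ] Lp ℂ 2 μ, ∀ F, W F =ᵐ[μ] fun x => w x * F (T x) := by
  have hq := absolutelyContinuous_of_measurePreserving hj hj0 hT
  have hmem : ∀ F : Lp ℂ 2 μ, MemLp (fun x => w x * F (T x)) 2 μ := fun F =>
    ⟨hw.mul ((Lp.aestronglyMeasurable F).comp_quasiMeasurePreserving hq),
      (eLpNorm_weightedComp_le hj hT hle hC (Lp.stronglyMeasurable F)).trans_lt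
        (ENNReal.mul_lt_top (ENNReal.rpow_lt_top_of_nonneg (by norm_num) hC) (Lp.memLp F).2)⟩
  let L : Lp ℂ 2 μ →ₗ[ℂ] Lp ℂ 2 μ :=
    { toFun := fun F => (hmem F).toLp _
      map_add' := fun F G => by
        refine Lp.ext ?_
        have h1 := hq.ae (Lp.coeFn_add F G)
        filter_upwards [(hmem (F + G)).coeFn_toLp, (hmem F).coeFn_toLp, (hmem G).coeFn_toLp,
          Lp.coeFn_add ((hmem F).toLp _) ((hmem G).toLp _), h1] with x a b c d e
        rw [a, d, Pi.add_apply, b, c, e, Pi.add_apply, mul_add]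
      map_smul' := fun k F => by
        refine Lp.ext ?_
        have h1 := hq.ae (Lp.coeFn_smul k F)
        filter_upwards [(hmem (k • F)).coeFn_toLp, (hmem F).coeFn_toLp,
          Lp.coeFn_smul k ((hmem F).toLp _), h1] with x a b d e
        rw [a, RingHom.id_apply, d, Pi.smul_apply, b, e, Pi.smul_apply, smul_eq_mul, smul_eq_mul]
        ring }
  refine ⟨L.mkContinuous (C ^ (1 / 2 : ℝ)).toReal fun F => ?_, fun F => (hmem F).coeFn_toLp⟩
  change ‖(hmem F).toLp _‖ ≤ _
  rw [Lp.norm_toLp, Lp.norm_def, ← ENNReal.toReal_mul]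
  exact ENNReal.toReal_mono (ENNReal.mul_lt_top (ENNReal.rpow_lt_top_of_nonneg (by norm_num) hC)
    (Lp.memLp F).2).ne (eLpNorm_weightedComp_le hj hT hle hC (Lp.stronglyMeasurable F))

/-- A cocycle `w` over an action by quasi-measure-preserving maps `T`, with `|w|²` bounded by the
Jacobians, gives a representation by weighted composition operators. -/
theorem exists_weightedRep {G : Type*} [Group G] {T : G → X → X} {w : G → X → ℂ}
    {j : G → X → ENNReal} {C : G → ENNReal} (hj : ∀ g, Measurable (j g))
    (hj0 : ∀ g, ∀ᵐ x ∂μ, j g x ≠ 0) (hT : ∀ g, MeasurePreserving (T g) (μ.withDensity (j g)) μ)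
    (hw : ∀ g, AEStronglyMeasurable (w g) μ) (hle : ∀ g, ∀ᵐ x ∂μ, ‖w g x‖ₑ ^ 2 ≤ C g * j g x)
    (hC : ∀ g, C g ≠ ⊤) (hT1 : ∀ᵐ x ∂μ, T 1 x = x) (hw1 : ∀ᵐ x ∂μ, w 1 x = 1)
    (hTm : ∀ g h, ∀ᵐ x ∂μ, T (g * h) x = T h (T g x))
    (hwm : ∀ g h, ∀ᵐ x ∂μ, w (g * h) x = w g x * w h (T g x)) :
    ∃ π : G →* (Lp ℂ 2 μ →L[ℂ] Lp ℂ 2 μ), ∀ g F, π g F =ᵐ[μ] fun x => w g x * F (T g x) := by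
  choose W hW using fun g => exists_weightedComp (hj g) (hj0 g) (hT g) (hw g) (hle g) (hC g)
  refine ⟨⟨⟨W, ?_⟩, ?_⟩, hW⟩
  · ext1 F
    refine Lp.ext ?_
    filter_upwards [hW 1 F, hT1, hw1] with x a b c
    rw [a, b, c, one_mul, one_apply_eq_self]
  · intro g h
    ext1 F
    refine Lp.ext ?_
    have hq := absolutelyContinuous_of_measurePreserving (hj g) (hj0 g) (hT g)
    filter_upwards [hW (g * h) F, hTm g h, hwm g h, hW g (W h F), hq.ae (hW h F)] with x a b c d e
    change (W (g * h) F : X → ℂ) x = (W g (W h F) : X → ℂ) x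
    rw [a, b, c, d, e, mul_assoc]

end WeightedComposition

section Representations

variable {n l : ℕ}

theorem measurable_mobius (g : SU n) : Measurable (mobius g) := by
  refine (WithLp.measurable_toLp 2 (Fin n → ℂ)).comp (measurable_pi_lambda _ fun i => ?_)
  have : ∀ z : Cn n, ((∑ j, entry g (Sum.inl i) (Sum.inl j) * z j) +
      entry g (Sum.inl i) (Sum.inr ())) / autJ g z =
      (rowA g i z + entry g (Sum.inl i) (Sum.inr ())) / autJ g z := fun z => by
    rw [← numer_eq]; rfl
  simp only [this]
  exact ((rowA g i).continuous.measurable.add_const _).div (continuous_autJ g).measurable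

theorem ae_muBall {p : Cn n → Prop} (h : ∀ z ∈ Ball n, p z) : ∀ᵐ z ∂(muBall n l), p z := by
  refine Measure.ae_smul_measure ?_ _
  refine (withDensity_absolutelyContinuous _ _).ae_le ?_
  exact (ae_restrict_iff' measurableSet_ball).2 (Eventually.of_forall h)

/-- The Jacobian of a Möbius transform for `μ_l`. -/
def ballJac (l : ℕ) (g : SU n) (z : Cn n) : ENNReal := ENNReal.ofReal (‖autJ g z‖⁻¹ ^ (2 * l + 2))

theorem measurable_ballJac (g : SU n) : Measurable (ballJac l g) :=
  ((continuous_autJ g).norm.measurable.inv.pow_const _).ennreal_ofReal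

theorem lintegral_ballWeight (F : Cn n → ENNReal) (hF : Measurable F) :
    ∫⁻ z, F z ∂(ballWeight n l) =
      ∫⁻ z in Ball n, ENNReal.ofReal ((1 - ‖z‖ ^ 2) ^ (l - n)) * F z := by
  rw [ballWeight, lintegral_withDensity_eq_lintegral_mul _ (by fun_prop) hF]
  rfl

theorem measurePreserving_mobius (hl : n ≤ l) (g : SU n) :
    MeasurePreserving (mobius g) ((muBall n l).withDensity (ballJac l g)) (muBall n l) := by
  refine ⟨measurable_mobius g, Measure.ext_of_lintegral _ fun F hF => ?_⟩
  rw [lintegral_map hF (measurable_mobius g),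
    lintegral_withDensity_eq_lintegral_mul _ (measurable_ballJac g)
      (g := fun z => F (mobius g z)) (hF.comp (measurable_mobius g)), muBall,
        lintegral_smul_measure, lintegral_smul_measure]
  congr 1
  rw [lintegral_ballWeight (ballJac l g * fun z => F (mobius g z))
      ((measurable_ballJac g).mul (hF.comp (measurable_mobius g))),
    lintegral_ballWeight _ hF,
    lintegral_ball_mobius g fun z => ENNReal.ofReal ((1 - ‖z‖ ^ 2) ^ (l - n)) * F z]
  refine setLIntegral_congr_fun measurableSet_ball fun z hz => ?_
  have hz1 := mem_ball_zero_iff.1 hz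
  have h1 : 0 ≤ 1 - ‖z‖ ^ 2 := by nlinarith [norm_nonneg z]
  simp only [Pi.mul_apply, ballJac]
  rw [← mul_assoc, ← mul_assoc, ← ENNReal.ofReal_mul (by positivity),
    ← ENNReal.ofReal_mul (by positivity), one_sub_norm_mobius g hz1.le, mul_pow, ← mul_assoc,
    ← pow_mul, ← pow_add]
  have h2 : 2 * n + 2 + 2 * (l - n) = 2 * l + 2 := by omega
  rw [h2, mul_comm (_ ^ (l - n))]

/-- The cocycles `J^m` and the Jacobians are bounded above and below, since `J` has no zeros on the
compact closed ball. -/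
theorem exists_bound_autJ_zpow (g : SU n) (m : ℤ) (k : ℕ) : ∃ C : ENNReal, C ≠ ⊤ ∧
    ∀ z ∈ Metric.closedBall (0 : Cn n) 1,
      ‖autJ g z ^ m‖ₑ ^ 2 ≤ C * ENNReal.ofReal (‖autJ g z‖⁻¹ ^ k) := by
  have hne : ∀ z ∈ Metric.closedBall (0 : Cn n) 1, autJ g z ≠ 0 := fun z hz =>
    autJ_ne_zero g (mem_closedBall_zero_iff.1 hz)
  have hc : ContinuousOn (fun z => ‖autJ g z ^ m‖ ^ 2 * ‖autJ g z‖ ^ k)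
      (Metric.closedBall (0 : Cn n) 1) :=
    (((continuous_autJ g).continuousOn.zpow₀ m fun z hz => Or.inl (hne z hz)).norm.pow 2).mul
      ((continuous_autJ g).norm.pow k).continuousOn
  obtain ⟨C, hC⟩ := (isCompact_closedBall (0 : Cn n) 1).exists_bound_of_continuousOn hc
  refine ⟨ENNReal.ofReal C, ENNReal.ofReal_ne_top, fun z hz => ?_⟩
  have h1 := hC z hz
  have h2 := norm_pos_iff.2 (hne z hz)
  rw [Real.norm_of_nonneg (by positivity)] at h1
  rw [← ENNReal.ofReal_mul ((by positivity : (0 : ℝ) ≤ _).trans h1), ← ofReal_norm,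
    ← ENNReal.ofReal_pow (norm_nonneg _)]
  apply ENNReal.ofReal_le_ofReal
  rw [inv_pow, ← div_eq_mul_inv, le_div_iff₀ (by positivity)]
  exact h1

theorem exists_ballRep (hl : n ≤ l) (m : ℤ) :
    ∃ π : SU n →* (L2B n l →L[ℂ] L2B n l), IsBallRep m π := by
  choose C hC hle using fun g : SU n => exists_bound_autJ_zpow g⁻¹ (-m) (2 * l + 2)
  refine exists_weightedRep (T := fun g => mobius g⁻¹) (w := fun g z => autJ g⁻¹ z ^ (-m))
    (j := fun g => ballJac l g⁻¹) (C := C) (fun g => measurable_ballJac _) ?_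
    (fun g => measurePreserving_mobius hl _) (fun g => ?_) ?_ hC ?_ ?_ ?_ ?_
  · refine fun g => ae_muBall fun z hz => ?_
    have := norm_pos_iff.2 (autJ_ne_zero g⁻¹ (mem_ball_zero_iff.1 hz).le)
    simp only [ballJac, ne_eq, ENNReal.ofReal_eq_zero, not_le]
    positivity
  · exact ((continuous_autJ g⁻¹).measurable.pow_const _).aestronglyMeasurable
  · exact fun g => ae_muBall fun z hz => hle g z (Metric.ball_subset_closedBall hz)
  · exact Eventually.of_forall fun z => by rw [inv_one, mobius_one]
  · exact Eventually.of_forall fun z => by simp [autJ_one]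
  · refine fun g h => ae_muBall fun z hz => ?_
    rw [mul_inv_rev, mobius_mul _ _ (autJ_ne_zero _ (mem_ball_zero_iff.1 hz).le)]
  · refine fun g h => ae_muBall fun z hz => ?_
    rw [mul_inv_rev, autJ_mul _ _ (autJ_ne_zero _ (mem_ball_zero_iff.1 hz).le), mul_zpow, mul_comm]

theorem autJ_sph_ne_zero (g : SU n) (ζ : Sph n) : autJ g (ζ : Cn n) ≠ 0 :=
  autJ_ne_zero g (norm_sph ζ).le

theorem sphMobius_mul (g h : SU n) (ζ : Sph n) :
    sphMobius (g * h) ζ = sphMobius g (sphMobius h ζ) :=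
  Subtype.ext (mobius_mul g h (autJ_sph_ne_zero h ζ))

theorem sphMobius_one (ζ : Sph n) : sphMobius (1 : SU n) ζ = ζ := Subtype.ext (mobius_one _)

theorem exists_sphereL2Rep [NeZero n] (m : ℤ) :
    ∃ U : SU n →* (L2S n →L[ℂ] L2S n), ∀ g f,
      U g f =ᵐ[surf n] fun ζ => autJ g⁻¹ (ζ : Cn n) ^ (-m) * f (sphMobius g⁻¹ ζ) := by
  choose C hC hle using fun g : SU n => exists_bound_autJ_zpow g⁻¹ (-m) (2 * n)
  refine exists_weightedRep (T := fun g => sphMobius g⁻¹)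
    (w := fun g (ζ : Sph n) => autJ g⁻¹ (ζ : Cn n) ^ (-m))
    (j := fun g (ζ : Sph n) => ENNReal.ofReal (‖autJ g⁻¹ (ζ : Cn n)‖⁻¹ ^ (2 * n))) (C := C)
    (fun g => measurable_sphJac _) ?_
    (fun g => measurePreserving_sphMobius _) (fun g => ?_) ?_ hC ?_ ?_ ?_ ?_
  · refine fun g => Eventually.of_forall fun ζ => ?_
    have := norm_pos_iff.2 (autJ_sph_ne_zero g⁻¹ ζ)
    simp only [ne_eq, ENNReal.ofReal_eq_zero, not_le]
    positivity
  · exact (((continuous_autJ g⁻¹).comp continuous_subtype_val).measurable.pow_const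
      _).aestronglyMeasurable
  · exact fun g => Eventually.of_forall fun ζ => hle g ζ
      (mem_closedBall_zero_iff.2 (norm_sph ζ).le)
  · exact Eventually.of_forall fun ζ => by rw [inv_one, sphMobius_one]
  · exact Eventually.of_forall fun ζ => by simp [autJ_one]
  · exact fun g h => Eventually.of_forall fun ζ => by rw [mul_inv_rev, sphMobius_mul]
  · refine fun g h => Eventually.of_forall fun ζ => ?_
    rw [mul_inv_rev, autJ_mul _ _ (autJ_sph_ne_zero _ _), mul_zpow, mul_comm]
    rfl

/-- The action of weight `m` of `SU(n,1)` on `L²(S^{2n-1})`. -/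
def repS (n : ℕ) [NeZero n] (m : ℤ) : SU n →* (L2S n →L[ℂ] L2S n) :=
  (exists_sphereL2Rep m).choose

theorem coeFn_repS [NeZero n] (m : ℤ) (g : SU n) (f : L2S n) :
    repS n m g f =ᵐ[surf n] fun ζ => autJ g⁻¹ (ζ : Cn n) ^ (-m) * f (sphMobius g⁻¹ ζ) :=
  (exists_sphereL2Rep m).choose_spec g f

end Representations

/-! ### The bilinear pairing and the smoothing operator `(1 + Δ_H)^{-r}` -/

section Pairing

variable {n : ℕ}

theorem inner_star_left (v w : L2S n) : ⟪star v, w⟫_ℂ = ∫ ζ, v ζ * w ζ ∂(surf n) := by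
  rw [inner_L2]
  refine integral_congr_ae ?_
  filter_upwards [Lp.coeFn_star v] with ζ h
  rw [h, Pi.star_apply, RCLike.star_def, Complex.conj_conj]

theorem inner_star_comm (v w : L2S n) : ⟪star v, w⟫_ℂ = ⟪star w, v⟫_ℂ := by
  rw [inner_star_left, inner_star_left]
  simp only [mul_comm]

theorem star_toL2 {f : Sph n → ℂ} (hf : Continuous f) :
    star (toL2 f) = toL2 fun ζ => (starRingEnd ℂ) (f ζ) := by
  refine eq_toL2 (Complex.continuous_conj.comp hf) ?_
  filter_upwards [Lp.coeFn_star (toL2 f), coeFn_toL2 hf] with ζ h1 h2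
  rw [h1, Pi.star_apply, h2]
  rfl

theorem star_smul_L2 (c : ℂ) (v : L2S n) : star (c • v) = (starRingEnd ℂ) c • star v := by
  refine Lp.ext ?_
  filter_upwards [Lp.coeFn_star (c • v), Lp.coeFn_smul c v, Lp.coeFn_star v,
    Lp.coeFn_smul ((starRingEnd ℂ) c) (star v)] with ζ h1 h2 h3 h4
  rw [h1, Pi.star_apply, h2, h4, Pi.smul_apply, Pi.smul_apply, h3]
  simp

theorem star_add_L2 (v w : L2S n) : star (v + w) = star v + star w := by
  refine Lp.ext ?_
  filter_upwards [Lp.coeFn_star (v + w), Lp.coeFn_add v w, Lp.coeFn_star v, Lp.coeFn_star w,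
    Lp.coeFn_add (star v) (star w)] with ζ h1 h2 h3 h4 h5
  rw [h1, Pi.star_apply, h2, h5, Pi.add_apply, Pi.add_apply, h3, h4]
  simp

theorem norm_star_L2 (v : L2S n) : ‖star v‖ = ‖v‖ := by
  have h : ⟪star v, star v⟫_ℂ = ⟪v, v⟫_ℂ := by
    rw [inner_star_comm, star_star]
  have h1 := congrArg Complex.re h
  rw [← RCLike.re_eq_complex_re, inner_self_eq_norm_sq, inner_self_eq_norm_sq] at h1
  exact (sq_eq_sq₀ (norm_nonneg _) (norm_nonneg _)).1 h1

theorem continuous_star_L2 : Continuous (fun v : L2S n => star v) := by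
  have h : ∀ v w : L2S n, star v - star w = star (v - w) := fun v w => by
    rw [sub_eq_iff_eq_add, ← star_add_L2, sub_add_cancel]
  refine (LipschitzWith.of_dist_le_mul (K := 1) fun v w => ?_).continuous
  rw [dist_eq_norm, dist_eq_norm, h, norm_star_L2, NNReal.coe_one, one_mul]

/-- A closed linear condition holds on `harm n i` if it holds for restrictions of bihomogeneous
harmonics. -/
theorem harm_induction {i : ℤ × ℤ} {P : L2S n → Prop} (hc : IsClosed {v | P v})
    (hgen : ∀ Y, IsHarm i.1 i.2 Y → P (toL2 (res Y))) (h0 : P 0)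
    (hadd : ∀ v w, P v → P w → P (v + w)) (hsmul : ∀ (c : ℂ) v, P v → P (c • v)) {v : L2S n}
    (hv : v ∈ harm n i) : P v := by
  have h1 : (Submodule.span ℂ {v : L2S n | ∃ Y, IsHarm i.1 i.2 Y ∧ v = toL2 (res Y)} :
      Set (L2S n)) ⊆ {v | P v} := by
    intro v hv
    induction hv using Submodule.span_induction with
    | mem v hv => obtain ⟨Y, hY, rfl⟩ := hv; exact hgen Y hY
    | zero => exact h0
    | add v w _ _ h1 h2 => exact hadd v w h1 h2
    | smul c v _ h => exact hsmul c v h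
  exact closure_minimal h1 hc hv

theorem star_mem_harm {i : ℤ × ℤ} {v : L2S n} (hv : v ∈ harm n i) : star v ∈ harm n i.swap := by
  have hc : IsClosed (harm n i.swap : Set (L2S n)) := Submodule.isClosed_topologicalClosure _
  refine harm_induction (P := fun v => star v ∈ harm n i.swap) (hc.preimage continuous_star_L2)
    (fun Y hY => ?_) ?_ (fun v w h1 h2 => ?_) (fun c v h => ?_) hv
  · rw [star_toL2 hY.continuous_res]
    exact hY.conj.mem_harm
  · have : star (0 : L2S n) = 0 := by rw [← norm_eq_zero, norm_star_L2, norm_zero]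
    rw [this]
    exact Submodule.zero_mem _
  · rw [star_add_L2]; exact Submodule.add_mem _ h1 h2
  · rw [star_smul_L2]; exact Submodule.smul_mem _ _ h

theorem hproj_star (i : ℤ × ℤ) (v : L2S n) : hproj i (star v) = star (hproj i.swap v) := by
  refine Submodule.eq_starProjection_of_mem_of_inner_eq_zero ?_ fun w hw => ?_
  · have := star_mem_harm (proj_mem (V := harm n) i.swap v)
    rwa [Prod.swap_swap] at this
  · have h1 : star v - star (hproj i.swap v) = star (v - hproj i.swap v) := by
      rw [sub_eq_iff_eq_add, ← star_add_L2, sub_add_cancel]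
    rw [h1, inner_star_comm, inner_sub_right, sub_eq_zero]
    have h2 := proj_of_mem (V := harm n) (star_mem_harm hw)
    rw [← h2, ← inner_proj_left (V := harm n)]

theorem lamPos_swap (i : ℤ × ℤ) : lamPos n i.swap = lamPos n i := by
  unfold lamPos lam
  simp only [Prod.fst_swap, Prod.snd_swap]
  split_ifs <;> push_cast <;> ring

theorem star_subLaplacianPow [NeZero n] (r : ℝ) {φ : Sph n → ℂ} (hφ : IsSmooth φ) :
    star (subLaplacianPow r φ) = subLaplacianPow r fun ζ => (starRingEnd ℂ) (φ ζ) := by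
  refine (isOrthDecomp_harm n).ext fun i => ?_
  change hproj i _ = hproj i _
  rw [hproj_star, hproj_subLaplacianPow r hφ, hproj_subLaplacianPow r hφ.conj, star_smul_L2,
    Complex.conj_ofReal, lamPos_swap, ← hproj_star, star_toL2 hφ.continuous]

/-- The weight `(1 + λ_{p,q})^{-r}`. -/
def wt (n : ℕ) (r : ℝ) (i : ℤ × ℤ) : ℝ := (1 + lamPos n i) ^ (-r)

theorem one_le_lamPos [NeZero n] (i : ℤ × ℤ) : 1 ≤ 1 + lamPos n i := by
  linarith [lamPos_nonneg (n := n) i]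

theorem wt_pos [NeZero n] (r : ℝ) (i : ℤ × ℤ) : 0 < wt n r i :=
  Real.rpow_pos_of_pos (by linarith [one_le_lamPos (n := n) i]) _

theorem wt_le_one [NeZero n] {r : ℝ} (hr : 0 ≤ r) (i : ℤ × ℤ) : wt n r i ≤ 1 :=
  Real.rpow_le_one_of_one_le_of_nonpos (one_le_lamPos i) (by linarith)

theorem exists_smoothing [NeZero n] {r : ℝ} (hr : 0 ≤ r) : ∃ T : L2S n →L[ℂ] L2S n,
    ∀ x i, hproj i (T x) = (wt n r i : ℂ) • hproj i x :=
  (isOrthDecomp_harm n).exists_diagonal (C := 1) fun i => by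
    rw [abs_of_pos (wt_pos r i)]; exact wt_le_one hr i

open Classical in
/-- The bounded operator `(1 + Δ_H)^{-r}` on `L²(S)` for `r ≥ 0` (and `0` for `r < 0`). -/
def smoothing (n : ℕ) [NeZero n] (r : ℝ) : L2S n →L[ℂ] L2S n :=
  if hr : 0 ≤ r then (exists_smoothing hr).choose else 0

theorem hproj_smoothing [NeZero n] {r : ℝ} (hr : 0 ≤ r) (x : L2S n) (i : ℤ × ℤ) :
    hproj i (smoothing n r x) = (wt n r i : ℂ) • hproj i x := by
  rw [smoothing, dif_pos hr]
  exact (exists_smoothing hr).choose_spec x i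

theorem wt_mul_rpow [NeZero n] (r : ℝ) (i : ℤ × ℤ) : wt n r i * (1 + lamPos n i) ^ r = 1 := by
  have h := one_le_lamPos (n := n) i
  rw [wt, ← Real.rpow_add (by linarith), neg_add_cancel, Real.rpow_zero]

theorem inner_subLaplacianPow_smoothing [NeZero n] {r : ℝ} (hr : 0 ≤ r) {φ : Sph n → ℂ}
    (hφ : IsSmooth φ) (x : L2S n) :
    ⟪subLaplacianPow r φ, smoothing n r x⟫_ℂ = ⟪toL2 φ, x⟫_ℂ := by
  have h1 := (isOrthDecomp_harm n).hasSum_inner (subLaplacianPow r φ) (smoothing n r x)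
  refine h1.unique ?_
  convert (isOrthDecomp_harm n).hasSum_inner (toL2 φ) x using 2 with i
  have h2 := hproj_subLaplacianPow r hφ i
  have h3 := hproj_smoothing hr x i
  rw [h2, h3, inner_smul_left, inner_smul_right, Complex.conj_ofReal, ← mul_assoc,
    ← Complex.ofReal_mul, mul_comm (_ ^ r), wt_mul_rpow, Complex.ofReal_one, one_mul]

/-- Pairing with the element `(1 + Δ_H)^{-r} f` of the space of order `-2r/κ` is integration
against `f`. -/
theorem integral_smoothing_mul [NeZero n] {r : ℝ} (hr : 0 ≤ r) {φ : Sph n → ℂ} (hφ : IsSmooth φ)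
    (f : L2S n) : ∫ ζ, smoothing n r f ζ * subLaplacianPow r φ ζ ∂(surf n) =
      ∫ ζ, f ζ * φ ζ ∂(surf n) := by
  rw [← inner_star_left, inner_star_comm, star_subLaplacianPow r hφ,
    inner_subLaplacianPow_smoothing hr hφ.conj, ← star_toL2 hφ.continuous, inner_star_comm,
    inner_star_left]
  refine integral_congr_ae ?_
  filter_upwards [coeFn_toL2 hφ.continuous] with ζ h
  rw [h]

/-- The range of `(1 + Δ_H)^{-r}` is dense. -/
theorem denseRange_smoothing [NeZero n] {r : ℝ} (hr : 0 ≤ r) : DenseRange (smoothing n r) := by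
  have h1 : (LinearMap.range (smoothing n r).toLinearMap).topologicalClosure = ⊤ := by
    rw [Submodule.topologicalClosure_eq_top_iff, Submodule.eq_bot_iff]
    intro x hx
    rw [Submodule.mem_orthogonal] at hx
    refine (isOrthDecomp_harm n).ext fun i => ?_
    rw [map_zero]
    have h2 := hx (smoothing n r (hproj i x)) ⟨_, rfl⟩
    have h3 : smoothing n r (hproj i x) = (wt n r i : ℂ) • hproj i x := by
      refine (isOrthDecomp_harm n).ext fun j => ?_
      change hproj j _ = hproj j _
      rw [hproj_smoothing hr, map_smul]
      by_cases hij : j = i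
      · rw [hij]
      · have : hproj j (hproj i x) = 0 :=
          (isOrthDecomp_harm n).proj_of_mem_ne hij (proj_mem (V := harm n) i x)
        rw [this, smul_zero, smul_zero]
    rw [h3, inner_smul_left, inner_proj_left (V := harm n), mul_eq_zero, inner_self_eq_zero] at h2
    rcases h2 with h2 | h2
    · rw [Complex.conj_ofReal, Complex.ofReal_eq_zero] at h2
      exact absurd h2 (wt_pos r i).ne'
    · exact h2
  rw [DenseRange, dense_iff_closure_eq]
  exact congrArg (fun s : Submodule ℂ (L2S n) => (s : Set (L2S n))) h1

end Pairing

/-! ### Test functions are preserved by the action on the sphere -/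

section TestFunctions

variable {n : ℕ}

/-- The test function that represents the transpose of the action of weight `m`. -/
def actTest (m : ℤ) (g : SU n) (φ : Sph n → ℂ) (η : Sph n) : ℂ :=
  autJ g (η : Cn n) ^ m * ((‖autJ g (η : Cn n)‖ ^ (-(2 * n : ℤ)) : ℝ) : ℂ) * φ (sphMobius g η)

theorem contDiffAt_zpow_of_ne {E : Type*} [NormedAddCommGroup E] [NormedSpace ℝ E] {𝕜 : Type*}
    [NormedField 𝕜] [NormedAlgebra ℝ 𝕜] {f : E → 𝕜} {x : E} (hf : ContDiffAt ℝ ∞ f x)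
    (h : f x ≠ 0) (m : ℤ) : ContDiffAt ℝ ∞ (fun y => f y ^ m) x := by
  obtain ⟨k, rfl | rfl⟩ := m.eq_nat_or_neg
  · simpa using hf.pow k
  · simp only [zpow_neg, zpow_natCast]
    exact (hf.pow k).inv (pow_ne_zero k h)

theorem contDiffAt_radialExt_mobius {φ : Sph n → ℂ} (hφ : IsSmooth φ) (g : SU n) (ζ : Sph n) :
    ContDiffAt ℝ ∞ (fun x => radialExt φ (mobius g x)) (ζ : Cn n) :=
  (hφ.contDiffAt (sph_ne_zero (sphMobius g ζ))).comp (ζ : Cn n)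
    ((contDiffAt_mobius g (autJ_sph_ne_zero g ζ)).restrict_scalars ℝ)

theorem isSmooth_actTest (m : ℤ) (g : SU n) {φ : Sph n → ℂ} (hφ : IsSmooth φ) :
    IsSmooth (actTest m g φ) := by
  refine IsSmooth.of_contDiffAt (fun x => autJ g x ^ m *
    ((‖autJ g x‖ ^ (-(2 * n : ℤ)) : ℝ) : ℂ) * radialExt φ (mobius g x)) (fun ζ => ?_) fun ζ => ?_
  · have hJ := autJ_sph_ne_zero g ζ
    have h1 : ContDiffAt ℝ ∞ (autJ g) (ζ : Cn n) :=
      ((contDiff_autJ g).restrict_scalars ℝ).contDiffAt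
    refine ((contDiffAt_zpow_of_ne h1 hJ m).mul ?_).mul (contDiffAt_radialExt_mobius hφ g ζ)
    exact Complex.ofRealCLM.contDiff.contDiffAt.comp (ζ : Cn n)
      (contDiffAt_zpow_of_ne (h1.norm ℝ hJ) (norm_ne_zero_iff.2 hJ) _)
  · have : radialExt φ (mobius g ζ) = φ (sphMobius g ζ) := radialExt_coe φ (sphMobius g ζ)
    rw [this]
    rfl

/-- The transpose of the action of weight `m` on functions on the sphere. -/
theorem integral_repS_mul [NeZero n] (m : ℤ) (g : SU n) (f : L2S n) {φ : Sph n → ℂ} :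
    ∫ ζ, repS n m g f ζ * φ ζ ∂(surf n) = ∫ η, f η * actTest m g φ η ∂(surf n) := by
  have h1 : ∫ ζ, repS n m g f ζ * φ ζ ∂(surf n) =
      ∫ ζ : Sph n, (autJ g⁻¹ (ζ : Cn n) ^ (-m) * f (sphMobius g⁻¹ ζ)) * φ ζ ∂(surf n) := by
    refine integral_congr_ae ?_
    filter_upwards [coeFn_repS m g f] with ζ h
    rw [h]
  rw [h1, ← integral_sphMobius g]
  refine integral_congr_ae (Eventually.of_forall fun η => ?_)
  have h2 : sphMobius g⁻¹ (sphMobius g η) = η := by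
    rw [← sphMobius_mul, inv_mul_cancel, sphMobius_one]
  have h3 : autJ g⁻¹ (sphMobius g η : Cn n) = (autJ g (η : Cn n))⁻¹ :=
    eq_inv_of_mul_eq_one_left (autJ_inv_mobius g (norm_sph η).le)
  simp only
  rw [h2, h3, actTest, inv_zpow', neg_neg, inv_pow, zpow_neg]
  norm_cast
  ring

end TestFunctions

/-! ### The stabilizer of the origin -/

section Stabilizer

variable {n : ℕ} {p q : ℤ}

theorem dd_comp_isometry {f : Cn n → ℂ} (hf : ContDiff ℝ ∞ f) (L : Cn n ≃ₗᵢ[ℂ] Cn n) (v : Cn n) :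
    dd v (fun z => f (L z)) = fun z => dd (L v) f (L z) := by
  funext z
  have h1 : HasFDerivAt (fun z => L z)
      ((L.toContinuousLinearEquiv : Cn n →L[ℂ] Cn n).restrictScalars ℝ) z :=
    ((L.toContinuousLinearEquiv : Cn n →L[ℂ] Cn n).restrictScalars ℝ).hasFDerivAt
  have h2 := (differentiableAt_of_smooth hf.contDiffAt).hasFDerivAt.comp z h1
  unfold dd
  rw [show (fun z => f (L z)) = f ∘ fun z => L z from rfl, h2.fderiv]
  rfl

theorem IsHarm.comp_isometry {Y : Cn n → ℂ} (h : IsHarm p q Y) (L : Cn n ≃ₗᵢ[ℂ] Cn n) :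
    IsHarm p q fun z => Y (L z) where
  smooth := h.smooth.comp
    ((L.toContinuousLinearEquiv : Cn n →L[ℂ] Cn n).restrictScalars ℝ).contDiff
  homog c hc z := by rw [map_smul]; exact h.homog c hc _
  harmonic z := by
    have hs : ContDiff ℝ ∞ fun z => Y (L z) := h.smooth.comp
      ((L.toContinuousLinearEquiv : Cn n →L[ℂ] Cn n).restrictScalars ℝ).contDiff
    let LR : Cn n ≃ₗᵢ[ℝ] Cn n := ⟨L.toLinearEquiv.restrictScalars ℝ, L.norm_map⟩
    let e := stdOrthonormalBasis ℝ (Cn n)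
    rw [laplacian_eq_sum_dd e hs.contDiffAt]
    have h1 : ∀ i, dd (e i) (dd (e i) fun z => Y (L z)) z =
        dd ((e.map LR) i) (dd ((e.map LR) i) Y) (L z) := fun i => by
      rw [dd_comp_isometry h.smooth, dd_comp_isometry (contDiff_dd h.smooth _)]
      rfl
    simp only [h1]
    rw [← laplacian_eq_sum_dd (e.map LR) h.smooth.contDiffAt, h.harmonic]

theorem mobius_inv_zero {k : SU n} (hk : mobius k 0 = 0) : mobius k⁻¹ 0 = 0 := by
  conv_lhs => rw [← hk]
  exact mobius_inv_mobius k (by simp)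

theorem norm_autJ_zero {k : SU n} (hk : mobius k 0 = 0) : ‖autJ k 0‖ = 1 := by
  have h := norm_mobius k (z := 0) (by simp)
  rw [hk] at h
  simp only [norm_zero] at h
  have h2 : ‖autJ k 0‖ ^ 2 = 1 := by linarith
  exact (pow_eq_one_iff_of_nonneg (norm_nonneg _) two_ne_zero).1 h2

/-- If `k` fixes the origin, then the kernel law at `(0, z)` shows that `J(k, ·)` is constant. -/
theorem autJ_of_fix_zero {k : SU n} (hk : mobius k 0 = 0) {z : Cn n} (hz : ‖z‖ ≤ 1) :
    autJ k z = autJ k 0 := by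
  have h0 : autJ k 0 ≠ 0 := autJ_ne_zero k (by simp)
  have h := inner_mobius k h0 (autJ_ne_zero k hz)
  have h' := inner_mobius k h0 h0
  simp only [hk, inner_zero_left, sub_zero, mul_one] at h h'
  have hc : (starRingEnd ℂ) (autJ k 0) ≠ 0 := by simpa using h0
  exact mul_left_cancel₀ hc (h.trans h'.symm)

/-- A Möbius transform that fixes the origin is unitary. -/
theorem exists_isometry {k : SU n} (hk : mobius k 0 = 0) :
    ∃ L : Cn n ≃ₗᵢ[ℂ] Cn n, ∀ z, ‖z‖ ≤ 1 → mobius k z = L z := by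
  have hb : ∀ i, entry k (Sum.inl i) (Sum.inr ()) = 0 := fun i => by
    have h1 := congrArg (fun z : Cn n => z i) hk
    simp only [mobius_apply, numer_eq, map_zero, zero_add] at h1
    exact (div_eq_zero_iff.1 h1).resolve_right (autJ_ne_zero k (by simp))
  let A : Cn n →ₗ[ℂ] Cn n :=
    { toFun := fun z => WithLp.toLp 2 fun i => rowA k i z / autJ k 0
      map_add' := fun z w => by ext i; simp [add_div]
      map_smul' := fun c z => by ext i; simp [mul_div_assoc] }
  have hA : ∀ z, ‖z‖ ≤ 1 → mobius k z = A z := fun z hz => by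
    ext i
    rw [mobius_apply, numer_eq, hb, add_zero, autJ_of_fix_zero hk hz]
    rfl
  have hnorm1 : ∀ z, ‖z‖ ≤ 1 → ‖A z‖ = ‖z‖ := fun z hz => by
    have h1 := norm_mobius k hz
    rw [autJ_of_fix_zero hk hz, norm_autJ_zero hk, hA z hz] at h1
    have h2 : ‖A z‖ ^ 2 = ‖z‖ ^ 2 := by linarith
    exact (sq_eq_sq₀ (norm_nonneg _) (norm_nonneg _)).1 h2
  have hnorm : ∀ z, ‖A z‖ = ‖z‖ := fun z => by
    by_cases hz : z = 0
    · rw [hz, map_zero]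
    have hz' : ‖z‖ ≠ 0 := norm_ne_zero_iff.2 hz
    have h1 := hnorm1 (((‖z‖⁻¹ : ℝ) : ℂ) • z) (by
      rw [norm_smul, Complex.norm_real, norm_inv, norm_norm, inv_mul_cancel₀ hz'])
    rw [map_smul, norm_smul, norm_smul] at h1
    refine mul_left_cancel₀ ?_ h1
    simpa using hz
  exact ⟨(⟨A, hnorm⟩ : Cn n →ₗᵢ[ℂ] Cn n).toLinearIsometryEquiv rfl, hA⟩

theorem repS_toL2 [NeZero n] (m : ℤ) (g : SU n) {f : Sph n → ℂ} (hf : Continuous f) :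
    repS n m g (toL2 f) =
      toL2 fun ζ : Sph n => autJ g⁻¹ (ζ : Cn n) ^ (-m) * f (sphMobius g⁻¹ ζ) := by
  refine eq_toL2 (((continuous_autJ g⁻¹).comp continuous_subtype_val).zpow₀ _
    (fun ζ => Or.inl (autJ_sph_ne_zero _ ζ)) |>.mul (hf.comp (continuous_sphMobius _))) ?_
  have hq := absolutelyContinuous_of_measurePreserving (measurable_sphJac g⁻¹)
    (μ := surf n) (T := sphMobius g⁻¹) (Eventually.of_forall fun ζ => by
      have := norm_pos_iff.2 (autJ_sph_ne_zero g⁻¹ ζ)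
      simp only [ne_eq, ENNReal.ofReal_eq_zero, not_le]
      positivity) (measurePreserving_sphMobius g⁻¹)
  filter_upwards [coeFn_repS m g (toL2 f), hq.ae (coeFn_toL2 hf)] with ζ h1 h2
  rw [h1, h2]
  rfl

/-- The stabilizer of the origin acts by unitary changes of variables and a constant factor, so it
preserves the bidegrees. -/
theorem repS_mem_harm [NeZero n] (m : ℤ) {k : SU n} (hk : mobius k 0 = 0) {i : ℤ × ℤ} {v : L2S n}
    (hv : v ∈ harm n i) : repS n m k v ∈ harm n i := by
  have hc : IsClosed (harm n i : Set (L2S n)) := Submodule.isClosed_topologicalClosure _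
  refine harm_induction (P := fun v => repS n m k v ∈ harm n i)
    (hc.preimage (repS n m k).continuous) (fun Y hY => ?_) (by simp)
    (fun v w h1 h2 => by rw [map_add]; exact Submodule.add_mem _ h1 h2)
    (fun c v h => by rw [map_smul]; exact Submodule.smul_mem _ _ h) hv
  obtain ⟨L, hL⟩ := exists_isometry (mobius_inv_zero hk)
  rw [repS_toL2 m k hY.continuous_res]
  have h1 : (fun ζ : Sph n => autJ k⁻¹ (ζ : Cn n) ^ (-m) * res Y (sphMobius k⁻¹ ζ)) =
      fun ζ : Sph n => autJ k⁻¹ 0 ^ (-m) * res (fun z => Y (L z)) ζ := by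
    funext ζ
    rw [autJ_of_fix_zero (mobius_inv_zero hk) (norm_sph ζ).le]
    simp only [res, sphMobius, hL _ (norm_sph ζ).le]
  rw [h1, toL2_const_mul (hY.comp_isometry L).continuous_res]
  exact Submodule.smul_mem _ _ (hY.comp_isometry L).mem_harm

/-- An operator that preserves the spaces of harmonics commutes with the projections on them. -/
theorem hproj_comm [NeZero n] {T : L2S n →L[ℂ] L2S n}
    (hT : ∀ i, ∀ v ∈ harm n i, T v ∈ harm n i) (i : ℤ × ℤ) (v : L2S n) :
    hproj i (T v) = T (hproj i v) := by
  have h1 := (((isOrthDecomp_harm n).hasSum_proj v).mapL T).mapL (hproj i)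
  refine h1.unique ?_
  have : (fun j => hproj i (T (hproj j v))) = fun j => if j = i then T (hproj i v) else 0 := by
    funext j
    split_ifs with hj
    · subst hj; exact proj_of_mem (V := harm n) (hT _ _ (proj_mem (V := harm n) _ _))
    · exact (isOrthDecomp_harm n).proj_of_mem_ne (Ne.symm hj) (hT j _ (proj_mem (V := harm n) _ _))
  change HasSum (fun j => hproj i (T (hproj j v))) _
  rw [this]
  exact hasSum_ite_eq i _

/-- The stabilizer of the origin commutes with `Δ_H`, because it preserves the spaces of
bihomogeneous harmonics. -/
theorem smoothing_repS_of_fix_zero [NeZero n] {r : ℝ} (hr : 0 ≤ r) (m : ℤ) {k : SU n}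
    (hk : mobius k 0 = 0) (v : L2S n) :
    smoothing n r (repS n m k v) = repS n m k (smoothing n r v) := by
  have hT : ∀ i, ∀ v ∈ harm n i, repS n m k v ∈ harm n i := fun i v => repS_mem_harm m hk
  refine (isOrthDecomp_harm n).ext fun i => ?_
  change hproj i _ = hproj i _
  rw [hproj_smoothing hr, hproj_comm hT, hproj_comm hT, hproj_smoothing hr, map_smul]

end Stabilizer

/-! ### Hyperbolic one-parameter groups -/

section Hyperbolic

variable {n : ℕ}

/-- The block matrix `(1 + (c - 1) b b*, s b; s b*, c)`. -/
def hypMat (b : Cn n) (c s : ℝ) : Matrix (Fin n ⊕ Unit) (Fin n ⊕ Unit) ℂ :=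
  Matrix.fromBlocks
    (1 + ((c - 1 : ℝ) : ℂ) • (Matrix.replicateCol Unit (fun i => b i) *
      Matrix.replicateRow Unit fun j => (starRingEnd ℂ) (b j)))
    ((s : ℂ) • Matrix.replicateCol Unit fun i => b i)
    ((s : ℂ) • Matrix.replicateRow Unit fun j => (starRingEnd ℂ) (b j)) ((c : ℂ) • 1)

theorem row_mul_col {b : Cn n} (hb : ‖b‖ = 1) :
    Matrix.replicateRow Unit (fun j => (starRingEnd ℂ) (b j)) *
      Matrix.replicateCol Unit (fun i => b i) = 1 := by
  have h1 : ⟪b, b⟫_ℂ = 1 := by rw [inner_self_eq_norm_sq_to_K, hb]; simp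
  rw [PiLp.inner_apply] at h1
  simp only [RCLike.inner_apply] at h1
  ext i j
  simp only [Matrix.mul_apply, Matrix.replicateRow_apply, Matrix.replicateCol_apply]
  simp only [mul_comm (b _)] at h1
  rw [h1]
  simp

theorem hypMat_mul {b : Cn n} (hb : ‖b‖ = 1) (c s c' s' : ℝ) :
    hypMat b c s * hypMat b c' s' = hypMat b (c * c' + s * s') (c * s' + s * c') := by
  have h := row_mul_col hb
  unfold hypMat
  rw [Matrix.fromBlocks_multiply]
  generalize Matrix.replicateCol Unit (fun i => b i) = β at h ⊢
  generalize Matrix.replicateRow Unit (fun j => (starRingEnd ℂ) (b j)) = ρ at h ⊢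
  have h1 : β * ρ * (β * ρ) = β * ρ := by
    rw [Matrix.mul_assoc, ← Matrix.mul_assoc ρ, h, Matrix.one_mul]
  have h2 : β * ρ * β = β := by rw [Matrix.mul_assoc, h, Matrix.mul_one]
  have h3 : ρ * (β * ρ) = ρ := by rw [← Matrix.mul_assoc, h, Matrix.one_mul]
  congr 1
  · simp only [Matrix.mul_add, Matrix.add_mul, Matrix.one_mul, Matrix.mul_one, Matrix.smul_mul,
      Matrix.mul_smul, h1]
    push_cast
    module
  · simp only [Matrix.add_mul, Matrix.one_mul, Matrix.mul_one, Matrix.smul_mul,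
      Matrix.mul_smul, h2]
    push_cast
    module
  · simp only [Matrix.mul_add, Matrix.one_mul, Matrix.mul_one, Matrix.smul_mul,
      Matrix.mul_smul, h3]
    push_cast
    module
  · simp only [Matrix.mul_one, Matrix.smul_mul, Matrix.mul_smul, h]
    push_cast
    module

theorem hypMat_one (b : Cn n) : hypMat b 1 0 = 1 := by
  simp [hypMat]

theorem formJ_eq : formJ n = Matrix.fromBlocks 1 0 0 (-1) := by
  unfold formJ
  ext i j
  rcases i with i | i <;> rcases j with j | j <;>
    simp [Matrix.diagonal_apply, Matrix.one_apply]

theorem hypMat_conjTranspose (b : Cn n) (c s : ℝ) :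
    (hypMat b c s).conjTranspose = hypMat b c s := by
  unfold hypMat
  rw [Matrix.fromBlocks_conjTranspose]
  have h1 : (Matrix.replicateCol Unit fun i => b i).conjTranspose =
      Matrix.replicateRow Unit fun j => (starRingEnd ℂ) (b j) := by ext; simp
  have h2 : (Matrix.replicateRow Unit fun j => (starRingEnd ℂ) (b j)).conjTranspose =
      Matrix.replicateCol Unit fun i => b i := by ext; simp
  simp only [Matrix.conjTranspose_add, Matrix.conjTranspose_smul, Matrix.conjTranspose_mul, h1, h2,
    Matrix.conjTranspose_one, RCLike.star_def, Complex.conj_ofReal]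

theorem hypMat_form {b : Cn n} (hb : ‖b‖ = 1) {c s : ℝ} (h : c ^ 2 - s ^ 2 = 1) :
    (hypMat b c s).conjTranspose * formJ n * hypMat b c s = formJ n := by
  have h1 : hypMat b c s * formJ n = formJ n * hypMat b c (-s) := by
    rw [formJ_eq]
    unfold hypMat
    rw [Matrix.fromBlocks_multiply, Matrix.fromBlocks_multiply]
    congr 1 <;> simp
  rw [hypMat_conjTranspose, h1, Matrix.mul_assoc, hypMat_mul hb]
  have h2 : c * c + -s * s = 1 := by linarith
  have h3 : c * s + -s * c = 0 := by ring
  rw [h2, h3, hypMat_one, Matrix.mul_one]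

theorem det_hypMat {b : Cn n} (hb : ‖b‖ = 1) {c s : ℝ} (h : c ^ 2 - s ^ 2 = 1) (hc : c ≠ 0) :
    (hypMat b c s).det = 1 := by
  have h0 := row_mul_col hb
  unfold hypMat
  generalize Matrix.replicateCol Unit (fun i => b i) = β at h0 ⊢
  generalize Matrix.replicateRow Unit (fun j => (starRingEnd ℂ) (b j)) = ρ at h0 ⊢
  have hc' : (c : ℂ) ≠ 0 := by exact_mod_cast hc
  let _ : Invertible ((c : ℂ) • (1 : Matrix Unit Unit ℂ)) :=
    Matrix.invertibleOfIsUnitDet _ (by simp [hc'])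
  have hinv : ⅟((c : ℂ) • (1 : Matrix Unit Unit ℂ)) = (c : ℂ)⁻¹ • 1 := by
    rw [invOf_eq_right_inv]
    rw [Matrix.smul_mul, Matrix.one_mul, smul_smul, mul_inv_cancel₀ hc', one_smul]
  rw [Matrix.det_fromBlocks₂₂, hinv]
  have h1 : (1 + ((c - 1 : ℝ) : ℂ) • (β * ρ) - (s : ℂ) • β * (c : ℂ)⁻¹ • (1 : Matrix Unit Unit ℂ) *
      (s : ℂ) • ρ) = 1 + (((c - 1 : ℝ) : ℂ) - s * s * (c : ℂ)⁻¹) • β * ρ := by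
    simp only [Matrix.smul_mul, Matrix.mul_smul, Matrix.mul_one]
    module
  rw [h1, Matrix.det_one_add_mul_comm, Matrix.mul_smul, h0]
  have hcs : (c : ℂ) ^ 2 - (s : ℂ) ^ 2 = 1 := by exact_mod_cast congrArg (fun x : ℝ => (x : ℂ)) h
  simp only [Matrix.det_unique, Matrix.smul_apply, Matrix.add_apply, Matrix.one_apply_eq,
    smul_eq_mul,
    mul_one]
  push_cast
  field_simp
  linear_combination hcs

/-- The hyperbolic element `a_t = exp (t (0 b; b* 0))` for a unit vector `b`. -/
def hyp {b : Cn n} (hb : ‖b‖ = 1) (t : ℝ) : SU n :=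
  ⟨⟨hypMat b (Real.cosh t) (Real.sinh t), det_hypMat hb (Real.cosh_sq_sub_sinh_sq t)
    (Real.cosh_pos t).ne'⟩, hypMat_form hb (Real.cosh_sq_sub_sinh_sq t)⟩

variable {b : Cn n} (hb : ‖b‖ = 1)

theorem mat_hyp (t : ℝ) : mat (hyp hb t) = hypMat b (Real.cosh t) (Real.sinh t) := rfl

theorem hyp_add (s t : ℝ) : hyp hb (s + t) = hyp hb s * hyp hb t := by
  refine Subtype.ext (Subtype.ext ?_)
  change mat (hyp hb (s + t)) = mat (hyp hb s * hyp hb t)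
  rw [mat_mul, mat_hyp, mat_hyp, mat_hyp, hypMat_mul hb, Real.cosh_add, Real.sinh_add]
  congr 1
  ring

theorem hyp_zero : hyp hb 0 = 1 := by
  refine Subtype.ext (Subtype.ext ?_)
  change mat (hyp hb 0) = mat 1
  rw [mat_hyp, Real.cosh_zero, Real.sinh_zero, hypMat_one, mat_one]

theorem hyp_neg (t : ℝ) : (hyp hb t)⁻¹ = hyp hb (-t) := by
  rw [inv_eq_iff_mul_eq_one, ← hyp_add, add_neg_cancel, hyp_zero]

theorem inner_eq_sum (b z : Cn n) : ⟪b, z⟫_ℂ = ∑ j, (starRingEnd ℂ) (b j) * z j := by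
  rw [PiLp.inner_apply]
  simp only [RCLike.inner_apply, mul_comm]

theorem autJ_hyp (t : ℝ) (z : Cn n) :
    autJ (hyp hb t) z = (Real.sinh t : ℂ) * ⟪b, z⟫_ℂ + (Real.cosh t : ℂ) := by
  have h1 : ∀ i j, entry (hyp hb t) i j = hypMat b (Real.cosh t) (Real.sinh t) i j := fun _ _ => rfl
  simp only [autJ, h1, hypMat, Matrix.fromBlocks_apply₂₁, Matrix.fromBlocks_apply₂₂,
    Matrix.smul_apply, Matrix.replicateRow_apply, smul_eq_mul, Matrix.one_apply_eq, mul_one,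
    inner_eq_sum, Finset.mul_sum, mul_assoc]

theorem mobius_hyp (t : ℝ) (z : Cn n) : mobius (hyp hb t) z = (autJ (hyp hb t) z)⁻¹ •
    (z + (((Real.cosh t - 1 : ℝ) : ℂ) * ⟪b, z⟫_ℂ + (Real.sinh t : ℂ)) • b) := by
  have h1 : ∀ i j, entry (hyp hb t) i j = hypMat b (Real.cosh t) (Real.sinh t) i j := fun _ _ => rfl
  ext i
  rw [mobius_apply, numer, PiLp.smul_apply, smul_eq_mul, div_eq_inv_mul]
  congr 1
  simp only [h1, hypMat, Matrix.fromBlocks_apply₁₁, Matrix.fromBlocks_apply₁₂, Matrix.add_apply,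
    Matrix.smul_apply, Matrix.replicateRow_apply, smul_eq_mul, Matrix.mul_apply, Matrix.one_apply,
    Matrix.replicateCol_apply, inner_eq_sum, PiLp.add_apply, PiLp.smul_apply, Finset.univ_unique,
    Finset.sum_singleton, add_mul, Finset.sum_add_distrib, ite_mul, one_mul, zero_mul,
    Finset.sum_ite_eq, Finset.mem_univ, if_true]
  have h2 : ∑ x, ((Real.cosh t - 1 : ℝ) : ℂ) * (b i * (starRingEnd ℂ) (b x)) * z x =
      ((Real.cosh t - 1 : ℝ) : ℂ) * (∑ x, (starRingEnd ℂ) (b x) * z x) * b i := by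
    rw [Finset.mul_sum, Finset.sum_mul]
    exact Finset.sum_congr rfl fun j _ => by ring
  rw [h2]
  ring

/-- The hyperbolic elements move the origin to any point of the ball. -/
theorem exists_mobius_hyp_zero [NeZero n] {w : Cn n} (hw1 : ‖w‖ < 1) :
    ∃ (b : Cn n) (hb : ‖b‖ = 1) (t : ℝ), 0 ≤ t ∧ mobius (hyp hb t) 0 = w := by
  obtain ⟨b, hb, hwb⟩ : ∃ b : Cn n, ‖b‖ = 1 ∧ w = ((‖w‖ : ℝ) : ℂ) • b := by
    by_cases h0 : w = 0
    · refine ⟨EuclideanSpace.single (0 : Fin n) 1, by simp, by simp [h0]⟩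
    · have h1 : ‖w‖ ≠ 0 := norm_ne_zero_iff.2 h0
      refine ⟨((‖w‖⁻¹ : ℝ) : ℂ) • w, ?_, ?_⟩
      · rw [norm_smul, Complex.norm_real, norm_inv, norm_norm, inv_mul_cancel₀ h1]
      · rw [smul_smul, ← Complex.ofReal_mul, mul_inv_cancel₀ h1, Complex.ofReal_one, one_smul]
  set ρ := ‖w‖ with hρ
  have hρ0 : 0 ≤ ρ := norm_nonneg _
  have h2 : 0 < 1 - ρ ^ 2 := by nlinarith
  -- `tanh t = ρ` means `sinh t = ρ / √(1 - ρ²)`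
  set x := ρ / √(1 - ρ ^ 2) with hx
  have hs : 0 < √(1 - ρ ^ 2) := Real.sqrt_pos.2 h2
  have hx2 : √(1 + x ^ 2) = 1 / √(1 - ρ ^ 2) := by
    rw [Real.sqrt_eq_iff_eq_sq (by positivity) (by positivity), hx, div_pow, div_pow,
      Real.sq_sqrt h2.le]
    field_simp
    ring
  refine ⟨b, hb, Real.arsinh x, Real.arsinh_nonneg_iff.2 (by positivity), ?_⟩
  rw [mobius_hyp, autJ_hyp, hwb, inner_zero_right, Real.sinh_arsinh, Real.cosh_arsinh, hx2]
  simp only [mul_zero, zero_add, smul_smul]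
  congr 1
  rw [hx]
  have : ((√(1 - ρ ^ 2) : ℝ) : ℂ) ≠ 0 := by exact_mod_cast hs.ne'
  push_cast
  field_simp

/-- `SU(n,1)` is generated by the stabilizer of the origin and the hyperbolic elements. -/
theorem exists_hyp_mul [NeZero n] (g : SU n) : ∃ (b : Cn n) (hb : ‖b‖ = 1) (t : ℝ) (k : SU n),
    0 ≤ t ∧ mobius k 0 = 0 ∧ g = hyp hb t * k := by
  obtain ⟨b, hb, t, ht, hm⟩ := exists_mobius_hyp_zero (norm_mobius_lt g (z := 0) (by simp))
  refine ⟨b, hb, t, (hyp hb t)⁻¹ * g, ht, ?_, by group⟩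
  rw [mobius_mul _ _ (autJ_ne_zero g (by simp)), ← hm, mobius_inv_mobius _ (by simp)]

end Hyperbolic

/-! ### The generator of a hyperbolic group on harmonics -/

section Generator

variable {n : ℕ}

theorem exists_mulOp (w : C(Sph n, ℂ)) : ∃ W : L2S n →L[ℂ] L2S n,
    ∀ F, W F =ᵐ[surf n] fun ζ => w ζ * F ζ := by
  refine exists_weightedComp (T := id) (j := fun _ => 1) (C := ENNReal.ofReal (‖w‖ ^ 2))
    measurable_const (by simp) ?_ w.continuous.aestronglyMeasurable ?_ ENNReal.ofReal_ne_top
  · have : (surf n).withDensity (fun _ => 1) = surf n := withDensity_one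
    rw [this]
    exact MeasurePreserving.id _
  · refine Eventually.of_forall fun ζ => ?_
    rw [mul_one, ← ofReal_norm, ← ENNReal.ofReal_pow (norm_nonneg _)]
    exact ENNReal.ofReal_le_ofReal (by gcongr; exact w.norm_coe_le_norm ζ)

/-- Multiplication by a continuous function on `L²(S)`. -/
def mulOp (w : C(Sph n, ℂ)) : L2S n →L[ℂ] L2S n := (exists_mulOp w).choose

theorem coeFn_mulOp (w : C(Sph n, ℂ)) (F : L2S n) : mulOp w F =ᵐ[surf n] fun ζ => w ζ * F ζ :=
  (exists_mulOp w).choose_spec F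

theorem mulOp_toL2 (w : C(Sph n, ℂ)) {f : Sph n → ℂ} (hf : Continuous f) :
    mulOp w (toL2 f) = toL2 fun ζ => w ζ * f ζ := by
  refine eq_toL2 (w.continuous.mul hf) ?_
  filter_upwards [coeFn_mulOp w (toL2 f), coeFn_toL2 hf] with ζ h1 h2
  rw [h1, h2]
  rfl

theorem inner_mulOp (w : C(Sph n, ℂ)) (x y : L2S n) :
    ⟪mulOp w x, y⟫_ℂ = ⟪x, mulOp (star w) y⟫_ℂ := by
  rw [inner_L2, inner_L2]
  refine integral_congr_ae ?_
  filter_upwards [coeFn_mulOp w x, coeFn_mulOp (star w) y] with ζ h1 h2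
  rw [h1, h2, map_mul, ContinuousMap.star_apply, RCLike.star_def]
  ring

variable {p q : ℤ} {Y : Cn n → ℂ}

/-- The part of degree `(p + 1, q)` of `(b̄ · z) Y`. -/
def up (p q : ℤ) (b : Cn n) (Y : Cn n → ℂ) (z : Cn n) : ℂ :=
  ell b z * Y z - ((n + p + q - 1 : ℂ))⁻¹ * (nsq z * dzb b Y z)

/-- The part of degree `(p, q + 1)` of `(b · z̄) Y`. -/
def upc (p q : ℤ) (b : Cn n) (Y : Cn n → ℂ) (z : Cn n) : ℂ :=
  (starRingEnd ℂ) (ell b z) * Y z - ((n + p + q - 1 : ℂ))⁻¹ * (nsq z * dz b Y z)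

theorem IsHarm.up (h : IsHarm p q Y) (b : Cn n) : IsHarm (p + 1) q (up p q b Y) := h.raise b

theorem conj_dzb {f : Cn n → ℂ} {x : Cn n} (hf : DifferentiableAt ℝ f x) (b : Cn n) :
    dzb b (fun y => (starRingEnd ℂ) (f y)) x = (starRingEnd ℂ) (dz b f x) := by
  have h := conj_dz (f := fun y => (starRingEnd ℂ) (f y)) (x := x)
    (Complex.conjCLE.differentiableAt.comp x hf) b
  simp only [Complex.conj_conj] at h
  rw [h, Complex.conj_conj]

theorem IsHarm.upc (h : IsHarm p q Y) (b : Cn n) : IsHarm p (q + 1) (upc p q b Y) := by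
  have h1 := (h.conj.up b).conj
  have h2 : SzegoBall.upc p q b Y = fun z => (starRingEnd ℂ)
      (SzegoBall.up q p b (fun z => (starRingEnd ℂ) (Y z)) z) := by
    funext z
    unfold SzegoBall.upc SzegoBall.up
    rw [conj_dzb (differentiableAt_of_smooth h.smooth.contDiffAt)]
    simp only [map_sub, map_mul, Complex.conj_conj, map_inv₀, map_add, map_natCast, map_intCast,
      map_one, nsq, Complex.conj_ofReal]
    ring
  rw [h2]
  exact h1

theorem toL2_up_add (h : IsHarm p q Y) (b : Cn n) :
    mulOp (cell b) (toL2 (res Y)) = toL2 (res (up p q b Y)) +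
      ((n + p + q - 1 : ℂ))⁻¹ • toL2 (res (dzb b Y)) := by
  rw [mulOp_toL2 _ h.continuous_res, ← toL2_const_mul (h.dzb b).continuous_res,
    ← toL2_add (h.up b).continuous_res ((h.dzb b).continuous_res.const_mul _)]
  congr 1
  funext ζ
  simp only [res, up, nsq_sph, cell, ContinuousMap.coe_mk]
  ring

theorem toL2_upc_add (h : IsHarm p q Y) (b : Cn n) :
    mulOp (star (cell b)) (toL2 (res Y)) = toL2 (res (upc p q b Y)) +
      ((n + p + q - 1 : ℂ))⁻¹ • toL2 (res (dz b Y)) := by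
  rw [mulOp_toL2 _ h.continuous_res, ← toL2_const_mul (h.dz b).continuous_res,
    ← toL2_add (h.upc b).continuous_res ((h.dz b).continuous_res.const_mul _)]
  congr 1
  funext ζ
  simp only [res, upc, nsq_sph, cell, ContinuousMap.coe_mk, ContinuousMap.star_apply,
    RCLike.star_def]
  ring

theorem hproj_toL2 (h : IsHarm p q Y) : hproj (p, q) (toL2 (res Y)) = toL2 (res Y) :=
  proj_of_mem (V := harm n) h.mem_harm

/-- The derivative at `t = 0` of `conj (J^m |J|^{-2n} (conj Y) ∘ a_t)` on the sphere. -/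
def genFun (p q m : ℤ) (b : Cn n) (Y : Cn n → ℂ) (z : Cn n) : ℂ :=
  dz b Y z + dzb b Y z - (p + n) * (ell b z * Y z) -
    (q + n - m) * ((starRingEnd ℂ) (ell b z) * Y z)

theorem continuous_genFun (h : IsHarm p q Y) (m : ℤ) (b : Cn n) :
    Continuous (genFun p q m b Y) := by
  have h1 := (contDiff_dz h.smooth b).continuous
  have h2 := (contDiff_dzb h.smooth b).continuous
  have h3 := h.smooth.continuous
  unfold genFun
  fun_prop

section Projections

variable [NeZero n]

theorem hproj_toL2_of_ne (h : IsHarm p q Y) {j : ℤ × ℤ} (hj : j ≠ (p, q)) :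
    hproj j (toL2 (res Y)) = 0 :=
  (isOrthDecomp_harm n).proj_of_mem_ne hj h.mem_harm

theorem hproj_mul_up (h : IsHarm p q Y) (b : Cn n) :
    hproj (p + 1, q) (mulOp (cell b) (toL2 (res Y))) = toL2 (res (up p q b Y)) := by
  rw [toL2_up_add h, map_add, map_smul, hproj_toL2 (h.up b),
    hproj_toL2_of_ne (h.dzb b) (by simp), smul_zero, add_zero]

theorem hproj_mul_down (h : IsHarm p q Y) (b : Cn n) :
    hproj (p, q - 1) (mulOp (cell b) (toL2 (res Y))) =
      ((n + p + q - 1 : ℂ))⁻¹ • toL2 (res (dzb b Y)) := by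
  rw [toL2_up_add h, map_add, map_smul, hproj_toL2 (h.dzb b),
    hproj_toL2_of_ne (h.up b) (by simp), zero_add]

theorem hproj_mulc_up (h : IsHarm p q Y) (b : Cn n) :
    hproj (p, q + 1) (mulOp (star (cell b)) (toL2 (res Y))) = toL2 (res (upc p q b Y)) := by
  rw [toL2_upc_add h, map_add, map_smul, hproj_toL2 (h.upc b),
    hproj_toL2_of_ne (h.dz b) (by simp), smul_zero, add_zero]

theorem hproj_mulc_down (h : IsHarm p q Y) (b : Cn n) :
    hproj (p - 1, q) (mulOp (star (cell b)) (toL2 (res Y))) =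
      ((n + p + q - 1 : ℂ))⁻¹ • toL2 (res (dz b Y)) := by
  rw [toL2_upc_add h, map_add, map_smul, hproj_toL2 (h.dz b),
    hproj_toL2_of_ne (h.upc b) (by simp), zero_add]

/-- The component of degree `(p, q)` of the generator of the hyperbolic group in direction `b` for
the action of weight `m`. -/
def genOp (n : ℕ) (m : ℤ) (b : Cn n) (i : ℤ × ℤ) : L2S n →L[ℂ] L2S n :=
  hproj i ∘L ((((i.1 - 1 + m : ℝ) : ℂ) • (mulOp (cell b) ∘L hproj (i.1 - 1, i.2))) +
    (((i.2 - 1 : ℝ) : ℂ) • (mulOp (star (cell b)) ∘L hproj (i.1, i.2 - 1))) -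
    (((i.1 + n : ℝ) : ℂ) • (mulOp (star (cell b)) ∘L hproj (i.1 + 1, i.2))) -
    (((i.2 + n - m : ℝ) : ℂ) • (mulOp (cell b) ∘L hproj (i.1, i.2 + 1))))

/-- The factor `n + p + q - 1` can be cancelled: where it is zero, the degree of `∂̄_b Y` is
negative in `z` or in `z̄`, so that `∂̄_b Y = 0` and the junk value of the inverse does not matter.
-/
theorem dzb_eq_mul_inv (h : IsHarm p q Y) (b z : Cn n) :
    dzb b Y z = (n + p + q - 1) * ((n + p + q - 1 : ℂ)⁻¹ * dzb b Y z) := by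
  by_cases h0 : (n + p + q - 1 : ℂ) = 0
  · have h0' : (n : ℤ) + p + q - 1 = 0 := by exact_mod_cast h0
    have hn := NeZero.one_le (n := n)
    have : dzb b Y z = 0 := by
      by_cases hq : q - 1 < 0
      · exact (h.dzb b).eq_zero_of_right_neg hq z
      · exact (h.dzb b).eq_zero_of_left_neg (by omega) z
    simp [this]
  · field_simp

theorem dz_eq_mul_inv (h : IsHarm p q Y) (b z : Cn n) :
    dz b Y z = (n + p + q - 1) * ((n + p + q - 1 : ℂ)⁻¹ * dz b Y z) := by
  have h1 := dzb_eq_mul_inv h.conj b z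
  rw [conj_dzb (differentiableAt_of_smooth h.smooth.contDiffAt)] at h1
  have h2 := congrArg (starRingEnd ℂ) h1
  simp only [map_mul, map_inv₀, map_sub, map_add, Complex.conj_conj, map_natCast, map_intCast,
    map_one] at h2
  rw [show (n + q + p - 1 : ℂ) = n + p + q - 1 by ring] at h2
  exact h2

/-- `genOp` is the adjoint of the operator `Y ↦ genFun p q m b Y`: on the sphere the latter is a
combination of the four parts of bidegrees `(p ± 1, q)` and `(p, q ± 1)` of `(b̄ · ζ) Y` and
`(b · ζ̄) Y`, since derivatives of `Y` are multiples of the lowered parts. -/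
theorem inner_genFun (h : IsHarm p q Y) (m : ℤ) (b : Cn n) (w : L2S n) :
    ⟪toL2 (res (genFun p q m b Y)), w⟫_ℂ = ⟪toL2 (res Y), genOp n m b (p, q) w⟫_ℂ := by
  have hX : toL2 (res (genFun p q m b Y)) =
      ((p - 1 + m : ℝ) : ℂ) • hproj (p - 1, q) (mulOp (star (cell b)) (toL2 (res Y))) +
      ((q - 1 : ℝ) : ℂ) • hproj (p, q - 1) (mulOp (cell b) (toL2 (res Y))) +
      ((-(p + n) : ℝ) : ℂ) • hproj (p + 1, q) (mulOp (cell b) (toL2 (res Y))) +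
      ((-(q + n - m) : ℝ) : ℂ) • hproj (p, q + 1) (mulOp (star (cell b)) (toL2 (res Y))) := by
    have c1 := (h.dz b).continuous_res
    have c2 := (h.dzb b).continuous_res
    have c3 := (h.up b).continuous_res
    have c4 := (h.upc b).continuous_res
    rw [hproj_mulc_down h, hproj_mul_down h, hproj_mul_up h, hproj_mulc_up h, smul_smul, smul_smul,
      ← toL2_const_mul c1, ← toL2_const_mul c2, ← toL2_const_mul c3, ← toL2_const_mul c4,
      ← toL2_add (by fun_prop) (by fun_prop), ← toL2_add (by fun_prop) (by fun_prop),
      ← toL2_add (by fun_prop) (by fun_prop)]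
    congr 1
    funext ζ
    have e1 := dz_eq_mul_inv h b (ζ : Cn n)
    have e2 := dzb_eq_mul_inv h b (ζ : Cn n)
    simp only [res, genFun, up, upc, nsq_sph]
    push_cast
    linear_combination e1 + e2
  have hp : ∀ j (x y : L2S n), ⟪hproj j x, y⟫_ℂ = ⟪x, hproj j y⟫_ℂ := fun j x y =>
    Submodule.inner_starProjection_left_eq_right _ _ _
  have hs : star (star (cell b)) = cell b := star_star _
  rw [hX, genOp, ContinuousLinearMap.comp_apply, ← hp, hproj_toL2 h]
  simp only [sub_apply, add_apply, smul_apply, ContinuousLinearMap.comp_apply, inner_add_left,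
    inner_add_right,
    inner_sub_right, inner_smul_left, inner_smul_right, Complex.conj_ofReal, hp, inner_mulOp, hs]
  push_cast
  ring

end Projections

end Generator

/-! ### The flow of a hyperbolic group -/

section Flow

variable {n : ℕ} {b : Cn n} {p q : ℤ} {Y Z : Cn n → ℂ}

/-- `J(a_t, z)` as a function of `(t, z)`. -/
def hypJ (b : Cn n) (x : ℝ × Cn n) : ℂ := (Real.sinh x.1 : ℂ) * ell b x.2 + (Real.cosh x.1 : ℂ)

/-- `a_t.z` as a function of `(t, z)`. -/
def hypV (b : Cn n) (x : ℝ × Cn n) : Cn n :=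
  (hypJ b x)⁻¹ • (x.2 + (((Real.cosh x.1 - 1 : ℝ) : ℂ) * ell b x.2 + (Real.sinh x.1 : ℂ)) • b)

theorem hypJ_eq (hb : ‖b‖ = 1) (t : ℝ) (z : Cn n) : hypJ b (t, z) = autJ (hyp hb t) z := by
  rw [autJ_hyp]; rfl

theorem hypV_eq (hb : ‖b‖ = 1) (t : ℝ) (z : Cn n) : hypV b (t, z) = mobius (hyp hb t) z := by
  rw [mobius_hyp, hypV, hypJ_eq hb]; rfl

theorem contDiff_sinh_fst : ContDiff ℝ ∞ fun x : ℝ × Cn n => (Real.sinh x.1 : ℂ) :=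
  Complex.ofRealCLM.contDiff.comp (Real.contDiff_sinh.comp contDiff_fst)

theorem contDiff_cosh_fst : ContDiff ℝ ∞ fun x : ℝ × Cn n => (Real.cosh x.1 : ℂ) :=
  Complex.ofRealCLM.contDiff.comp (Real.contDiff_cosh.comp contDiff_fst)

theorem contDiff_ell_snd (b : Cn n) : ContDiff ℝ ∞ fun x : ℝ × Cn n => ell b x.2 :=
  (ell b).contDiff.comp contDiff_snd

theorem contDiff_hypJ (b : Cn n) : ContDiff ℝ ∞ (hypJ b) :=
  (contDiff_sinh_fst.mul (contDiff_ell_snd b)).add contDiff_cosh_fst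

theorem contDiffAt_hypV (b : Cn n) {x : ℝ × Cn n} (hx : hypJ b x ≠ 0) :
    ContDiffAt ℝ ∞ (hypV b) x := by
  refine ((contDiff_hypJ b).contDiffAt.inv hx).smul ?_
  refine (contDiff_snd.add (ContDiff.smul (ContDiff.add (ContDiff.mul ?_ (contDiff_ell_snd b))
    contDiff_sinh_fst) contDiff_const)).contDiffAt
  exact Complex.ofRealCLM.contDiff.comp ((Real.contDiff_cosh.comp contDiff_fst).sub contDiff_const)

/-- `J^m |J|^{-2n} Z ∘ a_t` as a function of `(t, z)`. -/
def hypT (m : ℤ) (b : Cn n) (Z : Cn n → ℂ) (x : ℝ × Cn n) : ℂ :=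
  hypJ b x ^ m * (hypJ b x * (starRingEnd ℂ) (hypJ b x)) ^ (-(n : ℤ)) * Z (hypV b x)

theorem hypT_eq (hb : ‖b‖ = 1) (m : ℤ) (t : ℝ) (ζ : Sph n) :
    hypT m b Z (t, ζ) = actTest m (hyp hb t) (res Z) ζ := by
  rw [hypT, hypJ_eq hb, hypV_eq hb, actTest, Complex.mul_conj']
  congr 2
  push_cast
  rw [← zpow_natCast, ← zpow_mul]
  congr 1
  push_cast
  ring

theorem contDiffAt_hypT (m : ℤ) (hZ : ContDiff ℝ ∞ Z) {x : ℝ × Cn n} (hx : hypJ b x ≠ 0) :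
    ContDiffAt ℝ ∞ (hypT m b Z) x := by
  have h1 : ContDiffAt ℝ ∞ (hypJ b) x := (contDiff_hypJ b).contDiffAt
  have h2 : ContDiffAt ℝ ∞ (fun x => (starRingEnd ℂ) (hypJ b x)) x :=
    Complex.conjCLE.contDiff.contDiffAt.comp x h1
  refine ((contDiffAt_zpow_of_ne h1 hx m).mul (contDiffAt_zpow_of_ne (h1.mul h2) ?_ _)).mul
    (hZ.contDiffAt.comp x (contDiffAt_hypV b hx))
  exact mul_ne_zero hx (by simpa using hx)

theorem hypJ_ne_zero (hb : ‖b‖ = 1) (t : ℝ) {z : Cn n} (hz : ‖z‖ ≤ 1) : hypJ b (t, z) ≠ 0 := by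
  rw [hypJ_eq hb]; exact autJ_ne_zero _ hz

theorem hasDerivAt_hypT (hb : ‖b‖ = 1) (m : ℤ) (hZ : ContDiff ℝ ∞ Z) (t : ℝ) (ζ : Sph n) :
    HasDerivAt (fun t => hypT m b Z (t, ζ)) (fderiv ℝ (hypT m b Z) (t, ζ) (1, 0)) t := by
  have h1 := (contDiffAt_hypT m hZ (hypJ_ne_zero hb t (norm_sph ζ).le)).differentiableAt
    (by simp) |>.hasFDerivAt
  have h2 : HasDerivAt (fun t : ℝ => (t, (ζ : Cn n))) (1, 0) t :=
    (hasDerivAt_id t).prodMk (hasDerivAt_const t _)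
  exact h1.comp_hasDerivAt t h2

/-- The flow starts in the direction `b - (b̄ · z) z`, and Euler's identities turn the derivative of
the harmonic in the direction `(b̄ · z) z` into a multiple of it. -/
theorem hasDerivAt_hypT_zero (m : ℤ) (hY : IsHarm p q Y) (z : Cn n) :
    HasDerivAt (fun t => hypT m b (fun y => (starRingEnd ℂ) (Y y)) (t, z))
      ((starRingEnd ℂ) (genFun p q m b Y z)) 0 := by
  set Z := fun y => (starRingEnd ℂ) (Y y)
  have hZ : IsHarm q p Z := hY.conj
  have hJ : HasDerivAt (fun t => hypJ b (t, z)) (ell b z) 0 := by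
    have h1 := (Real.hasDerivAt_sinh 0).ofReal_comp.mul_const (ell b z)
    have h2 := (Real.hasDerivAt_cosh 0).ofReal_comp
    exact HasDerivAt.congr_deriv (h1.add h2) (by simp)
  have hJ0 : hypJ b (0, z) = 1 := by simp [hypJ]
  have hJc : HasDerivAt (fun t => (starRingEnd ℂ) (hypJ b (t, z))) ((starRingEnd ℂ) (ell b z)) 0 :=
    (Complex.conjCLE : ℂ →L[ℝ] ℂ).hasFDerivAt.comp_hasDerivAt (0 : ℝ) hJ
  have hV0 : hypV b (0, z) = z := by simp [hypV, hJ0]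
  have hV : HasDerivAt (fun t => hypV b (t, z)) (-(ell b z) • z + b) 0 := by
    have h1 := hJ.inv (by rw [hJ0]; exact one_ne_zero)
    have h2 := ((((Real.hasDerivAt_cosh 0).sub_const 1).ofReal_comp.mul_const (ell b z)).add
      (Real.hasDerivAt_sinh 0).ofReal_comp).smul_const b
    have h3 := h1.smul (h2.const_add z)
    exact HasDerivAt.congr_deriv h3 (by simp [hJ0, add_comm])
  have hZV : HasDerivAt (fun t => Z (hypV b (t, z))) (dd (-(ell b z) • z + b) Z z) 0 := by
    have h1 := (differentiableAt_of_smooth (hZ.smooth.contDiffAt (x := z))).hasFDerivAt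
    rw [← hV0] at h1
    have h2 := h1.comp_hasDerivAt (0 : ℝ) hV
    rw [hV0] at h2
    exact h2
  have hJm := (hasDerivAt_zpow m (hypJ b (0, z)) (Or.inl (by rw [hJ0]; exact one_ne_zero))).comp
    (0 : ℝ) hJ
  have hJn := (hasDerivAt_zpow (-(n : ℤ)) (hypJ b (0, z) * (starRingEnd ℂ) (hypJ b (0, z)))
    (Or.inl (by rw [hJ0]; simp))).comp (0 : ℝ) (hJ.mul hJc)
  have h := (hJm.mul hJn).mul hZV
  refine h.congr_deriv ?_
  have hdd : dd (-(ell b z) • z + b) Z z = dd b Z z -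
      (q * ell b z + p * (starRingEnd ℂ) (ell b z)) * Z z := by
    have h1 : dd (-(ell b z) • z + b) Z z = dd (-(ell b z) • z) Z z + dd b Z z := by
      unfold dd; rw [map_add]
    rw [h1, euler_aux hZ.smooth hZ.homog, map_neg]
    ring
  have hc : (starRingEnd ℂ) (genFun p q m b Y z) = dd b Z z -
      (p + n) * ((starRingEnd ℂ) (ell b z) * Z z) - (q + n - m) * (ell b z * Z z) := by
    have hd := differentiableAt_of_smooth (hY.smooth.contDiffAt (x := z))
    rw [← dz_add_dzb, conj_dz hd, conj_dzb hd, genFun]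
    simp only [map_sub, map_add, map_mul, Complex.conj_conj, map_natCast, map_intCast, Z]
    ring
  simp only [hV0, hJ0, hdd, hc, Function.comp_apply, one_zpow, map_one, mul_one, one_mul,
    Pi.mul_apply]
  push_cast
  ring

theorem integrable_L2S (w : L2S n) : Integrable w (surf n) :=
  (Lp.memLp w).integrable (by norm_num)

section

variable [NeZero n]

theorem inner_repS (hY : IsHarm p q Y) (m : ℤ) (g : SU n) (w : L2S n) :
    ⟪toL2 (res Y), repS n m g w⟫_ℂ =
      ∫ η, w η * actTest m g (res fun y => (starRingEnd ℂ) (Y y)) η ∂(surf n) := by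
  rw [inner_toL2_left hY.continuous_res, ← integral_repS_mul]
  refine integral_congr_ae (Eventually.of_forall fun ζ => ?_)
  simp only [res]
  ring

/-- The flow is weakly differentiable at `t = 0` against harmonics. The derivative falls on the
smooth kernel `hypT`, so `w` need not be smooth. -/
theorem hasDerivAt_inner_repS_zero (hb : ‖b‖ = 1) (hY : IsHarm p q Y) (m : ℤ) (w : L2S n) :
    HasDerivAt (fun t => ⟪toL2 (res Y), repS n m (hyp hb t) w⟫_ℂ)
      ⟪toL2 (res Y), genOp n m b (p, q) w⟫_ℂ 0 := by
  set Z := fun y => (starRingEnd ℂ) (Y y)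
  have hZ : IsHarm q p Z := hY.conj
  let K : Set (ℝ × Cn n) := Set.Icc (-1) 1 ×ˢ Metric.closedBall 0 1
  have hK : IsCompact K := isCompact_Icc.prod (isCompact_closedBall _ _)
  have hJK : ∀ x ∈ K, hypJ b x ≠ 0 := fun x hx =>
    hypJ_ne_zero hb x.1 (mem_closedBall_zero_iff.1 hx.2)
  have hcont : ContinuousOn (fun x => fderiv ℝ (hypT m b Z) x (1, 0)) K := fun x hx =>
    ((((contDiffAt_hypT m hZ.smooth (hJK x hx)).fderiv_right (m := 0)
      (by simp)).continuousAt).clm_apply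
      continuousAt_const).continuousWithinAt
  obtain ⟨C, hC⟩ := hK.exists_bound_of_continuousOn hcont
  have hmem : ∀ t ∈ Set.Icc (-1 : ℝ) 1, ∀ ζ : Sph n, (t, (ζ : Cn n)) ∈ K := fun t ht ζ =>
    ⟨ht, mem_closedBall_zero_iff.2 (norm_sph ζ).le⟩
  have hTc : ∀ t : ℝ, Continuous fun ζ : Sph n => hypT m b Z (t, ζ) := fun t =>
    continuous_iff_continuousAt.2 fun ζ =>
      (contDiffAt_hypT m hZ.smooth (hypJ_ne_zero hb t (norm_sph ζ).le)).continuousAt.comp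
        (f := fun ζ : Sph n => (t, (ζ : Cn n))) (by fun_prop)
  -- differentiation under the integral sign, with the bound `C` of the derivative on the compact
  -- set `K`
  have h := (hasDerivAt_integral_of_dominated_loc_of_deriv_le (μ := surf n) (x₀ := (0 : ℝ))
    (s := Set.Icc (-1) 1) (F := fun t (ζ : Sph n) => w ζ * hypT m b Z (t, ζ))
    (F' := fun t (ζ : Sph n) => w ζ * fderiv ℝ (hypT m b Z) (t, ζ) (1, 0))
    (bound := fun ζ => ‖w ζ‖ * C) (Icc_mem_nhds (by norm_num) (by norm_num))
    (Eventually.of_forall fun t =>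
      (Lp.aestronglyMeasurable w).mul (hTc t).aestronglyMeasurable)
    (((integrable_L2S w).mul_bdd (c := sSup (Set.range fun ζ : Sph n => ‖hypT m b Z (0, ζ)‖))
      (hTc 0).aestronglyMeasurable (Eventually.of_forall fun ζ => le_csSup
        (isCompact_range (hTc 0).norm).bddAbove ⟨ζ, rfl⟩)))
    ((Lp.aestronglyMeasurable w).mul (hcont.comp_continuous (by fun_prop)
      (hmem 0 (by norm_num))).aestronglyMeasurable)
    (Eventually.of_forall fun ζ t ht => by
      rw [norm_mul]; gcongr; exact hC _ (hmem t ht ζ))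
    ((integrable_L2S w).norm.mul_const _)
    (Eventually.of_forall fun ζ t _ => (hasDerivAt_hypT hb m hZ.smooth t ζ).const_mul _)).2
  have h1 : (fun t => ⟪toL2 (res Y), repS n m (hyp hb t) w⟫_ℂ) =
      fun t => ∫ ζ : Sph n, w ζ * hypT m b Z (t, ζ) ∂(surf n) := by
    funext t
    rw [inner_repS hY]
    simp only [hypT_eq hb]
    rfl
  rw [h1]
  refine h.congr_deriv ?_
  rw [← inner_genFun hY, inner_toL2_left (f := res (genFun p q m b Y))
    ((continuous_genFun hY m b).comp continuous_subtype_val)]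
  refine integral_congr_ae (Eventually.of_forall fun ζ => ?_)
  have h2 := (hasDerivAt_hypT hb m hZ.smooth 0 ζ).unique (hasDerivAt_hypT_zero m hY (ζ : Cn n))
  simp only
  rw [h2, mul_comm]
  rfl

/-- Weak differentiability at all times, by the group law. -/
theorem hasDerivAt_inner_repS (hb : ‖b‖ = 1) (hY : IsHarm p q Y) (m : ℤ) (w : L2S n) (t : ℝ) :
    HasDerivAt (fun t => ⟪toL2 (res Y), repS n m (hyp hb t) w⟫_ℂ)
      ⟪toL2 (res Y), genOp n m b (p, q) (repS n m (hyp hb t) w)⟫_ℂ t := by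
  have h := hasDerivAt_inner_repS_zero hb hY m (repS n m (hyp hb t) w)
  have h1 : (fun s => ⟪toL2 (res Y), repS n m (hyp hb s) w⟫_ℂ) =
      fun s => ⟪toL2 (res Y), repS n m (hyp hb (s - t)) (repS n m (hyp hb t) w)⟫_ℂ := by
    funext s
    have h2 : repS n m (hyp hb s) = repS n m (hyp hb (s - t)) * repS n m (hyp hb t) := by
      rw [← map_mul, ← hyp_add, sub_add_cancel]
    rw [h2]
    rfl
  rw [h1]
  exact HasDerivAt.comp_sub_const t t (by rwa [sub_self])

/-- Strong continuity of the flow on continuous functions. -/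
theorem continuous_repS_hyp (hb : ‖b‖ = 1) (m : ℤ) {f : Sph n → ℂ} (hf : Continuous f) :
    Continuous fun t => repS n m (hyp hb t) (toL2 f) := by
  have hJ : Continuous fun x : ℝ × Sph n => hypJ b (-x.1, (x.2 : Cn n)) :=
    (contDiff_hypJ b).continuous.comp (by fun_prop)
  have hJ0 : ∀ x : ℝ × Sph n, hypJ b (-x.1, (x.2 : Cn n)) ≠ 0 := fun x =>
    hypJ_ne_zero hb _ (norm_sph x.2).le
  have hV : Continuous fun x : ℝ × Sph n => hypV b (-x.1, (x.2 : Cn n)) :=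
    continuous_iff_continuousAt.2 fun x => (contDiffAt_hypV b (hJ0 x)).continuousAt.comp
      (f := fun x : ℝ × Sph n => (-x.1, (x.2 : Cn n))) (by fun_prop)
  have hmem : ∀ x : ℝ × Sph n, hypV b (-x.1, (x.2 : Cn n)) ∈ Metric.sphere (0 : Cn n) 1 :=
    fun x => by
    rw [hypV_eq hb]; exact mobius_mem_sphere _ _
  let F : C(ℝ × Sph n, ℂ) := ⟨fun x => hypJ b (-x.1, (x.2 : Cn n)) ^ (-m) *
    f ⟨hypV b (-x.1, (x.2 : Cn n)), hmem x⟩,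
    (hJ.zpow₀ _ fun x => Or.inl (hJ0 x)).mul (hf.comp (hV.subtype_mk hmem))⟩
  have h1 : (fun t => repS n m (hyp hb t) (toL2 f)) = fun t => cls n (F.curry t) := by
    funext t
    rw [repS_toL2 m _ hf, hyp_neg]
    have h2 : (fun ζ : Sph n => autJ (hyp hb (-t)) (ζ : Cn n) ^ (-m) *
        f (sphMobius (hyp hb (-t)) ζ)) = F.curry t := by
      funext ζ
      simp only [F, ContinuousMap.curry_apply, ContinuousMap.coe_mk, hypJ_eq hb]
      congr 2
      exact Subtype.ext (hypV_eq hb _ _).symm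
    rw [h2, toL2_eq_cls (F.curry t).continuous]
    rfl
  rw [h1]
  exact (cls n).continuous.comp F.curry.continuous

/-- The components of the flow of a continuous function are differentiable. -/
theorem hasDerivAt_hproj_repS (hb : ‖b‖ = 1) (m : ℤ) {f : Sph n → ℂ} (hf : Continuous f)
    (i : ℤ × ℤ) (t : ℝ) : HasDerivAt (fun t => hproj i (repS n m (hyp hb t) (toL2 f)))
      (genOp n m b i (repS n m (hyp hb t) (toL2 f))) t := by
  set u : ℝ → L2S n := fun t => repS n m (hyp hb t) (toL2 f)
  have hu : Continuous u := continuous_repS_hyp hb m hf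
  have hAu : Continuous fun t => genOp n m b i (u t) := (genOp n m b i).continuous.comp hu
  -- a weak derivative that is continuous is a strong one: the primitive `G` of the derivative
  -- agrees with the component, as both have the same inner products with harmonics
  let G : ℝ → L2S n := fun t => hproj i (u 0) + ∫ s in (0 : ℝ)..t, genOp n m b i (u s)
  have hG : ∀ t, HasDerivAt G (genOp n m b i (u t)) t := fun t =>
    (intervalIntegral.integral_hasDerivAt_right (hAu.intervalIntegrable _ _)
      hAu.stronglyMeasurable.stronglyMeasurableAtFilter hAu.continuousAt).const_add _
  have hmemA : ∀ x, genOp n m b i x ∈ harm n i := fun x => proj_mem (V := harm n) i _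
  have hclosed : IsClosed (harm n i : Set (L2S n)) := Submodule.isClosed_topologicalClosure _
  have hGp : ∀ t, hproj i (G t) = G t := by
    intro t
    simp only [G, map_add]
    rw [← ContinuousLinearMap.intervalIntegral_comp_comm _ (hAu.intervalIntegrable _ _)]
    congr 1
    · exact proj_of_mem (V := harm n) (proj_mem (V := harm n) i _)
    · refine intervalIntegral.integral_congr fun s _ => proj_of_mem (V := harm n) (hmemA _)
  have key : ∀ t, G t = hproj i (u t) := by
    intro t
    have h1 : G t - hproj i (u t) ∈ harm n i :=
      Submodule.sub_mem _ (by rw [← hGp t]; exact proj_mem (V := harm n) i _)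
        (proj_mem (V := harm n) i _)
    have h2 : ∀ v ∈ harm n i, ⟪v, G t - hproj i (u t)⟫_ℂ = 0 := by
      intro v hv
      refine harm_induction (P := fun v => ⟪v, G t - hproj i (u t)⟫_ℂ = 0) ?_ (fun Y hY => ?_)
        (inner_zero_left _) (fun v w h1 h2 => by rw [inner_add_left, h1, h2, add_zero])
        (fun c v h => by rw [inner_smul_left, h, mul_zero]) hv
      · exact isClosed_eq (continuous_id.inner continuous_const) continuous_const
      · have hYi : hproj i (toL2 (res Y)) = toL2 (res Y) := hproj_toL2 hY
        have hd : ∀ s, HasDerivAt (fun s => ⟪toL2 (res Y), G s⟫_ℂ - ⟪toL2 (res Y), u s⟫_ℂ) 0 s := by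
          intro s
          have e1 := ((innerSL ℂ (toL2 (res Y))).restrictScalars ℝ).hasFDerivAt.comp_hasDerivAt s
            (hG s)
          have e2 := hasDerivAt_inner_repS hb hY m (toL2 f) s
          have e3 := e1.sub e2
          simp only [ContinuousLinearMap.coe_restrictScalars', innerSL_apply_apply, Prod.mk.eta]
            at e3
          rw [sub_self] at e3
          exact e3
        have hconst := is_const_of_deriv_eq_zero (fun s => (hd s).differentiableAt)
          (fun s => (hd s).deriv) t 0
        have h0 : ⟪toL2 (res Y), G 0⟫_ℂ = ⟪toL2 (res Y), u 0⟫_ℂ := by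
          simp only [G, intervalIntegral.integral_same, add_zero]
          rw [← Submodule.inner_starProjection_left_eq_right, hYi]
        have h3 : ⟪toL2 (res Y), hproj i (u t)⟫_ℂ = ⟪toL2 (res Y), u t⟫_ℂ := by
          rw [← Submodule.inner_starProjection_left_eq_right, hYi]
        rw [inner_sub_right, h3, hconst, h0, sub_self]
    exact sub_eq_zero.1 (inner_self_eq_zero.1 (h2 _ h1))
  have h3 : (fun t => hproj i (u t)) = G := funext fun t => (key t).symm
  rw [h3]
  exact hG t

end

end Flow

/-! ### Slowly decaying weights -/

section Weights

/-- A positive decreasing sequence that decays at most polynomially. -/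
structure TameSeq (C : ℝ) (f : ℕ → ℝ) : Prop where
  pos : ∀ k, 0 < f k
  anti : ∀ k, f (k + 1) ≤ f k
  ratio : ∀ k, f k ≤ C * f (k + 1)
  slope : ∀ k, k * (f k - f (k + 1)) ≤ C * f (k + 1)

theorem TameSeq.one_le {C : ℝ} {f : ℕ → ℝ} (h : TameSeq C f) : 1 ≤ C := by
  have h1 := (h.anti 0).trans (h.ratio 0)
  have h2 := h.pos (0 + 1)
  nlinarith

theorem TameSeq.mul {C D : ℝ} {f g : ℕ → ℝ} (hf : TameSeq C f) (hg : TameSeq D g) :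
    TameSeq (2 * C * D) fun k => f k * g k := by
  have hC := hf.one_le
  have hD := hg.one_le
  refine ⟨fun k => mul_pos (hf.pos k) (hg.pos k), fun k => ?_, fun k => ?_, fun k => ?_⟩
  · exact mul_le_mul (hf.anti k) (hg.anti k) (hg.pos _).le (hf.pos _).le
  all_goals
    have f1 := hf.pos (k + 1)
    have g1 := hg.pos (k + 1)
    have h1 : 0 < C * D * (f (k + 1) * g (k + 1)) := by positivity
  · have := mul_le_mul (hf.ratio k) (hg.ratio k) (hg.pos _).le (by positivity)
    nlinarith
  · have e1 := mul_le_mul (hf.slope k) (hg.ratio k) (hg.pos _).le (by positivity)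
    have e2 := mul_le_mul_of_nonneg_left (hg.slope k) f1.le
    have e3 : D * (f (k + 1) * g (k + 1)) ≤ C * D * (f (k + 1) * g (k + 1)) :=
      mul_le_mul_of_nonneg_right (by nlinarith) (by positivity)
    nlinarith

/-- Negative powers of sequences that grow at most polynomially are tame. -/
theorem TameSeq.rpow {R s : ℝ} {v : ℕ → ℝ} (hs : 0 ≤ s) (hR : 1 ≤ R) (pos : ∀ k, 0 < v k)
    (mono : ∀ k, v k ≤ v (k + 1)) (ratio : ∀ k, v (k + 1) ≤ R * v k)
    (slope : ∀ k : ℕ, k * (v (k + 1) - v k) ≤ R * v k) :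
    TameSeq (R ^ s * (1 + s * R)) fun k => v k ^ (-s) := by
  have hRs : 0 < R ^ s := Real.rpow_pos_of_pos (by linarith) s
  have hr : ∀ k, v k ^ (-s) ≤ R ^ s * v (k + 1) ^ (-s) := fun k => by
    have h1 := pos k
    have h2 : v (k + 1) ^ s ≤ R ^ s * v k ^ s := by
      rw [← Real.mul_rpow (by linarith) h1.le]
      exact Real.rpow_le_rpow (pos _).le (ratio k) hs
    have h3 := Real.rpow_pos_of_pos h1 s
    have h4 := Real.rpow_pos_of_pos (pos (k + 1)) s
    rw [Real.rpow_neg h1.le, Real.rpow_neg (pos _).le, ← div_eq_mul_inv, inv_eq_one_div,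
      div_le_div_iff₀ h3 h4]
    linarith
  refine ⟨fun k => Real.rpow_pos_of_pos (pos k) _,
    fun k => Real.rpow_le_rpow_of_nonpos (pos k) (mono k) (by linarith), fun k => ?_, fun k => ?_⟩
  · refine (hr k).trans ?_
    have h1 := Real.rpow_pos_of_pos (pos (k + 1)) (-s)
    have h2 : R ^ s ≤ R ^ s * (1 + s * R) := le_mul_of_one_le_right hRs.le (by nlinarith)
    gcongr
  · have hv := pos k
    have hw := Real.rpow_pos_of_pos hv (-s)
    have hx : 0 < v (k + 1) / v k := div_pos (pos _) hv
    -- Bernoulli: `x ^ (-s) ≥ 1 - s (x - 1)`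
    have hB : 1 - s * (v (k + 1) / v k - 1) ≤ (v (k + 1) / v k) ^ (-s) := by
      rw [Real.rpow_def_of_pos hx]
      have h1 := Real.add_one_le_exp (Real.log (v (k + 1) / v k) * -s)
      have h2 := Real.log_le_sub_one_of_pos hx
      nlinarith
    have h1 : v (k + 1) ^ (-s) = (v (k + 1) / v k) ^ (-s) * v k ^ (-s) := by
      rw [← Real.mul_rpow hx.le hv.le, div_mul_cancel₀ _ hv.ne']
    have h2 : v k ^ (-s) - v (k + 1) ^ (-s) ≤ s * (v (k + 1) / v k - 1) * v k ^ (-s) := by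
      rw [h1]; nlinarith
    have h3 : (k : ℝ) * (v (k + 1) / v k - 1) ≤ R := by
      rw [div_sub_one hv.ne', ← mul_div_assoc, div_le_iff₀ hv]
      exact slope k
    calc (k : ℝ) * (v k ^ (-s) - v (k + 1) ^ (-s))
        ≤ k * (s * (v (k + 1) / v k - 1) * v k ^ (-s)) := by gcongr
      _ = s * (k * (v (k + 1) / v k - 1)) * v k ^ (-s) := by ring
      _ ≤ s * R * v k ^ (-s) := by gcongr
      _ ≤ (1 + s * R) * v k ^ (-s) := by gcongr; linarith
      _ ≤ (1 + s * R) * (R ^ s * v (k + 1) ^ (-s)) :=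
          mul_le_mul_of_nonneg_left (hr k) (by positivity)
      _ = _ := by ring

/-- A weight on bidegrees that is tame in each degree. -/
structure Tame (C : ℝ) (w : ℤ × ℤ → ℝ) : Prop where
  pos : ∀ i, 0 < w i
  left : ∀ q : ℕ, TameSeq C fun k : ℕ => w (k, q)
  right : ∀ p : ℕ, TameSeq C fun k : ℕ => w (p, k)

theorem Tame.mul {C D : ℝ} {v w : ℤ × ℤ → ℝ} (hv : Tame C v) (hw : Tame D w) :
    Tame (2 * C * D) fun i => v i * w i :=
  ⟨fun i => mul_pos (hv.pos i) (hw.pos i), fun q => (hv.left q).mul (hw.left q),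
    fun p => (hv.right p).mul (hw.right p)⟩

/-- The Sobolev weights `(1 + λ_{p,q})^{-2r}` are tame, as `λ_{p,q}` is a polynomial in each degree.
-/
theorem tame_wt_sq (n : ℕ) [NeZero n] {r : ℝ} (hr : 0 ≤ r) :
    Tame ((2 * n + 3 : ℝ) ^ (2 * r) * (1 + 2 * r * (2 * n + 3))) fun i => wt n r i ^ 2 := by
  have hn : (1 : ℝ) ≤ n := by exact_mod_cast NeZero.one_le (n := n)
  have h2 : ∀ i, wt n r i ^ 2 = (1 + lamPos n i) ^ (-(2 * r)) := fun i => by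
    rw [wt, ← Real.rpow_natCast, ← Real.rpow_mul (by linarith [one_le_lamPos (n := n) i])]
    congr 1
    push_cast
    ring
  have hl : ∀ k q : ℕ, lamPos n ((k : ℤ), (q : ℤ)) =
      if n = 1 then ((k : ℝ) + q) ^ 2 else 4 * k * q + (2 * n - 2) * (k + q) := fun k q => by
    rw [lamPos_eq (by simp) (by simp), lam]
    push_cast
    rfl
  have key : ∀ q : ℕ, TameSeq ((2 * n + 3 : ℝ) ^ (2 * r) * (1 + 2 * r * (2 * n + 3)))
      fun k : ℕ => (1 + lamPos n ((k : ℤ), (q : ℤ))) ^ (-(2 * r)) := by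
    intro q
    refine TameSeq.rpow (v := fun k : ℕ => 1 + lamPos n ((k : ℤ), (q : ℤ))) (by linarith)
      (by linarith) (fun k => by linarith [one_le_lamPos (n := n) ((k : ℤ), (q : ℤ))])
      (fun k => ?_) (fun k => ?_) (fun k => ?_)
    all_goals
      have hk : (0 : ℝ) ≤ k := k.cast_nonneg
      have hq : (0 : ℝ) ≤ q := q.cast_nonneg
      simp only [hl]
      push_cast
      split_ifs with h1
    · nlinarith
    · nlinarith [mul_nonneg hk hq]
    · nlinarith [mul_nonneg (by linarith : (0 : ℝ) ≤ n) (sq_nonneg ((k : ℝ) + q)),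
        sq_nonneg ((k : ℝ) + q - 1)]
    · have hn2 : (2 : ℝ) ≤ n := by
        have : 2 ≤ n := by have := NeZero.one_le (n := n); omega
        exact_mod_cast this
      nlinarith [mul_nonneg hk hq, mul_nonneg (by linarith : (0 : ℝ) ≤ n) (mul_nonneg hk hq),
        mul_nonneg (by linarith : (0 : ℝ) ≤ n - 2) hq,
        mul_nonneg (by linarith : (0 : ℝ) ≤ n - 2) hk,
        mul_nonneg (by linarith : (0 : ℝ) ≤ n) (mul_nonneg (by linarith : (0 : ℝ) ≤ n - 2) hq),
        mul_nonneg (by linarith : (0 : ℝ) ≤ n) (mul_nonneg (by linarith : (0 : ℝ) ≤ n - 2) hk)]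
    · have hkk : (k : ℝ) ≤ (k : ℝ) ^ 2 := by
        have : k ≤ k ^ 2 := Nat.le_self_pow two_ne_zero k
        exact_mod_cast this
      nlinarith [mul_nonneg hk hq, mul_nonneg (by linarith : (0 : ℝ) ≤ n) (sq_nonneg ((k : ℝ) + q))]
    · nlinarith [mul_nonneg hk hq, mul_nonneg (by linarith : (0 : ℝ) ≤ n) (mul_nonneg hk hq),
        mul_nonneg (by linarith : (0 : ℝ) ≤ n - 1) hq,
        mul_nonneg (by linarith : (0 : ℝ) ≤ n - 1) hk,
        mul_nonneg (by linarith : (0 : ℝ) ≤ n) (mul_nonneg (by linarith : (0 : ℝ) ≤ n - 1) hq),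
        mul_nonneg (by linarith : (0 : ℝ) ≤ n) (mul_nonneg (by linarith : (0 : ℝ) ≤ n - 1) hk)]
  refine ⟨fun i => by have := wt_pos (n := n) r i; positivity, fun q => ?_, fun p => ?_⟩
  · simp only [h2]; exact key q
  · simp only [h2]
    have : ∀ k : ℕ, lamPos n ((p : ℤ), (k : ℤ)) = lamPos n ((k : ℤ), (p : ℤ)) := fun k =>
      lamPos_swap ((k : ℤ), (p : ℤ))
    simp only [this]
    exact key p

/-- The regularizing weight `((1 + ε |p|) (1 + ε |q|))^{-4}`. -/
def regWt (ε : ℝ) (i : ℤ × ℤ) : ℝ := ((1 + ε * |(i.1 : ℝ)|) * (1 + ε * |(i.2 : ℝ)|)) ^ (-(4 : ℝ))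

/-- The regularizing weights are tame with a constant that does not depend on `ε`. -/
theorem tame_regWt {ε : ℝ} (h0 : 0 < ε) (h1 : ε ≤ 1) :
    Tame ((2 : ℝ) ^ (4 : ℝ) * (1 + 4 * 2)) (regWt ε) := by
  have key : ∀ q : ℕ, TameSeq ((2 : ℝ) ^ (4 : ℝ) * (1 + 4 * 2))
      fun k : ℕ => ((1 + ε * k) * (1 + ε * q)) ^ (-(4 : ℝ)) := by
    intro q
    have hq : 0 < 1 + ε * q := by positivity
    refine TameSeq.rpow (v := fun k : ℕ => (1 + ε * k) * (1 + ε * q)) (by norm_num) (by norm_num)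
      (fun k => by positivity) (fun k => ?_) (fun k => ?_) (fun k => ?_)
    · gcongr; simp
    all_goals
      push_cast
      have : 0 ≤ ε * k := by positivity
    · rw [← mul_assoc]; gcongr; nlinarith
    · have : k * ((1 + ε * (k + 1)) * (1 + ε * q) - (1 + ε * k) * (1 + ε * q)) =
          (ε * k) * (1 + ε * q) := by ring
      rw [this, ← mul_assoc]
      exact mul_le_mul_of_nonneg_right (by linarith) hq.le
  refine ⟨fun i => by unfold regWt; positivity, fun q => ?_, fun p => ?_⟩
  · simpa only [regWt, Int.cast_natCast, Nat.abs_cast] using key q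
  · simpa only [regWt, Int.cast_natCast, Nat.abs_cast, mul_comm] using key p

theorem summable_int_inv_sq : Summable fun p : ℤ => ((1 + |(p : ℝ)|) ^ 2)⁻¹ := by
  have h : Summable fun k : ℕ => ((1 + (k : ℝ)) ^ 2)⁻¹ := by
    have := (summable_nat_add_iff 1).2 (Real.summable_nat_pow_inv (p := 2).2 (by norm_num))
    refine this.congr fun k => ?_
    push_cast
    rw [add_comm]
  refine Summable.of_nat_of_neg ?_ ?_ <;> simpa using h

theorem summable_regWt {ε : ℝ} (h0 : 0 < ε) (h1 : ε ≤ 1) :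
    Summable fun i : ℤ × ℤ => regWt ε i * (1 + |(i.1 : ℝ)| + |(i.2 : ℝ)|) := by
  have hs := (summable_int_inv_sq.mul_of_nonneg summable_int_inv_sq (fun _ => by positivity)
    fun _ => by positivity).mul_left (ε ^ 8)⁻¹
  refine Summable.of_nonneg_of_le (fun i => ?_) (fun i => ?_) hs
  · have := (tame_regWt h0 h1).pos i
    positivity
  · obtain ⟨p, q⟩ := i
    simp only [regWt]
    set x := |(p : ℝ)|
    set y := |(q : ℝ)|
    have hx : 0 ≤ x := abs_nonneg _
    have hy : 0 ≤ y := abs_nonneg _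
    have hx1 : ε * (1 + x) ≤ 1 + ε * x := by nlinarith
    have hy1 : ε * (1 + y) ≤ 1 + ε * y := by nlinarith
    have hA : (ε * (1 + x)) ^ 4 * (ε * (1 + y)) ^ 4 ≤ ((1 + ε * x) * (1 + ε * y)) ^ 4 := by
      rw [← mul_pow]; gcongr
    have hB : 1 + x + y ≤ (1 + x) ^ 2 * (1 + y) ^ 2 := by
      nlinarith [mul_nonneg hx hy, mul_nonneg (mul_nonneg hx hy) hx,
        mul_nonneg (mul_nonneg hx hy) hy,
        mul_nonneg (mul_nonneg hx hy) (mul_nonneg hx hy)]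
    rw [Real.rpow_neg (by positivity), show (4 : ℝ) = ((4 : ℕ) : ℝ) by norm_num, Real.rpow_natCast]
    calc (((1 + ε * x) * (1 + ε * y)) ^ 4)⁻¹ * (1 + x + y)
        ≤ ((ε * (1 + x)) ^ 4 * (ε * (1 + y)) ^ 4)⁻¹ * ((1 + x) ^ 2 * (1 + y) ^ 2) := by gcongr
      _ = _ := by field_simp

end Weights

/-! ### The energy estimate -/

section Energy

variable {n : ℕ} {b : Cn n}

theorem norm_mulOp_star_le (w : C(Sph n, ℂ)) (x y : L2S n) :
    |(⟪x, mulOp w y⟫_ℂ).re| ≤ ‖mulOp w‖ * (‖x‖ * ‖y‖) := by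
  refine (Complex.abs_re_le_norm _).trans ((norm_inner_le_norm _ _).trans ?_)
  calc ‖x‖ * ‖mulOp w y‖ ≤ ‖x‖ * (‖mulOp w‖ * ‖y‖) := by gcongr; exact (mulOp w).le_opNorm y
    _ = _ := by ring

/-- `Re ⟪P_{p+1,q} x, M P_{p,q} x⟫`, where `M` is multiplication by `b̄ · ζ`. -/
def matA (b : Cn n) (x : L2S n) (i : ℤ × ℤ) : ℝ :=
  (⟪hproj (i.1 + 1, i.2) x, mulOp (cell b) (hproj i x)⟫_ℂ).re

/-- `Re ⟪P_{p,q} x, M P_{p,q+1} x⟫`, where `M` is multiplication by `b̄ · ζ`. -/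
def matB (b : Cn n) (x : L2S n) (i : ℤ × ℤ) : ℝ :=
  (⟪hproj i x, mulOp (cell b) (hproj (i.1, i.2 + 1) x)⟫_ℂ).re

/-- The quadratic form of the generator. Every matrix coefficient between neighbouring bidegrees
enters twice, in the raising and in the lowering term, with coefficients of opposite signs. -/
theorem re_inner_genOp (m : ℤ) (x : L2S n) (i : ℤ × ℤ) :
    (⟪hproj i x, genOp n m b i x⟫_ℂ).re =
      (i.1 - 1 + m) * matA b x (i.1 - 1, i.2) + (i.2 - 1) * matB b x (i.1, i.2 - 1) -
      (i.1 + n) * matA b x i - (i.2 + n - m) * matB b x i := by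
  have hp : ∀ y, ⟪hproj i x, hproj i y⟫_ℂ = ⟪hproj i x, y⟫_ℂ := fun y =>
    (inner_proj_left (V := harm n) i x y).symm
  have hs : ∀ y z : L2S n, (⟪y, mulOp (star (cell b)) z⟫_ℂ).re = (⟪z, mulOp (cell b) y⟫_ℂ).re :=
    fun y z => by
      rw [← inner_mulOp, ← inner_conj_symm, Complex.conj_re]
  simp only [genOp, ContinuousLinearMap.comp_apply, hp, sub_apply, add_apply, smul_apply,
    inner_sub_right, inner_add_right, inner_smul_right, Complex.sub_re, Complex.add_re,
    Complex.re_ofReal_mul, hs, matA, matB, sub_add_cancel]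

theorem norm_hproj_le (i : ℤ × ℤ) (x : L2S n) : ‖hproj i x‖ ≤ ‖x‖ :=
  Submodule.norm_starProjection_apply_le _ _

theorem abs_matA_le (b : Cn n) (x : L2S n) (i : ℤ × ℤ) :
    |matA b x i| ≤ ‖mulOp (cell b)‖ * (‖hproj (i.1 + 1, i.2) x‖ * ‖hproj i x‖) :=
  norm_mulOp_star_le _ _ _

theorem abs_matB_le (b : Cn n) (x : L2S n) (i : ℤ × ℤ) :
    |matB b x i| ≤ ‖mulOp (cell b)‖ * (‖hproj i x‖ * ‖hproj (i.1, i.2 + 1) x‖) :=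
  norm_mulOp_star_le _ _ _

theorem abs_mat_le (b : Cn n) (x : L2S n) (i : ℤ × ℤ) :
    |matA b x i| ≤ ‖mulOp (cell b)‖ * ‖x‖ ^ 2 ∧ |matB b x i| ≤ ‖mulOp (cell b)‖ * ‖x‖ ^ 2 := by
  rw [sq]
  refine ⟨(abs_matA_le b x i).trans ?_, (abs_matB_le b x i).trans ?_⟩ <;> gcongr <;>
    exact norm_hproj_le _ _

/-- The weighted energy of a vector. -/
def energy (w : ℤ × ℤ → ℝ) (x : L2S n) : ℝ := ∑' i, w i * ‖hproj i x‖ ^ 2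

/-- The linear weight that bounds the coefficients of the generator. -/
def linWt (i : ℤ × ℤ) : ℝ := 1 + |(i.1 : ℝ)| + |(i.2 : ℝ)|

theorem one_le_linWt (i : ℤ × ℤ) : 1 ≤ linWt i := by
  unfold linWt
  linarith [abs_nonneg (i.1 : ℝ), abs_nonneg (i.2 : ℝ)]

variable {w : ℤ × ℤ → ℝ} {C : ℝ}

theorem summable_energy (hw : ∀ i, 0 < w i) (hs : Summable fun i => w i * linWt i) (x : L2S n) :
    Summable fun i => w i * ‖hproj i x‖ ^ 2 := by
  refine Summable.of_nonneg_of_le (fun i => by have := hw i; positivity) (fun i => ?_)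
    (hs.mul_left (‖x‖ ^ 2))
  have h1 := hw i
  have h2 := one_le_linWt i
  calc w i * ‖hproj i x‖ ^ 2 ≤ w i * ‖x‖ ^ 2 := by gcongr; exact norm_hproj_le i x
    _ ≤ ‖x‖ ^ 2 * (w i * linWt i) := by nlinarith [mul_nonneg (sq_nonneg ‖x‖) h1.le]

variable [NeZero n]

theorem coeff_le (m : ℤ) (i : ℤ × ℤ) : |(i.1 - 1 + m : ℝ)| ≤ (n + |(m : ℝ)|) * linWt i ∧
    |(i.2 - 1 : ℝ)| ≤ (n + |(m : ℝ)|) * linWt i ∧ |(i.1 + n : ℝ)| ≤ (n + |(m : ℝ)|) * linWt i ∧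
    |(i.2 + n - m : ℝ)| ≤ (n + |(m : ℝ)|) * linWt i := by
  have hn : (1 : ℝ) ≤ n := by exact_mod_cast NeZero.one_le (n := n)
  have h0 := abs_nonneg (m : ℝ)
  have h1 := abs_nonneg (i.1 : ℝ)
  have h2 := abs_nonneg (i.2 : ℝ)
  have h3 := mul_nonneg (by linarith : (0 : ℝ) ≤ n - 1) h1
  have h4 := mul_nonneg (by linarith : (0 : ℝ) ≤ n - 1) h2
  have h5 := mul_nonneg h0 h1
  have h6 := mul_nonneg h0 h2
  unfold linWt
  refine ⟨?_, ?_, ?_, ?_⟩ <;> rw [abs_le] <;> constructor <;>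
    nlinarith [le_abs_self (i.1 : ℝ), neg_abs_le (i.1 : ℝ), le_abs_self (i.2 : ℝ),
      neg_abs_le (i.2 : ℝ), le_abs_self (m : ℝ), neg_abs_le (m : ℝ)]

theorem summable_of_linWt (hw : ∀ i, 0 < w i) (hs : Summable fun i => w i * linWt i)
    {c y : ℤ × ℤ → ℝ} {A B : ℝ} (hc : ∀ i, |c i| ≤ A * linWt i) (hy : ∀ i, |y i| ≤ B) :
    Summable fun i => w i * (c i * y i) := by
  refine Summable.of_norm_bounded (hs.mul_left (A * B)) fun i => ?_
  rw [Real.norm_eq_abs, abs_mul, abs_mul, abs_of_pos (hw i)]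
  have h1 : 0 ≤ A * linWt i := (abs_nonneg _).trans (hc i)
  calc w i * (|c i| * |y i|) ≤ w i * (A * linWt i * B) :=
        mul_le_mul_of_nonneg_left (mul_le_mul (hc i) (hy i) (abs_nonneg _) h1) (hw i).le
    _ = _ := by ring

/-- The two coefficients that are attached to the same matrix coefficient of the generator cancel up
to a bounded multiple of the weight: the linear growth `p` is compensated by the smallness of
`w - w'`. -/
theorem bracket_le {w w' p c d : ℝ} (h0 : 0 ≤ p) (hw : 0 < w') (hanti : w' ≤ w) (hr : w ≤ C * w')
    (hsl : p * (w - w') ≤ C * w') :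
    |w' * (p + c) - w * (p + d)| ≤ (C + |c| + |d| * C) * w' := by
  have h1 : w' * (p + c) - w * (p + d) = -(p * (w - w')) + c * w' - d * w := by ring
  have h2 : 0 ≤ p * (w - w') := mul_nonneg h0 (by linarith)
  have h3 : |c * w'| = |c| * w' := by rw [abs_mul, abs_of_pos hw]
  have h4 : |d * w| ≤ |d| * (C * w') := by
    rw [abs_mul, abs_of_pos (by linarith : 0 < w)]; gcongr
  have h5 := abs_le.1 h3.le
  have h6 := abs_le.1 h4
  rw [h1, abs_le]
  constructor <;> nlinarith

/-- The generator changes the energy at most by a bounded factor: raising and lowering operators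
nearly cancel, since tame weights vary slowly. -/
theorem tsum_re_genOp_le (hw : Tame C w) (hs : Summable fun i => w i * linWt i) (m : ℤ)
    (x : L2S n) : ∑' i, w i * (2 * (⟪hproj i x, genOp n m b i x⟫_ℂ).re) ≤
      4 * (C + (n + |(m : ℝ)|) + (n + |(m : ℝ)|) * C) * ‖mulOp (cell b)‖ * energy w x := by
  set κ := ‖mulOp (cell b)‖
  set D := C + (n + |(m : ℝ)|) + (n + |(m : ℝ)|) * C
  have hC : 1 ≤ C := (hw.left 0).one_le
  have hD : 0 ≤ D := by positivity
  set a := fun i => matA b x i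
  set e := fun i => matB b x i
  let e1 : ℤ × ℤ ≃ ℤ × ℤ := (Equiv.addRight (1 : ℤ)).prodCongr (Equiv.refl ℤ)
  let e2 : ℤ × ℤ ≃ ℤ × ℤ := (Equiv.refl ℤ).prodCongr (Equiv.addRight (1 : ℤ))
  have hab := abs_mat_le b x
  have s1 := summable_of_linWt hw.pos hs (fun i => (coeff_le (n := n) m i).1) fun i =>
    (hab (i.1 - 1, i.2)).1
  have s2 := summable_of_linWt hw.pos hs (fun i => (coeff_le (n := n) m i).2.1) fun i =>
    (hab (i.1, i.2 - 1)).2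
  have s3 := summable_of_linWt hw.pos hs (fun i => (coeff_le (n := n) m i).2.2.1) fun i => (hab i).1
  have s4 := summable_of_linWt hw.pos hs (fun i => (coeff_le (n := n) m i).2.2.2) fun i => (hab i).2
  have s1' := s1.comp_injective e1.injective
  have s2' := s2.comp_injective e2.injective
  simp only [Function.comp_def] at s1' s2'
  have hsE := summable_energy hw.pos hs x
  have hsE1 := hsE.comp_injective e1.injective
  have hsE2 := hsE.comp_injective e2.injective
  -- shift the indices of the raising terms, so that each matrix coefficient occurs once
  have hL : ∑' i, w i * (2 * (⟪hproj i x, genOp n m b i x⟫_ℂ).re) =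
      2 * ∑' i : ℤ × ℤ, ((w (i.1 + 1, i.2) * (i.1 + m) - w i * (i.1 + n)) * a i +
        (w (i.1, i.2 + 1) * i.2 - w i * (i.2 + n - m)) * e i) := by
    have h1 : ∀ i : ℤ × ℤ, w i * (2 * (⟪hproj i x, genOp n m b i x⟫_ℂ).re) =
        2 * (w i * ((i.1 - 1 + m) * a (i.1 - 1, i.2)) + w i * ((i.2 - 1) * e (i.1, i.2 - 1)) -
          w i * ((i.1 + n) * a i) - w i * ((i.2 + n - m) * e i)) := fun i => by
      rw [re_inner_genOp]; ring
    simp only [h1]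
    rw [tsum_mul_left, ((s1.add s2).sub s3).tsum_sub s4, (s1.add s2).tsum_sub s3, s1.tsum_add s2,
      ← e1.tsum_eq (fun i : ℤ × ℤ => w i * ((i.1 - 1 + m : ℝ) * matA b x (i.1 - 1, i.2))),
      ← e2.tsum_eq (fun i : ℤ × ℤ => w i * ((i.2 - 1 : ℝ) * matB b x (i.1, i.2 - 1))),
      ← s1'.tsum_add s2', ← (s1'.add s2').tsum_sub s3, ← ((s1'.add s2').sub s3).tsum_sub s4]
    congr 1
    refine tsum_congr fun i => ?_
    simp only [e1, e2, Equiv.prodCongr_apply, Prod.map, Equiv.coe_addRight,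
      Equiv.refl_apply, add_sub_cancel_right, Prod.mk.eta, Int.cast_add, Int.cast_one, a, e]
    ring
  -- estimate each matrix coefficient by the energies of the two bidegrees that it connects
  have hterm : ∀ i : ℤ × ℤ, (w (i.1 + 1, i.2) * (i.1 + m) - w i * (i.1 + n)) * a i +
      (w (i.1, i.2 + 1) * i.2 - w i * (i.2 + n - m)) * e i ≤
      D * κ / 2 * ((w (e1 i) * ‖hproj (e1 i) x‖ ^ 2 + w i * ‖hproj i x‖ ^ 2) +
        (w (e2 i) * ‖hproj (e2 i) x‖ ^ 2 + w i * ‖hproj i x‖ ^ 2)) := by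
    rintro ⟨p, q⟩
    have w0 := hw.pos (p, q)
    have w1 := hw.pos (p + 1, q)
    have w2 := hw.pos (p, q + 1)
    have he1 : e1 (p, q) = (p + 1, q) := rfl
    have he2 : e2 (p, q) = (p, q + 1) := rfl
    rw [he1, he2]
    -- tameness is assumed for natural numbers only; components of negative degrees vanish
    by_cases hneg : p < 0 ∨ q < 0
    · have h0 : hproj (p, q) x = 0 := proj_harm_neg hneg x
      have ha : a (p, q) = 0 := by simp only [a, matA, h0, map_zero, inner_zero_right,
        Complex.zero_re]
      have he : e (p, q) = 0 := by simp only [e, matB, h0, inner_zero_left, Complex.zero_re]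
      rw [ha, he]
      simp only [mul_zero, add_zero]
      positivity
    push Not at hneg
    obtain ⟨k, rfl⟩ := Int.eq_ofNat_of_zero_le hneg.1
    obtain ⟨j, rfl⟩ := Int.eq_ofNat_of_zero_le hneg.2
    have hn0 : (0 : ℝ) ≤ n := n.cast_nonneg
    have hgen : ∀ {W W' c d P x0 x1 y : ℝ}, 0 < W → 0 < W' → W' ≤ W → W ≤ C * W' → 0 ≤ P →
        P * (W - W') ≤ C * W' → |c| ≤ n + |(m : ℝ)| → |d| ≤ n + |(m : ℝ)| →
        |y| ≤ κ * (x1 * x0) → 0 ≤ x0 → 0 ≤ x1 →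
        (W' * (P + c) - W * (P + d)) * y ≤ D * κ / 2 * (W' * x1 ^ 2 + W * x0 ^ 2) := by
      intro W W' c d P x0 x1 y hW hW' h1 h2 h3 h4 h5 h6 h7 h8 h9
      have hb := bracket_le (c := c) (d := d) h3 hW' h1 h2 h4
      have hκ : 0 ≤ κ := norm_nonneg _
      have hb2 : |W' * (P + c) - W * (P + d)| ≤ D * W' := by
        refine hb.trans (mul_le_mul_of_nonneg_right ?_ hW'.le)
        exact add_le_add (add_le_add le_rfl h5) (mul_le_mul_of_nonneg_right h6 (by linarith))
      have h10 : 2 * (x1 * x0) ≤ x1 ^ 2 + x0 ^ 2 := by nlinarith [sq_nonneg (x1 - x0)]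
      have h11 : 0 ≤ D * κ * W' := by positivity
      calc _ ≤ |(W' * (P + c) - W * (P + d)) * y| := le_abs_self _
        _ = |W' * (P + c) - W * (P + d)| * |y| := abs_mul _ _
        _ ≤ D * W' * (κ * (x1 * x0)) := mul_le_mul hb2 h7 (abs_nonneg _) (by positivity)
        _ = D * κ * W' * (2 * (x1 * x0)) / 2 := by ring
        _ ≤ D * κ * W' * (x1 ^ 2 + x0 ^ 2) / 2 := by gcongr
        _ ≤ D * κ / 2 * (W' * x1 ^ 2 + W * x0 ^ 2) := by
          have : D * κ * (W' * x0 ^ 2) ≤ D * κ * (W * x0 ^ 2) := by gcongr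
          nlinarith
    have hnm : |(n - m : ℝ)| ≤ n + |(m : ℝ)| := by
      rw [abs_le]; constructor <;> linarith [le_abs_self (m : ℝ), neg_abs_le (m : ℝ)]
    have t1 := hgen (y := a (k, j)) (c := m) (d := n) (P := (k : ℝ)) w0 w1
      (by exact_mod_cast (hw.left j).anti k) (by exact_mod_cast (hw.left j).ratio k) k.cast_nonneg
      (by exact_mod_cast (hw.left j).slope k) (by linarith)
        (by rw [abs_of_nonneg hn0]; linarith [abs_nonneg (m : ℝ)])
      (abs_matA_le b x (k, j)) (norm_nonneg _) (norm_nonneg _)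
    have t2 := hgen (y := e (k, j)) (x0 := ‖hproj ((k : ℤ), (j : ℤ)) x‖)
      (x1 := ‖hproj ((k : ℤ), (j : ℤ) + 1) x‖) (c := 0) (d := n - m) (P := (j : ℝ)) w0 w2
      (by exact_mod_cast (hw.right k).anti j) (by exact_mod_cast (hw.right k).ratio j) j.cast_nonneg
      (by exact_mod_cast (hw.right k).slope j) (by rw [abs_zero]; positivity) hnm
      ((abs_matB_le b x (k, j)).trans_eq (by rw [mul_comm ‖hproj _ x‖])) (norm_nonneg _)
        (norm_nonneg _)
    simp only [Int.cast_natCast]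
    refine (le_of_eq ?_).trans ((add_le_add t1 t2).trans_eq ?_) <;> ring
  have hR := (((hsE1.add hsE).add (hsE2.add hsE)).mul_left (D * κ / 2))
  have hsl : Summable fun i : ℤ × ℤ => ((w (i.1 + 1, i.2) * (i.1 + m) - w i * (i.1 + n)) * a i +
      (w (i.1, i.2 + 1) * i.2 - w i * (i.2 + n - m)) * e i) := by
    refine (((s1'.add s2').sub s3).sub s4).congr fun i => ?_
    simp only [e1, e2, Equiv.prodCongr_apply, Prod.map, Equiv.coe_addRight,
      Equiv.refl_apply, add_sub_cancel_right, Prod.mk.eta, Int.cast_add, Int.cast_one, a, e]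
    ring
  have h1 := hsl.tsum_le_tsum hterm hR
  have h2 : ∑' i, D * κ / 2 * ((w (e1 i) * ‖hproj (e1 i) x‖ ^ 2 + w i * ‖hproj i x‖ ^ 2) +
        (w (e2 i) * ‖hproj (e2 i) x‖ ^ 2 + w i * ‖hproj i x‖ ^ 2)) = 2 * D * κ * energy w x := by
    have h3 := e1.tsum_eq (fun i => w i * ‖hproj i x‖ ^ 2)
    have h4 := e2.tsum_eq (fun i => w i * ‖hproj i x‖ ^ 2)
    have h5 := (hsE1.add hsE).tsum_add (hsE2.add hsE)
    rw [hsE1.tsum_add hsE, hsE2.tsum_add hsE] at h5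
    simp only [Function.comp_apply] at h5
    rw [tsum_mul_left, h5, h3, h4, energy]
    ring
  rw [hL]
  rw [h2] at h1
  linarith

end Energy

/-! ### Boundedness of the translations in Sobolev norms -/

section Gronwall

variable {n : ℕ} [NeZero n] {b : Cn n} {w : ℤ × ℤ → ℝ} {C : ℝ}

/-- The crude bound without cancellation. It makes the series of derivatives of the energy converge
uniformly when the weight decays fast enough. -/
theorem abs_re_inner_genOp_le (m : ℤ) (x : L2S n) (i : ℤ × ℤ) :
    |(⟪hproj i x, genOp n m b i x⟫_ℂ).re| ≤
      4 * (n + |(m : ℝ)|) * ‖mulOp (cell b)‖ * ‖x‖ ^ 2 * linWt i := by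
  obtain ⟨c1, c2, c3, c4⟩ := coeff_le (n := n) m i
  have hA : ∀ {c y : ℝ}, |c| ≤ (n + |(m : ℝ)|) * linWt i → |y| ≤ ‖mulOp (cell b)‖ * ‖x‖ ^ 2 →
      |c * y| ≤ (n + |(m : ℝ)|) * ‖mulOp (cell b)‖ * ‖x‖ ^ 2 * linWt i := fun {c y} h1 h2 => by
    rw [abs_mul]
    exact (mul_le_mul h1 h2 (abs_nonneg _) ((abs_nonneg _).trans h1)).trans_eq (by ring)
  have t1 := abs_le.1 (hA c1 (abs_mat_le b x (i.1 - 1, i.2)).1)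
  have t2 := abs_le.1 (hA c2 (abs_mat_le b x (i.1, i.2 - 1)).2)
  have t3 := abs_le.1 (hA c3 (abs_mat_le b x i).1)
  have t4 := abs_le.1 (hA c4 (abs_mat_le b x i).2)
  rw [re_inner_genOp, abs_le]
  constructor <;> linarith [t1.1, t1.2, t2.1, t2.2, t3.1, t3.2, t4.1, t4.2]

theorem hasDerivAt_norm_sq_hproj (hb : ‖b‖ = 1) (m : ℤ) {f : Sph n → ℂ} (hf : Continuous f)
    (i : ℤ × ℤ) (t : ℝ) :
    HasDerivAt (fun t => ‖hproj i (repS n m (hyp hb t) (toL2 f))‖ ^ 2)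
      (2 * (⟪hproj i (repS n m (hyp hb t) (toL2 f)),
        genOp n m b i (repS n m (hyp hb t) (toL2 f))⟫_ℂ).re) t := by
  have h1 := hasDerivAt_hproj_repS hb m hf i t
  have h2 := Complex.reCLM.hasFDerivAt.comp_hasDerivAt t (h1.inner ℂ h1)
  have h3 : ∀ x : L2S n, ‖x‖ ^ 2 = Complex.reCLM ⟪x, x⟫_ℂ := fun x => by
    rw [inner_self_eq_norm_sq_to_K, Complex.reCLM_apply]; norm_cast
  simp only [h3]
  refine h2.congr_deriv ?_
  rw [map_add, Complex.reCLM_apply, Complex.reCLM_apply, ← inner_conj_symm, Complex.conj_re]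
  ring

theorem hasDerivAt_energy (hb : ‖b‖ = 1) (hw : ∀ i, 0 < w i) (hs : Summable fun i => w i * linWt i)
    (m : ℤ) {f : Sph n → ℂ} (hf : Continuous f) (t : ℝ) :
    HasDerivAt (fun t => energy w (repS n m (hyp hb t) (toL2 f)))
      (∑' i, w i * (2 * (⟪hproj i (repS n m (hyp hb t) (toL2 f)),
        genOp n m b i (repS n m (hyp hb t) (toL2 f))⟫_ℂ).re)) t := by
  obtain ⟨M, hM⟩ := (isCompact_Icc (a := t - 1) (b := t + 1)).exists_bound_of_continuousOn
    (continuous_repS_hyp hb m hf).continuousOn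
  have ht : t ∈ Set.Ioo (t - 1) (t + 1) := ⟨by linarith, by linarith⟩
  refine hasDerivAt_tsum_of_isPreconnected
    (hs.mul_left (8 * (n + |(m : ℝ)|) * ‖mulOp (cell b)‖ * M ^ 2)) isOpen_Ioo
    isPreconnected_Ioo (fun i y _ => (hasDerivAt_norm_sq_hproj hb m hf i y).const_mul (w i))
    (fun i y hy => ?_) ht (summable_energy hw hs _) ht
  have h1 := abs_re_inner_genOp_le (b := b) m (repS n m (hyp hb y) (toL2 f)) i
  have h2 := hM y (Set.Ioo_subset_Icc_self hy)
  have h3 := hw i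
  have h4 := one_le_linWt i
  rw [Real.norm_eq_abs, abs_mul, abs_mul, abs_two, abs_of_pos h3]
  calc _ ≤ w i * (2 * (4 * (n + |(m : ℝ)|) * ‖mulOp (cell b)‖ * M ^ 2 * linWt i)) := by
        refine mul_le_mul_of_nonneg_left (mul_le_mul_of_nonneg_left (h1.trans ?_) (by norm_num))
          h3.le
        gcongr
    _ = _ := by ring

/-- Grönwall's inequality for the energy along a one-parameter group of translations. -/
theorem energy_repS_le (hb : ‖b‖ = 1) (hw : Tame C w) (hs : Summable fun i => w i * linWt i)
    (m : ℤ) {f : Sph n → ℂ} (hf : Continuous f) {t : ℝ} (ht : 0 ≤ t) :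
    energy w (repS n m (hyp hb t) (toL2 f)) ≤
      Real.exp (4 * (C + (n + |(m : ℝ)|) + (n + |(m : ℝ)|) * C) * ‖mulOp (cell b)‖ * t) *
        energy w (toL2 f) := by
  set K := 4 * (C + (n + |(m : ℝ)|) + (n + |(m : ℝ)|) * C) * ‖mulOp (cell b)‖
  have h1 : ∀ t, HasDerivAt
      (fun t => energy w (repS n m (hyp hb t) (toL2 f)) * Real.exp (-K * t)) _ t := fun t =>
    (hasDerivAt_energy hb hw.pos hs m hf t).mul (((hasDerivAt_id t).const_mul (-K)).exp)
  have h2 : Antitone fun t => energy w (repS n m (hyp hb t) (toL2 f)) * Real.exp (-K * t) := by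
    refine antitone_of_deriv_nonpos (fun t => (h1 t).differentiableAt) fun t => ?_
    rw [(h1 t).deriv]
    have h3 := tsum_re_genOp_le (b := b) hw hs m (repS n m (hyp hb t) (toL2 f))
    have h4 := Real.exp_pos (-K * t)
    simp only [id, mul_one]
    nlinarith
  have h3 := h2 ht
  simp only [hyp_zero, map_one, mul_zero, Real.exp_zero, mul_one] at h3
  rw [neg_mul, Real.exp_neg, ← div_eq_mul_inv, div_le_iff₀ (Real.exp_pos _)] at h3
  exact h3.trans_eq (mul_comm _ _)

theorem norm_sq_smoothing {r : ℝ} (hr : 0 ≤ r) (x : L2S n) :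
    HasSum (fun i => wt n r i ^ 2 * ‖hproj i x‖ ^ 2) (‖smoothing n r x‖ ^ 2) := by
  have h := (isOrthDecomp_harm n).hasSum_norm_sq (smoothing n r x)
  convert h using 2 with i
  change _ = ‖hproj i (smoothing n r x)‖ ^ 2
  rw [hproj_smoothing hr, norm_smul, mul_pow, Complex.norm_real, Real.norm_eq_abs, sq_abs]

/-- Boundedness of the hyperbolic translations for the norm `‖(1 + Δ_H)^{-r} x‖`, whose square is
the energy for the weight `wt n r ^ 2`. As this weight need not be summable, the energy estimate is
applied to its products with `regWt ε`, with constants that do not depend on `ε`. -/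
theorem norm_smoothing_repS_hyp_le {r : ℝ} (hr : 0 ≤ r) (m : ℤ) (hb : ‖b‖ = 1) {t : ℝ}
    (ht : 0 ≤ t) : ∃ A, ∀ x, ‖smoothing n r (repS n m (hyp hb t) x)‖ ≤ A * ‖smoothing n r x‖ := by
  obtain ⟨C, hC⟩ : ∃ C, ∀ ε, 0 < ε → ε ≤ 1 → Tame C fun i => wt n r i ^ 2 * regWt ε i :=
    ⟨_, fun ε h0 h1 => (tame_wt_sq n hr).mul (tame_regWt h0 h1)⟩
  set M := Real.exp (4 * (C + (n + |(m : ℝ)|) + (n + |(m : ℝ)|) * C) * ‖mulOp (cell b)‖ * t)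
  have hM : 0 < M := Real.exp_pos _
  have hreg1 : ∀ ε, 0 < ε → ∀ i, regWt ε i ≤ 1 := fun ε h0 i => by
    refine Real.rpow_le_one_of_one_le_of_nonpos ?_ (by norm_num)
    have h1 : 0 ≤ ε * |(i.1 : ℝ)| := by positivity
    have h2 : 0 ≤ ε * |(i.2 : ℝ)| := by positivity
    nlinarith [mul_nonneg h1 h2]
  have hwt1 : ∀ i, wt n r i ^ 2 ≤ 1 := fun i => by
    have h1 := wt_pos (n := n) r i
    have h2 := wt_le_one (n := n) hr i
    nlinarith
  have key : ∀ f : Sph n → ℂ, Continuous f →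
      ‖smoothing n r (repS n m (hyp hb t) (toL2 f))‖ ^ 2 ≤ M * ‖smoothing n r (toL2 f)‖ ^ 2 := by
    intro f hf
    set u := repS n m (hyp hb t) (toL2 f)
    rw [← (norm_sq_smoothing hr u).tsum_eq]
    -- let `ε → 0` in the finite partial sums
    refine (norm_sq_smoothing hr u).summable.tsum_le_of_sum_le fun s => ?_
    have hlim : Tendsto (fun ε => ∑ i ∈ s, wt n r i ^ 2 * regWt ε i * ‖hproj i u‖ ^ 2) (𝓝[>] 0)
        (𝓝 (∑ i ∈ s, wt n r i ^ 2 * ‖hproj i u‖ ^ 2)) := by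
      refine tendsto_finsetSum _ fun i _ => ?_
      have h1 : ContinuousAt (fun ε : ℝ => wt n r i ^ 2 * regWt ε i * ‖hproj i u‖ ^ 2) 0 := by
        unfold regWt
        refine (ContinuousAt.mul continuousAt_const (ContinuousAt.rpow_const ?_ ?_)).mul
          continuousAt_const
        · fun_prop
        · left; simp
      have h2 := h1.tendsto
      simp only [regWt, zero_mul, add_zero, mul_one, Real.one_rpow] at h2
      exact h2.mono_left nhdsWithin_le_nhds
    refine le_of_tendsto hlim ?_
    filter_upwards [Ioc_mem_nhdsGT one_pos] with ε hε
    have hw := hC ε hε.1 hε.2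
    have hsum : Summable fun i => wt n r i ^ 2 * regWt ε i * linWt i := by
      refine Summable.of_nonneg_of_le (fun i => ?_) (fun i => ?_) (summable_regWt hε.1 hε.2)
      · have := hw.pos i; have := one_le_linWt i; positivity
      · have h1 := (tame_regWt hε.1 hε.2).pos i
        have h2 := one_le_linWt i
        rw [mul_assoc]
        exact mul_le_of_le_one_left (by positivity) (hwt1 i)
    calc _ ≤ energy (fun i => wt n r i ^ 2 * regWt ε i) u :=
          (summable_energy hw.pos hsum u).sum_le_tsum s fun i _ => by have := hw.pos i; positivity
      _ ≤ M * energy (fun i => wt n r i ^ 2 * regWt ε i) (toL2 f) :=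
          energy_repS_le hb hw hsum m hf ht
      _ ≤ M * ‖smoothing n r (toL2 f)‖ ^ 2 := by
          refine mul_le_mul_of_nonneg_left ?_ hM.le
          rw [← (norm_sq_smoothing hr (toL2 f)).tsum_eq]
          refine (summable_energy hw.pos hsum _).tsum_le_tsum (fun i => ?_)
            (norm_sq_smoothing hr _).summable
          gcongr
          exact mul_le_of_le_one_right (sq_nonneg _) (hreg1 ε hε.1 i)
  refine ⟨√M, fun x => ?_⟩
  -- both sides are continuous in `x`, and continuous functions are dense
  have hd : DenseRange (cls n) := ContinuousMap.toLp_denseRange ℂ (surf n) ℂ (by norm_num)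
  refine hd.induction_on x (isClosed_le (by fun_prop) (by fun_prop)) fun f => ?_
  have h := key f f.continuous
  rw [toL2_eq_cls f.continuous] at h
  rw [← Real.sqrt_sq (norm_nonneg (smoothing n r (repS n m (hyp hb t) (cls n f)))),
    ← Real.sqrt_sq (norm_nonneg (smoothing n r (cls n f))), ← Real.sqrt_mul hM.le]
  exact Real.sqrt_le_sqrt h

/-- The translations are bounded for the norm of the Sobolev space of negative order. -/
theorem exists_norm_smoothing_repS_le {r : ℝ} (hr : 0 ≤ r) (m : ℤ) (g : SU n) :
    ∃ A, ∀ x, ‖smoothing n r (repS n m g x)‖ ≤ A * ‖smoothing n r x‖ := by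
  obtain ⟨b, hb, t, k, ht, hk, rfl⟩ := exists_hyp_mul g
  obtain ⟨A, hA⟩ := norm_smoothing_repS_hyp_le (n := n) hr m hb ht
  refine ⟨|A| * ‖repS n m k‖, fun x => ?_⟩
  rw [map_mul, mul_apply_eq_comp]
  calc _ ≤ A * ‖smoothing n r (repS n m k x)‖ := hA _
    _ ≤ |A| * ‖smoothing n r (repS n m k x)‖ := by gcongr; exact le_abs_self A
    _ = |A| * ‖repS n m k (smoothing n r x)‖ := by rw [smoothing_repS_of_fix_zero hr m hk]
    _ ≤ |A| * (‖repS n m k‖ * ‖smoothing n r x‖) := by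
        gcongr; exact ContinuousLinearMap.le_opNorm _ _
    _ = _ := by ring

end Gronwall

/-! ### The representations on the Sobolev space -/

section SobolevRep

variable {n : ℕ} [NeZero n] {r : ℝ}

/-- The translation on the space of distributions `(1 + Δ_H)^r v`, expressed in terms of `v`. -/
def sobT (n : ℕ) [NeZero n] (r : ℝ) (m : ℤ) (g : SU n) : L2S n →L[ℂ] L2S n :=
  (smoothing n r ∘L repS n m g).toLinearMap.extendOfNorm (smoothing n r).toLinearMap

/-- On functions the translation is the one of `repS`; by boundedness and density it extends from
functions to distributions. -/
theorem sobT_smoothing (hr : 0 ≤ r) (m : ℤ) (g : SU n) (x : L2S n) :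
    sobT n r m g (smoothing n r x) = smoothing n r (repS n m g x) :=
  LinearMap.extendOfNorm_eq (denseRange_smoothing hr) (exists_norm_smoothing_repS_le hr m g) x

theorem ext_smoothing (hr : 0 ≤ r) {E : Type*} [TopologicalSpace E] [T2Space E] {f g : L2S n → E}
    (hf : Continuous f) (hg : Continuous g)
    (h : ∀ x, f (smoothing n r x) = g (smoothing n r x)) : f = g :=
  (denseRange_smoothing hr).equalizer hf hg (funext h)

/-- The representation of weight `m` on the space of distributions `(1 + Δ_H)^r v`. -/
def sobRep (hr : 0 ≤ r) (m : ℤ) : SU n →* (L2S n →L[ℂ] L2S n) where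
  toFun := sobT n r m
  map_one' := by
    refine DFunLike.coe_injective (ext_smoothing hr (by fun_prop) (by fun_prop) fun x => ?_)
    rw [sobT_smoothing hr, map_one]; rfl
  map_mul' g h := by
    refine DFunLike.coe_injective (ext_smoothing hr (by fun_prop) (by fun_prop) fun x => ?_)
    rw [mul_apply_eq_comp, sobT_smoothing hr, sobT_smoothing hr, sobT_smoothing hr, map_mul]; rfl

theorem sobRep_smoothing (hr : 0 ≤ r) (m : ℤ) (g : SU n) (x : L2S n) :
    sobRep hr m g (smoothing n r x) = smoothing n r (repS n m g x) := sobT_smoothing hr m g x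

/-- The representation acts on distributions by transposition. -/
theorem integral_sobRep_mul (hr : 0 ≤ r) (m : ℤ) (g : SU n) {φ : Sph n → ℂ} (hφ : IsSmooth φ)
    (v : L2S n) : ∫ ζ, sobRep hr m g v ζ * subLaplacianPow r φ ζ ∂(surf n) =
      ∫ ζ, v ζ * subLaplacianPow r (actTest m g φ) ζ ∂(surf n) := by
  have h1 : ∀ v w : L2S n, ∫ ζ, v ζ * w ζ ∂(surf n) = ⟪star w, v⟫_ℂ := fun v w => by
    rw [← inner_star_left, inner_star_comm]
  have h2 : (fun v => ⟪star (subLaplacianPow r φ), sobRep hr m g v⟫_ℂ) =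
      fun v => ⟪star (subLaplacianPow r (actTest m g φ)), v⟫_ℂ := by
    refine ext_smoothing hr (by fun_prop) (by fun_prop) fun x => ?_
    rw [sobRep_smoothing, ← h1, ← h1, integral_smoothing_mul hr hφ,
      integral_smoothing_mul hr (isSmooth_actTest m g hφ), integral_repS_mul]
  rw [h1, h1]
  exact congrFun h2 v

theorem isSphereRep_sobRep {s : ℝ} (hr : 0 ≤ -(filtrationStep n * s) / 2) (m : ℤ) :
    IsSphereRep (n := n) (s := s) m (sobRep hr m) :=
  fun g u _ hφ => integral_sobRep_mul hr m g hφ u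

end SobolevRep

/-! ### The Szegő kernel and holomorphic functions -/

section Szego

variable {n : ℕ}

/-- The rotation of the sphere by a complex number of modulus one. -/
def rotSph {c : ℂ} (hc : ‖c‖ = 1) (ζ : Sph n) : Sph n := ⟨c • (ζ : Cn n), by
  rw [mem_sphere_zero_iff_norm, norm_smul, hc, norm_sph, mul_one]⟩

/-- Rotations preserve the surface measure, which is defined by the Lebesgue measure of cones. -/
theorem measurePreserving_rotSph {c : ℂ} (hc : ‖c‖ = 1) :
    MeasurePreserving (rotSph (n := n) hc) (surf n) (surf n) := by
  have hc0 : c ≠ 0 := by rintro rfl; simp at hc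
  let L : Cn n ≃ₗᵢ[ℝ] Cn n := ⟨(LinearEquiv.smulOfNeZero ℂ (Cn n) c hc0).restrictScalars ℝ,
    fun z => by simp [norm_smul, hc]⟩
  have hm : Continuous (rotSph (n := n) hc) := by unfold rotSph; fun_prop
  refine ⟨hm.measurable, Measure.ext fun s hs => ?_⟩
  rw [Measure.map_apply hm.measurable hs, surf, Measure.toSphere_apply' _ hs,
    Measure.toSphere_apply' _ (hm.measurable hs)]
  congr 1
  refine Eq.trans ?_ (L.measurePreserving.measure_preimage_emb L.toHomeomorph.measurableEmbedding _)
  congr 1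
  ext z
  simp only [Set.mem_smul, Set.mem_image, Set.mem_preimage]
  constructor
  · rintro ⟨t, ht, _, ⟨ζ, hζ, rfl⟩, rfl⟩
    exact ⟨t, ht, _, ⟨_, hζ, rfl⟩, smul_comm t c (ζ : Cn n)⟩
  · rintro ⟨t, ht, _, ⟨ζ, hζ, rfl⟩, h⟩
    have hc' : ‖c⁻¹‖ = 1 := by rw [norm_inv, hc, inv_one]
    refine ⟨t, ht, _, ⟨rotSph hc' ζ, ?_, rfl⟩, ?_⟩
    · have : rotSph hc (rotSph hc' ζ) = ζ := Subtype.ext (smul_inv_smul₀ hc0 _)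
      rwa [this]
    · have h1 : c • z = t • (ζ : Cn n) := h.symm
      rw [← inv_smul_smul₀ hc0 z, h1]
      exact smul_comm t c⁻¹ (ζ : Cn n)

theorem smul_sph_mem_ball {r : ℝ} (h0 : 0 ≤ r) (h1 : r < 1) (ζ : Sph n) :
    r • (ζ : Cn n) ∈ Ball n := by
  rw [mem_ball_zero_iff, norm_smul, norm_sph, mul_one, Real.norm_of_nonneg h0]
  exact h1

/-- The mean value property of holomorphic functions. -/
theorem integral_sphere_of_differentiableOn {G : Cn n → ℂ}
    (hc : ContinuousOn G (Metric.closedBall 0 1)) (hd : DifferentiableOn ℂ G (Ball n)) :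
    ∫ ζ : Sph n, G ζ ∂(surf n) = (surf n).real Set.univ * G 0 := by
  have hmem : ∀ (θ : ℝ) (ζ : Sph n), circleMap 0 1 θ • (ζ : Cn n) ∈
      Metric.closedBall (0 : Cn n) 1 :=
    fun θ ζ => by simp [norm_smul]
  -- rotations do not change the integral, so it may be averaged over the circle orbits, on which
  -- the mean value property of one variable applies
  have h1 : ∀ θ : ℝ, ∫ ζ : Sph n, G (circleMap 0 1 θ • (ζ : Cn n)) ∂(surf n) =
      ∫ ζ : Sph n, G ζ ∂(surf n) := fun θ => by
    have hcθ : ‖circleMap 0 1 θ‖ = 1 := by simp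
    have hcts : Continuous fun ζ : Sph n => G ζ := hc.comp_continuous (by fun_prop) fun ζ => by
      rw [mem_closedBall_zero_iff]; exact (norm_sph ζ).le
    rw [← (measurePreserving_rotSph hcθ).map_eq, integral_map
      (measurePreserving_rotSph hcθ).measurable.aemeasurable hcts.aestronglyMeasurable,
      (measurePreserving_rotSph hcθ).map_eq]
    rfl
  have h2 : ∀ ζ : Sph n, ∫ θ in (0 : ℝ)..2 * Real.pi, G (circleMap 0 1 θ • (ζ : Cn n)) =
      (2 * Real.pi : ℝ) * G 0 := fun ζ => by
    have hdc : DiffContOnCl ℂ (fun w : ℂ => G (w • (ζ : Cn n))) (Metric.ball 0 |1|) := by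
      rw [abs_one]
      refine ⟨hd.comp (by fun_prop) fun w hw => ?_, ?_⟩
      · rw [mem_ball_zero_iff] at hw ⊢
        rwa [norm_smul, norm_sph, mul_one]
      · rw [closure_ball _ one_ne_zero]
        refine hc.comp (by fun_prop) fun w hw => ?_
        rw [mem_closedBall_zero_iff] at hw ⊢
        rwa [norm_smul, norm_sph, mul_one]
    have h3 := hdc.circleAverage
    rw [Real.circleAverage, zero_smul, inv_smul_eq_iff₀ (by positivity)] at h3
    rw [h3, Complex.real_smul]
  have hpi : (0 : ℝ) < 2 * Real.pi := by positivity
  have h3 : ∫ θ in (0 : ℝ)..2 * Real.pi, ∫ ζ : Sph n, G (circleMap 0 1 θ • (ζ : Cn n)) ∂(surf n) =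
      ∫ ζ : Sph n, (∫ θ in (0 : ℝ)..2 * Real.pi, G (circleMap 0 1 θ • (ζ : Cn n))) ∂(surf n) := by
    simp only [intervalIntegral.integral_of_le hpi.le]
    refine integral_integral_swap ?_
    have hcu : Continuous (Function.uncurry fun (θ : ℝ) (ζ : Sph n) =>
        G (circleMap 0 1 θ • (ζ : Cn n))) :=
      hc.comp_continuous (by fun_prop) fun x => hmem x.1 x.2
    obtain ⟨M, hM⟩ := (isCompact_closedBall (0 : Cn n) 1).exists_bound_of_continuousOn hc
    exact Integrable.of_bound hcu.aestronglyMeasurable M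
      (Eventually.of_forall fun x => hM _ (hmem x.1 x.2))
  simp only [h1, h2] at h3
  rw [intervalIntegral.integral_const, integral_const, sub_zero, Complex.real_smul,
    Complex.real_smul] at h3
  have hpi' : ((2 * Real.pi : ℝ) : ℂ) ≠ 0 := by exact_mod_cast hpi.ne'
  exact mul_left_cancel₀ hpi' (h3.trans (by ring))

variable [NeZero n]

/-- The Szegő map intertwines the actions of weight `n`. -/
theorem szego_translate (g : SU n) (f : Sph n → ℂ) {z : Cn n} (hz : z ∈ Ball n) :
    szego (fun ζ => autJ g⁻¹ (ζ : Cn n) ^ (-(n : ℤ)) * f (sphMobius g⁻¹ ζ)) z =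
      ballAct n g (szego f) z := by
  have hz1 : ‖z‖ < 1 := mem_ball_zero_iff.1 hz
  set w := mobius g⁻¹ z with hw
  have hw1 : ‖w‖ < 1 := norm_mobius_lt _ hz1
  have hgw : mobius g w = z := mobius_mobius_inv g hz1.le
  have hJw := autJ_ne_zero g hw1.le
  have hJ : autJ g⁻¹ z = (autJ g w)⁻¹ :=
    eq_inv_of_mul_eq_one_right (autJ_mobius_inv g hz1.le)
  rw [ballAct, szego, szego, ← hw, ← integral_sphMobius g, mul_left_comm,
    ← integral_const_mul (autJ g⁻¹ z ^ (-(n : ℤ)))]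
  congr 2
  funext η
  have hJη := autJ_sph_ne_zero g η
  have hJg : autJ g⁻¹ (sphMobius g η : Cn n) = (autJ g (η : Cn n))⁻¹ :=
    eq_inv_of_mul_eq_one_left (autJ_inv_mobius g (norm_sph η).le)
  have h1 : sphMobius g⁻¹ (sphMobius g η) = η := by
    rw [← sphMobius_mul, inv_mul_cancel, sphMobius_one]
  have h2 := inner_mobius g hJη hJw
  have h3 : ((‖autJ g (η : Cn n)‖⁻¹ ^ (2 * n) : ℝ) : ℂ) =
      ((autJ g (η : Cn n) * (starRingEnd ℂ) (autJ g (η : Cn n)))⁻¹) ^ n := by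
    rw [Complex.mul_conj']; push_cast; rw [pow_mul, inv_pow]
  have hne : (starRingEnd ℂ) (autJ g (η : Cn n)) ≠ 0 := by simpa using hJη
  rw [hgw] at h2
  have hs : ((sphMobius g η : Sph n) : Cn n) = mobius g (η : Cn n) := rfl
  rw [h3, h1, hJg, hJ, ← h2, zpow_neg, zpow_neg, zpow_natCast, zpow_natCast, hs]
  simp only [inv_pow, inv_inv, mul_pow]
  field_simp

/-- The Szegő map reproduces holomorphic functions up to this factor. -/
def szC (n : ℕ) : ℂ := 1 / (2 * (Real.pi : ℂ) * Complex.I) ^ n * (surf n).real Set.univ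

/-- The reproducing property of the Szegő kernel. At the origin it is the mean value property, and
equivariance moves the origin to any point of the ball. -/
theorem szego_of_differentiableOn {G : Cn n → ℂ} (hc : ContinuousOn G (Metric.closedBall 0 1))
    (hd : DifferentiableOn ℂ G (Ball n)) {z : Cn n} (hz : z ∈ Ball n) :
    szego (fun ζ : Sph n => G ζ) z = szC n * G z := by
  -- by equivariance, the value at `z = g⁻¹.0` is a mean value of the translate of `G`
  obtain ⟨b, hb, t, -, hg⟩ := exists_mobius_hyp_zero (mem_ball_zero_iff.1 hz)
  set g := (hyp hb t)⁻¹ with hgdef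
  have hg' : mobius g⁻¹ 0 = z := by rw [hgdef, inv_inv]; exact hg
  have hJ : ∀ w ∈ Metric.closedBall (0 : Cn n) 1, autJ g⁻¹ w ≠ 0 := fun w hw =>
    autJ_ne_zero _ (mem_closedBall_zero_iff.1 hw)
  have h1 := szego_translate g (fun ζ : Sph n => G ζ) (z := 0) (by simp)
  have h2 := integral_sphere_of_differentiableOn (G := ballAct n g G)
    (((continuous_autJ _).continuousOn.zpow₀ _ fun w hw => Or.inl (hJ w hw)).mul
      (hc.comp (continuousOn_mobius _) fun w hw => mobius_mem_closedBall _ hw))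
    (DifferentiableOn.mul (((contDiff_autJ _ (k := 1)).differentiable
      one_ne_zero).differentiableOn.zpow
      (Or.inl fun w hw => hJ w (Metric.ball_subset_closedBall hw)))
      (hd.comp (fun w hw => ((contDiffAt_mobius g⁻¹ (k := 1)
        (hJ w (Metric.ball_subset_closedBall hw))).differentiableAt
          one_ne_zero).differentiableWithinAt)
        fun w hw => mem_ball_zero_iff.2 (norm_mobius_lt _ (mem_ball_zero_iff.1 hw))))
  have h3 : szego (fun ζ : Sph n => autJ g⁻¹ (ζ : Cn n) ^ (-(n : ℤ)) * G (sphMobius g⁻¹ ζ)) 0 =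
      szC n * ballAct n g G 0 := by
    simp only [szego, inner_zero_right, sub_zero, one_pow, div_one]
    rw [szC, mul_assoc (1 / _) _ (ballAct _ _ _ _), ← h2]
    rfl
  rw [h3, ballAct, ballAct, hg', mul_left_comm] at h1
  exact (mul_left_cancel₀ (zpow_ne_zero _ (hJ 0 (by simp))) h1).symm

end Szego

/-! ### Homogeneous holomorphic components -/

section Taylor

variable {n k : ℕ}

theorem IsHarm.ell_mul_holo {p : ℤ} {Y : Cn n → ℂ} (h : IsHarm p 0 Y) (b : Cn n) :
    IsHarm (p + 1) 0 fun z => ell b z * Y z := by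
  have h1 : SzegoBall.up p 0 b Y = fun z => ell b z * Y z := funext fun z => by
    rw [SzegoBall.up, (h.dzb b).eq_zero_of_right_neg (by omega) z]; ring
  exact h1 ▸ h.up b

theorem isHarm_ell_pow (b : Cn n) (k : ℕ) : IsHarm k 0 fun z => ell b z ^ k := by
  induction k with
  | zero => simpa using IsHarm.const (n := n) 1
  | succ k ih => simpa [pow_succ'] using ih.ell_mul_holo b

/-- A holomorphic monomial of degree `k`. -/
def mono {n k : ℕ} (f : Fin k → Fin n) (z : Cn n) : ℂ := ∏ j, z (f j)

theorem isHarm_mono (f : Fin k → Fin n) : IsHarm k 0 (mono f) := by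
  induction k with
  | zero =>
    have : mono f = fun _ : Cn n => 1 := funext fun z => by simp [mono]
    exact this ▸ IsHarm.const 1
  | succ k ih =>
    have h1 := (ih fun j => f j.succ).ell_mul_holo (EuclideanSpace.single (f 0) 1)
    have h2 : (fun z : Cn n => ell (EuclideanSpace.single (f 0) 1) z * mono (fun j => f j.succ) z) =
        mono f := funext fun z => by
      simp [mono, Fin.prod_univ_succ, ell_apply, EuclideanSpace.inner_single_left]
    rw [h2] at h1
    exact_mod_cast h1

theorem differentiable_mono (f : Fin k → Fin n) : Differentiable ℂ (mono f) := by
  unfold mono; fun_prop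

/-- The restriction of a monomial to the sphere. -/
def monoC (f : Fin k → Fin n) : C(Sph n, ℂ) := (isHarm_mono f).cres

/-- The multinomial expansion of `(z̄ · ζ)^k`. -/
theorem cell_pow_eq_sum (z : Cn n) (k : ℕ) :
    cell z ^ k = ∑ f : Fin k → Fin n, (starRingEnd ℂ) (mono f z) • monoC f := by
  ext ζ
  have h1 : ell z (ζ : Cn n) = ∑ i, (starRingEnd ℂ) (z i) * (ζ : Cn n) i := by
    rw [ell_apply, inner_eq_sum]
  simp only [ContinuousMap.pow_apply, ContinuousMap.sum_apply, ContinuousMap.smul_apply]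
  change ell z (ζ : Cn n) ^ k = ∑ f, (starRingEnd ℂ) (mono f z) • mono f (ζ : Cn n)
  rw [h1, Fintype.sum_pow]
  simp only [mono, map_prod, Finset.prod_mul_distrib, smul_eq_mul]

/-- The coefficients of the expansion of the Szegő kernel, normalized by the area of the sphere. -/
def szCoeff (n k : ℕ) : ℝ := ((k + (n - 1)).choose (n - 1) : ℝ) / (surf n).real Set.univ

/-- The homogeneous component of degree `k` of the holomorphic part of `v ∈ L²(S)`, extended
to `ℂⁿ`. -/
def taylor (k : ℕ) (v : L2S n) (z : Cn n) : ℂ := szCoeff n k * ⟪cls n (cell z ^ k), v⟫_ℂ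

theorem taylor_eq_sum (k : ℕ) (v : L2S n) (z : Cn n) :
    taylor k v z = ∑ f : Fin k → Fin n, szCoeff n k * ⟪cls n (monoC f), v⟫_ℂ * mono f z := by
  rw [taylor, cell_pow_eq_sum, map_sum, sum_inner, Finset.mul_sum]
  refine Finset.sum_congr rfl fun f _ => ?_
  rw [map_smul, inner_smul_left, Complex.conj_conj]
  ring

theorem taylor_add (k : ℕ) (v w : L2S n) (z : Cn n) :
    taylor k (v + w) z = taylor k v z + taylor k w z := by
  rw [taylor, inner_add_right, mul_add]; rfl

theorem taylor_smul (k : ℕ) (c : ℂ) (v : L2S n) (z : Cn n) :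
    taylor k (c • v) z = c * taylor k v z := by
  rw [taylor, inner_smul_right, mul_left_comm]; rfl

theorem isHarm_taylor (k : ℕ) (v : L2S n) : IsHarm k 0 (taylor k v) := by
  have h : ∀ s : Finset (Fin k → Fin n), IsHarm (n := n) k 0
      fun z => ∑ f ∈ s, szCoeff n k * ⟪cls n (monoC f), v⟫_ℂ * mono f z := fun s => by
    classical
    induction s using Finset.induction_on with
    | empty => simpa using IsHarm.zero
    | insert f s hf ih =>
      simp only [Finset.sum_insert hf]
      exact ((isHarm_mono f).const_mul _).add ih
  rw [funext (taylor_eq_sum k v)]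
  exact h _

theorem differentiable_taylor (k : ℕ) (v : L2S n) : Differentiable ℂ (taylor k v) := by
  rw [funext (taylor_eq_sum k v)]
  exact Differentiable.fun_sum fun f _ => (differentiable_mono f).const_mul _

theorem cls_cell_pow_mem (z : Cn n) (k : ℕ) : cls n (cell z ^ k) ∈ harm n ((k : ℤ), 0) := by
  have := (isHarm_ell_pow z k).mem_harm
  rwa [toL2_eq_cls (isHarm_ell_pow z k).continuous_res] at this

theorem taylor_hproj (k : ℕ) (v : L2S n) (z : Cn n) :
    taylor k (hproj ((k : ℤ), 0) v) z = taylor k v z := by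
  rw [taylor, taylor, ← Submodule.inner_starProjection_left_eq_right,
    proj_of_mem (V := harm n) (cls_cell_pow_mem z k)]

theorem norm_cell_pow_le {n : ℕ} (z : Cn n) (k : ℕ) : ‖cell z ^ k‖ ≤ ‖z‖ ^ k := by
  rw [ContinuousMap.norm_le _ (by positivity)]
  intro ζ
  have := norm_inner_le_norm (𝕜 := ℂ) z (ζ : Cn n)
  rw [norm_sph, mul_one] at this
  rw [ContinuousMap.pow_apply, norm_pow]
  gcongr
  exact this

variable [NeZero n]

theorem surf_real_pos : 0 < (surf n).real Set.univ := by
  have : Nontrivial (Cn n) := inferInstance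
  have h : (surf n) Set.univ ≠ 0 := by
    rw [surf, Ne, Measure.measure_univ_eq_zero]
    exact Measure.toSphere_ne_zero _
  exact ENNReal.toReal_pos h (measure_ne_top _ _)

theorem szCoeff_nonneg (n k : ℕ) : 0 ≤ szCoeff n k := by unfold szCoeff; positivity

theorem norm_taylor_le {n : ℕ} (k : ℕ) (v : L2S n) (z : Cn n) :
    ‖taylor k v z‖ ≤ szCoeff n k * (‖cls n‖ * ‖v‖) * ‖z‖ ^ k := by
  have h1 : ‖cls n (cell z ^ k)‖ ≤ ‖cls n‖ * ‖z‖ ^ k :=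
    ((cls n).le_opNorm _).trans (by gcongr; exact norm_cell_pow_le z k)
  rw [taylor, norm_mul, Complex.norm_real, Real.norm_of_nonneg (szCoeff_nonneg n k), mul_assoc]
  refine mul_le_mul_of_nonneg_left ?_ (szCoeff_nonneg n k)
  calc _ ≤ ‖cls n (cell z ^ k)‖ * ‖v‖ := norm_inner_le_norm _ _
    _ ≤ ‖cls n‖ * ‖z‖ ^ k * ‖v‖ := by gcongr
    _ = _ := by ring

theorem summable_szCoeff {n : ℕ} {x : ℝ} (h0 : 0 ≤ x) (h1 : x < 1) :
    Summable fun k => szCoeff n k * x ^ k := by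
  have h := (hasSum_choose_mul_geometric_of_norm_lt_one (n - 1) (r := x)
    (by rwa [Real.norm_of_nonneg h0])).summable.mul_left ((surf n).real Set.univ)⁻¹
  refine h.congr fun k => ?_
  rw [szCoeff]; ring

/-- The Szegő map is the sum of the homogeneous components. -/
theorem hasSum_szego (v : L2S n) {z : Cn n} (hz : z ∈ Ball n) :
    HasSum (fun k => szC n * taylor k v z) (szego v z) := by
  have hz1 : ‖z‖ < 1 := mem_ball_zero_iff.1 hz
  have hA : ((surf n).real Set.univ : ℂ) ≠ 0 := by exact_mod_cast (surf_real_pos (n := n)).ne'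
  have hx : ∀ ζ : Sph n, ‖⟪(ζ : Cn n), z⟫_ℂ‖ ≤ ‖z‖ := fun ζ => by
    have := norm_inner_le_norm (𝕜 := ℂ) (ζ : Cn n) z
    rwa [norm_sph, one_mul] at this
  -- the terms of the binomial series of `(1 - ζ̄ · z)^{-n}`, times `v`
  set F : ℕ → Sph n → ℂ := fun k ζ =>
    v ζ * (((k + (n - 1)).choose (n - 1) : ℂ) * ⟪(ζ : Cn n), z⟫_ℂ ^ k)
  have hF : ∀ k, ∀ ζ, ‖F k ζ‖ ≤ ((surf n).real Set.univ * (szCoeff n k * ‖z‖ ^ k)) * ‖v ζ‖ :=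
    fun k ζ => by
      rw [szCoeff, div_mul_eq_mul_div, mul_div_cancel₀ _ (surf_real_pos (n := n)).ne', norm_mul,
        norm_mul, norm_pow, Complex.norm_natCast, mul_comm]
      gcongr
      exact hx ζ
  have hi : ∀ k, Integrable (F k) (surf n) := fun k =>
    ((integrable_L2S v).norm.const_mul _).mono'
      ((Lp.aestronglyMeasurable v).mul (by fun_prop)) (Eventually.of_forall (hF k))
  have hs : Summable fun k => ∫ ζ, ‖F k ζ‖ ∂(surf n) := by
    refine Summable.of_nonneg_of_le (fun k => integral_nonneg fun _ => norm_nonneg _) (fun k =>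
      (integral_mono (hi k).norm ((integrable_L2S v).norm.const_mul _) (hF k)).trans_eq ?_)
      (((summable_szCoeff (n := n) (norm_nonneg z) hz1).mul_left
        ((surf n).real Set.univ)).mul_right (∫ ζ, ‖v ζ‖ ∂(surf n)))
    rw [integral_const_mul]
  have h1 := (hasSum_integral_of_summable_integral_norm hi hs).mul_left
    (1 / (2 * (Real.pi : ℂ) * Complex.I) ^ n)
  have h2 : ∀ ζ : Sph n, ∑' k, F k ζ = v ζ / (1 - ⟪(ζ : Cn n), z⟫_ℂ) ^ n := fun ζ => by
    have h := (hasSum_choose_mul_geometric_of_norm_lt_one (n - 1)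
      (r := ⟪(ζ : Cn n), z⟫_ℂ) ((hx ζ).trans_lt hz1)).mul_left (v ζ)
    rw [h.tsum_eq, Nat.sub_add_cancel NeZero.one_le, mul_one_div]
  simp only [h2] at h1
  suffices h : (fun k => szC n * taylor k v z) = fun k =>
      1 / (2 * (Real.pi : ℂ) * Complex.I) ^ n * ∫ ζ, F k ζ ∂(surf n) by rw [h]; exact h1
  funext k
  rw [szC, taylor, inner_L2]
  have h3 : ∫ ζ, F k ζ ∂(surf n) = ((k + (n - 1)).choose (n - 1) : ℂ) *
      ∫ ζ, (starRingEnd ℂ) (cls n (cell z ^ k) ζ) * v ζ ∂(surf n) := by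
    rw [← integral_const_mul]
    refine integral_congr_ae ?_
    filter_upwards [coeFn_cls (cell z ^ k)] with ζ h
    rw [h, ContinuousMap.pow_apply, map_pow]
    have : (starRingEnd ℂ) (cell z ζ) = ⟪(ζ : Cn n), z⟫_ℂ :=
      inner_conj_symm (𝕜 := ℂ) (ζ : Cn n) z
    rw [this]
    ring
  rw [h3, szCoeff]
  push_cast
  field_simp

theorem szego_congr {n : ℕ} {f g : Sph n → ℂ} (h : f =ᵐ[surf n] g) : szego f = szego g := by
  funext z
  rw [szego, szego]
  congr 1
  refine integral_congr_ae ?_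
  filter_upwards [h] with ζ hζ
  rw [hζ]

theorem szC_ne_zero : szC n ≠ 0 := by
  have hA : ((surf n).real Set.univ : ℂ) ≠ 0 := by exact_mod_cast (surf_real_pos (n := n)).ne'
  have : (2 * (Real.pi : ℂ) * Complex.I) ≠ 0 := by simp [Real.pi_ne_zero]
  exact mul_ne_zero (one_div_ne_zero (pow_ne_zero n this)) hA

/-- A holomorphic function on the closed ball is the sum of its homogeneous components. -/
theorem hasSum_taylor {G : Cn n → ℂ} (hc : ContinuousOn G (Metric.closedBall 0 1))
    (hd : DifferentiableOn ℂ G (Ball n)) {z : Cn n} (hz : z ∈ Ball n) :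
    HasSum (fun k => taylor k (toL2 fun ζ : Sph n => G ζ) z) (G z) := by
  have hcts : Continuous fun ζ : Sph n => G ζ := hc.comp_continuous (by fun_prop) fun ζ => by
    rw [mem_closedBall_zero_iff]; exact (norm_sph ζ).le
  have h := hasSum_szego (toL2 fun ζ : Sph n => G ζ) hz
  rw [szego_congr (coeFn_toL2 hcts), szego_of_differentiableOn hc hd hz] at h
  exact (hasSum_mul_left_iff szC_ne_zero).1 h

/-- The class of the restriction of `taylor k v`, as a bounded operator in `v`. -/
theorem toL2_taylor {n : ℕ} (k : ℕ) (v : L2S n) : toL2 (res (taylor k v)) =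
    ∑ f : Fin k → Fin n, (szCoeff n k * ⟪cls n (monoC f), v⟫_ℂ) • cls n (monoC f) := by
  have h : (⟨res (taylor k v), (isHarm_taylor k v).continuous_res⟩ : C(Sph n, ℂ)) =
      ∑ f : Fin k → Fin n, (szCoeff n k * ⟪cls n (monoC f), v⟫_ℂ) • monoC f := by
    ext ζ
    simp only [ContinuousMap.sum_apply, ContinuousMap.smul_apply]
    exact taylor_eq_sum k v (ζ : Cn n)
  rw [toL2_eq_cls (isHarm_taylor k v).continuous_res, h, map_sum]
  simp only [map_smul]

/-- Holomorphic homogeneous polynomials are their own homogeneous components. -/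
theorem taylor_toL2 {Y : Cn n → ℂ} (hY : IsHarm k 0 Y) (hd : Differentiable ℂ Y) (z : Cn n) :
    taylor k (toL2 (res Y)) z = Y z := by
  have key : ∀ z ∈ Ball n, taylor k (toL2 (res Y)) z = Y z := fun z hz => by
    have h := hasSum_taylor (G := Y) hd.continuous.continuousOn hd.differentiableOn hz
    refine (h.unique (hasSum_single k fun j hj => ?_)).symm
    have hjk : ((j : ℤ), (0 : ℤ)) ≠ ((k : ℤ), 0) := by simpa using hj
    rw [taylor]
    have := harm_orth hjk (cls_cell_pow_mem z j) hY.mem_harm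
    exact mul_eq_zero_of_right _ this
  -- both sides are homogeneous of degree `k`, so it suffices to scale `z` into the ball
  set c : ℂ := ((‖z‖ + 1 : ℝ) : ℂ) with hc
  have hpos : 0 < ‖z‖ + 1 := by positivity
  have hc0 : c ≠ 0 := by rw [hc]; exact_mod_cast hpos.ne'
  have h1 := key (c⁻¹ • z) (by
    rw [mem_ball_zero_iff, norm_smul, norm_inv, hc, Complex.norm_real, Real.norm_of_nonneg hpos.le,
      inv_mul_lt_iff₀ hpos]
    linarith)
  have h2 := (isHarm_taylor k (toL2 (res Y))).homog c hc0 (c⁻¹ • z)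
  have h3 := hY.homog c hc0 (c⁻¹ • z)
  rw [smul_inv_smul₀ hc0] at h2 h3
  rw [h2, h3, h1]

end Taylor

/-! ### Power series with coefficients in the Hardy space -/

section HolSeries

variable {n : ℕ} {k : ℕ}

/-- A bihomogeneous harmonic of degree `(p, 0)` is holomorphic: its derivatives `∂̄_b Y` have degree
`-1` in `z̄`, so they vanish. -/
theorem IsHarm.differentiable {p : ℤ} {Y : Cn n → ℂ} (h : IsHarm p 0 Y) : Differentiable ℂ Y := by
  intro z
  have hI : ∀ b : Cn n, fderiv ℝ Y z (Complex.I • b) = Complex.I * fderiv ℝ Y z b := fun b => by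
    have h1 := (h.dzb b).eq_zero_of_right_neg (by omega) z
    have h2 : dd b Y z + Complex.I * dd (Complex.I • b) Y z = 0 := by
      simpa [SzegoBall.dzb] using h1
    have h3 := congrArg (Complex.I * ·) h2
    simp only [mul_add, ← mul_assoc, Complex.I_mul_I, mul_zero, neg_one_mul] at h3
    have h4 : Complex.I * dd b Y z - dd (Complex.I • b) Y z = 0 := by
      rw [sub_eq_add_neg]; simpa using h3
    exact (eq_of_sub_eq_zero h4).symm
  refine (differentiableAt_iff_restrictScalars ℝ
    (h.smooth.contDiffAt.differentiableAt (by simp))).2 ⟨⟨⟨(fderiv ℝ Y z : Cn n →+ ℂ),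
      fun c b => ?_⟩, (fderiv ℝ Y z).continuous⟩, rfl⟩
  have h1 := dd_smul_complex (f := Y) (x := z) c b
  simp only [dd, hI] at h1
  change fderiv ℝ Y z (c • b) = c * fderiv ℝ Y z b
  rw [h1]
  conv_rhs => rw [← Complex.re_add_im c]
  ring

/-- A series of continuous functions that converges uniformly by the Weierstrass criterion converges
in `L²(S)`. -/
theorem hasSum_toL2 {g : ℕ → Sph n → ℂ} {f : Sph n → ℂ} {b : ℕ → ℝ} (hg : ∀ k, Continuous (g k))
    (hf : Continuous f) (hb : Summable b) (hgb : ∀ k ζ, ‖g k ζ‖ ≤ b k)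
    (h : ∀ ζ, HasSum (fun k => g k ζ) (f ζ)) : HasSum (fun k => toL2 (g k)) (toL2 f) := by
  have hs : Summable fun k => (⟨g k, hg k⟩ : C(Sph n, ℂ)) := by
    refine Summable.of_norm_bounded (g := fun k => |b k|) hb.abs fun k => ?_
    rw [ContinuousMap.norm_le _ (abs_nonneg _)]
    exact fun ζ => (hgb k ζ).trans (le_abs_self _)
  have h1 : ∑' k, (⟨g k, hg k⟩ : C(Sph n, ℂ)) = ⟨f, hf⟩ := by
    ext ζ
    exact ((ContinuousMap.evalCLM ℂ ζ).hasSum hs.hasSum).unique (h ζ)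
  have h2 := (cls n).hasSum hs.hasSum
  rw [h1, ← toL2_eq_cls hf] at h2
  simpa only [Function.comp_def, ← toL2_eq_cls (hg _)] using h2

variable [NeZero n]

/-- The restriction of the component of degree `k` is the orthogonal projection to the space of
homogeneous holomorphic polynomials. -/
theorem toL2_taylor_eq (k : ℕ) (v : L2S n) :
    toL2 (res (taylor k v)) = hproj ((k : ℤ), 0) v := by
  have key : ∀ {w : L2S n}, w ∈ harm n ((k : ℤ), 0) → toL2 (res (taylor k w)) = w := by
    intro w hw
    refine harm_induction (P := fun w => toL2 (res (taylor k w)) = w) ?_ (fun Y hY => ?_) ?_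
      (fun v w hv hw => ?_) (fun c v hv => ?_) hw
    · simp only [toL2_taylor]
      exact isClosed_eq (by fun_prop) continuous_id
    · rw [show taylor k (toL2 (res Y)) = Y from funext (taylor_toL2 hY hY.differentiable)]
    · simp [toL2_taylor]
    · simp only [toL2_taylor, inner_add_right, mul_add, add_smul, Finset.sum_add_distrib] at hv hw ⊢
      rw [hv, hw]
    · simp only [toL2_taylor, inner_smul_right, mul_left_comm _ c, mul_smul,
        ← Finset.smul_sum] at hv ⊢
      rw [hv]
  have h := key (proj_mem (V := harm n) ((k : ℤ), 0) v)
  rw [← h]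
  congr 2
  exact funext fun z => (taylor_hproj k v z).symm

/-- The coefficients `(1 + λ)^r` grow polynomially in the degree, so the expansions of distributions
still converge inside the ball. -/
theorem summable_lamPos_szCoeff (r : ℝ) {x : ℝ} (h0 : 0 ≤ x) (h1 : x < 1) :
    Summable fun k : ℕ => (1 + lamPos n ((k : ℤ), 0)) ^ r * (szCoeff n k * x ^ k) := by
  obtain ⟨N, hN⟩ := exists_nat_ge r
  have hn : (1 : ℝ) ≤ n := by exact_mod_cast NeZero.one_le (n := n)
  have hy1 : √x < 1 := by rw [Real.sqrt_lt' one_pos]; simpa using h1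
  have hlam : ∀ k : ℕ, 1 + lamPos n ((k : ℤ), 0) ≤ 2 * n * ((k + 1 : ℕ) : ℝ) ^ 2 := fun k => by
    have hk : (0 : ℝ) ≤ k := k.cast_nonneg
    rw [lamPos_eq (by simp) (by simp), lam]
    push_cast
    split_ifs
    · nlinarith [mul_nonneg (by linarith : (0 : ℝ) ≤ n - 1) (sq_nonneg ((k : ℝ) + 1))]
    · nlinarith [mul_nonneg (by linarith : (0 : ℝ) ≤ n) (sq_nonneg (k : ℝ)),
        mul_nonneg (by linarith : (0 : ℝ) ≤ n) hk]
  have ht : Tendsto (fun k : ℕ => ((k + 1 : ℕ) : ℝ) ^ (2 * N) * √x ^ (k + 1)) atTop (𝓝 0) :=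
    (tendsto_pow_const_mul_const_pow_of_abs_lt_one (2 * N)
      (by rwa [abs_of_nonneg (Real.sqrt_nonneg x)])).comp (tendsto_add_atTop_nat 1)
  by_cases hx0 : x = 0
  · refine summable_of_ne_finset_zero (s := {0}) fun k hk => ?_
    rw [hx0, zero_pow (by simpa using hk)]; ring
  have hx : 0 < √x := Real.sqrt_pos.2 (lt_of_le_of_ne h0 (Ne.symm hx0))
  obtain ⟨M, hM⟩ := ht.bddAbove_range
  -- write `x ^ k = √x ^ k * √x ^ k`: one factor absorbs the polynomial growth
  refine Summable.of_nonneg_of_le (fun k => ?_) (fun k => ?_)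
    ((summable_szCoeff (n := n) (Real.sqrt_nonneg x) hy1).mul_left ((2 * n) ^ N * (M * (√x)⁻¹)))
  · have := one_le_lamPos (n := n) ((k : ℤ), 0)
    have := szCoeff_nonneg n k
    positivity
  · have h1 := one_le_lamPos (n := n) ((k : ℤ), 0)
    have h2 : (1 + lamPos n ((k : ℤ), 0)) ^ r ≤ (2 * n) ^ N * ((k + 1 : ℕ) : ℝ) ^ (2 * N) := by
      calc _ ≤ (1 + lamPos n ((k : ℤ), 0)) ^ (N : ℝ) := Real.rpow_le_rpow_of_exponent_le h1 hN
        _ = (1 + lamPos n ((k : ℤ), 0)) ^ N := Real.rpow_natCast _ _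
        _ ≤ (2 * n * ((k + 1 : ℕ) : ℝ) ^ 2) ^ N := by gcongr; exact hlam k
        _ = _ := by rw [mul_pow, ← pow_mul]
    have h3 : ((k + 1 : ℕ) : ℝ) ^ (2 * N) * √x ^ (k + 1) ≤ M := hM ⟨k, rfl⟩
    have h4 := szCoeff_nonneg n k
    have h5 : x ^ k = √x ^ (k + 1) * (√x)⁻¹ * √x ^ k := by
      rw [pow_succ, mul_inv_cancel_right₀ hx.ne', ← mul_pow, Real.mul_self_sqrt h0]
    rw [h5]
    calc _ ≤ (2 * n) ^ N * ((k + 1 : ℕ) : ℝ) ^ (2 * N) *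
          (szCoeff n k * (√x ^ (k + 1) * (√x)⁻¹ * √x ^ k)) := by gcongr
      _ = (2 * n) ^ N * ((((k + 1 : ℕ) : ℝ) ^ (2 * N) * √x ^ (k + 1)) * (√x)⁻¹) *
          (szCoeff n k * √x ^ k) := by ring
      _ ≤ _ := by gcongr

/-- The coefficient `(1 + λ)^r` for the eigenvalue `λ` of the sub-Laplacian on the homogeneous
holomorphic polynomials of degree `k`. -/
def holWt (n : ℕ) (r : ℝ) (k : ℕ) : ℝ := (1 + lamPos n ((k : ℤ), 0)) ^ r

theorem holWt_pos (r : ℝ) (k : ℕ) : 0 < holWt n r k :=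
  Real.rpow_pos_of_pos (by linarith [one_le_lamPos (n := n) ((k : ℤ), 0)]) _

/-- The holomorphic function on the ball whose boundary value is the holomorphic part of
`(1 + Δ_H)^r v`. -/
def holExt (r : ℝ) (v : L2S n) (z : Cn n) : ℂ := ∑' k, (holWt n r k : ℂ) * taylor k v z

theorem norm_holTerm_le (r : ℝ) (k : ℕ) (v : L2S n) (z : Cn n) :
    ‖(holWt n r k : ℂ) * taylor k v z‖ ≤
      (‖cls n‖ * ‖v‖) * ((1 + lamPos n ((k : ℤ), 0)) ^ r * (szCoeff n k * ‖z‖ ^ k)) := by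
  have h := norm_taylor_le k v z
  have h0 := holWt_pos (n := n) r k
  rw [norm_mul, Complex.norm_real, Real.norm_of_nonneg h0.le]
  calc _ ≤ holWt n r k * (szCoeff n k * (‖cls n‖ * ‖v‖) * ‖z‖ ^ k) := by gcongr
    _ = _ := by rw [holWt]; ring

variable {r : ℝ}

theorem hasSum_holExt (v : L2S n) {z : Cn n} (hz : z ∈ Ball n) :
    HasSum (fun k => (holWt n r k : ℂ) * taylor k v z) (holExt r v z) :=
  (Summable.of_norm_bounded ((summable_lamPos_szCoeff r (norm_nonneg z)
    (mem_ball_zero_iff.1 hz)).mul_left _) (fun k => norm_holTerm_le r k v z)).hasSum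

theorem differentiableOn_holExt (r : ℝ) (v : L2S n) :
    DifferentiableOn ℂ (holExt r v) (Ball n) := by
  intro z hz
  obtain ⟨R, hzR, hR1⟩ := exists_between (mem_ball_zero_iff.1 hz)
  obtain ⟨R', hRR', hR'1⟩ := exists_between hR1
  have hR0 : 0 < R := (norm_nonneg z).trans_lt hzR
  have hsum := (((summable_lamPos_szCoeff (n := n) r (hR0.trans hRR').le hR'1).mul_left
    (‖cls n‖ * ‖v‖)).mul_left 2).div_const (R' - R)
  have hdiff : ∀ k, Differentiable ℂ fun z => (holWt n r k : ℂ) * taylor k v z := fun k =>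
    (differentiable_taylor k v).const_mul _
  have hmem : z ∈ Metric.ball (0 : Cn n) R := mem_ball_zero_iff.2 hzR
  refine (hasFDerivAt_tsum_of_isPreconnected hsum Metric.isOpen_ball
    (convex_ball (0 : Cn n) R).isPreconnected (fun k y _ => (hdiff k y).hasFDerivAt)
    (fun k y hy => ?_) hmem (hasSum_holExt v hz).summable
    hmem).differentiableAt.differentiableWithinAt
  -- Cauchy's estimate on a slightly larger ball
  refine Complex.norm_fderiv_le_div_of_mapsTo_ball (hdiff k).differentiableOn (fun w hw => ?_)
    (by linarith)
  have hb : ∀ w : Cn n, ‖w‖ ≤ R' → ‖(holWt n r k : ℂ) * taylor k v w‖ ≤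
      (‖cls n‖ * ‖v‖) * ((1 + lamPos n ((k : ℤ), 0)) ^ r * (szCoeff n k * R' ^ k)) := fun w hw => by
    refine (norm_holTerm_le r k v w).trans ?_
    have := one_le_lamPos (n := n) ((k : ℤ), 0)
    have := szCoeff_nonneg n k
    gcongr
  rw [mem_ball_zero_iff] at hy
  rw [mem_ball_iff_norm] at hw
  have hwn : ‖w‖ ≤ R' := by
    have := norm_add_le (w - y) y
    rw [sub_add_cancel] at this
    linarith
  rw [mem_closedBall_iff_norm]
  refine (norm_sub_le _ _).trans ?_
  linarith [hb w hwn, hb y (by linarith)]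

/-- The homogeneous expansion on spheres of radius less than one, in `L²(S)`. -/
theorem hasSum_toL2_holExt (v : L2S n) {t : ℝ} (h0 : 0 ≤ t) (h1 : t < 1) :
    HasSum (fun k => ((holWt n r k * t ^ k : ℝ) : ℂ) • hproj ((k : ℤ), 0) v)
      (toL2 fun ζ : Sph n => holExt r v (t • (ζ : Cn n))) := by
  have hmem : ∀ ζ : Sph n, t • (ζ : Cn n) ∈ Ball n := smul_sph_mem_ball h0 h1
  have h := hasSum_toL2 (g := fun k (ζ : Sph n) => (holWt n r k : ℂ) * taylor k v (t • (ζ : Cn n)))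
    (fun k => ((differentiable_taylor k v).continuous.comp (by fun_prop)).const_mul _)
    ((differentiableOn_holExt r v).continuousOn.comp_continuous (by fun_prop) hmem)
    ((summable_lamPos_szCoeff (n := n) r h0 h1).mul_left (‖cls n‖ * ‖v‖))
    (fun k ζ => (norm_holTerm_le r k v _).trans_eq (by
      rw [norm_smul, norm_sph, mul_one, Real.norm_of_nonneg h0]))
    (fun ζ => hasSum_holExt v (hmem ζ))
  suffices e : ∀ k, ((holWt n r k * t ^ k : ℝ) : ℂ) • hproj ((k : ℤ), 0) v =
      toL2 fun ζ : Sph n => (holWt n r k : ℂ) * taylor k v (t • (ζ : Cn n)) by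
    simp only [e]; exact h
  intro k
  rw [← toL2_taylor_eq, ← toL2_const_mul (isHarm_taylor k v).continuous_res]
  congr 1
  funext ζ
  rw [res, Complex.ofReal_mul, mul_assoc]
  congr 1
  rw [taylor_eq_sum, taylor_eq_sum, Finset.mul_sum]
  refine Finset.sum_congr rfl fun f _ => ?_
  simp only [mono, PiLp.smul_apply, Complex.real_smul, Finset.prod_mul_distrib, Finset.prod_const,
    Finset.card_univ, Fintype.card_fin]
  push_cast
  ring

end HolSeries

/-! ### Homogeneous expansion of holomorphic functions -/

section Expansion

variable {n : ℕ} [NeZero n]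

/-- The bidegrees `(k, 0)` of the holomorphic polynomials. -/
def IsHol (i : ℤ × ℤ) : Prop := ∃ k : ℕ, i = ((k : ℤ), 0)

/-- A sum of multiples of the holomorphic components of a vector has these multiples as its
components, and no others. -/
theorem hproj_of_hasSum {c : ℕ → ℂ} {v x : L2S n}
    (h : HasSum (fun k => c k • hproj ((k : ℤ), 0) v) x) :
    (∀ k : ℕ, hproj ((k : ℤ), 0) x = c k • hproj ((k : ℤ), 0) v) ∧
      ∀ i, ¬IsHol i → hproj i x = 0 := by
  have h1 : ∀ i, HasSum (fun k => c k • hproj i (hproj ((k : ℤ), 0) v)) (hproj i x) := fun i => by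
    simpa only [Function.comp_def, map_smul] using (hproj i).hasSum h
  have h2 : ∀ i (k : ℕ), i ≠ ((k : ℤ), 0) → hproj i (hproj ((k : ℤ), 0) v) = 0 := fun i k hi =>
    (isOrthDecomp_harm n).proj_of_mem_ne hi (proj_mem (V := harm n) _ v)
  refine ⟨fun j => ?_, fun i hi => ?_⟩
  · have h3 := (h1 ((j : ℤ), 0)).unique (hasSum_single j fun k hk => by
      rw [h2 _ k (by simpa using hk.symm), smul_zero])
    rw [h3, proj_of_mem (proj_mem (V := harm n) _ v)]
  · refine (h1 i).unique ?_
    have : (fun k : ℕ => c k • hproj i (hproj ((k : ℤ), 0) v)) = fun _ => 0 := funext fun k => by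
      rw [h2 i k fun h => hi ⟨k, h⟩, smul_zero]
    rw [this]
    exact hasSum_zero

theorem hproj_eq_zero_of_inner {n : ℕ} {i : ℤ × ℤ} {v : L2S n}
    (h : ∀ Y, IsHarm i.1 i.2 Y → ⟪toL2 (res Y), v⟫_ℂ = 0) : hproj i v = 0 := by
  rw [Submodule.starProjection_apply_eq_zero_iff, Submodule.mem_orthogonal]
  intro u hu
  refine harm_induction (P := fun u => ⟪u, v⟫_ℂ = 0) ?_ h (by simp) (fun x y hx hy => ?_)
    (fun c x hx => ?_) hu
  · exact isClosed_eq (by fun_prop) continuous_const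
  · rw [inner_add_left, hx, hy, add_zero]
  · rw [inner_smul_left, hx, mul_zero]

/-- The restriction of a function on the ball to the sphere of radius `t`. -/
def dil (h : Cn n → ℂ) (t : ℝ) : L2S n := toL2 fun ζ : Sph n => h (t • (ζ : Cn n))

theorem holExt_zero {G : Cn n → ℂ} (hc : ContinuousOn G (Metric.closedBall 0 1))
    (hd : DifferentiableOn ℂ G (Ball n)) {z : Cn n} (hz : z ∈ Ball n) :
    holExt 0 (toL2 fun ζ : Sph n => G ζ) z = G z := by
  refine (hasSum_holExt (r := 0) _ hz).unique ?_
  simpa only [holWt, Real.rpow_zero, Complex.ofReal_one, one_mul] using hasSum_taylor hc hd hz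

theorem hasSum_dil {G : Cn n → ℂ} (hc : ContinuousOn G (Metric.closedBall 0 1))
    (hd : DifferentiableOn ℂ G (Ball n)) {s : ℝ} (h0 : 0 ≤ s) (h1 : s < 1) :
    HasSum (fun k : ℕ => ((s ^ k : ℝ) : ℂ) • hproj ((k : ℤ), 0) (toL2 fun ζ : Sph n => G ζ))
      (dil G s) := by
  have h := hasSum_toL2_holExt (r := 0) (toL2 fun ζ : Sph n => G ζ) h0 h1
  simp only [holExt_zero hc hd (smul_sph_mem_ball h0 h1 _)] at h
  simp only [holWt, Real.rpow_zero, one_mul] at h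
  exact h

variable {h : Cn n → ℂ}

theorem continuousOn_comp_smul {n : ℕ} {h : Cn n → ℂ} {t : ℝ} (h0 : 0 ≤ t) (h1 : t < 1)
    (hd : DifferentiableOn ℂ h (Ball n)) :
    ContinuousOn (fun z => h (t • z)) (Metric.closedBall 0 1) ∧
      DifferentiableOn ℂ (fun z => h (t • z)) (Ball n) := by
  have hmem : ∀ z : Cn n, ‖z‖ ≤ 1 → t • z ∈ Ball n := fun z hz => by
    rw [mem_ball_zero_iff, norm_smul, Real.norm_of_nonneg h0]
    nlinarith [norm_nonneg z]
  refine ⟨hd.continuousOn.comp (by fun_prop) fun z hz => hmem z (mem_closedBall_zero_iff.1 hz),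
    hd.comp ?_ fun z hz => hmem z (mem_ball_zero_iff.1 hz).le⟩
  exact ((t • ContinuousLinearMap.id ℂ (Cn n)).differentiable).differentiableOn

theorem hasSum_dil_of_lt (hd : DifferentiableOn ℂ h (Ball n)) {t R : ℝ} (h0 : 0 < t) (h1 : t < R)
    (h2 : R < 1) :
    HasSum (fun k : ℕ => (((t / R) ^ k : ℝ) : ℂ) • hproj ((k : ℤ), 0) (dil h R)) (dil h t) := by
  have hR : 0 < R := h0.trans h1
  obtain ⟨hc', hd'⟩ := continuousOn_comp_smul hR.le h2 hd
  have h3 := hasSum_dil hc' hd' (s := t / R) (by positivity) ((div_lt_one hR).2 h1)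
  have h4 : dil (fun z => h (R • z)) (t / R) = dil h t := by
    simp only [dil, smul_smul, mul_div_cancel₀ t hR.ne']
  rw [h4] at h3
  exact h3

/-- The homogeneous components of a holomorphic function on the ball, as vectors in `L²(S)`. -/
def holComp (h : Cn n → ℂ) (k : ℕ) : L2S n := (2 ^ k : ℂ) • hproj ((k : ℤ), 0) (dil h (1 / 2))

/-- The components on the sphere of radius `t` are `t ^ k` times `holComp h k`, for all `t`; in
particular the radius `1 / 2` in the definition of `holComp` is irrelevant. -/
theorem hproj_dil (hd : DifferentiableOn ℂ h (Ball n)) {t : ℝ} (h0 : 0 < t) (h1 : t < 1) (k : ℕ) :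
    hproj ((k : ℤ), 0) (dil h t) = ((t ^ k : ℝ) : ℂ) • holComp h k := by
  obtain ⟨R, hR, hR1⟩ := exists_between (max_lt h1 (by norm_num : (1 / 2 : ℝ) < 1))
  have hR0 : 0 < R := h0.trans ((le_max_left _ _).trans_lt hR)
  rw [holComp, (hproj_of_hasSum (hasSum_dil_of_lt hd h0 ((le_max_left _ _).trans_lt hR) hR1)).1,
    (hproj_of_hasSum (hasSum_dil_of_lt hd (by norm_num) ((le_max_right _ _).trans_lt hR) hR1)).1,
    smul_smul, smul_smul]
  congr 1
  have : (R : ℂ) ≠ 0 := by exact_mod_cast hR0.ne'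
  push_cast
  rw [div_pow, div_pow, div_pow, one_pow]
  field_simp

theorem hproj_dil_of_not (hd : DifferentiableOn ℂ h (Ball n)) {t : ℝ} (h0 : 0 < t) (h1 : t < 1)
    {i : ℤ × ℤ} (hi : ¬IsHol i) : hproj i (dil h t) = 0 := by
  obtain ⟨R, hR, hR1⟩ := exists_between h1
  exact (hproj_of_hasSum (hasSum_dil_of_lt hd h0 hR hR1)).2 i hi

theorem hasSum_holComp (hd : DifferentiableOn ℂ h (Ball n)) {z : Cn n} (hz : z ∈ Ball n) :
    HasSum (fun k => taylor k (holComp h k) z) (h z) := by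
  obtain ⟨t, htz, ht1⟩ := exists_between (mem_ball_zero_iff.1 hz)
  have ht : 0 < t := (norm_nonneg z).trans_lt htz
  obtain ⟨hc', hd'⟩ := continuousOn_comp_smul ht.le ht1 hd
  have hz' : t⁻¹ • z ∈ Ball n := by
    rw [mem_ball_zero_iff, norm_smul, norm_inv, Real.norm_of_nonneg ht.le, inv_mul_lt_iff₀ ht]
    simpa using htz
  have h1 := hasSum_taylor hc' hd' hz'
  simp only [smul_inv_smul₀ ht.ne'] at h1
  have h2 : ∀ k, taylor k (toL2 fun ζ : Sph n => h (t • (ζ : Cn n))) (t⁻¹ • z) =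
      taylor k (holComp h k) z := fun k => by
    have htc : (t : ℂ) ≠ 0 := by exact_mod_cast ht.ne'
    have h3 := (isHarm_taylor k (holComp h k)).homog (t : ℂ) htc (t⁻¹ • z)
    have h4 : (t : ℂ) • t⁻¹ • z = z := smul_inv_smul₀ ht.ne' z
    rw [h4] at h3
    rw [h3, ← taylor_hproj k (toL2 _)]
    change taylor k (hproj ((k : ℤ), 0) (dil h t)) _ = _
    rw [hproj_dil hd ht ht1, taylor_smul]
    simp
  simpa only [h2] using h1

theorem eq_zero_of_holComp (hd : DifferentiableOn ℂ h (Ball n)) (h0 : ∀ k, holComp h k = 0)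
    {z : Cn n} (hz : z ∈ Ball n) : h z = 0 := by
  refine (hasSum_holComp hd hz).unique ?_
  simp only [h0, taylor, inner_zero_right, mul_zero]
  exact hasSum_zero

/-- Boundary values of holomorphic functions have only holomorphic components. -/
theorem hproj_boundary {G : Cn n → ℂ} (hc : ContinuousOn G (Metric.closedBall 0 1))
    (hd : DifferentiableOn ℂ G (Ball n)) {i : ℤ × ℤ} (hi : ¬IsHol i) :
    hproj i (toL2 fun ζ : Sph n => G ζ) = 0 := by
  refine hproj_eq_zero_of_inner fun Y hY => ?_
  have hF : ContinuousOn (fun z => (starRingEnd ℂ) (Y z) * G z) (Metric.closedBall 0 1) :=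
    ((Complex.continuous_conj.comp hY.smooth.continuous).continuousOn).mul hc
  -- on spheres of radius `t < 1` the inner product with `Y` vanishes; let `t → 1`
  have h1 := (continuousOn_sphere_mean hF) 1 (by simp)
  have hG : ∀ t ∈ Set.Icc (0 : ℝ) 1, Continuous fun ζ : Sph n => G (t • (ζ : Cn n)) := fun t ht =>
    hc.comp_continuous (by fun_prop) fun ζ => smul_sph_mem_closedBall ht.1 ht.2 ζ
  have h2 : ∀ t ∈ Set.Ioo (0 : ℝ) 1,
      ∫ ζ : Sph n, (starRingEnd ℂ) (Y (t • (ζ : Cn n))) * G (t • (ζ : Cn n)) ∂(surf n) = 0 := by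
    intro t ht
    have h3 : ⟪toL2 (res Y), dil G t⟫_ℂ = 0 := by
      have h4 := hY.mem_harm
      rw [← proj_of_mem (V := harm n) h4, Submodule.inner_starProjection_left_eq_right,
        show (harm n (i.1, i.2)).starProjection (dil G t) = 0 from
          hproj_dil_of_not hd ht.1 ht.2 hi, inner_zero_right]
    rw [dil, inner_toL2 hY.continuous_res (hG t ⟨ht.1.le, ht.2.le⟩)] at h3
    have htc : (t : ℂ) ≠ 0 := by exact_mod_cast ht.1.ne'
    have h5 : ∀ ζ : Sph n, (starRingEnd ℂ) (Y (t • (ζ : Cn n))) * G (t • (ζ : Cn n)) =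
        (starRingEnd ℂ) ((t : ℂ) ^ i.1 * (starRingEnd ℂ) (t : ℂ) ^ i.2) *
          ((starRingEnd ℂ) (res Y ζ) * G (t • (ζ : Cn n))) := fun ζ => by
      rw [show t • (ζ : Cn n) = (t : ℂ) • (ζ : Cn n) from rfl, hY.homog (t : ℂ) htc, map_mul,
        mul_assoc]
      rfl
    simp only [h5]
    rw [integral_const_mul, h3, mul_zero]
  rw [inner_toL2 hY.continuous_res (by simpa using hG 1 (by simp))]
  have h3 : Tendsto (fun t : ℝ => ∫ ζ : Sph n, (starRingEnd ℂ) (Y (t • (ζ : Cn n))) *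
      G (t • (ζ : Cn n)) ∂(surf n)) (𝓝[Set.Ioo 0 1] 1)
      (𝓝 (∫ ζ : Sph n, (starRingEnd ℂ) (Y ((1 : ℝ) • (ζ : Cn n))) *
        G ((1 : ℝ) • (ζ : Cn n)) ∂(surf n))) :=
    h1.mono_left (nhdsWithin_mono _ Set.Ioo_subset_Icc_self)
  simp only [one_smul] at h3
  have h4 : (𝓝[Set.Ioo 0 1] (1 : ℝ)).NeBot := by
    rw [nhdsWithin_Ioo_eq_nhdsLT one_pos]; infer_instance
  refine tendsto_nhds_unique h3 (tendsto_const_nhds.congr' ?_)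
  filter_upwards [self_mem_nhdsWithin] with t ht using (h2 t ht).symm

end Expansion

/-! ### Orthogonal sums of operators on the Hardy components -/

section OrthSum

variable {n : ℕ} {K : Type*} [NormedAddCommGroup K] [InnerProductSpace ℂ K]
  {A : ℕ → L2S n →L[ℂ] K} {β s : ℕ → ℝ} {M m : ℝ}

theorem hol_injective : Function.Injective fun k : ℕ => ((k : ℤ), (0 : ℤ)) := fun j k h => by
  simpa using h

/-- Riesz–Fischer for the holomorphic components. -/
theorem exists_of_summable_hol [NeZero n] {w : ℕ → L2S n}
    (hw : ∀ k : ℕ, w k ∈ harm n ((k : ℤ), 0))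
    (hs : Summable fun k => ‖w k‖ ^ 2) :
    ∃ v, ∀ k : ℕ, hproj ((k : ℤ), 0) v = w k := by
  set W : ℤ × ℤ → L2S n := Function.extend (fun k : ℕ => ((k : ℤ), (0 : ℤ))) w
    (fun _ => (0 : L2S n))
  have h1 : ∀ k : ℕ, W ((k : ℤ), 0) = w k := fun k => hol_injective.extend_apply w _ k
  have h2 : ∀ i ∉ Set.range fun k : ℕ => ((k : ℤ), (0 : ℤ)), W i = 0 := fun i hi =>
    Function.extend_apply' w _ i fun ⟨k, hk⟩ => hi ⟨k, hk⟩
  obtain ⟨v, -, hv⟩ := (isOrthDecomp_harm n).exists_of_summable (w := W) (fun i => by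
    by_cases hi : i ∈ Set.range fun k : ℕ => ((k : ℤ), (0 : ℤ))
    · obtain ⟨k, rfl⟩ := hi
      simp only [h1]
      exact hw k
    · rw [h2 i hi]; exact Submodule.zero_mem _)
    ((hol_injective.summable_iff fun i hi => by rw [h2 i hi]; simp).1
      (by simpa only [Function.comp_def, h1] using hs))
  exact ⟨v, fun k => (hv _).trans (h1 k)⟩

/-- The operators `A k` are multiples of isometries on the components of bidegree `(k, 0)`, with
pairwise orthogonal ranges. -/
structure IsHolFamily (A : ℕ → L2S n →L[ℂ] K) (β : ℕ → ℝ) : Prop where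
  pos : ∀ k, 0 < β k
  proj : ∀ k v, A k (hproj ((k : ℤ), 0) v) = A k v
  inner_self : ∀ k v w, ⟪A k v, A k w⟫_ℂ =
    β k * ⟪hproj ((k : ℤ), 0) v, hproj ((k : ℤ), 0) w⟫_ℂ
  inner_ne : ∀ j k v w, j ≠ k → ⟪A j v, A k w⟫_ℂ = 0

namespace IsHolFamily

theorem norm_sq (h : IsHolFamily A β) (k : ℕ) (v : L2S n) :
    ‖A k v‖ ^ 2 = β k * ‖hproj ((k : ℤ), 0) v‖ ^ 2 := by
  have h1 := h.inner_self k v v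
  rw [inner_self_eq_norm_sq_to_K, inner_self_eq_norm_sq_to_K] at h1
  have h2 : ((‖A k v‖ ^ 2 : ℝ) : ℂ) = ((β k * ‖hproj ((k : ℤ), 0) v‖ ^ 2 : ℝ) : ℂ) := by
    push_cast
    exact h1
  exact_mod_cast h2

theorem orthogonalFamily (h : IsHolFamily A β) :
    OrthogonalFamily ℂ (fun k => LinearMap.range (A k).toLinearMap)
      fun k => (LinearMap.range (A k).toLinearMap).subtypeₗᵢ := by
  rintro j k hjk ⟨_, v, rfl⟩ ⟨_, w, rfl⟩
  exact h.inner_ne j k v w hjk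

theorem norm_sq_sum (h : IsHolFamily A β) (F : Finset ℕ) (u : ℕ → L2S n) :
    ‖∑ k ∈ F, A k (u k)‖ ^ 2 = ∑ k ∈ F, β k * ‖hproj ((k : ℤ), 0) (u k)‖ ^ 2 := by
  simp only [← h.norm_sq]
  exact h.orthogonalFamily.norm_sum (fun k => ⟨A k (u k), u k, rfl⟩) F

theorem sum_norm_hproj_le [NeZero n] (F : Finset ℕ) (v : L2S n) :
    ∑ k ∈ F, ‖hproj ((k : ℤ), 0) v‖ ^ 2 ≤ ‖v‖ ^ 2 := by
  have h1 := (isOrthDecomp_harm n).hasSum_norm_sq v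
  have h2 := sum_le_hasSum (F.map ⟨_, hol_injective⟩) (fun i _ => sq_nonneg _) h1
  rwa [Finset.sum_map] at h2

theorem norm_sum_le [NeZero n] (h : IsHolFamily A β) (hM : ∀ k, s k ^ 2 * β k ≤ M) (F : Finset ℕ)
    (v : L2S n) : ‖∑ k ∈ F, (s k : ℂ) • A k v‖ ≤ √M * ‖v‖ := by
  have hM0 : 0 ≤ M := (mul_nonneg (sq_nonneg (s 0)) (h.pos 0).le).trans (hM 0)
  refine le_of_sq_le_sq ?_ (by positivity)
  rw [mul_pow, Real.sq_sqrt hM0]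
  have h1 := h.norm_sq_sum F fun k => (s k : ℂ) • v
  simp only [map_smul, norm_smul, mul_pow, Complex.norm_real, Real.norm_eq_abs, sq_abs] at h1
  rw [h1]
  calc _ ≤ ∑ k ∈ F, M * ‖hproj ((k : ℤ), 0) v‖ ^ 2 := by
        refine Finset.sum_le_sum fun k _ => ?_
        rw [← mul_assoc, mul_comm (β k)]
        gcongr
        exact hM k
    _ ≤ _ := by
        rw [← Finset.mul_sum]
        gcongr
        exact sum_norm_hproj_le F v

/-- A weighted sum of the operators `A k` with `s k ^ 2 * β k` bounded is a bounded operator. -/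
theorem exists_sum [NeZero n] [CompleteSpace K] (h : IsHolFamily A β)
    (hM : ∀ k, s k ^ 2 * β k ≤ M) :
    ∃ S : L2S n →L[ℂ] K, ∀ v, HasSum (fun k => (s k : ℂ) • A k v) (S v) := by
  have hs : ∀ v, Summable fun k => (s k : ℂ) • A k v := fun v => by
    have h1 := (h.orthogonalFamily.summable_iff_norm_sq_summable fun k =>
      ⟨A k ((s k : ℂ) • v), _, rfl⟩).2 ?_
    · simpa only [map_smul] using! h1
    · refine Summable.of_nonneg_of_le (fun k => sq_nonneg _) (fun k => ?_)
        (((isOrthDecomp_harm n).hasSum_norm_sq v).summable.comp_injective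
          hol_injective |>.mul_left M)
      change ‖A k ((s k : ℂ) • v)‖ ^ 2 ≤ M * ‖hproj ((k : ℤ), 0) v‖ ^ 2
      rw [h.norm_sq, map_smul, norm_smul, mul_pow, Complex.norm_real, Real.norm_eq_abs, sq_abs,
        ← mul_assoc, mul_comm (β k)]
      gcongr
      exact hM k
  refine ⟨LinearMap.mkContinuous ⟨⟨fun v => ∑' k, (s k : ℂ) • A k v, fun v w => ?_⟩, fun c v => ?_⟩
    (√M) fun v => ?_, fun v => (hs v).hasSum⟩
  · simp only [map_add, smul_add]
    exact (hs v).tsum_add (hs w)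
  · simp only [map_smul, smul_comm _ c, RingHom.id_apply]
    exact (hs v).tsum_const_smul c
  · exact le_of_tendsto (hs v).hasSum.norm (Eventually.of_forall fun F => h.norm_sum_le hM F v)

variable {S : L2S n →L[ℂ] K}

theorem inner_sum (h : IsHolFamily A β) (hS : ∀ v, HasSum (fun k => (s k : ℂ) • A k v) (S v))
    (j : ℕ) (w v : L2S n) : ⟪A j w, S v⟫_ℂ =
      s j * (β j * ⟪hproj ((j : ℤ), 0) w, hproj ((j : ℤ), 0) v⟫_ℂ) := by
  have h1 := (hS v).mapL (innerSL ℂ (A j w))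
  simp only [innerSL_apply_apply, inner_smul_right] at h1
  rw [← h.inner_self]
  exact h1.unique (hasSum_single j fun k hk => by rw [h.inner_ne j k w v hk.symm, mul_zero])

theorem sum_eq_zero_iff (h : IsHolFamily A β) (hs : ∀ k, 0 < s k)
    (hS : ∀ v, HasSum (fun k => (s k : ℂ) • A k v) (S v)) {v : L2S n} :
    S v = 0 ↔ ∀ k : ℕ, hproj ((k : ℤ), 0) v = 0 := by
  constructor
  · intro h0 k
    have h1 := h.inner_sum hS k v v
    have hsk : (s k : ℂ) ≠ 0 := by exact_mod_cast (hs k).ne'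
    have hβk : (β k : ℂ) ≠ 0 := by exact_mod_cast (h.pos k).ne'
    rw [h0, inner_zero_right] at h1
    simpa [hsk, hβk] using h1.symm
  · intro h0
    refine (hS v).unique ?_
    have : (fun k => (s k : ℂ) • A k v) = fun _ => 0 := funext fun k => by
      rw [← h.proj k v, h0, map_zero, smul_zero]
    rw [this]
    exact hasSum_zero

/-- Bessel's inequality: every vector has the same projections to the ranges of the `A k` as a
vector in the range of the sum. -/
theorem exists_inner_eq [NeZero n] [CompleteSpace K] (h : IsHolFamily A β) (hm : 0 < m)
    (hs : ∀ k, 0 < s k) (hms : ∀ k, m ≤ s k ^ 2 * β k)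
    (hS : ∀ v, HasSum (fun k => (s k : ℂ) • A k v) (S v)) (y : K) :
    ∃ v, ∀ k w, ⟪A k w, y - S v⟫_ℂ = 0 := by
  set P : ℕ → L2S n →L[ℂ] L2S n := fun k => hproj ((k : ℤ), 0)
  have hPP : ∀ k v, P k (P k v) = P k v := fun k v => proj_of_mem (proj_mem (V := harm n) _ v)
  have hPs : ∀ k v w, ⟪P k v, w⟫_ℂ = ⟪v, P k w⟫_ℂ := fun k v w =>
    Submodule.inner_starProjection_left_eq_right _ _ _
  -- `A k (u k)` is the projection of `y` to the range of `A k`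
  set u : ℕ → L2S n := fun k => ((β k)⁻¹ : ℂ) • P k ((A k).adjoint y) with hu
  have huP : ∀ k, P k (u k) = u k := fun k => by simp only [hu, map_smul, hPP]
  have hAy : ∀ k w, ⟪A k w, y⟫_ℂ = β k * ⟪w, u k⟫_ℂ := fun k w => by
    have hβ : (β k : ℂ) ≠ 0 := by exact_mod_cast (h.pos k).ne'
    rw [← h.proj k w, ← ContinuousLinearMap.adjoint_inner_right, hu, inner_smul_right,
      mul_inv_cancel_left₀ hβ]
    exact hPs k w _
  have hBes : ∀ F : Finset ℕ, ∑ k ∈ F, β k * ‖u k‖ ^ 2 ≤ ‖y‖ ^ 2 := fun F => by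
    set X := ∑ k ∈ F, β k * ‖u k‖ ^ 2 with hX
    have hX0 : 0 ≤ X := Finset.sum_nonneg fun k _ => by have := h.pos k; positivity
    have h1 : ‖∑ k ∈ F, A k (u k)‖ ^ 2 = X := by
      rw [h.norm_sq_sum]
      exact Finset.sum_congr rfl fun k _ => by rw [show hproj ((k : ℤ), 0) (u k) = u k from huP k]
    have h2 : ⟪∑ k ∈ F, A k (u k), y⟫_ℂ = (X : ℂ) := by
      rw [sum_inner, hX]
      push_cast
      refine Finset.sum_congr rfl fun k _ => ?_
      rw [hAy, inner_self_eq_norm_sq_to_K]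
      rfl
    have h3 := norm_inner_le_norm (𝕜 := ℂ) (∑ k ∈ F, A k (u k)) y
    rw [h2, Complex.norm_real, Real.norm_of_nonneg hX0] at h3
    nlinarith [norm_nonneg y, norm_nonneg (∑ k ∈ F, A k (u k)),
      sq_nonneg (‖∑ k ∈ F, A k (u k)‖ - ‖y‖)]
  have hsum : Summable fun k => ‖((s k)⁻¹ : ℂ) • u k‖ ^ 2 := by
    refine summable_of_sum_le (c := m⁻¹ * ‖y‖ ^ 2) (fun k => sq_nonneg _) fun F => ?_
    refine le_trans ?_ (mul_le_mul_of_nonneg_left (hBes F) (inv_nonneg.2 hm.le))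
    rw [Finset.mul_sum]
    refine Finset.sum_le_sum fun k _ => ?_
    have hk := hs k
    rw [norm_smul, mul_pow, norm_inv, Complex.norm_real, Real.norm_of_nonneg hk.le, inv_pow,
      ← mul_assoc]
    refine mul_le_mul_of_nonneg_right ?_ (sq_nonneg _)
    rw [inv_mul_eq_div, le_div_iff₀ hm, inv_mul_le_iff₀ (by positivity)]
    exact hms k
  obtain ⟨v, hv⟩ := exists_of_summable_hol (w := fun k => ((s k)⁻¹ : ℂ) • u k) (fun k => by
    refine Submodule.smul_mem _ _ ?_
    rw [← huP k]
    exact proj_mem (V := harm n) _ _) hsum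
  refine ⟨v, fun k w => ?_⟩
  have hsk : (s k : ℂ) ≠ 0 := by exact_mod_cast (hs k).ne'
  have h1 : ⟪hproj ((k : ℤ), 0) w, u k⟫_ℂ = ⟪w, u k⟫_ℂ := by
    have := hPs k w (u k)
    rwa [huP] at this
  rw [inner_sub_right, hAy, h.inner_sum hS, hv,
    inner_smul_right (hproj ((k : ℤ), 0) w) (u k), h1, mul_left_comm (s k : ℂ),
    mul_inv_cancel_left₀ hsk, sub_self]

/-- The range is closed: a vector in its closure differs from the vector of `exists_inner_eq` by a
vector that is orthogonal to the range and lies in its closure. -/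
theorem isClosed_range [NeZero n] [CompleteSpace K] (h : IsHolFamily A β) (hm : 0 < m)
    (hs : ∀ k, 0 < s k) (hms : ∀ k, m ≤ s k ^ 2 * β k)
    (hS : ∀ v, HasSum (fun k => (s k : ℂ) • A k v) (S v)) :
    IsClosed (Set.range S) := by
  refine isClosed_of_closure_subset fun y hy => ?_
  obtain ⟨v, hv⟩ := h.exists_inner_eq hm hs hms hS y
  have h1 : ∀ x ∈ closure (Set.range S), ⟪y - S v, x⟫_ℂ = 0 := by
    refine closure_minimal (t := {x | ⟪y - S v, x⟫_ℂ = 0}) ?_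
      (isClosed_eq (by fun_prop) continuous_const)
    rintro _ ⟨w, rfl⟩
    have h2 := (hS w).mapL (innerSL ℂ (y - S v))
    refine h2.unique ?_
    simp only [innerSL_apply_apply, inner_smul_right]
    have : (fun k => (s k : ℂ) * ⟪y - S v, A k w⟫_ℂ) = fun _ => 0 := funext fun k => by
      rw [← inner_conj_symm, hv, map_zero, mul_zero]
    rw [this]
    exact hasSum_zero
  have h2 : ⟪y - S v, y - S v⟫_ℂ = 0 := by
    rw [inner_sub_right, h1 y hy, h1 _ (subset_closure ⟨v, rfl⟩), sub_zero]
  exact ⟨v, (sub_eq_zero.1 (inner_self_eq_zero.1 h2)).symm⟩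

end IsHolFamily

end OrthSum

/-! ### The moments of the weight -/

section Moments

open scoped Nat

/-- The moments of the radial weight `(1 - t²)^N`. -/
def radMoment (a N : ℕ) : ℝ := ∫ t in (0 : ℝ)..1, t ^ (2 * a + 1) * (1 - t ^ 2) ^ N

theorem radMoment_zero (a : ℕ) : (a + 1) * (2 * radMoment a 0) = 1 := by
  have h : radMoment a 0 = 1 / (2 * a + 2) := by
    simp only [radMoment, pow_zero, mul_one, integral_pow]
    norm_num
    ring
  rw [h]
  field_simp

theorem radMoment_succ (a N : ℕ) :
    (a + 1) * radMoment a (N + 1) = (N + 1) * radMoment (a + 1) N := by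
  -- integration by parts
  have h := intervalIntegral.integral_mul_deriv_eq_deriv_mul (a := 0) (b := 1)
    (u := fun t : ℝ => (1 - t ^ 2) ^ (N + 1)) (u' := fun t => -(2 * (N + 1)) * t * (1 - t ^ 2) ^ N)
    (v := fun t : ℝ => t ^ (2 * a + 2)) (v' := fun t => (2 * (a + 1)) * t ^ (2 * a + 1))
    (fun t _ => by
      have := ((hasDerivAt_const t (1 : ℝ)).sub (hasDerivAt_pow 2 t)).pow (N + 1)
      convert! this using 1
      push_cast
      simp
      ring)
    (fun t _ => by
      convert! hasDerivAt_pow (2 * a + 2) t using 1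
      rw [show 2 * a + 2 - 1 = 2 * a + 1 by omega]
      push_cast
      ring)
    (Continuous.intervalIntegrable (by fun_prop) _ _)
    (Continuous.intervalIntegrable (by fun_prop) _ _)
  have h1 : ∫ t in (0 : ℝ)..1, (1 - t ^ 2) ^ (N + 1) * (2 * (a + 1) * t ^ (2 * a + 1)) =
      2 * (a + 1) * radMoment a (N + 1) := by
    rw [radMoment, ← intervalIntegral.integral_const_mul]
    exact intervalIntegral.integral_congr fun t _ => by ring
  have h2 : ∫ t in (0 : ℝ)..1, -(2 * (N + 1)) * t * (1 - t ^ 2) ^ N * t ^ (2 * a + 2) =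
      -(2 * (N + 1)) * radMoment (a + 1) N := by
    rw [radMoment, ← intervalIntegral.integral_const_mul]
    exact intervalIntegral.integral_congr fun t _ => by ring
  rw [h1, h2] at h
  simp at h
  linarith

/-- The beta integral `2 ∫ t^{2a+1} (1 - t²)^N dt = N! / ((a + 1) ⋯ (a + N + 1))`. -/
theorem ascFactorial_mul_radMoment (N a : ℕ) :
    ((a + 1).ascFactorial (N + 1) : ℝ) * (2 * radMoment a N) = N ! := by
  induction N generalizing a with
  | zero => simpa [Nat.ascFactorial_succ] using radMoment_zero a
  | succ N ih =>
    have h1 : (a + 1).ascFactorial (N + 2) = (a + 1) * (a + 2).ascFactorial (N + 1) := by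
      rw [Nat.succ_ascFactorial, Nat.ascFactorial_succ]
    have h2 := ih (a + 1)
    rw [h1, Nat.factorial_succ]
    push_cast at h2 ⊢
    rw [← h2]
    linear_combination (2 * ((a + 2).ascFactorial (N + 1) : ℝ)) * radMoment_succ a N

/-- The moments decay like `(a + 1)^{-(N+1)}`. -/
theorem radMoment_bounds (a N : ℕ) :
    (N ! : ℝ) ≤ 2 * radMoment a N * (a + 1 + N) ^ (N + 1) ∧
      2 * radMoment a N * (a + 1) ^ (N + 1) ≤ (N ! : ℝ) ∧ 0 < radMoment a N := by
  have h := ascFactorial_mul_radMoment N a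
  have h1 : (((a + 1) ^ (N + 1) : ℕ) : ℝ) ≤ ((a + 1).ascFactorial (N + 1) : ℕ) :=
    Nat.cast_le.2 (Nat.pow_succ_le_ascFactorial _ _)
  have h2 : (((a + 1).ascFactorial (N + 1) : ℕ) : ℝ) ≤ ((a + (N + 1)) ^ (N + 1) : ℕ) :=
    Nat.cast_le.2 (Nat.ascFactorial_le_pow_add _ _)
  have h3 : (0 : ℝ) < N ! := by exact_mod_cast N.factorial_pos
  have h4 : 0 < radMoment a N := by
    have h5 : (0 : ℝ) ≤ ((a + 1).ascFactorial (N + 1) : ℝ) := Nat.cast_nonneg _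
    by_contra hc
    nlinarith
  push_cast at h1 h2
  rw [show (a : ℝ) + 1 + N = a + (N + 1) by ring]
  exact ⟨by nlinarith, by nlinarith, h4⟩

variable {n : ℕ} [NeZero n]

/-- The weights on the Hardy components have the size of powers of the degree. -/
theorem exists_holWt_sq (N : ℕ) : ∃ q : ℕ → ℝ,
    (∀ k : ℕ, ((k : ℝ) + 1) / 2 ≤ q k ∧ q k ≤ 2 * n * (k + 1)) ∧
    ∀ k, holWt n (filtrationStep n * ((N + 1 : ℝ) / 2) / 2) k ^ 2 = q k ^ (N + 1) := by
  have hn : (1 : ℝ) ≤ n := by exact_mod_cast NeZero.one_le (n := n)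
  have hsq : ∀ k, holWt n (filtrationStep n * ((N + 1 : ℝ) / 2) / 2) k ^ 2 =
      ((1 + lamPos n ((k : ℤ), 0)) ^ (filtrationStep n / 2)) ^ (N + 1) := fun k => by
    have h0 : 0 ≤ 1 + lamPos n ((k : ℤ), 0) := by linarith [one_le_lamPos (n := n) ((k : ℤ), 0)]
    rw [holWt, ← Real.rpow_natCast, ← Real.rpow_natCast, ← Real.rpow_mul h0, ← Real.rpow_mul h0]
    congr 1
    push_cast
    ring
  -- `1 + λ` is `1 + k²` for `n = 1` and `1 + (2n - 2) k` for `n ≥ 2`; its power `κ / 2` has linear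
  -- growth in both cases
  refine ⟨fun k => (1 + lamPos n ((k : ℤ), 0)) ^ (filtrationStep n / 2), fun k => ?_, hsq⟩
  have hk : (0 : ℝ) ≤ k := k.cast_nonneg
  simp only [lamPos_eq (n := n) (i := ((k : ℤ), 0)) (by simp) (by simp), lam, filtrationStep]
  split_ifs with h1
  · subst h1
    push_cast
    rw [← Real.sqrt_eq_rpow]
    refine ⟨Real.le_sqrt_of_sq_le ?_, Real.sqrt_le_iff.2 ⟨by positivity, ?_⟩⟩ <;>
      nlinarith [sq_nonneg ((k : ℝ) - 1)]
  · have h2 : (2 : ℝ) ≤ n := by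
      have := NeZero.one_le (n := n)
      exact_mod_cast (by omega : 2 ≤ n)
    simp only [div_self (two_ne_zero' ℝ), Real.rpow_one]
    push_cast
    constructor <;> nlinarith

/-- The norms of the weighted homogeneous components on the ball and on the sphere are
equivalent. -/
theorem exists_holWt_sq_bounds (N : ℕ) {ν : ℝ} (hν : 0 < ν) : ∃ m M : ℝ, 0 < m ∧ ∀ k : ℕ,
    m ≤ holWt n (filtrationStep n * ((N + 1 : ℝ) / 2) / 2) k ^ 2 *
      (ν * radMoment (n - 1 + k) N) ∧
    holWt n (filtrationStep n * ((N + 1 : ℝ) / 2) / 2) k ^ 2 *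
      (ν * radMoment (n - 1 + k) N) ≤ M := by
  obtain ⟨q, hq, hsq⟩ := exists_holWt_sq (n := n) N
  have hn : (1 : ℝ) ≤ n := by exact_mod_cast NeZero.one_le (n := n)
  have hf : (0 : ℝ) < N ! := by exact_mod_cast N.factorial_pos
  have hnN : (0 : ℝ) < n + N := by positivity
  refine ⟨ν * (N ! / 2) * (1 / (2 * (n + N))) ^ (N + 1), ν * (N ! / 2) * (2 * n) ^ (N + 1),
    by positivity, fun k => ?_⟩
  obtain ⟨h1, h2, h3⟩ := radMoment_bounds (n - 1 + k) N
  rw [hsq]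
  have hk : (0 : ℝ) ≤ k := k.cast_nonneg
  have hN : (0 : ℝ) ≤ N := N.cast_nonneg
  have e : ((n - 1 + k : ℕ) : ℝ) = n - 1 + k := by
    rw [Nat.cast_add, Nat.cast_sub (NeZero.one_le), Nat.cast_one]
  rw [e] at h1 h2
  have hq0 : 0 ≤ q k := le_trans (by positivity) (hq k).1
  constructor
  · have h4 : 1 / (2 * (n + N)) * ((n : ℝ) - 1 + k + 1 + N) ≤ q k := by
      refine le_trans ?_ (hq k).1
      rw [div_mul_eq_mul_div, div_le_div_iff₀ (by positivity) two_pos]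
      nlinarith
    have h5 : (0 : ℝ) ≤ n - 1 + k + 1 + N := by linarith
    calc _ ≤ ν * (2 * radMoment (n - 1 + k) N * (n - 1 + k + 1 + N) ^ (N + 1) / 2) *
          (1 / (2 * (n + N))) ^ (N + 1) := by gcongr
      _ = (1 / (2 * (n + N)) * ((n : ℝ) - 1 + k + 1 + N)) ^ (N + 1) *
          (ν * radMoment (n - 1 + k) N) := by rw [mul_pow]; ring
      _ ≤ _ := by gcongr
  · have h4 : q k ≤ 2 * n * ((n : ℝ) - 1 + k + 1) := by
      refine (hq k).2.trans ?_
      gcongr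
      linarith
    calc _ ≤ (2 * n * ((n : ℝ) - 1 + k + 1)) ^ (N + 1) * (ν * radMoment (n - 1 + k) N) := by gcongr
      _ = ν * (2 * radMoment (n - 1 + k) N * (n - 1 + k + 1) ^ (N + 1) / 2) *
          (2 * n) ^ (N + 1) := by rw [mul_pow]; ring
      _ ≤ _ := by gcongr

end Moments

/-! ### Homogeneous components in the weighted Bergman space -/

section BallSide

variable {n : ℕ} {l : ℕ}

theorem one_sub_norm_sq_pos {z : Cn n} (hz : z ∈ Ball n) : 0 < 1 - ‖z‖ ^ 2 := by
  have := mem_ball_zero_iff.1 hz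
  nlinarith [norm_nonneg z]

theorem ballWeight_univ_ne_top : ballWeight n l Set.univ ≠ ⊤ := by
  refine ne_top_of_le_ne_top (measure_ball_lt_top (μ := (volume : Measure (Cn n)))
    (x := 0) (r := 1)).ne ?_
  rw [ballWeight, withDensity_apply _ MeasurableSet.univ, Measure.restrict_univ]
  calc _ ≤ ∫⁻ _ in Ball n, 1 := by
        refine setLIntegral_mono measurable_const fun z hz => ?_
        rw [ENNReal.ofReal_le_one]
        exact pow_le_one₀ (one_sub_norm_sq_pos hz).le (by nlinarith [sq_nonneg ‖z‖])
    _ = _ := by simp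

theorem ballWeight_univ_ne_zero : ballWeight n l Set.univ ≠ 0 := by
  rw [ballWeight, withDensity_apply _ MeasurableSet.univ, Measure.restrict_univ]
  refine (((setLIntegral_pos_iff (by fun_prop)).2 ?_).ne')
  rw [Set.inter_eq_right.2 fun z hz => ?_]
  · exact Metric.measure_ball_pos _ _ one_pos
  · rw [Function.mem_support]
    exact (ENNReal.ofReal_pos.2 (pow_pos (one_sub_norm_sq_pos hz) _)).ne'

instance : IsFiniteMeasure (muBall n l) :=
  ⟨by
    rw [muBall, Measure.smul_apply, smul_eq_mul]
    exact ENNReal.mul_lt_top (ENNReal.inv_lt_top.2 (pos_iff_ne_zero.2 ballWeight_univ_ne_zero))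
      (lt_top_iff_ne_top.2 ballWeight_univ_ne_top)⟩

/-- The normalising constant of `μ_l`. -/
def ballConst (n l : ℕ) : ℝ := (ballWeight n l Set.univ)⁻¹.toReal

theorem ballConst_pos : 0 < ballConst n l :=
  ENNReal.toReal_pos (ENNReal.inv_ne_zero.2 ballWeight_univ_ne_top)
    (ENNReal.inv_ne_top.2 ballWeight_univ_ne_zero)

/-- Polar coordinates for `μ_l`. -/
theorem integral_muBall [NeZero n] {H : Cn n → ℂ} (hH : Integrable H (muBall n l)) :
    ∫ z, H z ∂(muBall n l) = ballConst n l *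
      ∫ t in (0 : ℝ)..1, ((t ^ (2 * n - 1) * (1 - t ^ 2) ^ (l - n) : ℝ) : ℂ) *
        ∫ ζ : Sph n, H (t • (ζ : Cn n)) ∂(surf n) := by
  have hd : Measurable fun z : Cn n => ENNReal.ofReal ((1 - ‖z‖ ^ 2) ^ (l - n)) := by fun_prop
  have hlt : ∀ᵐ z ∂((volume : Measure (Cn n)).restrict (Ball n)),
      ENNReal.ofReal ((1 - ‖z‖ ^ 2) ^ (l - n)) < ⊤ := ae_of_all _ fun z => ENNReal.ofReal_lt_top
  have h1 : Integrable H (ballWeight n l) := by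
    rwa [muBall, integrable_smul_measure (ENNReal.inv_ne_zero.2 ballWeight_univ_ne_top)
      (ENNReal.inv_ne_top.2 ballWeight_univ_ne_zero)] at hH
  have h2 : IntegrableOn (fun z => ((1 - ‖z‖ ^ 2) ^ (l - n) : ℝ) • H z) (Ball n) := by
    rw [ballWeight, integrable_withDensity_iff_integrable_smul' hd hlt] at h1
    refine IntegrableOn.congr_fun h1 (fun z hz => ?_) measurableSet_ball
    simp only [ENNReal.toReal_ofReal (pow_nonneg (one_sub_norm_sq_pos hz).le _)]
  have h3 := integral_polar_iterated (h2.integrable_indicator measurableSet_ball)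
  rw [integral_indicator measurableSet_ball] at h3
  have h4 : ∫ z, H z ∂(ballWeight n l) = ∫ z in Ball n, ((1 - ‖z‖ ^ 2) ^ (l - n) : ℝ) • H z := by
    rw [ballWeight, integral_withDensity_eq_integral_toReal_smul hd hlt]
    refine setIntegral_congr_fun measurableSet_ball fun z hz => ?_
    simp only [ENNReal.toReal_ofReal (pow_nonneg (one_sub_norm_sq_pos hz).le _)]
  rw [muBall, integral_smul_measure, h4, h3, intervalIntegral.integral_of_le zero_le_one,
    Complex.real_smul]
  congr 1
  rw [integral_Ioc_eq_integral_Ioo, setIntegral_eq_of_subset_of_forall_sdiff_eq_zero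
    measurableSet_Ioi Set.Ioo_subset_Ioi_self]
  · refine setIntegral_congr_fun measurableSet_Ioo fun t ht => ?_
    have hm : ∀ ζ : Sph n, t • (ζ : Cn n) ∈ Ball n := smul_sph_mem_ball ht.1.le ht.2
    simp only [Set.indicator_of_mem (hm _), norm_smul, norm_sph, mul_one, Real.norm_eq_abs, sq_abs,
      Complex.real_smul]
    rw [integral_const_mul]
    push_cast
    ring
  · intro t ht
    have hm : ∀ ζ : Sph n, t • (ζ : Cn n) ∉ Ball n := fun ζ hζ => by
      rw [mem_ball_zero_iff, norm_smul, norm_sph, mul_one, Real.norm_of_nonneg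
        (le_of_lt ht.1)] at hζ
      exact ht.2 ⟨ht.1, hζ⟩
    simp only [Set.indicator_of_notMem (hm _), integral_zero, smul_zero]

theorem memLp_taylor (k : ℕ) (v : L2S n) : MemLp (taylor k v) 2 (muBall n l) := by
  refine MemLp.of_bound (differentiable_taylor k v).continuous.aestronglyMeasurable
    (szCoeff n k * (‖cls n‖ * ‖v‖)) (ae_muBall fun z hz => ?_)
  refine (norm_taylor_le k v z).trans (mul_le_of_le_one_right ?_ ?_)
  · have := szCoeff_nonneg n k
    positivity
  · exact pow_le_one₀ (norm_nonneg z) (mem_ball_zero_iff.1 hz).le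

/-- The homogeneous component of degree `k` of the Poisson extension, as an element of
`L²(B, μ_l)`. -/
def ballComp (n l k : ℕ) : L2S n →L[ℂ] L2B n l :=
  LinearMap.mkContinuous
    ⟨⟨fun v => (memLp_taylor k v).toLp (taylor k v), fun v w => by
      rw [← MemLp.toLp_add]
      exact MemLp.toLp_congr _ _ (ae_of_all _ (taylor_add k v w))⟩, fun c v => by
      exact MemLp.toLp_congr (memLp_taylor k (c • v)) ((memLp_taylor k v).const_smul c)
        (ae_of_all _ fun z => taylor_smul k c v z)⟩
    ((measureUnivNNReal (muBall n l) : ℝ) ^ (2 : ENNReal).toReal⁻¹ * (szCoeff n k * ‖cls n‖))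
    fun v => by
      have h0 : 0 ≤ szCoeff n k * (‖cls n‖ * ‖v‖) := by
        have := szCoeff_nonneg n k
        positivity
      have h := Lp.norm_le_of_ae_bound (f := (memLp_taylor k v).toLp (taylor k v)) h0 (by
        filter_upwards [(memLp_taylor (l := l) k v).coeFn_toLp,
          ae_muBall (n := n) (l := l) fun z hz => mem_ball_zero_iff.1 hz] with z hz hz1
        rw [hz]
        exact (norm_taylor_le k v z).trans
          (mul_le_of_le_one_right h0 (pow_le_one₀ (norm_nonneg z) hz1.le)))
      refine h.trans_eq ?_
      ring

theorem coeFn_ballComp (k : ℕ) (v : L2S n) : ballComp n l k v =ᵐ[muBall n l] taylor k v :=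
  (memLp_taylor k v).coeFn_toLp

theorem taylor_smul_sph (k : ℕ) (v : L2S n) {t : ℝ} (ht : 0 < t) (ζ : Cn n) :
    taylor k v (t • ζ) = ((t ^ k : ℝ) : ℂ) * taylor k v ζ := by
  have htc : (t : ℂ) ≠ 0 := by exact_mod_cast ht.ne'
  have h := (isHarm_taylor k v).homog (t : ℂ) htc ζ
  rw [show (t : ℂ) • ζ = t • ζ from rfl] at h
  rw [h]
  simp

variable [NeZero n]

theorem dil_taylor (k : ℕ) (v : L2S n) {t : ℝ} (ht : 0 < t) :
    dil (taylor k v) t = ((t ^ k : ℝ) : ℂ) • hproj ((k : ℤ), 0) v := by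
  rw [← toL2_taylor_eq, ← toL2_const_mul (isHarm_taylor k v).continuous_res]
  simp only [dil, taylor_smul_sph k v ht]
  rfl

theorem holComp_taylor (k : ℕ) (v : L2S n) : holComp (taylor k v) k = hproj ((k : ℤ), 0) v := by
  rw [holComp, dil_taylor k v (by norm_num), map_smul, proj_of_mem (proj_mem (V := harm n) _ _),
    smul_smul]
  push_cast
  rw [← mul_pow]
  norm_num

theorem holComp_taylor_ne {j k : ℕ} (hjk : j ≠ k) (v : L2S n) : holComp (taylor k v) j = 0 := by
  rw [holComp, dil_taylor k v (by norm_num), map_smul, (isOrthDecomp_harm n).proj_of_mem_ne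
    (fun h => hjk (by simpa using h)) (proj_mem (V := harm n) _ _), smul_zero, smul_zero]

/-- The inner product with a homogeneous polynomial only depends on the homogeneous component of
the same degree. -/
theorem inner_ballComp (k : ℕ) (v : L2S n) {F : L2B n l} {h : Cn n → ℂ}
    (hd : DifferentiableOn ℂ h (Ball n)) (hF : F =ᵐ[muBall n l] h) :
    ⟪ballComp n l k v, F⟫_ℂ =
      ((ballConst n l * radMoment (n - 1 + k) (l - n) : ℝ) : ℂ) * ⟪v, holComp h k⟫_ℂ := by
  have hae : (fun z => ⟪(ballComp n l k v : Cn n → ℂ) z, F z⟫_ℂ) =ᵐ[muBall n l]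
      fun z => (starRingEnd ℂ) (taylor k v z) * h z := by
    filter_upwards [coeFn_ballComp (l := l) k v, hF] with z h1 h2
    rw [h1, h2, RCLike.inner_apply, mul_comm]
  rw [L2.inner_def, integral_congr_ae hae,
    integral_muBall ((L2.integrable_inner (ballComp n l k v) F).congr hae)]
  have h1 : ∀ t ∈ Set.Ioo (0 : ℝ) 1,
      ((t ^ (2 * n - 1) * (1 - t ^ 2) ^ (l - n) : ℝ) : ℂ) *
        ∫ ζ : Sph n, (starRingEnd ℂ) (taylor k v (t • (ζ : Cn n))) * h (t • (ζ : Cn n)) ∂(surf n) =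
      ((t ^ (2 * (n - 1 + k) + 1) * (1 - t ^ 2) ^ (l - n) : ℝ) : ℂ) * ⟪v, holComp h k⟫_ℂ := by
    intro t ht
    have hc : Continuous fun ζ : Sph n => h (t • (ζ : Cn n)) :=
      hd.continuousOn.comp_continuous (by fun_prop) (smul_sph_mem_ball ht.1.le ht.2)
    have h2 : ∫ ζ : Sph n, (starRingEnd ℂ) (taylor k v (t • (ζ : Cn n))) * h (t • (ζ : Cn n))
        ∂(surf n) = ⟪dil (taylor k v) t, dil h t⟫_ℂ :=
      (inner_toL2 ((differentiable_taylor k v).continuous.comp (by fun_prop)) hc).symm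
    rw [h2, dil_taylor k v ht.1, inner_smul_left, Submodule.inner_starProjection_left_eq_right,
      hproj_dil hd ht.1 ht.2, inner_smul_right, Complex.conj_ofReal]
    have e : 2 * (n - 1 + k) + 1 = 2 * n - 1 + k + k := by
      have := NeZero.one_le (n := n)
      omega
    rw [e, pow_add, pow_add]
    push_cast
    ring
  rw [intervalIntegral.integral_of_le zero_le_one, integral_Ioc_eq_integral_Ioo,
    setIntegral_congr_fun measurableSet_Ioo h1, ← integral_Ioc_eq_integral_Ioo,
    ← intervalIntegral.integral_of_le zero_le_one, intervalIntegral.integral_mul_const,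
    intervalIntegral.integral_ofReal, radMoment]
  push_cast
  ring

theorem isHolFamily_ballComp : IsHolFamily (ballComp n l)
    fun k => ballConst n l * radMoment (n - 1 + k) (l - n) where
  pos k := mul_pos ballConst_pos (radMoment_bounds _ _).2.2
  proj k v := by
    apply Lp.ext
    filter_upwards [coeFn_ballComp (l := l) k v,
      coeFn_ballComp (l := l) k (hproj ((k : ℤ), 0) v)] with z h1 h2
    rw [h1, h2, taylor_hproj]
  inner_self k v w := by
    rw [inner_ballComp k v (differentiable_taylor k w).differentiableOn (coeFn_ballComp k w),
      holComp_taylor, Submodule.inner_starProjection_left_eq_right,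
      proj_of_mem (proj_mem (V := harm n) _ _)]
  inner_ne j k v w hjk := by
    rw [inner_ballComp j v (differentiable_taylor k w).differentiableOn (coeFn_ballComp k w),
      holComp_taylor_ne hjk, inner_zero_right, mul_zero]

end BallSide

/-! ### The extended Szegö map -/

section SzegoMap

variable {n : ℕ} [NeZero n] {l : ℕ} {r : ℝ} {S : L2S n →L[ℂ] L2B n l}

/-- The Hardy space: the vectors in `L²(S)` with only holomorphic components. -/
def hardy (n : ℕ) : Submodule ℂ (L2S n) where
  carrier := {v | ∀ i, ¬IsHol i → hproj i v = 0}
  add_mem' hv hw i hi := by rw [map_add, hv i hi, hw i hi, add_zero]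
  zero_mem' _ _ := map_zero _
  smul_mem' c v hv i hi := by rw [map_smul, hv i hi, smul_zero]

theorem isClosed_hardy (n : ℕ) : IsClosed (hardy n : Set (L2S n)) := by
  have h : (hardy n : Set (L2S n)) = ⋂ (i) (_ : ¬IsHol i), {v | hproj i v = 0} := by
    ext v
    simp only [Set.mem_iInter]
    rfl
  rw [h]
  exact isClosed_biInter fun i _ => isClosed_eq (hproj i).continuous continuous_const

/-- Closed subspaces containing all homogeneous holomorphic polynomials contain the Hardy space. -/
theorem hardy_le {P : Submodule ℂ (L2S n)} (hc : IsClosed (P : Set (L2S n)))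
    (h : ∀ (k : ℕ) Y, IsHarm k 0 Y → toL2 (res Y) ∈ P) : hardy n ≤ P := by
  intro v hv
  refine hc.mem_of_tendsto ((isOrthDecomp_harm n).hasSum_proj v)
    (Eventually.of_forall fun F => Submodule.sum_mem _ fun i _ => ?_)
  by_cases hi : IsHol i
  · obtain ⟨k, rfl⟩ := hi
    exact harm_induction (P := fun v => v ∈ P) hc (h k) P.zero_mem
      (fun _ _ => P.add_mem) (fun c _ => P.smul_mem c) (proj_mem (V := harm n) _ v)
  · have h0 : (harm n i).starProjection v = 0 := hv i hi
    rw [h0]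
    exact P.zero_mem

/-- The `L²` limit of the partial sums of the homogeneous expansion is its pointwise sum. -/
theorem coeFn_of_hasSum (hS : ∀ v, HasSum (fun k => (holWt n r k : ℂ) • ballComp n l k v) (S v))
    (v : L2S n) : S v =ᵐ[muBall n l] holExt r v := by
  have h1 : ∀ N : ℕ, ((∑ k ∈ Finset.range N, (holWt n r k : ℂ) • ballComp n l k v : L2B n l) :
      Cn n → ℂ) =ᵐ[muBall n l] fun z => ∑ k ∈ Finset.range N, (holWt n r k : ℂ) * taylor k v z := by
    intro N
    induction N with
    | zero =>
      simp only [Finset.range_zero, Finset.sum_empty]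
      exact Lp.coeFn_zero _ _ _
    | succ N ih =>
      rw [Finset.sum_range_succ]
      filter_upwards [Lp.coeFn_add (∑ k ∈ Finset.range N, (holWt n r k : ℂ) • ballComp n l k v)
        ((holWt n r N : ℂ) • ballComp n l N v), ih, Lp.coeFn_smul (holWt n r N : ℂ)
        (ballComp n l N v), coeFn_ballComp (l := l) N v] with z h1 h2 h3 h4
      rw [h1, Pi.add_apply, h2, h3, Pi.smul_apply, h4, Finset.sum_range_succ, smul_eq_mul]
  -- convergence in `L²` implies convergence almost everywhere along a subsequence
  obtain ⟨ns, hns, hae⟩ :=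
    (tendstoInMeasure_of_tendsto_Lp (hS v).tendsto_sum_nat).exists_seq_tendsto_ae
  filter_upwards [hae, ae_all_iff.2 h1, ae_muBall (n := n) (l := l) fun z hz => hz] with z h2 h3 hz
  refine tendsto_nhds_unique h2 ?_
  simp only [h3]
  exact ((hasSum_holExt v hz).tendsto_sum_nat).comp hns.tendsto_atTop

/-- The weights `(1 + λ)^r` of `holExt` undo the operator `(1 + Δ_H)^{-r}`. -/
theorem holExt_smoothing (hr : 0 ≤ r) (x : L2S n) {z : Cn n} (hz : z ∈ Ball n) :
    szC n * holExt r (smoothing n r x) z = szego x z := by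
  refine ((hasSum_holExt (r := r) (smoothing n r x) hz).mul_left (szC n)).unique ?_
  have h : ∀ k : ℕ, szC n * ((holWt n r k : ℂ) * taylor k (smoothing n r x) z) =
      szC n * taylor k x z := fun k => by
    rw [← taylor_hproj, hproj_smoothing hr, taylor_smul, taylor_hproj,
      ← mul_assoc (holWt n r k : ℂ),
      ← Complex.ofReal_mul, holWt, mul_comm (_ ^ r), wt_mul_rpow, Complex.ofReal_one, one_mul]
  simp only [h]
  exact hasSum_szego x hz

/-- The operator extends the Szegő map: the function `x`, as a distribution, is stored as the vector
`smoothing n r x`. -/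
theorem coeFn_smoothing (hr : 0 ≤ r)
    (hS : ∀ v, HasSum (fun k => (holWt n r k : ℂ) • ballComp n l k v) (S v)) (x : L2S n) :
    (szC n • S) (smoothing n r x) =ᵐ[muBall n l] szego x := by
  filter_upwards [Lp.coeFn_smul (szC n) (S (smoothing n r x)), coeFn_of_hasSum hS (smoothing n r x),
    ae_muBall (n := n) (l := l) fun z hz => hz] with z h1 h2 hz
  rw [smul_apply, h1, Pi.smul_apply, h2, smul_eq_mul, holExt_smoothing hr x hz]

theorem ae_comp_mobius {n l : ℕ} (hl : n ≤ l) (g : SU n) {p : Cn n → Prop}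
    (h : ∀ᵐ z ∂(muBall n l), p z) :
    ∀ᵐ z ∂(muBall n l), p (mobius g z) := by
  have h1 := (measurePreserving_mobius hl g).quasiMeasurePreserving.ae h
  rw [ae_withDensity_iff (measurable_ballJac g)] at h1
  filter_upwards [h1, ae_muBall (n := n) (l := l) fun z hz => hz] with z h2 hz
  refine h2 (ENNReal.ofReal_pos.2 (pow_pos (inv_pos.2 (norm_pos_iff.2 ?_)) _)).ne'
  exact autJ_ne_zero g (mem_ball_zero_iff.1 hz).le

theorem ae_comp_sphMobius (g : SU n) {p : Sph n → Prop} (h : ∀ᵐ ζ ∂(surf n), p ζ) :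
    ∀ᵐ ζ ∂(surf n), p (sphMobius g ζ) := by
  have h1 := (measurePreserving_sphMobius g).quasiMeasurePreserving.ae h
  rw [sphJac, ae_withDensity_iff (measurable_sphJac g)] at h1
  filter_upwards [h1] with ζ h2
  exact h2 (ENNReal.ofReal_pos.2 (pow_pos (inv_pos.2 (norm_pos_iff.2 (autJ_sph_ne_zero g ζ)))
    _)).ne'

theorem ballRep_congr {n l : ℕ} (hl : n ≤ l) {m : ℤ} {π : SU n →* (L2B n l →L[ℂ] L2B n l)}
    (hπ : IsBallRep m π) (g : SU n) {F : L2B n l} {h : Cn n → ℂ} (hF : F =ᵐ[muBall n l] h) :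
    π g F =ᵐ[muBall n l] ballAct m g h := by
  filter_upwards [hπ g F, ae_comp_mobius hl g⁻¹ hF] with z h1 h2
  rw [h1, ballAct, ballAct, h2]

/-- Equivariance of weight `n` on functions is the transformation law of the Szegő kernel; it
extends to distributions by density. -/
theorem szego_equivariant (hl : n ≤ l) (hr : 0 ≤ r)
    (hS : ∀ v, HasSum (fun k => (holWt n r k : ℂ) • ballComp n l k v) (S v))
    {π : SU n →* (L2B n l →L[ℂ] L2B n l)} (hπ : IsBallRep n π) (g : SU n) (u : L2S n) :
    (szC n • S) (sobRep hr n g u) = π g ((szC n • S) u) := by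
  refine congrFun (ext_smoothing (f := fun u => (szC n • S) (sobRep hr n g u))
    (g := fun u => π g ((szC n • S) u)) hr (by fun_prop) (by fun_prop) fun x => ?_) u
  apply Lp.ext
  rw [sobRep_smoothing]
  filter_upwards [coeFn_smoothing hr hS (repS n n g x),
    ballRep_congr hl hπ g (coeFn_smoothing hr hS x),
    ae_muBall (n := n) (l := l) fun z hz => hz] with z h1 h2 hz
  rw [h1, h2, szego_congr (coeFn_repS n g x), szego_translate g x hz]

theorem ballAct_holo {n : ℕ} (m : ℤ) (g : SU n) {Y : Cn n → ℂ} (hY : Differentiable ℂ Y) :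
    ContinuousOn (ballAct m g Y) (Metric.closedBall 0 1) ∧
      DifferentiableOn ℂ (ballAct m g Y) (Ball n) := by
  have h : ∀ z ∈ Metric.closedBall (0 : Cn n) 1, DifferentiableAt ℂ (ballAct m g Y) z := by
    intro z hz
    have hJ := autJ_ne_zero g⁻¹ (mem_closedBall_zero_iff.1 hz)
    have h1 : DifferentiableAt ℂ (autJ g⁻¹) z :=
      ((contDiff_autJ g⁻¹ (k := 1)).differentiable one_ne_zero) z
    have h2 : DifferentiableAt ℂ (mobius g⁻¹) z :=
      (contDiffAt_mobius g⁻¹ hJ (k := 1)).differentiableAt one_ne_zero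
    exact (h1.zpow (Or.inl hJ)).mul ((hY _).comp z h2)
  exact ⟨fun z hz => (h z hz).continuousAt.continuousWithinAt,
    fun z hz => (h z (Metric.ball_subset_closedBall hz)).differentiableWithinAt⟩

theorem smoothing_of_mem (hr : 0 ≤ r) {i : ℤ × ℤ} {v : L2S n} (hv : v ∈ harm n i) :
    smoothing n r v = (wt n r i : ℂ) • v := by
  refine (isOrthDecomp_harm n).ext fun j => ?_
  change hproj j _ = hproj j _
  rw [hproj_smoothing hr, map_smul]
  by_cases hj : j = i
  · rw [hj]
  · rw [show hproj j v = 0 from (isOrthDecomp_harm n).proj_of_mem_ne hj hv, smul_zero, smul_zero]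

/-- On boundary values of holomorphic functions, the Szegö map is the identity up to a factor, so
that it commutes with all the actions. -/
theorem szego_equivariant_hardy (hl : n ≤ l) (hr : 0 ≤ r)
    (hS : ∀ v, HasSum (fun k => (holWt n r k : ℂ) • ballComp n l k v) (S v)) (m : ℤ)
    {π : SU n →* (L2B n l →L[ℂ] L2B n l)} (hπ : IsBallRep m π) (g : SU n) {u : L2S n}
    (hu : u ∈ hardy n) :
    sobRep hr m g u ∈ hardy n ∧ (szC n • S) (sobRep hr m g u) = π g ((szC n • S) u) := by
  set D : L2S n →L[ℂ] L2B n l := (szC n • S) ∘L sobRep hr m g - π g ∘L (szC n • S) with hD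
  set P : Submodule ℂ (L2S n) :=
    (hardy n).comap (sobRep hr m g).toLinearMap ⊓ LinearMap.ker D.toLinearMap with hP
  suffices h : hardy n ≤ P from ⟨(h hu).1, sub_eq_zero.1 (h hu).2⟩
  have hc : IsClosed (P : Set (L2S n)) :=
    ((isClosed_hardy n).preimage (sobRep hr m g).continuous).inter
      (isClosed_eq D.continuous continuous_const)
  -- by continuity it suffices to consider polynomials, whose translates are holomorphic on the
  -- closed ball
  refine hardy_le hc fun k Y hY => ?_
  have hw : (wt n r ((k : ℤ), 0) : ℂ) ≠ 0 := by exact_mod_cast (wt_pos r _).ne'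
  rw [← Submodule.smul_mem_iff P hw, ← smoothing_of_mem hr hY.mem_harm]
  obtain ⟨hGc, hGd⟩ := ballAct_holo m g hY.differentiable
  have hrep : repS n m g (toL2 (res Y)) = toL2 fun ζ : Sph n => ballAct m g Y ζ := by
    refine eq_toL2 (hGc.comp_continuous (by fun_prop) fun ζ => Metric.sphere_subset_closedBall ζ.2)
      ?_
    filter_upwards [coeFn_repS m g (toL2 (res Y)),
      ae_comp_sphMobius g⁻¹ (coeFn_toL2 hY.continuous_res)] with ζ h1 h2
    rw [h1, h2]
    rfl
  have hsm : sobRep hr m g (smoothing n r (toL2 (res Y))) =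
      smoothing n r (toL2 fun ζ : Sph n => ballAct m g Y ζ) := by
    rw [sobRep_smoothing, hrep]
  refine ⟨?_, ?_⟩
  · change sobRep hr m g (smoothing n r (toL2 (res Y))) ∈ hardy n
    rw [hsm]
    intro i hi
    rw [hproj_smoothing hr, hproj_boundary hGc hGd hi, smul_zero]
  · change (szC n • S) (sobRep hr m g (smoothing n r (toL2 (res Y)))) -
      π g ((szC n • S) (smoothing n r (toL2 (res Y)))) = 0
    rw [sub_eq_zero, hsm]
    apply Lp.ext
    have hGs : Continuous fun ζ : Sph n => ballAct m g Y ζ :=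
      hGc.comp_continuous (by fun_prop) fun ζ => Metric.sphere_subset_closedBall ζ.2
    filter_upwards [coeFn_smoothing hr hS (toL2 fun ζ : Sph n => ballAct m g Y ζ),
      ballRep_congr hl hπ g (coeFn_smoothing hr hS (toL2 (res Y))),
      ae_muBall (n := n) (l := l) fun z hz => hz] with z h1 h2 hz
    rw [h1, h2, szego_congr (coeFn_toL2 hGs), szego_of_differentiableOn hGc hGd hz, ballAct,
      ballAct,
      szego_congr (coeFn_toL2 hY.continuous_res)]
    have h3 := szego_of_differentiableOn hY.differentiable.continuous.continuousOn
      hY.differentiable.differentiableOn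
      (mem_ball_zero_iff.2 (norm_mobius_lt g⁻¹ (mem_ball_zero_iff.1 hz)))
    change szC n * _ = _ * szego (fun ζ : Sph n => Y ζ) _
    rw [h3]
    ring

/-- An operator that vanishes exactly on the vectors without holomorphic components has the Hardy
space as its source space. -/
theorem ker_orthogonal {K : Type*} [NormedAddCommGroup K] [InnerProductSpace ℂ K]
    {S : L2S n →L[ℂ] K} (h : ∀ v, S v = 0 ↔ ∀ k : ℕ, hproj ((k : ℤ), 0) v = 0) :
    (LinearMap.ker S.toLinearMap)ᗮ = hardy n := by
  ext v
  rw [Submodule.mem_orthogonal]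
  constructor
  · intro hv i hi
    have h1 : S (hproj i v) = 0 := (h _).2 fun k =>
      (isOrthDecomp_harm n).proj_of_mem_ne (fun h => hi ⟨k, h.symm⟩) (proj_mem (V := harm n) _ _)
    have h2 := hv _ h1
    rw [inner_proj_left (V := harm n)] at h2
    exact inner_self_eq_zero.1 h2
  · intro hv w hw
    refine ((isOrthDecomp_harm n).hasSum_inner w v).unique ?_
    have h1 : ∀ i, ⟪(harm n i).starProjection w, (harm n i).starProjection v⟫_ℂ = 0 := fun i => by
      by_cases hi : IsHol i
      · obtain ⟨k, rfl⟩ := hi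
        rw [show (harm n ((k : ℤ), 0)).starProjection w = 0 from (h w).1 hw k, inner_zero_left]
      · rw [show (harm n i).starProjection v = 0 from hv i hi, inner_zero_right]
    simp only [h1]
    exact hasSum_zero

/-- The holomorphic elements are the boundary values of holomorphic functions. -/
theorem mem_hardy_iff (v : L2S n) : v ∈ hardy n ↔
    ∃ F : Cn n → ℂ, DifferentiableOn ℂ F (Ball n) ∧ ∀ φ : Sph n → ℂ, IsSmooth φ →
      Tendsto (fun t : ℝ => ∫ ζ : Sph n, F (t • (ζ : Cn n)) * φ ζ ∂(surf n)) (𝓝[<] 1)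
        (𝓝 (∫ ζ, v ζ * subLaplacianPow r φ ζ ∂(surf n))) := by
  have hlim : ∀ φ : Sph n → ℂ, IsSmooth φ → ∫ ζ, v ζ * subLaplacianPow r φ ζ ∂(surf n) =
      ⟪subLaplacianPow r (fun ζ => (starRingEnd ℂ) (φ ζ)), v⟫_ℂ := fun φ hφ => by
    rw [← inner_star_left, inner_star_comm, star_subLaplacianPow r hφ]
  have hint : ∀ {F : Cn n → ℂ}, DifferentiableOn ℂ F (Ball n) → ∀ {t : ℝ}, t ∈ Set.Ioo (0 : ℝ) 1 →
      ∀ {φ : Sph n → ℂ}, IsSmooth φ → ∫ ζ : Sph n, F (t • (ζ : Cn n)) * φ ζ ∂(surf n) =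
        ⟪toL2 fun ζ => (starRingEnd ℂ) (φ ζ), dil F t⟫_ℂ := fun {F} hF {t} ht {φ} hφ => by
    have hc : Continuous fun ζ : Sph n => F (t • (ζ : Cn n)) :=
      hF.continuousOn.comp_continuous (by fun_prop) (smul_sph_mem_ball ht.1.le ht.2)
    rw [dil, inner_toL2 hφ.conj.continuous hc]
    simp only [Complex.conj_conj, mul_comm]
  have hI : Set.Ioo (0 : ℝ) 1 ∈ 𝓝[<] (1 : ℝ) := Ioo_mem_nhdsLT one_pos
  constructor
  · intro hv
    refine ⟨holExt r v, differentiableOn_holExt r v, fun φ hφ => ?_⟩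
    set x := toL2 fun ζ => (starRingEnd ℂ) (φ ζ) with hx
    set a : ℕ → ℂ := fun k => (holWt n r k : ℂ) * ⟪x, hproj ((k : ℤ), 0) v⟫_ℂ with ha
    have h1 : HasSum a (∫ ζ, v ζ * subLaplacianPow r φ ζ ∂(surf n)) := by
      rw [hlim φ hφ]
      have h2 := (isOrthDecomp_harm n).hasSum_inner
        (subLaplacianPow r fun ζ => (starRingEnd ℂ) (φ ζ)) v
      have h3 : a = (fun i => ⟪(harm n i).starProjection
          (subLaplacianPow r fun ζ => (starRingEnd ℂ) (φ ζ)), (harm n i).starProjection v⟫_ℂ) ∘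
          fun k : ℕ => ((k : ℤ), (0 : ℤ)) := funext fun k => by
        have h4 := hproj_subLaplacianPow r hφ.conj ((k : ℤ), (0 : ℤ))
        rw [Function.comp_apply, show (harm n ((k : ℤ), 0)).starProjection _ = _ from h4,
          inner_smul_left, Submodule.inner_starProjection_left_eq_right,
          proj_of_mem (proj_mem (V := harm n) _ _), Complex.conj_ofReal]
        rfl
      rw [h3]
      refine (hol_injective.hasSum_iff fun i hi => ?_).2 h2
      have hi' : ¬IsHol i := fun ⟨k, hk⟩ => hi ⟨k, hk.symm⟩
      rw [show (harm n i).starProjection v = 0 from hv i hi', inner_zero_right]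
    -- Abel's limit theorem for the power series in the radius
    have h3 := Complex.tendsto_tsum_powerSeries_nhdsWithin_lt h1.tendsto_sum_nat
    rw [tendsto_map'_iff] at h3
    refine h3.congr' ?_
    filter_upwards [hI] with t ht
    rw [hint (differentiableOn_holExt r v) ht hφ]
    have h4 := (hasSum_toL2_holExt (r := r) v ht.1.le ht.2).mapL (innerSL ℂ x)
    simp only [innerSL_apply_apply, inner_smul_right] at h4
    refine Eq.trans ?_ h4.tsum_eq
    refine tsum_congr fun k => ?_
    simp only [ha]
    push_cast
    ring
  · rintro ⟨F, hF, hlimF⟩ i hi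
    -- test the boundary value on conjugates of harmonics that are not holomorphic
    refine hproj_eq_zero_of_inner fun Y hY => ?_
    have h1 := hlimF _ hY.isSmooth.conj
    have h2 : ∫ ζ, v ζ * subLaplacianPow r (fun ζ => (starRingEnd ℂ) (res Y ζ)) ζ ∂(surf n) =
        0 := by
      refine tendsto_nhds_unique h1 (tendsto_const_nhds.congr' ?_)
      filter_upwards [hI] with t ht
      rw [hint hF ht hY.isSmooth.conj]
      simp only [Complex.conj_conj]
      rw [← proj_of_mem (V := harm n) hY.mem_harm, Submodule.inner_starProjection_left_eq_right,
        show (harm n i).starProjection (dil F t) = 0 from hproj_dil_of_not hF ht.1 ht.2 hi,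
        inner_zero_right]
    rw [hlim _ hY.isSmooth.conj] at h2
    simp only [Complex.conj_conj] at h2
    have h3 : subLaplacianPow r (res Y) = (((1 + lamPos n i) ^ r : ℝ) : ℂ) • toL2 (res Y) := by
      refine (isOrthDecomp_harm n).ext fun j => ?_
      change hproj j _ = hproj j _
      rw [hproj_subLaplacianPow r hY.isSmooth, map_smul]
      by_cases hj : j = i
      · rw [hj]
      · rw [show hproj j (toL2 (res Y)) = 0 from
          (isOrthDecomp_harm n).proj_of_mem_ne hj hY.mem_harm, smul_zero, smul_zero]
    have h4 : (((1 + lamPos n i) ^ r : ℝ) : ℂ) ≠ 0 := by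
      exact_mod_cast (Real.rpow_pos_of_pos (by linarith [one_le_lamPos (n := n) i]) r).ne'
    have h5 : subLaplacianPow r (fun ζ => res Y ζ) = subLaplacianPow r (res Y) := rfl
    rw [h5, h3, inner_smul_left, mul_eq_zero] at h2
    exact h2.resolve_left ((map_ne_zero _).2 h4)

/-- The range is the weighted Bergman space: a holomorphic function orthogonal to all homogeneous
polynomials vanishes. -/
theorem range_szego {m : ℝ} (hm : 0 < m)
    (hms : ∀ k, m ≤ holWt n r k ^ 2 * (ballConst n l * radMoment (n - 1 + k) (l - n)))
    (hS : ∀ v, HasSum (fun k => (holWt n r k : ℂ) • ballComp n l k v) (S v)) :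
    Set.range S = bergman n l := by
  ext y
  constructor
  · rintro ⟨v, rfl⟩
    exact ⟨holExt r v, differentiableOn_holExt r v, coeFn_of_hasSum hS v⟩
  · rintro ⟨h, hd, hy⟩
    obtain ⟨v, hv⟩ := isHolFamily_ballComp.exists_inner_eq hm (holWt_pos r) hms hS y
    refine ⟨v, Eq.symm (sub_eq_zero.1 ?_)⟩
    have hd' : DifferentiableOn ℂ (h - holExt r v) (Ball n) := hd.sub (differentiableOn_holExt r v)
    have hy' : (y - S v : L2B n l) =ᵐ[muBall n l] h - holExt r v :=
      (Lp.coeFn_sub y (S v)).trans (hy.sub (coeFn_of_hasSum hS v))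
    have h0 : ∀ k, holComp (h - holExt r v) k = 0 := fun k => by
      have h1 := hv k (holComp (h - holExt r v) k)
      have h2 : ((ballConst n l * radMoment (n - 1 + k) (l - n) : ℝ) : ℂ) ≠ 0 := by
        exact_mod_cast ((isHolFamily_ballComp (n := n) (l := l)).pos k).ne'
      rw [inner_ballComp k _ hd' hy', mul_eq_zero] at h1
      exact inner_self_eq_zero.1 (h1.resolve_left h2)
    refine Lp.ext ?_
    filter_upwards [hy', Lp.coeFn_zero ℂ 2 (muBall n l),
      ae_muBall (n := n) (l := l) fun z hz => hz] with z h1 h2 hz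
    rw [h1, h2, eq_zero_of_holComp hd' h0 hz, Pi.zero_apply]

end SzegoMap

end SzegoBall

end

theorem mainTheorem8 (n l : ℕ) (hn : 1 ≤ n) (hl : n ≤ l) (s : ℝ)
    (hs : s = ((l : ℝ) - (n : ℝ) + 1) / 2) :
    ∃ S : SzegoBall.HeisSob n (-s) →L[ℂ] SzegoBall.L2B n l,
      -- `S` extends the classical Szegö map
      (∀ f : SzegoBall.Sph n → ℂ, SzegoBall.IsSmooth f →
        ∃ u : SzegoBall.HeisSob n (-s), u.IsFunction f ∧
          S u =ᵐ[SzegoBall.muBall n l] SzegoBall.szego f) ∧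
      -- `SU(n,1)` acts on source and target with weight `n`, and `S` is equivariant
      (∃ (ρ : SzegoBall.SU n →* (SzegoBall.HeisSob n (-s) →L[ℂ] SzegoBall.HeisSob n (-s)))
          (π : SzegoBall.SU n →* (SzegoBall.L2B n l →L[ℂ] SzegoBall.L2B n l)),
        SzegoBall.IsSphereRep (n : ℤ) ρ ∧ SzegoBall.IsBallRep (n : ℤ) π ∧
          ∀ g u, S (ρ g u) = π g (S u)) ∧
      -- on its source space, `S` is moreover equivariant for the actions of every weight `m`
      (∀ m : ℤ,
        ∃ (ρ : SzegoBall.SU n →* (SzegoBall.HeisSob n (-s) →L[ℂ] SzegoBall.HeisSob n (-s)))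
          (π : SzegoBall.SU n →* (SzegoBall.L2B n l →L[ℂ] SzegoBall.L2B n l)),
        SzegoBall.IsSphereRep m ρ ∧ SzegoBall.IsBallRep m π ∧
          ∀ g, ∀ u ∈ (LinearMap.ker S.toLinearMap)ᗮ,
            ρ g u ∈ (LinearMap.ker S.toLinearMap)ᗮ ∧ S (ρ g u) = π g (S u)) ∧
      -- closed range, equal to the weighted Bergman space
      IsClosed (Set.range S) ∧
      Set.range S = SzegoBall.bergman n l ∧
      -- the source space is the space of the elements that extend holomorphically to the ball
      ∀ u : SzegoBall.HeisSob n (-s),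
        u ∈ (LinearMap.ker S.toLinearMap)ᗮ ↔ u.ExtendsHolomorphically := by
  have : NeZero n := ⟨by omega⟩
  have hcast : ((l - n : ℕ) : ℝ) = (l : ℝ) - n := Nat.cast_sub hl
  obtain ⟨m, M, hm, hmM⟩ := SzegoBall.exists_holWt_sq_bounds (n := n) (l - n)
    (SzegoBall.ballConst_pos (n := n) (l := l))
  have hrs : SzegoBall.filtrationStep n * (((l - n : ℕ) + 1 : ℝ) / 2) / 2 =
      -(SzegoBall.filtrationStep n * -s) / 2 := by
    rw [hs, hcast]
    ring
  rw [hrs] at hmM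
  have hr : 0 ≤ -(SzegoBall.filtrationStep n * -s) / 2 := by
    rw [← hrs, SzegoBall.filtrationStep]
    split_ifs <;> positivity
  set r := -(SzegoBall.filtrationStep n * -s) / 2 with hrdef
  have hfam := SzegoBall.isHolFamily_ballComp (n := n) (l := l)
  obtain ⟨S, hS⟩ := hfam.exists_sum (s := SzegoBall.holWt n r) fun k => (hmM k).2
  have hpos := SzegoBall.holWt_pos (n := n) r
  have hc := SzegoBall.szC_ne_zero (n := n)
  have hrange : Set.range (SzegoBall.szC n • S) = Set.range S := by
    ext y
    constructor
    · rintro ⟨v, rfl⟩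
      exact ⟨SzegoBall.szC n • v, map_smul _ _ _⟩
    · rintro ⟨v, rfl⟩
      exact ⟨(SzegoBall.szC n)⁻¹ • v, by rw [smul_apply, map_smul, smul_inv_smul₀ hc]⟩
  have hker : (LinearMap.ker (SzegoBall.szC n • S).toLinearMap)ᗮ = SzegoBall.hardy n :=
    SzegoBall.ker_orthogonal fun v => by
      rw [smul_apply, smul_eq_zero_iff_right hc]
      exact hfam.sum_eq_zero_iff hpos hS
  refine ⟨SzegoBall.szC n • S, fun f hf => ?_, ?_, fun k => ?_, ?_, ?_, fun u => ?_⟩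
  · refine ⟨SzegoBall.smoothing n r (SzegoBall.toL2 f), fun φ hφ => ?_, ?_⟩
    · refine (SzegoBall.integral_smoothing_mul hr hφ _).trans (integral_congr_ae ?_)
      filter_upwards [SzegoBall.coeFn_toL2 hf.continuous] with ζ h
      rw [h]
    · rw [← SzegoBall.szego_congr (SzegoBall.coeFn_toL2 hf.continuous)]
      exact SzegoBall.coeFn_smoothing hr hS _
  · obtain ⟨π, hπ⟩ := SzegoBall.exists_ballRep hl n
    exact ⟨SzegoBall.sobRep hr n, π, SzegoBall.isSphereRep_sobRep hr n, hπ, fun g u =>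
      SzegoBall.szego_equivariant hl hr hS hπ g u⟩
  · obtain ⟨π, hπ⟩ := SzegoBall.exists_ballRep hl k
    refine ⟨SzegoBall.sobRep hr k, π, SzegoBall.isSphereRep_sobRep hr k, hπ, fun g u hu => ?_⟩
    have hu' : u ∈ SzegoBall.hardy n := hker ▸ hu
    obtain ⟨h1, h2⟩ := SzegoBall.szego_equivariant_hardy hl hr hS k hπ g hu'
    exact ⟨hker.symm ▸ h1, h2⟩
  · have h1 := hfam.isClosed_range hm hpos (fun k => (hmM k).1) hS
    rwa [← hrange] at h1
  · exact hrange.trans (SzegoBall.range_szego hm (fun k => (hmM k).1) hS)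
  · have h1 : u ∈ (LinearMap.ker (SzegoBall.szC n • S).toLinearMap)ᗮ ↔ u ∈ SzegoBall.hardy n :=
      hker ▸ Iff.rfl
    exact h1.trans (SzegoBall.mem_hardy_iff u)
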